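/- **Setting.** Let $f\in\mathrm{Lip}(\mathbb R)$ with $f(0)=0$; let $\beta,\nu,\mu\in C^2\cap BV\cap W^{2,\infty}(\mathbb R)$ (that is, $C^2$, of finite total variation, and bounded together with their first two derivatives) with $\beta(0)=\nu(0)=0$; let $u_0\in L^1\cap BV(\mathbb R)$ with $u_0\ge 0$ a.e. Consider $$\partial_t u+\partial_x\big(f(u)\,\nu(\mu*\beta(u))\big)=0\ \text{ in } Q_T=(0,T)\times\mathbb R,\qquad u(0,\cdot)=u_0 .$$ An *entropy solution* on $[0,T]$ is a function $u\in C([0,T];L^1(\mathbb R))\cap L^\infty(Q_T)$ such that, with $\mathcal U(t,x)=\nu((\mu*\beta(u(t,\cdot)))(x))$, for all $k\in\mathbb R$ and all non-negative $\phi\in C_c^\infty([0,T)\times\mathbb R)$, $$\int_{Q_T}|u-k|\phi_t+\int_{Q_T}\operatorname{sgn}(u-k)\,\mathcal U\,(f(u)-f(k))\phi_x-\int_{Q_T}f(k)\operatorname{sgn}(u-k)\,\mathcal U_x\,\phi+\int_{\mathbb R}|u_0-k|\phi(0,x)\,dx\ \ge 0 ,$$ where $\operatorname{sgn}(0)=0$.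 **Scheme.** Let $\Delta x,\Delta t>0$, $N\in\mathbb N$ with $N\Delta t=T$, $\lambda=\Delta t/\Delta x$, $x_s=s\Delta x$, $C_i=[x_{i-1/2},x_{i+1/2})$. Put $u_i^0=\frac1{\Delta x}\int_{C_i}u_0\,dx$ and $$u_i^{n+1}=H\big(\nu(c^n_{i-1/2}),\nu(c^n_{i+1/2}),u^n_{i-1},u^n_i,u^n_{i+1}\big),\qquad H(a,b,l,m,r)=m-\lambda\,[F(b,m,r)-F(a,l,m)],$$ $$c^n_{i+1/2}=\Delta x\sum_{p\in\mathbb Z}\mu(x_{i+1/2-p})\,\beta(u^n_{p+1/2}),$$ where $u^n_{p+1/2}$ is an arbitrary convex combination of $u^n_p,u^n_{p+1}$ (it may vary with $n$ and $p$). Let $u^\Delta(t,x)=u_i^n$ for $t\in[n\Delta t,(n+1)\Delta t)$, $x\in C_i$, $0\le n\le N$. Given constants $K,D$, the numerical flux $F$ is one of the following: * *Lax–Friedrichs*: $F(a,b,c)=\frac a2(f(b)+f(c))-\theta\frac{c-b}{2\lambda}$, with $\theta\in(0,\frac23)$, the CFL condition $\lambda\le\dfrac{\min(1,4-6\theta,6\theta)}{1+6|f|_{\mathrm{Lip}}\|\nu\|_{L^\infty}}$,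 and $\theta/\lambda\le D$ (which holds with $D=\theta/\lambda$ if $\theta$ and $\lambda$ are kept fixed); * *Godunov*: $F(a,b,c)=a\,F_{G}(b,c)$, where $F_G(b,c)=\min_{[b,c]}f$ if $b\le c$ and $\max_{[c,b]}f$ if $b>c$, with the CFL condition $\lambda|f|_{\mathrm{Lip}}\|\nu\|_{L^\infty}\le\frac16$, and $\nu(c^n_{i+1/2})\ge 0$ for all $i\in\mathbb Z$, $n\le N$; * *general monotone*: $F(a,b,c)=a\,g(b,c)-d(b,c)$ with $g(s,s)=f(s)$, $d(s,s)=0$, $|g(b,c)-g(b',c')|\le K(|b-b'|+|c-c'|)$, $|d(b,c)-d(b',c')|\le D(|b-b'|+|c-c'|)$, such that for all $i\in\mathbb Z$, $n\le N$ the map $H(\nu(c^n_{i-1/2}),\nu(c^n_{i+1/2}),\cdot,\cdot,\cdot)$ is non-decreasing in each argument on $\mathbb R^3$. **Theorem (Existence).** (A) For every $K$ there are constants $\mathcal L_1,\mathcal L_2$, and for all $T>0$ and $D$ a further constant $\mathcal L_3$, all independent of $\Delta x,\Delta t,N$, of the numerical flux and of the convex combinations (so $\mathcal L_1,\mathcal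 L_2$ do not depend on $T$ or $D$ either), such that every run of the scheme as above satisfies, for all $i\in\mathbb Z$ and $0\le m,n\le N$: 1. $u_i^n\ge 0$; 2. $\|u^n\|_{L^\infty}\le e^{\mathcal L_1T}\|u^0\|_{L^\infty}$ (and the left side is finite); 3. $\|u^n\|_{L^1}=\|u^0\|_{L^1}<\infty$, where $\|u^n\|_{L^1}=\Delta x\sum_i|u_i^n|$; 4. $TV(u^n)\le e^{\mathcal L_2T}\,(TV(u^0)+\mathcal L_2)$, where $TV(u^n)=\sum_i|u^n_{i+1}-u^n_i|<\infty$; 5. $\Delta x\sum_i|u_i^m-u_i^n|\le\mathcal L_3\,|m-n|\,\Delta t$; 6. for all $k\in\mathbb R$, $$|u_i^{n+1}-k|-|u_i^n-k|+\lambda\big(\mathcal G^n_{i+1/2}(u_i^n,u_{i+1}^n,k)-\mathcal G^n_{i-1/2}(u_{i-1}^n,u_i^n,k)\big)+\lambda\operatorname{sgn}(u_i^{n+1}-k)f(k)\big(\nu(c^n_{i+1/2})-\nu(c^n_{i-1/2})\big)\le 0,$$ where $\mathcal G^n_{i+1/2}(a,b,k)=F(\nu(c^n_{i+1/2}),a\vee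 k,b\vee k)-F(\nu(c^n_{i+1/2}),a\wedge k,b\wedge k)$. (B) For every $T>0$ there is an entropy solution $u$ on $[0,T]$; every entropy solution $v$ with the same initial datum satisfies $v(t,\cdot)=u(t,\cdot)$ a.e. for every $t\in[0,T]$; and for all fixed $K,D$ the approximations converge to it: $\sup_{t\in[0,T]}\|u^\Delta(t,\cdot)-u(t,\cdot)\|_{L^1(\mathbb R)}\to 0$ as $\Delta x,\Delta t\to 0$, uniformly over all runs as above. -/

import Mathlib

open MeasureTheory Filter Topology

noncomputable section

namespace NonlocalFV

/-! ### Function classes and norms -/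

/-- `g ∈ C² ∩ BV ∩ W^{2,∞}(ℝ)`: twice continuously differentiable, of finite total variation, and
with `g`, `g'`, `g''` bounded. -/
def SmoothBV (g : ℝ → ℝ) : Prop :=
  ContDiff ℝ 2 g ∧ BoundedVariationOn g Set.univ ∧
    ∃ C : ℝ, ∀ x, |g x| ≤ C ∧ |deriv g x| ≤ C ∧ |deriv (deriv g) x| ≤ C

/-- `w ∈ (L¹ ∩ BV)(ℝ)`, as a class of almost everywhere equal functions. -/
def L1BV (w : ℝ → ℝ) : Prop :=
  Integrable w volume ∧ ∃ v : ℝ → ℝ, v =ᵐ[volume] w ∧ BoundedVariationOn v Set.univ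

/-- The Lipschitz seminorm `|g|_{Lip(ℝ)}` (a diagonal pair contributes `0 / 0 = 0`). -/
def lipSeminorm (g : ℝ → ℝ) : ℝ := ⨆ p : ℝ × ℝ, |g p.1 - g p.2| / |p.1 - p.2|

/-- The sup norm `‖g‖_{L^∞(ℝ)}` of a bounded continuous function. -/
def supNorm (g : ℝ → ℝ) : ℝ := ⨆ x : ℝ, |g x|

/-! ### Entropy solutions of `∂ₜ u + ∂ₓ (f(u) ν(μ * β(u))) = 0` on `(0, T) × ℝ` -/

/-- The nonlocal coefficient `x ↦ ν((μ * β(w))(x))` of a function `w` of space. -/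
def nonlocalCoeff (β ν μ : ℝ → ℝ) (w : ℝ → ℝ) (x : ℝ) : ℝ :=
  ν (∫ y, μ (x - y) * β (w y))

/-- Non-negative test functions `φ ∈ C_c^∞([0, T) × ℝ)`, given by a smooth extension to `ℝ × ℝ`
(only the values with `0 ≤ t` matter, and only these have to be non-negative). -/
def IsTestFunction (T : ℝ) (φ : ℝ → ℝ → ℝ) : Prop :=
  ContDiff ℝ ((⊤ : ℕ∞) : WithTop ℕ∞) (Function.uncurry φ) ∧
  HasCompactSupport (Function.uncurry φ) ∧
  tsupport (Function.uncurry φ) ⊆ {p : ℝ × ℝ | p.1 < T} ∧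
  ∀ t x : ℝ, 0 ≤ t → 0 ≤ φ t x

/-- The left-hand side of the Kruzhkov entropy inequality on `Q_T = (0, T) × ℝ`. -/
def entropyForm (f β ν μ : ℝ → ℝ) (u₀ : ℝ → ℝ) (T : ℝ) (u : ℝ → ℝ → ℝ) (k : ℝ)
    (φ : ℝ → ℝ → ℝ) : ℝ :=
  (∫ p in Set.Ioo 0 T ×ˢ (Set.univ : Set ℝ),
      |u p.1 p.2 - k| * deriv (fun s => φ s p.2) p.1)
  + (∫ p in Set.Ioo 0 T ×ˢ (Set.univ : Set ℝ),
      Real.sign (u p.1 p.2 - k) * nonlocalCoeff β ν μ (u p.1) p.2 * (f (u p.1 p.2) - f k)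
        * deriv (fun y => φ p.1 y) p.2)
  - (∫ p in Set.Ioo 0 T ×ˢ (Set.univ : Set ℝ),
      f k * Real.sign (u p.1 p.2 - k) * deriv (nonlocalCoeff β ν μ (u p.1)) p.2 * φ p.1 p.2)
  + ∫ x, |u₀ x - k| * φ 0 x

/-- `u ∈ C([0, T]; L¹(ℝ)) ∩ L^∞(Q_T)` is an entropy solution with initial datum `u₀`. -/
structure IsEntropySolution (f β ν μ : ℝ → ℝ) (u₀ : ℝ → ℝ) (T : ℝ) (u : ℝ → ℝ → ℝ) : Prop where
  integrable : ∀ t ∈ Set.Icc 0 T, Integrable (u t) volume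
  continuous : ∀ t ∈ Set.Icc 0 T,
    Tendsto (fun s => ∫ x, |u s x - u t x|) (𝓝[Set.Icc 0 T] t) (𝓝 0)
  measurable : AEStronglyMeasurable (Function.uncurry u)
    (volume.restrict (Set.Ioo 0 T ×ˢ (Set.univ : Set ℝ)))
  bounded : ∃ M : ℝ, ∀ᵐ p ∂(volume.restrict (Set.Ioo 0 T ×ˢ (Set.univ : Set ℝ))),
    |u p.1 p.2| ≤ M
  entropy : ∀ (k : ℝ) (φ : ℝ → ℝ → ℝ), IsTestFunction T φ → 0 ≤ entropyForm f β ν μ u₀ T u k φ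

/-! ### The finite volume scheme

Interfaces are indexed by integers: the index `i` of an interface quantity stands for `i + 1/2`. -/

/-- The cell average of `u₀` over `C_i = [x_{i-1/2}, x_{i+1/2})`. -/
def cellAverage (u₀ : ℝ → ℝ) (Δx : ℝ) (i : ℤ) : ℝ :=
  Δx⁻¹ * ∫ x in Set.Ico (((i : ℝ) - 1 / 2) * Δx) (((i : ℝ) + 1 / 2) * Δx), u₀ x

/-- The quadrature `c_{i+1/2} = Δx ∑_p μ(x_{i+1/2-p}) β(w_{p+1/2})`, where `w_{p+1/2}` is the convex
combination of `w_p` and `w_{p+1}` with weight `α_p ∈ [0, 1]`. -/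
def quadrature (β μ : ℝ → ℝ) (Δx : ℝ) (α : ℤ → ℝ) (w : ℤ → ℝ) (i : ℤ) : ℝ :=
  Δx * ∑' p : ℤ, μ (((i : ℝ) + 1 / 2 - p) * Δx) * β ((1 - α p) * w p + α p * w (p + 1))

/-- The update `H(a, b, l, m, r) = m - lam (F(b, m, r) - F(a, l, m))`. -/
def update (F : ℝ → ℝ → ℝ → ℝ) (lam a b l m r : ℝ) : ℝ :=
  m - lam * (F b m r - F a l m)

/-- The approximations `u_i^n` produced by the marching formula with numerical flux `F`, mesh sizes
`Δx`, `Δt`, and quadrature weights `α n p`. -/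
def approx (β ν μ u₀ : ℝ → ℝ) (F : ℝ → ℝ → ℝ → ℝ) (Δx Δt : ℝ) (α : ℕ → ℤ → ℝ) : ℕ → ℤ → ℝ
  | 0 => cellAverage u₀ Δx
  | n + 1 => fun i =>
      let w := approx β ν μ u₀ F Δx Δt α n
      update F (Δt / Δx)
        (ν (quadrature β μ Δx (α n) w (i - 1))) (ν (quadrature β μ Δx (α n) w i))
        (w (i - 1)) (w i) (w (i + 1))

/-- The coefficient `ν(c^n_{i+1/2})` of the scheme. -/
def coeff (β ν μ u₀ : ℝ → ℝ) (F : ℝ → ℝ → ℝ → ℝ) (Δx Δt : ℝ) (α : ℕ → ℤ → ℝ)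
    (n : ℕ) (i : ℤ) : ℝ :=
  ν (quadrature β μ Δx (α n) (approx β ν μ u₀ F Δx Δt α n) i)

/-- The piecewise constant approximate solution: `u^Δ(t, x) = u_i^n` for
`t ∈ [n Δt, (n+1) Δt)` and `x ∈ C_i`. -/
def approxFun (β ν μ u₀ : ℝ → ℝ) (F : ℝ → ℝ → ℝ → ℝ) (Δx Δt : ℝ) (α : ℕ → ℤ → ℝ)
    (t x : ℝ) : ℝ :=
  approx β ν μ u₀ F Δx Δt α ⌊t / Δt⌋₊ ⌊x / Δx + 1 / 2⌋

/-- The numerical entropy flux `F(a, x ∨ k, y ∨ k) - F(a, x ∧ k, y ∧ k)`. -/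
def entropyFlux (F : ℝ → ℝ → ℝ → ℝ) (a x y k : ℝ) : ℝ :=
  F a (max x k) (max y k) - F a (min x k) (min y k)

/-! ### Numerical fluxes -/

/-- The Lax-Friedrichs type flux. -/
def laxFriedrichs (f : ℝ → ℝ) (θ lam : ℝ) (a b c : ℝ) : ℝ :=
  a / 2 * (f b + f c) - θ * (c - b) / (2 * lam)

/-- The Godunov flux of the local conservation law `u_t + f(u)_x = 0`: the minimum of `f` over
`[b, c]` if `b ≤ c`, and the maximum of `f` over `[c, b]` otherwise. -/
def localGodunov (f : ℝ → ℝ) (b c : ℝ) : ℝ :=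
  if b ≤ c then sInf (f '' Set.Icc b c) else sSup (f '' Set.Icc c b)

/-- The Godunov type flux. -/
def godunov (f : ℝ → ℝ) (a b c : ℝ) : ℝ := a * localGodunov f b c

/-- General nonlocal extensions `F(a, b, c) = a g(b, c) - d(b, c)` of a local numerical flux `g`
consistent with `f`, with a numerical viscosity `d` vanishing on the diagonal, both Lipschitz. -/
def IsNonlocalFlux (f : ℝ → ℝ) (K D : ℝ) (F : ℝ → ℝ → ℝ → ℝ) : Prop :=
  ∃ g d : ℝ → ℝ → ℝ,
    (∀ a b c, F a b c = a * g b c - d b c) ∧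
    (∀ s, g s s = f s) ∧ (∀ s, d s s = 0) ∧
    (∀ b c b' c', |g b c - g b' c'| ≤ K * (|b - b'| + |c - c'|)) ∧
    (∀ b c b' c', |d b c - d b' c'| ≤ D * (|b - b'| + |c - c'|))

/-- `H(a, b, ·, ·, ·)` is increasing (in the wide sense) in its last three arguments. -/
def UpdateIncreasing (F : ℝ → ℝ → ℝ → ℝ) (lam a b : ℝ) : Prop :=
  ∀ l l' m m' r r' : ℝ, l ≤ l' → m ≤ m' → r ≤ r' →
    update F lam a b l m r ≤ update F lam a b l' m' r'

/-- The admissible choices of a numerical flux `F` for the mesh ratio `lam = Δt / Δx`, where `A n i`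
is the interface coefficient `ν(c^n_{i+1/2})` of the run, for the time levels `n ≤ N`.
* Lax-Friedrichs flux under its CFL condition; `D` bounds its numerical viscosity `θ / lam`, that is,
  it bounds `lam` from below.
* Godunov flux under its CFL condition, the coefficients being non-negative (for a negative
  coefficient `a` the flux `a * localGodunov f b c` is downwind, and the scheme is not monotone).
* Any flux of the general form for which the scheme is monotone. -/
inductive Admissible (f ν : ℝ → ℝ) (K D lam : ℝ) (A : ℕ → ℤ → ℝ) (N : ℕ) :
    (ℝ → ℝ → ℝ → ℝ) → Prop
  | laxFriedrichs (θ : ℝ) (hθ₀ : 0 < θ) (hθ₁ : θ < 2 / 3)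
      (cfl : lam ≤ min 1 (min (4 - 6 * θ) (6 * θ)) / (1 + 6 * lipSeminorm f * supNorm ν))
      (hD : θ / lam ≤ D) :
      Admissible f ν K D lam A N (laxFriedrichs f θ lam)
  | godunov (cfl : lam * lipSeminorm f * supNorm ν ≤ 1 / 6)
      (hA : ∀ n ≤ N, ∀ i, 0 ≤ A n i) :
      Admissible f ν K D lam A N (godunov f)
  | general (F : ℝ → ℝ → ℝ → ℝ) (hF : IsNonlocalFlux f K D F)
      (mono : ∀ n ≤ N, ∀ i, UpdateIncreasing F lam (A n (i - 1)) (A n i)) :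
      Admissible f ν K D lam A N F

/-- A run of the scheme on `[0, T]`: mesh sizes with `T = N Δt`, quadrature weights in `[0, 1]`, and
an admissible numerical flux. -/
structure IsRun (f β ν μ u₀ : ℝ → ℝ) (K D T : ℝ) (F : ℝ → ℝ → ℝ → ℝ) (Δx Δt : ℝ) (N : ℕ)
    (α : ℕ → ℤ → ℝ) : Prop where
  dx_pos : 0 < Δx
  dt_pos : 0 < Δt
  final_time : N * Δt = T
  weights : ∀ n p, α n p ∈ Set.Icc (0 : ℝ) 1
  admissible : Admissible f ν K D (Δt / Δx) (coeff β ν μ u₀ F Δx Δt α) N F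

end NonlocalFV

end

namespace NonlocalFV

/-! ### Lipschitz constants and sup norms -/

/-! The estimates of (A) come from the monotonicity of one step. Every admissible flux is brought to
the form `a g(b,c) - d(b,c)` with a monotone update (`Admissible.toGeneral`). Comparison with
constant states gives the sign and the growth of the sup norm, because the coefficient changes only
by `O(Δx)` from one cell to the next. The conservation form gives the mass. A monotone conservative
map is a contraction of `ℓ¹` (`step_contraction`); applied to a state and to its shift by one cell
it controls the total variation, up to first and second differences of the coefficients
(`step_variation`). These are `O(Δx)` and `O(Δx²)`, with constants depending only on the conserved
mass, since the shift falls on the smooth kernel `μ` (`coeffBound_quadrature`). Comparison with `u ∨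
k` and `u ∧ k` gives the discrete entropy inequality (`step_entropy`).

Part (B) rests on one comparison of Kuznetsov type, `Pair.l1Dist_le_of_approxEntropy`. Two functions
satisfying the Kruzhkov inequality up to a small error are close in `L¹` at every time near which
the second varies little, provided that the first has a linear modulus of translation in space and
time, up to a small defect. The approximations satisfy both requirements
(`MonotoneRun.approxEntropy`, `MonotoneRun.regular`). Two approximations are therefore close, so
that they form a Cauchy sequence in `C([0,T]; L¹)` and no compactness theorem is used. The limit is
a regular entropy solution. Compared with any entropy solution it gives uniqueness; compared with
any run it gives uniform convergence.

For the comparison, `u` is taken at `(t,x)` with level `k = v(s,y)`, and `v` at `(s,y)` with level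
`u(t,x)`, both tested with `w(t-s) χ(s) w(x-y)`. The time derivatives of the mollifier cancel and
`|u-v| χ'` remains. The two solutions have different coefficients, but averaging bounds the
difference of the coefficients and of their derivatives uniformly by the `L¹` distance `E(s)`. The
dangerous product of that difference with `w'(x-y)`, of order `1/ρ`, is frozen at `(s,y)`; the
frozen part integrates to zero in `x` (`Pair.integral_special_kernel`). What remains next to `w'`
carries either an increment of the coefficient over a distance `ρ`, or `|u(t,x) - u(s,y)|`, whose
integral is `O(ρ)`. This gives `-∫ E χ' ≤ Λ ∫ E χ` plus small errors, and an exponentially weighted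
cutoff turns it into a bound of `E`.

The level `v(s,y)` is integrated over the whole line, so a constant error in the entropy inequality
would be useless. In `ApproxEntropy` the error is `g(y) + ε |k|` with `g` integrable and `y` the
centre of the support of the test function. In the passage to the limit the sign is discontinuous;
it is harmless at all but countably many levels, and every other level is the mean of its two
one-sided limits, in agreement with `sgn(0) = 0`. -/

lemma lipSeminorm_bddAbove {f : ℝ → ℝ} (hf : ∃ L, LipschitzWith L f) :
    BddAbove (Set.range fun p : ℝ × ℝ => |f p.1 - f p.2| / |p.1 - p.2|) := by
  obtain ⟨L, hL⟩ := hf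
  refine ⟨L, ?_⟩
  rintro _ ⟨p, rfl⟩
  have h := hL.dist_le_mul p.1 p.2
  rw [Real.dist_eq, Real.dist_eq] at h
  exact div_le_of_le_mul₀ (abs_nonneg _) L.2 h

lemma lipSeminorm_nonneg (f : ℝ → ℝ) : 0 ≤ lipSeminorm f :=
  Real.iSup_nonneg fun _ => by positivity

lemma abs_sub_le_lipSeminorm {f : ℝ → ℝ} (hf : ∃ L, LipschitzWith L f) (x y : ℝ) :
    |f x - f y| ≤ lipSeminorm f * |x - y| := by
  rcases eq_or_ne x y with rfl | hxy
  · simp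
  · have h := le_ciSup (lipSeminorm_bddAbove hf) (x, y)
    have hpos : 0 < |x - y| := abs_pos.2 (sub_ne_zero.2 hxy)
    exact (div_le_iff₀ hpos).1 h

lemma abs_le_supNorm {g : ℝ → ℝ} {C : ℝ} (hC : ∀ x, |g x| ≤ C) (x : ℝ) : |g x| ≤ supNorm g :=
  le_ciSup (f := fun x => |g x|) ⟨C, by rintro _ ⟨y, rfl⟩; exact hC y⟩ x

/-! ### The Godunov flux -/

section Godunov

variable {f : ℝ → ℝ} {L : ℝ}

lemma continuous_of_abs_sub_le (hf : ∀ x y, |f x - f y| ≤ L * |x - y|) : Continuous f := by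
  have : LipschitzWith (Real.toNNReal L) f := by
    refine LipschitzWith.of_dist_le_mul fun x y => ?_
    rw [Real.dist_eq, Real.dist_eq]
    exact (hf x y).trans (mul_le_mul_of_nonneg_right (Real.le_coe_toNNReal L) (abs_nonneg _))
  exact this.continuous

lemma localGodunov_self (s : ℝ) : localGodunov f s s = f s := by
  simp [localGodunov]

/-- A change of sign of `f` exchanges minima and maxima, hence the two arguments. All statements on
maxima, or on the second argument, follow from those on minima and on the first. -/
lemma localGodunov_neg (b c : ℝ) :
    localGodunov f b c = -localGodunov (fun x => -f x) c b := by
  have himg : ∀ s : Set ℝ, (fun x => -f x) '' s = -(f '' s) := by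
    intro s
    rw [← Set.image_neg_eq_neg, Set.image_image]
  unfold localGodunov
  rcases lt_trichotomy b c with h | h | h
  · rw [if_pos h.le, if_neg (not_le.2 h), himg, Real.sSup_neg, neg_neg]
  · subst h; simp
  · rw [if_neg (not_le.2 h), if_pos h.le, himg, Real.sInf_neg, neg_neg]

lemma localGodunov_le (hf : Continuous f) {b c x : ℝ} (hx : x ∈ Set.Icc b c) :
    localGodunov f b c ≤ f x := by
  rw [localGodunov, if_pos (hx.1.trans hx.2)]
  exact csInf_le (isCompact_Icc.image hf).bddBelow ⟨x, hx, rfl⟩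

lemma le_localGodunov (hf : Continuous f) {b c x : ℝ} (hx : x ∈ Set.Icc c b) :
    f x ≤ localGodunov f b c := by
  rw [localGodunov_neg]
  linarith [localGodunov_le (f := fun x => -f x) hf.neg hx]

lemma exists_localGodunov_eq_of_le (hf : Continuous f) {b c : ℝ} (h : b ≤ c) :
    ∃ x ∈ Set.Icc b c, localGodunov f b c = f x := by
  rw [localGodunov, if_pos h]
  obtain ⟨x, hx, hxe⟩ := (isCompact_Icc.image hf).sInf_mem
    (Set.image_nonempty.2 (Set.nonempty_Icc.2 h))
  exact ⟨x, hx, hxe.symm⟩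

lemma exists_localGodunov_eq_of_ge (hf : Continuous f) {b c : ℝ} (h : c ≤ b) :
    ∃ x ∈ Set.Icc c b, localGodunov f b c = f x := by
  obtain ⟨x, hx, hxe⟩ := exists_localGodunov_eq_of_le (f := fun x => -f x) hf.neg h
  exact ⟨x, hx, by rw [localGodunov_neg, hxe, neg_neg]⟩

lemma localGodunov_mono_left (hf : Continuous f) {b b' : ℝ} (h : b ≤ b') (c : ℝ) :
    localGodunov f b c ≤ localGodunov f b' c := by
  rcases le_total b' c with h1 | h1
  · obtain ⟨x, hx, hxe⟩ := exists_localGodunov_eq_of_le hf h1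
    rw [hxe]
    exact localGodunov_le hf ⟨h.trans hx.1, hx.2⟩
  · rcases le_total b c with h2 | h2
    · exact (localGodunov_le hf ⟨h2, le_rfl⟩).trans (le_localGodunov hf ⟨le_rfl, h1⟩)
    · obtain ⟨x, hx, hxe⟩ := exists_localGodunov_eq_of_ge hf h2
      rw [hxe]
      exact le_localGodunov hf ⟨hx.1, hx.2.trans h⟩

/-- The extremum is attained at some point. Either this point also belongs to the interval of the
other value, or it lies within `b' - b` of a point of it. -/
lemma localGodunov_sub_left_le (hL : 0 ≤ L) (hf : ∀ x y, |f x - f y| ≤ L * |x - y|) {b b' : ℝ}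
    (h : b ≤ b') (c : ℝ) :
    localGodunov f b' c - localGodunov f b c ≤ L * (b' - b) := by
  have hc := continuous_of_abs_sub_le hf
  have key : ∀ x y, f x - f y ≤ L * |x - y| := fun x y => (le_abs_self _).trans (hf x y)
  have key' : ∀ x y d, |x - y| ≤ d → f x - f y ≤ L * d := fun x y d hd =>
    (key x y).trans (mul_le_mul_of_nonneg_left hd hL)
  rcases le_total b' c with h1 | h1
  · obtain ⟨x, hx, hxe⟩ := exists_localGodunov_eq_of_le hc (h.trans h1)
    rw [hxe]
    rcases le_total b' x with h2 | h2
    · have := localGodunov_le hc (b := b') (c := c) ⟨h2, hx.2⟩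
      nlinarith
    · have h3 := localGodunov_le hc (b := b') (c := c) ⟨le_rfl, h1⟩
      have h4 := key' b' x (b' - b) (by rw [abs_of_nonneg] <;> linarith [hx.1])
      linarith
  · rcases le_total b c with h2 | h2
    · obtain ⟨x, hx, hxe⟩ := exists_localGodunov_eq_of_le hc h2
      obtain ⟨y, hy, hye⟩ := exists_localGodunov_eq_of_ge hc h1
      rw [hxe, hye]
      exact key' y x (b' - b) (by
        rw [abs_of_nonneg] <;> linarith [hx.1, hx.2, hy.1, hy.2])
    · obtain ⟨y, hy, hye⟩ := exists_localGodunov_eq_of_ge hc h1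
      rw [hye]
      rcases le_total y b with h3 | h3
      · have := le_localGodunov hc (b := b) (c := c) ⟨hy.1, h3⟩
        nlinarith
      · have h4 := le_localGodunov hc (b := b) (c := c) ⟨h2, le_rfl⟩
        have h5 := key' y b (b' - b) (by rw [abs_of_nonneg] <;> linarith [hy.2])
        linarith

lemma localGodunov_anti_right (hf : Continuous f) {c c' : ℝ} (h : c ≤ c') (b : ℝ) :
    localGodunov f b c' ≤ localGodunov f b c := by
  rw [localGodunov_neg b c', localGodunov_neg b c]
  exact neg_le_neg (localGodunov_mono_left (f := fun x => -f x) hf.neg h b)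

lemma localGodunov_sub_right_le (hL : 0 ≤ L) (hf : ∀ x y, |f x - f y| ≤ L * |x - y|) {c c' : ℝ}
    (h : c ≤ c') (b : ℝ) :
    localGodunov f b c - localGodunov f b c' ≤ L * (c' - c) := by
  rw [localGodunov_neg b c', localGodunov_neg b c]
  have := localGodunov_sub_left_le (f := fun x => -f x) hL
    (fun x y => by rw [neg_sub_neg, abs_sub_comm]; exact hf x y) h b
  linarith

lemma abs_localGodunov_sub_le (hL : 0 ≤ L) (hf : ∀ x y, |f x - f y| ≤ L * |x - y|)
    (b c b' c' : ℝ) :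
    |localGodunov f b c - localGodunov f b' c'| ≤ L * (|b - b'| + |c - c'|) := by
  have hc := continuous_of_abs_sub_le hf
  have h1 : |localGodunov f b c - localGodunov f b' c| ≤ L * |b - b'| := by
    rcases le_total b b' with h | h
    · rw [abs_sub_comm, abs_of_nonneg (by linarith [localGodunov_mono_left hc h c]),
        abs_sub_comm, abs_of_nonneg (by linarith)]
      exact localGodunov_sub_left_le hL hf h c
    · rw [abs_of_nonneg (by linarith [localGodunov_mono_left hc h c]),
        abs_of_nonneg (by linarith)]
      exact localGodunov_sub_left_le hL hf h c
  have h2 : |localGodunov f b' c - localGodunov f b' c'| ≤ L * |c - c'| := by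
    rcases le_total c c' with h | h
    · rw [abs_of_nonneg (by linarith [localGodunov_anti_right hc h b']),
        abs_sub_comm c, abs_of_nonneg (by linarith)]
      exact localGodunov_sub_right_le hL hf h b'
    · rw [abs_sub_comm, abs_of_nonneg (by linarith [localGodunov_anti_right hc h b']),
        abs_of_nonneg (by linarith)]
      exact localGodunov_sub_right_le hL hf h b'
  calc _ ≤ |localGodunov f b c - localGodunov f b' c|
        + |localGodunov f b' c - localGodunov f b' c'| := abs_sub_le _ _ _
    _ ≤ _ := by linarith

end Godunov

/-! ### Every admissible flux is a monotone flux of the general form -/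

lemma IsNonlocalFlux.mono {f : ℝ → ℝ} {K D K' D' : ℝ} {F : ℝ → ℝ → ℝ → ℝ}
    (h : IsNonlocalFlux f K D F) (hK : K ≤ K') (hD : D ≤ D') : IsNonlocalFlux f K' D' F := by
  obtain ⟨g, d, h1, h2, h3, h4, h5⟩ := h
  refine ⟨g, d, h1, h2, h3, fun b c b' c' => (h4 b c b' c').trans ?_,
    fun b c b' c' => (h5 b c b' c').trans ?_⟩ <;> gcongr

lemma isNonlocalFlux_laxFriedrichs {f : ℝ → ℝ} {L θ lam : ℝ}
    (hf : ∀ x y, |f x - f y| ≤ L * |x - y|) (hL : 0 ≤ L) (hθ : 0 ≤ θ) (hlam : 0 < lam) :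
    IsNonlocalFlux f L (θ / lam) (laxFriedrichs f θ lam) := by
  refine ⟨fun b c => (f b + f c) / 2, fun b c => θ * (c - b) / (2 * lam), fun a b c => ?_,
    fun s => by ring, fun s => by simp, fun b c b' c' => ?_, fun b c b' c' => ?_⟩
  · simp only [laxFriedrichs]; ring
  · have h1 := abs_le.1 (hf b b')
    have h2 := abs_le.1 (hf c c')
    have h3 : 0 ≤ L * |b - b'| := by positivity
    have h4 : 0 ≤ L * |c - c'| := by positivity
    rw [abs_le]
    constructor <;> linarith [h1.1, h1.2, h2.1, h2.2]
  · have hrw : θ * (c - b) / (2 * lam) - θ * (c' - b') / (2 * lam)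
        = θ / lam * (((c - c') - (b - b')) / 2) := by
      field_simp; ring
    rw [hrw, abs_mul, abs_of_nonneg (by positivity : 0 ≤ θ / lam)]
    refine mul_le_mul_of_nonneg_left ?_ (by positivity)
    rw [abs_le]
    constructor <;> linarith [neg_abs_le (b - b'), le_abs_self (b - b'), neg_abs_le (c - c'),
      le_abs_self (c - c')]

/-- The viscosity gives the weight `θ/2` to each neighbour and leaves `1 - θ` to the middle value.
The convective part can take away at most `lam L S / 2` from each neighbour and twice that from the
middle. -/
lemma updateIncreasing_laxFriedrichs {f : ℝ → ℝ} {L θ lam S a b : ℝ}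
    (hf : ∀ x y, |f x - f y| ≤ L * |x - y|) (hlam : 0 < lam)
    (ha : |a| ≤ S) (hb : |b| ≤ S) (h1 : lam * L * S ≤ θ) (h2 : lam * L * S ≤ 1 - θ) :
    UpdateIncreasing (laxFriedrichs f θ lam) lam a b := by
  intro l l' m m' r r' hl hm hr
  have hS : 0 ≤ S := (abs_nonneg a).trans ha
  have key : ∀ c, |c| ≤ S → ∀ x y, x ≤ y → lam * |c * (f y - f x)| ≤ lam * L * S * (y - x) := by
    intro c hc x y hxy
    have := hf y x
    rw [abs_of_nonneg (sub_nonneg.2 hxy)] at this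
    rw [abs_mul]
    calc lam * (|c| * |f y - f x|) ≤ lam * (S * (L * (y - x))) := by gcongr
      _ = _ := by ring
  have e1 := key a ha l l' hl
  have e2 := key a ha m m' hm
  have e3 := key b hb m m' hm
  have e4 := key b hb r r' hr
  have rw1 : ∀ x y z, update (laxFriedrichs f θ lam) lam a b x y z
      = y * (1 - θ) + θ / 2 * z + θ / 2 * x - lam * (b * f y) / 2 - lam * (b * f z) / 2
        + lam * (a * f x) / 2 + lam * (a * f y) / 2 := by
    intro x y z
    simp only [update, laxFriedrichs]
    field_simp
    ring
  rw [rw1, rw1]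
  have d1 : -(lam * L * S * (l' - l)) ≤ lam * (a * (f l' - f l)) := by
    have := neg_abs_le (a * (f l' - f l)); nlinarith
  have d2 : -(lam * L * S * (m' - m)) ≤ lam * (a * (f m' - f m)) := by
    have := neg_abs_le (a * (f m' - f m)); nlinarith
  have d3 : lam * (b * (f m' - f m)) ≤ lam * L * S * (m' - m) := by
    have := le_abs_self (b * (f m' - f m)); nlinarith
  have d4 : lam * (b * (f r' - f r)) ≤ lam * L * S * (r' - r) := by
    have := le_abs_self (b * (f r' - f r)); nlinarith
  have p1 := mul_le_mul_of_nonneg_right h1 (sub_nonneg.2 hl)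
  have p2 := mul_le_mul_of_nonneg_right h2 (sub_nonneg.2 hm)
  have p3 := mul_le_mul_of_nonneg_right h1 (sub_nonneg.2 hr)
  linarith

/-- Non-negative coefficients make both neighbours act with the right sign. Only the middle argument
needs the CFL condition: it loses at most `2 lam L S ≤ 1/3` of its increment. -/
lemma updateIncreasing_godunov {f : ℝ → ℝ} {L lam S a b : ℝ}
    (hf : ∀ x y, |f x - f y| ≤ L * |x - y|) (hL : 0 ≤ L) (hlam : 0 < lam)
    (ha : |a| ≤ S) (hb : |b| ≤ S) (ha0 : 0 ≤ a) (hb0 : 0 ≤ b) (h1 : lam * L * S ≤ 1 / 6) :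
    UpdateIncreasing (godunov f) lam a b := by
  intro l l' m m' r r' hl hm hr
  have hc := continuous_of_abs_sub_le hf
  rw [abs_of_nonneg ha0] at ha
  rw [abs_of_nonneg hb0] at hb
  simp only [update, godunov]
  have e1 := localGodunov_mono_left hc hl m'
  have e2 := localGodunov_sub_right_le hL hf hm l
  have e3 := localGodunov_sub_left_le hL hf hm r
  have e4 := localGodunov_anti_right hc hr m'
  have i1 : 0 ≤ a * (localGodunov f l' m' - localGodunov f l m') :=
    mul_nonneg ha0 (by linarith)
  have i4 : 0 ≤ b * (localGodunov f m' r - localGodunov f m' r') :=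
    mul_nonneg hb0 (by linarith)
  have hmm : 0 ≤ L * (m' - m) := mul_nonneg hL (by linarith)
  have i2 : a * (localGodunov f l m - localGodunov f l m') ≤ S * (L * (m' - m)) :=
    (mul_le_mul_of_nonneg_left e2 ha0).trans (mul_le_mul_of_nonneg_right ha hmm)
  have i3 : b * (localGodunov f m' r - localGodunov f m r) ≤ S * (L * (m' - m)) :=
    (mul_le_mul_of_nonneg_left e3 hb0).trans (mul_le_mul_of_nonneg_right hb hmm)
  have i5 : lam * (S * (L * (m' - m))) ≤ 1 / 6 * (m' - m) := by
    have := mul_le_mul_of_nonneg_right h1 (sub_nonneg.2 hm)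
    linarith
  have j : b * localGodunov f m' r' - a * localGodunov f l' m'
      - (b * localGodunov f m r - a * localGodunov f l m) ≤ 2 * (S * (L * (m' - m))) := by
    linarith
  have := mul_le_mul_of_nonneg_left j hlam.le
  linarith

/-- Every admissible flux is a monotone flux of the general form. -/
lemma Admissible.toGeneral {f ν : ℝ → ℝ} {K D lam : ℝ} {A : ℕ → ℤ → ℝ} {N : ℕ}
    {F : ℝ → ℝ → ℝ → ℝ} (h : Admissible f ν K D lam A N F) (hlam : 0 < lam)
    (hf : ∃ L, LipschitzWith L f) (hA : ∀ n i, |A n i| ≤ supNorm ν) :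
    IsNonlocalFlux f (max K (lipSeminorm f)) (max D 0) F ∧
      ∀ n ≤ N, ∀ i, UpdateIncreasing F lam (A n (i - 1)) (A n i) := by
  have hfl := abs_sub_le_lipSeminorm hf
  have hL := lipSeminorm_nonneg f
  have hS : 0 ≤ supNorm ν := (abs_nonneg _).trans (hA 0 0)
  have hLS : 0 ≤ lipSeminorm f * supNorm ν := mul_nonneg hL hS
  cases h with
  | laxFriedrichs θ hθ₀ hθ₁ cfl hD =>
    refine ⟨(isNonlocalFlux_laxFriedrichs hfl hL hθ₀.le hlam).mono (le_max_right _ _)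
      (hD.trans (le_max_left _ _)), fun n _ i => ?_⟩
    rw [le_div_iff₀ (by positivity)] at cfl
    -- Divided by six, the CFL condition says `lam L S ≤ 2/3 - θ ≤ 1 - θ` and `lam L S ≤ θ`.
    have c1 : lam * (1 + 6 * lipSeminorm f * supNorm ν) ≤ 4 - 6 * θ :=
      cfl.trans ((min_le_right _ _).trans (min_le_left _ _))
    have c2 : lam * (1 + 6 * lipSeminorm f * supNorm ν) ≤ 6 * θ :=
      cfl.trans ((min_le_right _ _).trans (min_le_right _ _))
    refine updateIncreasing_laxFriedrichs hfl hlam (hA _ _) (hA _ _) ?_ ?_ <;> linarith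
  | godunov cfl hA0 =>
    refine ⟨⟨localGodunov f, fun _ _ => 0, fun a b c => by simp [NonlocalFV.godunov], localGodunov_self,
      fun _ => rfl, fun b c b' c' => ?_, fun b c b' c' => ?_⟩, fun n hn i => ?_⟩
    · refine (abs_localGodunov_sub_le hL hfl b c b' c').trans ?_
      gcongr
      exact le_max_right _ _
    · rw [sub_self, abs_zero]
      have := le_max_right D 0
      positivity
    · exact updateIncreasing_godunov hfl hL hlam (hA _ _) (hA _ _) (hA0 n hn _) (hA0 n hn _) cfl
  | general F hF mono => exact ⟨hF.mono (le_max_left _ _) (le_max_left _ _), mono⟩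

end NonlocalFV

namespace NonlocalFV

/-! ### Quantitative form of the regularity of the data -/

/-- `g` and `g'` are bounded by `C` and Lipschitz continuous with constant `C`. -/
structure SmoothBound (g : ℝ → ℝ) (C : ℝ) : Prop where
  nonneg : 0 ≤ C
  differentiable : Differentiable ℝ g
  bound : ∀ x, |g x| ≤ C
  deriv_bound : ∀ x, |deriv g x| ≤ C
  lip : ∀ x y, |g x - g y| ≤ C * |x - y|
  deriv_lip : ∀ x y, |deriv g x - deriv g y| ≤ C * |x - y|

lemma abs_sub_le_of_abs_deriv_le {g : ℝ → ℝ} {C : ℝ} (hg : Differentiable ℝ g)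
    (hC : ∀ x, |deriv g x| ≤ C) (x y : ℝ) : |g x - g y| ≤ C * |x - y| := by
  have := Convex.norm_image_sub_le_of_norm_deriv_le (f := g) (s := Set.univ) (C := C)
    (fun x _ => hg x) (fun x _ => by simpa using hC x) convex_univ (Set.mem_univ y)
    (Set.mem_univ x)
  simpa using this

lemma SmoothBV.exists_smoothBound {g : ℝ → ℝ} (h : SmoothBV g) : ∃ C, SmoothBound g C := by
  obtain ⟨h1, -, C, hC⟩ := h
  have hd : Differentiable ℝ g := h1.differentiable (by norm_num)
  have hd2 : Differentiable ℝ (deriv g) := by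
    have h2 : ContDiff ℝ 1 (deriv g) := by
      have : ContDiff ℝ (1 + 1) g := by simpa [one_add_one_eq_two] using h1
      exact (contDiff_succ_iff_deriv.1 this).2.2
    exact h2.differentiable (by norm_num)
  exact ⟨C, (abs_nonneg _).trans (hC 0).1, hd, fun x => (hC x).1, fun x => (hC x).2.1,
    abs_sub_le_of_abs_deriv_le hd fun x => (hC x).2.1,
    abs_sub_le_of_abs_deriv_le hd2 fun x => (hC x).2.2⟩

namespace SmoothBound

variable {g : ℝ → ℝ} {C C' : ℝ}

lemma mono (h : SmoothBound g C) (hC : C ≤ C') : SmoothBound g C' where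
  nonneg := h.nonneg.trans hC
  differentiable := h.differentiable
  bound x := (h.bound x).trans hC
  deriv_bound x := (h.deriv_bound x).trans hC
  lip x y := (h.lip x y).trans (by gcongr)
  deriv_lip x y := (h.deriv_lip x y).trans (by gcongr)

lemma continuous (h : SmoothBound g C) : Continuous g := h.differentiable.continuous

lemma continuous_deriv (h : SmoothBound g C) : Continuous (deriv g) :=
  continuous_of_abs_sub_le h.deriv_lip

lemma abs_le_of_zero (h : SmoothBound g C) (h0 : g 0 = 0) (x : ℝ) : |g x| ≤ C * |x| := by
  simpa [h0] using h.lip x 0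

/-- The function `s ↦ g(s + e) - g(s)` has a derivative of size `C |e|`, because `g'` is Lipschitz.
Its increment over a further step `e` is the second difference. -/
lemma second_difference (h : SmoothBound g C) (x e : ℝ) :
    |g (x + e) - 2 * g x + g (x - e)| ≤ C * e ^ 2 := by
  have hd : ∀ s, HasDerivAt (fun s => g (s + e) - g s) (deriv g (s + e) - deriv g s) s :=
    fun s => ((h.differentiable _).hasDerivAt.comp_add_const s e).sub
      (h.differentiable _).hasDerivAt
  have := abs_sub_le_of_abs_deriv_le (C := C * |e|) (fun s => (hd s).differentiableAt)
    (fun s => by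
      rw [(hd s).deriv]
      simpa using h.deriv_lip (s + e) s) x (x - e)
  simp only [sub_add_cancel] at this
  calc _ = |g (x + e) - g x - (g x - g (x - e))| := by congr 1; ring
    _ ≤ _ := this
    _ = C * e ^ 2 := by rw [sub_sub_cancel, mul_assoc, ← sq, sq_abs]

/-- The value at `a` is compared with the value at `2b - c`, which continues the arithmetic
progression `c`, `b`; the plain second difference with step `b - c` then applies. -/
lemma second_difference_comp (h : SmoothBound g C) (a b c : ℝ) :
    |g a - 2 * g b + g c| ≤ C * |a - 2 * b + c| + C * (b - c) ^ 2 := by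
  have h1 := h.second_difference b (b - c)
  have h2 := h.lip a (b + (b - c))
  rw [sub_sub_cancel] at h1
  have e : a - (b + (b - c)) = a - 2 * b + c := by ring
  rw [e] at h2
  calc |g a - 2 * g b + g c|
      = |(g a - g (b + (b - c))) + (g (b + (b - c)) - 2 * g b + g c)| := by congr 1; ring
    _ ≤ _ := (abs_add_le _ _).trans (add_le_add h2 h1)

end SmoothBound

/-! ### Sums over the integers -/

lemma summable_shift {f : ℤ → ℝ} (h : Summable f) (k : ℤ) : Summable fun i => f (i + k) :=
  (Equiv.addRight k).summable_iff.2 h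

lemma tsum_shift (f : ℤ → ℝ) (k : ℤ) : ∑' i, f (i + k) = ∑' i, f i :=
  (Equiv.addRight k).tsum_eq f

lemma summable_shift_sub {f : ℤ → ℝ} (h : Summable f) (k : ℤ) : Summable fun i => f (i - k) :=
  summable_shift h (-k)

lemma tsum_shift_sub (f : ℤ → ℝ) (k : ℤ) : ∑' i, f (i - k) = ∑' i, f i :=
  tsum_shift f (-k)

lemma summable_of_abs_le {f g : ℤ → ℝ} (hg : Summable g) (h : ∀ i, |f i| ≤ g i) : Summable f :=
  Summable.of_norm_bounded hg h

lemma abs_tsum_le {f g : ℤ → ℝ} (hg : Summable g) (h : ∀ i, |f i| ≤ g i) :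
    |∑' i, f i| ≤ ∑' i, g i :=
  tsum_of_norm_bounded (f := f) hg.hasSum h

lemma summable_abs_diff {w : ℤ → ℝ} (hw : Summable fun i => |w i|) :
    Summable fun i => |w (i + 1) - w i| :=
  summable_of_abs_le ((summable_shift hw 1).add hw) fun i => by
    rw [abs_abs]; exact abs_sub _ _

/-! ### The quadrature -/

section Quadrature

/-- The convex combination of `w_p` and `w_{p+1}` with weight `α_p`. -/
def interp (α w : ℤ → ℝ) (p : ℤ) : ℝ := (1 - α p) * w p + α p * w (p + 1)

variable {β ν μ : ℝ → ℝ} {C Δx : ℝ} {α w : ℤ → ℝ}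

lemma abs_interp_le (hα : ∀ p, α p ∈ Set.Icc (0 : ℝ) 1) (w : ℤ → ℝ) (p : ℤ) :
    |interp α w p| ≤ |w p| + |w (p + 1)| := by
  obtain ⟨h0, h1⟩ := hα p
  refine (abs_add_le _ _).trans ?_
  rw [abs_mul, abs_mul, abs_of_nonneg h0, abs_of_nonneg (by linarith : 0 ≤ 1 - α p)]
  nlinarith [abs_nonneg (w p), abs_nonneg (w (p + 1))]

lemma abs_interp_sub_le (hα : ∀ p, α p ∈ Set.Icc (0 : ℝ) 1) (w : ℤ → ℝ) (p : ℤ) :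
    |interp α w p - w p| ≤ |w (p + 1) - w p| := by
  obtain ⟨h0, h1⟩ := hα p
  have : interp α w p - w p = α p * (w (p + 1) - w p) := by simp only [interp]; ring
  rw [this, abs_mul, abs_of_nonneg h0]
  exact mul_le_of_le_one_left (abs_nonneg _) h1

lemma summable_abs_interp (hα : ∀ p, α p ∈ Set.Icc (0 : ℝ) 1) (hw : Summable fun i => |w i|) :
    Summable fun p => |interp α w p| :=
  summable_of_abs_le (hw.add (summable_shift hw 1)) fun p => by
    rw [abs_abs]; exact abs_interp_le hα w p

lemma tsum_abs_interp_le (hα : ∀ p, α p ∈ Set.Icc (0 : ℝ) 1) (hw : Summable fun i => |w i|) :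
    ∑' p, |interp α w p| ≤ 2 * ∑' p, |w p| := by
  have h := (summable_abs_interp hα hw).tsum_le_tsum (fun p => abs_interp_le hα w p)
    (hw.add (summable_shift hw 1))
  rw [hw.tsum_add (summable_shift hw 1), tsum_shift (fun i => |w i|) 1] at h
  linarith

lemma summable_mul_interp (hβ : SmoothBound β C) (hβ0 : β 0 = 0)
    (hα : ∀ p, α p ∈ Set.Icc (0 : ℝ) 1) (hw : Summable fun i => |w i|) {m : ℤ → ℝ} {B : ℝ}
    (hm : ∀ p, |m p| ≤ B) : Summable fun p => m p * β (interp α w p) :=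
  summable_of_abs_le ((summable_abs_interp hα hw).mul_left (B * C)) fun p => by
    have := hβ.abs_le_of_zero hβ0 (interp α w p)
    rw [abs_mul, mul_assoc]
    exact mul_le_mul (hm p) this (abs_nonneg _) ((abs_nonneg _).trans (hm p))

lemma abs_tsum_mul_interp_le (hβ : SmoothBound β C) (hβ0 : β 0 = 0)
    (hα : ∀ p, α p ∈ Set.Icc (0 : ℝ) 1) (hw : Summable fun i => |w i|) {m : ℤ → ℝ} {B : ℝ}
    (hm : ∀ p, |m p| ≤ B) : |∑' p, m p * β (interp α w p)| ≤ B * C * (2 * ∑' p, |w p|) := by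
  have hB : 0 ≤ B := (abs_nonneg _).trans (hm 0)
  refine (abs_tsum_le ((summable_abs_interp hα hw).mul_left (B * C)) fun p => ?_).trans ?_
  · have := hβ.abs_le_of_zero hβ0 (interp α w p)
    rw [abs_mul, mul_assoc]
    exact mul_le_mul (hm p) this (abs_nonneg _) hB
  · rw [tsum_mul_left]
    exact mul_le_mul_of_nonneg_left (tsum_abs_interp_le hα hw) (mul_nonneg hB hβ.nonneg)

/-- The shift is put on the smooth kernel and not on `w`, so that only the mass of `w` is needed.
The factor 2 is there because every `w p` enters two of the interpolated values. -/
lemma abs_quadrature_diff_le (hβ : SmoothBound β C) (hβ0 : β 0 = 0) (hμ : SmoothBound μ C)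
    (hα : ∀ p, α p ∈ Set.Icc (0 : ℝ) 1) (hw : Summable fun i => |w i|) (hΔx : 0 < Δx) (i : ℤ) :
    |quadrature β μ Δx α w i - quadrature β μ Δx α w (i - 1)|
      ≤ 2 * C ^ 2 * (Δx * ∑' p, |w p|) * Δx := by
  have hs : ∀ j : ℤ, Summable fun p : ℤ =>
      μ (((j : ℝ) + 1 / 2 - p) * Δx) * β (interp α w p) := fun j =>
    summable_mul_interp hβ hβ0 hα hw fun p => hμ.bound _
  have h := abs_tsum_mul_interp_le hβ hβ0 hα hw (B := C * Δx)
    (m := fun p : ℤ => μ (((i : ℝ) + 1 / 2 - p) * Δx) - μ ((((i - 1 : ℤ) : ℝ) + 1 / 2 - p) * Δx))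
    (fun p => by
      refine (hμ.lip _ _).trans (le_of_eq ?_)
      rw [← sub_mul, abs_mul, abs_of_pos hΔx]
      congr 1
      have : ((i : ℝ) + 1 / 2 - p) - (((i - 1 : ℤ) : ℝ) + 1 / 2 - p) = 1 := by push_cast; ring
      rw [this, abs_one, one_mul])
  have e : quadrature β μ Δx α w i - quadrature β μ Δx α w (i - 1)
      = Δx * ∑' p : ℤ, (μ (((i : ℝ) + 1 / 2 - p) * Δx)
          - μ ((((i - 1 : ℤ) : ℝ) + 1 / 2 - p) * Δx)) * β (interp α w p) := by
    rw [tsum_congr fun p => sub_mul _ _ _, (hs i).tsum_sub (hs (i - 1)), mul_sub]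
    rfl
  rw [e, abs_mul, abs_of_pos hΔx]
  calc _ ≤ Δx * (C * Δx * C * (2 * ∑' p, |w p|)) := by gcongr
    _ = _ := by ring

lemma abs_quadrature_second_diff_le (hβ : SmoothBound β C) (hβ0 : β 0 = 0)
    (hμ : SmoothBound μ C) (hα : ∀ p, α p ∈ Set.Icc (0 : ℝ) 1) (hw : Summable fun i => |w i|)
    (hΔx : 0 < Δx) (i : ℤ) :
    |quadrature β μ Δx α w (i + 1) - 2 * quadrature β μ Δx α w i
        + quadrature β μ Δx α w (i - 1)|
      ≤ 2 * C ^ 2 * (Δx * ∑' p, |w p|) * Δx ^ 2 := by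
  have hs : ∀ j : ℤ, Summable fun p : ℤ =>
      μ (((j : ℝ) + 1 / 2 - p) * Δx) * β (interp α w p) := fun j =>
    summable_mul_interp hβ hβ0 hα hw fun p => hμ.bound _
  have h := abs_tsum_mul_interp_le hβ hβ0 hα hw (B := C * Δx ^ 2)
    (m := fun p : ℤ => μ ((((i + 1 : ℤ) : ℝ) + 1 / 2 - p) * Δx)
      - 2 * μ (((i : ℝ) + 1 / 2 - p) * Δx) + μ ((((i - 1 : ℤ) : ℝ) + 1 / 2 - p) * Δx))
    (fun p => by
      have := hμ.second_difference (((i : ℝ) + 1 / 2 - p) * Δx) Δx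
      convert this using 6 <;> push_cast <;> ring)
  have e : quadrature β μ Δx α w (i + 1) - 2 * quadrature β μ Δx α w i
        + quadrature β μ Δx α w (i - 1)
      = Δx * ∑' p : ℤ, (μ ((((i + 1 : ℤ) : ℝ) + 1 / 2 - p) * Δx)
      - 2 * μ (((i : ℝ) + 1 / 2 - p) * Δx)
      + μ ((((i - 1 : ℤ) : ℝ) + 1 / 2 - p) * Δx)) * β (interp α w p) := by
    rw [tsum_congr fun (p : ℤ) => show _ = μ ((((i + 1 : ℤ) : ℝ) + 1 / 2 - p) * Δx) * β (interp α w p)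
        - 2 * (μ (((i : ℝ) + 1 / 2 - p) * Δx) * β (interp α w p))
        + μ ((((i - 1 : ℤ) : ℝ) + 1 / 2 - p) * Δx) * β (interp α w p) by ring]
    rw [((hs (i + 1)).sub ((hs i).mul_left 2)).tsum_add (hs (i - 1)),
      (hs (i + 1)).tsum_sub ((hs i).mul_left 2), tsum_mul_left]
    simp only [quadrature, interp]
    ring
  rw [e, abs_mul, abs_of_pos hΔx]
  calc _ ≤ Δx * (C * Δx ^ 2 * C * (2 * ∑' p, |w p|)) := by gcongr
    _ = _ := by ring

/-- Bounds of the first two differences of the interface coefficients. -/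
structure CoeffBound (a : ℤ → ℝ) (S A B Δx : ℝ) : Prop where
  bound : ∀ i, |a i| ≤ S
  diff : ∀ i, |a i - a (i - 1)| ≤ A * Δx
  second_diff : ∀ i, |a (i + 1) - 2 * a i + a (i - 1)| ≤ B * Δx ^ 2

/-- With `δ = 2 C² m Δx` bounding the first differences of the quadrature, those of `ν` of it are at
most `C δ` and the second ones at most `2 C³ m Δx² + C δ²`. Neither the sup norm nor the variation
of `w` enters. -/
lemma coeffBound_quadrature (hβ : SmoothBound β C) (hβ0 : β 0 = 0) (hν : SmoothBound ν C)
    (hμ : SmoothBound μ C) (hα : ∀ p, α p ∈ Set.Icc (0 : ℝ) 1) (hw : Summable fun i => |w i|)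
    (hΔx : 0 < Δx) {m : ℝ} (hm : Δx * ∑' p, |w p| ≤ m) :
    CoeffBound (fun i => ν (quadrature β μ Δx α w i)) C (2 * C ^ 3 * m)
      (2 * C ^ 3 * m + 4 * C ^ 5 * m ^ 2) Δx := by
  have hC := hβ.nonneg
  have h1 : ∀ i, |quadrature β μ Δx α w i - quadrature β μ Δx α w (i - 1)|
      ≤ 2 * C ^ 2 * m * Δx := fun i =>
    (abs_quadrature_diff_le hβ hβ0 hμ hα hw hΔx i).trans (by gcongr)
  have h2 : ∀ i, |quadrature β μ Δx α w (i + 1) - 2 * quadrature β μ Δx α w i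
      + quadrature β μ Δx α w (i - 1)| ≤ 2 * C ^ 2 * m * Δx ^ 2 := fun i =>
    (abs_quadrature_second_diff_le hβ hβ0 hμ hα hw hΔx i).trans (by gcongr)
  refine ⟨fun i => hν.bound _, fun i => ?_, fun i => ?_⟩
  · calc _ ≤ C * (2 * C ^ 2 * m * Δx) :=
        (hν.lip _ _).trans (mul_le_mul_of_nonneg_left (h1 i) hC)
      _ = _ := by ring
  · refine (hν.second_difference_comp _ _ _).trans ?_
    have h3 : (quadrature β μ Δx α w i - quadrature β μ Δx α w (i - 1)) ^ 2
        ≤ (2 * C ^ 2 * m * Δx) ^ 2 := by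
      rw [← sq_abs]
      exact pow_le_pow_left₀ (abs_nonneg _) (h1 i) 2
    calc _ ≤ C * (2 * C ^ 2 * m * Δx ^ 2) + C * (2 * C ^ 2 * m * Δx) ^ 2 :=
        add_le_add (mul_le_mul_of_nonneg_left (h2 i) hC) (mul_le_mul_of_nonneg_left h3 hC)
      _ = _ := by ring

end Quadrature

/-! ### One step of the scheme -/

namespace IsNonlocalFlux

variable {f : ℝ → ℝ} {K D : ℝ} {F : ℝ → ℝ → ℝ → ℝ}

lemma apply_self (h : IsNonlocalFlux f K D F) (a s : ℝ) : F a s s = a * f s := by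
  obtain ⟨g, d, h1, h2, h3, -, -⟩ := h
  rw [h1, h2, h3, sub_zero]

lemma lip (h : IsNonlocalFlux f K D F) {S : ℝ} {a : ℝ} (ha : |a| ≤ S)
    (b c b' c' : ℝ) :
    |F a b c - F a b' c'| ≤ (S * K + D) * (|b - b'| + |c - c'|) := by
  obtain ⟨g, d, h1, -, -, h4, h5⟩ := h
  rw [h1, h1]
  have e : a * g b c - d b c - (a * g b' c' - d b' c')
      = a * (g b c - g b' c') - (d b c - d b' c') := by ring
  rw [e]
  refine (abs_sub _ _).trans ?_
  rw [abs_mul, add_mul, mul_assoc]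
  exact add_le_add (mul_le_mul ha (h4 _ _ _ _) (abs_nonneg _) ((abs_nonneg _).trans ha))
    (h5 _ _ _ _)

lemma abs_le (h : IsNonlocalFlux f K D F) (hf0 : f 0 = 0) {S : ℝ} {a : ℝ} (ha : |a| ≤ S)
    (b c : ℝ) : |F a b c| ≤ (S * K + D) * (|b| + |c|) := by
  have := h.lip ha b c 0 0
  simpa [h.apply_self, hf0] using this

lemma coef_diff (h : IsNonlocalFlux f K D F) (hf0 : f 0 = 0) (a a' b c : ℝ) :
    |F a b c - F a' b c| ≤ |a - a'| * (K * (|b| + |c|)) := by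
  obtain ⟨g, d, h1, h2, -, h4, -⟩ := h
  have e : F a b c - F a' b c = (a - a') * g b c := by rw [h1, h1]; ring
  rw [e, abs_mul]
  refine mul_le_mul_of_nonneg_left ?_ (abs_nonneg _)
  simpa [h2, hf0] using h4 b c 0 0

/-- A discrete product rule, possible because the flux is affine in the coefficient. The viscosity
does not see the coefficient and drops out; this is why the variation bound does not depend on `D`.
-/
lemma coef_second_diff (h : IsNonlocalFlux f K D F) (hf0 : f 0 = 0) (a₀ a₁ a₂ b c d : ℝ) :
    |(F a₂ c d - F a₁ c d) - (F a₁ b c - F a₀ b c)|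
      ≤ |a₂ - 2 * a₁ + a₀| * (K * (|c| + |d|)) + |a₁ - a₀| * (K * (|c - b| + |d - c|)) := by
  obtain ⟨g, e, h1, h2, -, h4, -⟩ := h
  have e1 : (F a₂ c d - F a₁ c d) - (F a₁ b c - F a₀ b c)
      = (a₂ - 2 * a₁ + a₀) * g c d + (a₁ - a₀) * (g c d - g b c) := by
    rw [h1, h1, h1, h1]; ring
  rw [e1]
  refine (abs_add_le _ _).trans (add_le_add ?_ ?_)
  · rw [abs_mul]
    refine mul_le_mul_of_nonneg_left ?_ (abs_nonneg _)
    simpa [h2, hf0] using h4 c d 0 0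
  · rw [abs_mul]
    exact mul_le_mul_of_nonneg_left (h4 c d b c) (abs_nonneg _)

end IsNonlocalFlux

/-- One time step of the scheme with interface coefficients `a`. -/
def step (F : ℝ → ℝ → ℝ → ℝ) (lam : ℝ) (a w : ℤ → ℝ) (i : ℤ) : ℝ :=
  update F lam (a (i - 1)) (a i) (w (i - 1)) (w i) (w (i + 1))

section Step

variable {f : ℝ → ℝ} {K D lam S A B Δx : ℝ} {F : ℝ → ℝ → ℝ → ℝ} {a v w : ℤ → ℝ}

lemma step_eq (i : ℤ) :
    step F lam a w i = w i - lam * (F (a i) (w i) (w (i + 1))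
      - F (a (i - 1)) (w (i - 1)) (w (i - 1 + 1))) := by
  rw [sub_add_cancel]; rfl

/-- A constant state is not preserved: the jump of the coefficient acts as a source. The state `0`
is preserved because `f 0 = 0`. Comparison with these values gives positivity, the sup norm bound
and the entropy inequality. -/
lemma update_const (hF : IsNonlocalFlux f K D F) (x y k : ℝ) :
    update F lam x y k k k = k - lam * (y - x) * f k := by
  simp only [update, hF.apply_self]; ring

lemma step_nonneg (hF : IsNonlocalFlux f K D F) (hf0 : f 0 = 0)
    (hmono : ∀ i, UpdateIncreasing F lam (a (i - 1)) (a i)) (hw : ∀ i, 0 ≤ w i) (i : ℤ) :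
    0 ≤ step F lam a w i := by
  have := hmono i 0 (w (i - 1)) 0 (w i) 0 (w (i + 1)) (hw _) (hw _) (hw _)
  rw [update_const hF, hf0] at this
  simpa [step] using this

lemma step_le (hF : IsNonlocalFlux f K D F) {L : ℝ} (hf : ∀ x, |f x| ≤ L * |x|)
    (ha : CoeffBound a S A B Δx) (hlam : 0 ≤ lam)
    (hmono : ∀ i, UpdateIncreasing F lam (a (i - 1)) (a i)) {M : ℝ} (hM : 0 ≤ M)
    (hw : ∀ i, w i ≤ M) (i : ℤ) :
    step F lam a w i ≤ (1 + lam * Δx * (A * L)) * M := by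
  have h := hmono i (w (i - 1)) M (w i) M (w (i + 1)) M (hw _) (hw _) (hw _)
  rw [update_const hF] at h
  have h1 : -((a i - a (i - 1)) * f M) ≤ A * Δx * (L * M) := by
    refine (neg_le_abs _).trans ?_
    rw [abs_mul]
    have := hf M
    rw [abs_of_nonneg hM] at this
    exact mul_le_mul (ha.diff i) this (abs_nonneg _) ((abs_nonneg _).trans (ha.diff i))
  have h2 := mul_le_mul_of_nonneg_left h1 hlam
  calc step F lam a w i ≤ M - lam * (a i - a (i - 1)) * f M := h
    _ ≤ _ := by linarith

lemma summable_flux (hF : IsNonlocalFlux f K D F) (hf0 : f 0 = 0)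
    (ha : ∀ i, |a i| ≤ S) (hw : Summable fun i => |w i|) :
    Summable fun i => F (a i) (w i) (w (i + 1)) :=
  summable_of_abs_le ((hw.add (summable_shift hw 1)).mul_left (S * K + D)) fun i =>
    hF.abs_le hf0 (ha i) _ _

lemma summable_step (hF : IsNonlocalFlux f K D F) (hf0 : f 0 = 0)
    (ha : ∀ i, |a i| ≤ S) (hw : Summable fun i => |w i|) :
    Summable (step F lam a w) := by
  have h := summable_flux hF hf0 ha hw
  have := hw.of_abs.sub ((h.sub (summable_shift_sub h 1)).mul_left lam)
  exact this.congr fun i => by rw [step_eq]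

lemma tsum_step (hF : IsNonlocalFlux f K D F) (hf0 : f 0 = 0)
    (ha : ∀ i, |a i| ≤ S) (hw : Summable fun i => |w i|) :
    ∑' i, step F lam a w i = ∑' i, w i := by
  have h := summable_flux hF hf0 ha hw
  have h2 := summable_shift_sub h 1
  have := hw.of_abs.tsum_sub ((h.sub h2).mul_left lam)
  rw [tsum_mul_left, h.tsum_sub h2,
    tsum_shift_sub (fun i => F (a i) (w i) (w (i + 1))) 1, sub_self, mul_zero, sub_zero] at this
  rw [← this]
  exact tsum_congr fun i => by rw [step_eq]

/-- The argument of Crandall and Tartar: both images lie between the images of the minimum and of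
the maximum of `v` and `w`, and the sum of that gap is conserved. Both states must be advanced with
the same coefficients. -/
lemma step_contraction (hF : IsNonlocalFlux f K D F) (hf0 : f 0 = 0)
    (ha : ∀ i, |a i| ≤ S) (hmono : ∀ i, UpdateIncreasing F lam (a (i - 1)) (a i))
    (hv : Summable fun i => |v i|) (hw : Summable fun i => |w i|) :
    Summable (fun i => |step F lam a v i - step F lam a w i|) ∧
      ∑' i, |step F lam a v i - step F lam a w i| ≤ ∑' i, |v i - w i| := by
  set p : ℤ → ℝ := fun i => max (v i) (w i)
  set q : ℤ → ℝ := fun i => min (v i) (w i)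
  have hp : Summable fun i => |p i| := summable_of_abs_le (hv.add hw) fun i => by
    rw [abs_abs]
    refine (abs_max_le_max_abs_abs).trans (max_le ?_ ?_) <;>
      linarith [abs_nonneg (v i), abs_nonneg (w i)]
  have hq : Summable fun i => |q i| := summable_of_abs_le (hv.add hw) fun i => by
    rw [abs_abs]
    refine (abs_min_le_max_abs_abs).trans (max_le ?_ ?_) <;>
      linarith [abs_nonneg (v i), abs_nonneg (w i)]
  have h1 : ∀ i, |step F lam a v i - step F lam a w i|
      ≤ step F lam a p i - step F lam a q i := fun i => by
    have e1 := hmono i (v (i - 1)) (p (i - 1)) (v i) (p i) (v (i + 1)) (p (i + 1))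
      (le_max_left _ _) (le_max_left _ _) (le_max_left _ _)
    have e2 := hmono i (w (i - 1)) (p (i - 1)) (w i) (p i) (w (i + 1)) (p (i + 1))
      (le_max_right _ _) (le_max_right _ _) (le_max_right _ _)
    have e3 := hmono i (q (i - 1)) (v (i - 1)) (q i) (v i) (q (i + 1)) (v (i + 1))
      (min_le_left _ _) (min_le_left _ _) (min_le_left _ _)
    have e4 := hmono i (q (i - 1)) (w (i - 1)) (q i) (w i) (q (i + 1)) (w (i + 1))
      (min_le_right _ _) (min_le_right _ _) (min_le_right _ _)
    simp only [step]
    rw [abs_le]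
    constructor <;> linarith
  have hs := (summable_step (lam := lam) hF hf0 ha hp).sub
    (summable_step (lam := lam) hF hf0 ha hq)
  have hsum : Summable (fun i => |step F lam a v i - step F lam a w i|) :=
    summable_of_abs_le hs fun i => by rw [abs_abs]; exact h1 i
  refine ⟨hsum, (hsum.tsum_le_tsum h1 hs).trans (le_of_eq ?_)⟩
  rw [(summable_step hF hf0 ha hp).tsum_sub (summable_step hF hf0 ha hq),
    tsum_step hF hf0 ha hp, tsum_step hF hf0 ha hq,
    ← hp.of_abs.tsum_sub hq.of_abs]
  exact tsum_congr fun i => max_sub_min_eq_abs' _ _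

/-- The contraction is applied to `w` and its shift with the coefficients unshifted. The shift of
the coefficients is then an explicit error, a mixed difference of the flux estimated by
`coef_second_diff`. -/
lemma step_variation (hF : IsNonlocalFlux f K D F) (hf0 : f 0 = 0) (hK : 0 ≤ K)
    (ha : CoeffBound a S A B Δx) (hmono : ∀ i, UpdateIncreasing F lam (a (i - 1)) (a i))
    (hlam : 0 ≤ lam) (hw : Summable fun i => |w i|) :
    ∑' i, |step F lam a w (i + 1) - step F lam a w i| ≤
      (1 + 2 * A * K * (lam * Δx)) * ∑' i, |w (i + 1) - w i|
        + 2 * B * K * (lam * Δx) * (Δx * ∑' i, |w i|) := by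
  have hw1 := summable_shift hw 1
  have hw2 := summable_shift hw 2
  have hd := summable_abs_diff hw
  have hd1 := summable_shift hd 1
  obtain ⟨hc, hc'⟩ := step_contraction hF hf0 ha.bound hmono
    (v := fun i => w (i + 1)) (w := w) hw1 hw
  set R : ℤ → ℝ := fun i => lam * (B * Δx ^ 2 * (K * (|w (i + 1)| + |w (i + 2)|))
    + A * Δx * (K * (|w (i + 1) - w i| + |w (i + 1 + 1) - w (i + 1)|))) with hR
  have hRs : Summable R :=
    ((((hw1.add hw2).mul_left K).mul_left _).add (((hd.add hd1).mul_left K).mul_left _)).mul_left _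
  have hRt : ∑' i, R i = lam * (B * Δx ^ 2 * (K * (2 * ∑' i, |w i|))
      + A * Δx * (K * (2 * ∑' i, |w (i + 1) - w i|))) := by
    have s1 : Summable fun i => B * Δx ^ 2 * (K * (|w (i + 1)| + |w (i + 2)|)) :=
      ((hw1.add hw2).mul_left K).mul_left _
    have s2 : Summable fun i => A * Δx * (K * (|w (i + 1) - w i| + |w (i + 1 + 1) - w (i + 1)|)) :=
      ((hd.add hd1).mul_left K).mul_left _
    rw [hR, tsum_mul_left, s1.tsum_add s2, tsum_mul_left, tsum_mul_left, tsum_mul_left,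
      tsum_mul_left, hw1.tsum_add hw2, hd.tsum_add hd1, tsum_shift (fun i => |w i|) 1,
      tsum_shift (fun i => |w i|) 2, tsum_shift (fun i => |w (i + 1) - w i|) 1]
    ring
  have hpt : ∀ i, |step F lam a w (i + 1) - step F lam a w i|
      ≤ |step F lam a (fun i => w (i + 1)) i - step F lam a w i| + R i := fun i => by
    have e : step F lam a w (i + 1) - step F lam a (fun i => w (i + 1)) i
        = -(lam * ((F (a (i + 1)) (w (i + 1)) (w (i + 2)) - F (a i) (w (i + 1)) (w (i + 2)))
          - (F (a i) (w i) (w (i + 1)) - F (a (i - 1)) (w i) (w (i + 1))))) := by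
      simp only [step, update, add_sub_cancel_right, sub_add_cancel, add_assoc, one_add_one_eq_two]
      ring
    have e2 : |step F lam a w (i + 1) - step F lam a (fun i => w (i + 1)) i| ≤ R i := by
      rw [e, abs_neg, abs_mul, abs_of_nonneg hlam]
      refine mul_le_mul_of_nonneg_left ?_ hlam
      refine (hF.coef_second_diff hf0 _ _ _ _ _ _).trans (add_le_add ?_ ?_)
      · exact mul_le_mul_of_nonneg_right (ha.second_diff i) (by positivity)
      · have : i + 1 + 1 = i + 2 := by ring
        rw [this]
        exact mul_le_mul_of_nonneg_right (ha.diff i) (by positivity)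
    calc _ ≤ |step F lam a w (i + 1) - step F lam a (fun i => w (i + 1)) i|
          + |step F lam a (fun i => w (i + 1)) i - step F lam a w i| := abs_sub_le _ _ _
      _ ≤ _ := by linarith
  have hs : Summable fun i => |step F lam a w (i + 1) - step F lam a w i| :=
    summable_of_abs_le (hc.add hRs) fun i => by rw [abs_abs]; exact hpt i
  refine (hs.tsum_le_tsum hpt (hc.add hRs)).trans ?_
  rw [hc.tsum_add hRs, hRt]
  have := hc'
  calc _ ≤ ∑' i, |w (i + 1) - w i| + lam * (B * Δx ^ 2 * (K * (2 * ∑' i, |w i|))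
      + A * Δx * (K * (2 * ∑' i, |w (i + 1) - w i|))) := by linarith
    _ = _ := by ring

/-- The flux difference is split into an increment of the states at a fixed coefficient and an
increment of the coefficient. The first part feels the viscosity, so that `D` enters the continuity
in time. -/
lemma step_time_diff (hF : IsNonlocalFlux f K D F) (hf0 : f 0 = 0) (hK : 0 ≤ K)
    (ha : CoeffBound a S A B Δx) (hlam : 0 ≤ lam) (hw : Summable fun i => |w i|) :
    Summable (fun i => |step F lam a w i - w i|) ∧
    ∑' i, |step F lam a w i - w i| ≤
      lam * (2 * (S * K + D) * ∑' i, |w (i + 1) - w i| + 2 * A * K * (Δx * ∑' i, |w i|)) := by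
  have hw1 := summable_shift_sub hw 1
  have hd := summable_abs_diff hw
  have hd1 := summable_shift_sub hd 1
  set R : ℤ → ℝ := fun i => lam * ((S * K + D) * (|w (i - 1 + 1) - w (i - 1)| + |w (i + 1) - w i|)
    + A * Δx * (K * (|w (i - 1)| + |w i|))) with hR
  have s1 : Summable fun i => (S * K + D) * (|w (i - 1 + 1) - w (i - 1)| + |w (i + 1) - w i|) :=
    (hd1.add hd).mul_left _
  have s2 : Summable fun i => A * Δx * (K * (|w (i - 1)| + |w i|)) :=
    ((hw1.add hw).mul_left K).mul_left _
  have hRs : Summable R := (s1.add s2).mul_left _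
  have hRt : ∑' i, R i = lam * (2 * (S * K + D) * ∑' i, |w (i + 1) - w i|
      + 2 * A * K * (Δx * ∑' i, |w i|)) := by
    rw [hR, tsum_mul_left, s1.tsum_add s2, tsum_mul_left, tsum_mul_left, tsum_mul_left,
      hd1.tsum_add hd, hw1.tsum_add hw, tsum_shift_sub (fun i => |w i|) 1,
      tsum_shift_sub (fun i => |w (i + 1) - w i|) 1]
    ring
  have hpt : ∀ i, |step F lam a w i - w i| ≤ R i := fun i => by
    have e : step F lam a w i - w i = -(lam * ((F (a i) (w i) (w (i + 1))
        - F (a i) (w (i - 1)) (w i)) + (F (a i) (w (i - 1)) (w i)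
        - F (a (i - 1)) (w (i - 1)) (w i)))) := by
      simp only [step, update]; ring
    rw [e, abs_neg, abs_mul, abs_of_nonneg hlam]
    refine mul_le_mul_of_nonneg_left ((abs_add_le _ _).trans (add_le_add ?_ ?_)) hlam
    · rw [sub_add_cancel]
      exact hF.lip (ha.bound i) _ _ _ _
    · exact (hF.coef_diff hf0 _ _ _ _).trans
        (mul_le_mul_of_nonneg_right (ha.diff i) (by positivity))
  have hs : Summable (fun i => |step F lam a w i - w i|) :=
    summable_of_abs_le hRs fun i => by rw [abs_abs]; exact hpt i
  exact ⟨hs, (hs.tsum_le_tsum hpt hRs).trans_eq hRt⟩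

lemma sign_mul_self_eq_abs (x : ℝ) : Real.sign x * x = |x| := by
  rcases lt_trichotomy x 0 with h | h | h
  · rw [Real.sign_of_neg h, abs_of_neg h]; ring
  · simp [h]
  · rw [Real.sign_of_pos h, abs_of_pos h]; ring

lemma abs_sign_le (x : ℝ) : |Real.sign x| ≤ 1 := by
  rcases Real.sign_apply_eq x with h | h | h <;> rw [h] <;> norm_num

/-- The discrete entropy inequality. -/
lemma step_entropy (hF : IsNonlocalFlux f K D F)
    (hmono : ∀ i, UpdateIncreasing F lam (a (i - 1)) (a i)) (i : ℤ) (k : ℝ) :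
    |step F lam a w i - k| - |w i - k|
      + lam * (entropyFlux F (a i) (w i) (w (i + 1)) k
        - entropyFlux F (a (i - 1)) (w (i - 1)) (w i) k)
      + lam * Real.sign (step F lam a w i - k) * f k * (a i - a (i - 1)) ≤ 0 := by
  set W := step F lam a w i with hW
  have e1 := hmono i (w (i - 1)) (max (w (i - 1)) k) (w i) (max (w i) k) (w (i + 1))
    (max (w (i + 1)) k) (le_max_left _ _) (le_max_left _ _) (le_max_left _ _)
  have e2 := hmono i k (max (w (i - 1)) k) k (max (w i) k) k
    (max (w (i + 1)) k) (le_max_right _ _) (le_max_right _ _) (le_max_right _ _)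
  have e3 := hmono i (min (w (i - 1)) k) (w (i - 1)) (min (w i) k) (w i) (min (w (i + 1)) k)
    (w (i + 1)) (min_le_left _ _) (min_le_left _ _) (min_le_left _ _)
  have e4 := hmono i (min (w (i - 1)) k) k (min (w i) k) k (min (w (i + 1)) k) k
    (min_le_right _ _) (min_le_right _ _) (min_le_right _ _)
  rw [update_const hF] at e2 e4
  have hWu : update F lam (a (i - 1)) (a i) (w (i - 1)) (w i) (w (i + 1)) = W := rfl
  rw [hWu] at e1 e3
  -- The new value and the image of the constant state `k` both lie between the images of the
  -- minimum and of the maximum with `k`.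
  have h1 : |W - (k - lam * (a i - a (i - 1)) * f k)| ≤
      update F lam (a (i - 1)) (a i) (max (w (i - 1)) k) (max (w i) k) (max (w (i + 1)) k)
      - update F lam (a (i - 1)) (a i) (min (w (i - 1)) k) (min (w i) k) (min (w (i + 1)) k) := by
    rw [abs_le]
    constructor <;> linarith
  -- Multiplication by `sgn(W - k)` bounds the absolute value from below and produces `|W - k|` plus
  -- the source term with exactly the sign required.
  have h2 : Real.sign (W - k) * (W - (k - lam * (a i - a (i - 1)) * f k))
      ≤ |W - (k - lam * (a i - a (i - 1)) * f k)| := by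
    refine (le_abs_self _).trans ?_
    rw [abs_mul]
    exact mul_le_of_le_one_left (abs_nonneg _) (abs_sign_le _)
  have h3 := sign_mul_self_eq_abs (W - k)
  have h4 : max (w i) k - min (w i) k = |w i - k| := max_sub_min_eq_abs' _ _
  simp only [update] at h1
  simp only [entropyFlux]
  nlinarith

end Step

end NonlocalFV

namespace NonlocalFV

/-! ### Cells and step functions -/

/-- The cell `C_i = [x_{i-1/2}, x_{i+1/2})`. -/
def cell (Δx : ℝ) (i : ℤ) : Set ℝ := Set.Ico (((i : ℝ) - 1 / 2) * Δx) (((i : ℝ) + 1 / 2) * Δx)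

/-- The index of the cell that contains `x`. -/
noncomputable def cellIndex (Δx x : ℝ) : ℤ := ⌊x / Δx + 1 / 2⌋

/-- The piecewise constant function with the value `w i` on `C_i`. -/
noncomputable def stepFun (Δx : ℝ) (w : ℤ → ℝ) (x : ℝ) : ℝ := w (cellIndex Δx x)

section Cells

variable {Δx : ℝ}

lemma mem_cell_iff (hΔx : 0 < Δx) {x : ℝ} {i : ℤ} : x ∈ cell Δx i ↔ cellIndex Δx x = i := by
  rw [cellIndex, Int.floor_eq_iff, cell, Set.mem_Ico]
  have e : x = x / Δx * Δx := by field_simp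
  constructor
  · rintro ⟨h1, h2⟩
    rw [e] at h1 h2
    have h3 := le_of_mul_le_mul_right h1 hΔx
    have h4 := lt_of_mul_lt_mul_right h2 hΔx.le
    constructor <;> linarith
  · rintro ⟨h1, h2⟩
    rw [e]
    exact ⟨mul_le_mul_of_nonneg_right (by linarith) hΔx.le,
      mul_lt_mul_of_pos_right (by linarith) hΔx⟩

lemma mem_cell_cellIndex (hΔx : 0 < Δx) (x : ℝ) : x ∈ cell Δx (cellIndex Δx x) :=
  (mem_cell_iff hΔx).2 rfl

lemma measurable_cellIndex (Δx : ℝ) : Measurable (cellIndex Δx) :=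
  Int.measurable_floor.comp ((measurable_id.div_const Δx).add_const _)

lemma measurableSet_cell (Δx : ℝ) (i : ℤ) : MeasurableSet (cell Δx i) := measurableSet_Ico

lemma iUnion_cell (hΔx : 0 < Δx) : ⋃ i, cell Δx i = Set.univ :=
  Set.eq_univ_of_forall fun x => Set.mem_iUnion.2 ⟨_, mem_cell_cellIndex hΔx x⟩

lemma pairwise_disjoint_cell (hΔx : 0 < Δx) :
    Pairwise (Function.onFun Disjoint (cell Δx)) := fun _ _ hij =>
  Set.disjoint_left.2 fun _ hi hj =>
    hij (((mem_cell_iff hΔx).1 hi).symm.trans ((mem_cell_iff hΔx).1 hj))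

lemma volume_real_cell (hΔx : 0 < Δx) (i : ℤ) : volume.real (cell Δx i) = Δx := by
  rw [cell, Real.volume_real_Ico_of_le] <;> nlinarith

lemma hasSum_integral_cell (hΔx : 0 < Δx) {g : ℝ → ℝ} (hg : Integrable g) :
    HasSum (fun i => ∫ x in cell Δx i, g x) (∫ x, g x) := by
  have := hasSum_integral_iUnion (μ := volume) (f := g) (fun i => measurableSet_cell Δx i)
    (pairwise_disjoint_cell hΔx) (by rw [iUnion_cell hΔx]; exact hg.integrableOn)
  rwa [iUnion_cell hΔx, Measure.restrict_univ] at this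

lemma measurable_stepFun (Δx : ℝ) (w : ℤ → ℝ) : Measurable (stepFun Δx w) :=
  (measurable_from_top (f := w)).comp (measurable_cellIndex Δx)

lemma cellIndex_add (hΔx : 0 < Δx) (x : ℝ) : cellIndex Δx (x + Δx) = cellIndex Δx x + 1 := by
  rw [cellIndex, cellIndex, ← Int.floor_add_one]
  congr 1
  field_simp
  ring

lemma cellIndex_sub (hΔx : 0 < Δx) (x : ℝ) : cellIndex Δx (x - Δx) = cellIndex Δx x - 1 := by
  have := cellIndex_add hΔx (x - Δx)
  rw [sub_add_cancel] at this
  omega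

lemma cellIndex_mono (hΔx : 0 < Δx) : Monotone (cellIndex Δx) := fun x y h =>
  Int.floor_le_floor (by gcongr)

lemma setIntegral_cell_stepFun (hΔx : 0 < Δx) (w : ℤ → ℝ) (i : ℤ) :
    ∫ x in cell Δx i, stepFun Δx w x = Δx * w i := by
  rw [setIntegral_congr_fun (g := fun _ => w i) (measurableSet_cell Δx i)
    (fun x hx => by simp only [stepFun, (mem_cell_iff hΔx).1 hx])]
  simp [volume_real_cell hΔx]

lemma integrable_stepFun (hΔx : 0 < Δx) {w : ℤ → ℝ} (hw : Summable fun i => |w i|) :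
    Integrable (stepFun Δx w) := by
  have h : IntegrableOn (stepFun Δx w) (⋃ i, cell Δx i) := by
    refine integrableOn_iUnion_of_summable_integral_norm (fun i => ?_) ?_
    · refine (integrableOn_congr_fun (f := fun _ => w i) (fun x hx => ?_)
        (measurableSet_cell Δx i)).1 ?_
      · simp only [stepFun, (mem_cell_iff hΔx).1 hx]
      · rw [cell]; simp
    · refine (hw.mul_left Δx).congr fun i => ?_
      exact (setIntegral_cell_stepFun hΔx (fun i => |w i|) i).symm
  rwa [iUnion_cell hΔx, integrableOn_univ] at h

lemma integral_stepFun (hΔx : 0 < Δx) {w : ℤ → ℝ} (hw : Summable fun i => |w i|) :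
    ∫ x, stepFun Δx w x = Δx * ∑' i, w i := by
  have h := hasSum_integral_cell hΔx (integrable_stepFun hΔx hw)
  simp only [setIntegral_cell_stepFun hΔx] at h
  rw [← h.tsum_eq, tsum_mul_left]

lemma integral_abs_stepFun (hΔx : 0 < Δx) {w : ℤ → ℝ} (hw : Summable fun i => |w i|) :
    ∫ x, |stepFun Δx w x| = Δx * ∑' i, |w i| :=
  integral_stepFun hΔx (w := fun i => |w i|) (by simpa using hw)

end Cells

/-! ### Functions of bounded variation -/

/-- `h` is non-decreasing with total increase at most `V`, and dominates the increments of `v`. -/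
structure VariationBound (v h : ℝ → ℝ) (V : ℝ) : Prop where
  mono : Monotone h
  increments : ∀ ⦃x y⦄, x ≤ y → |v y - v x| ≤ h y - h x
  total : ∀ x y, h y - h x ≤ V

lemma exists_variationBound {v : ℝ → ℝ} (hv : BoundedVariationOn v Set.univ) :
    ∃ h V, VariationBound v h V := by
  have hl := hv.locallyBoundedVariationOn
  set h := variationOnFromTo v Set.univ 0
  have hmono : Monotone h := fun x y hxy =>
    variationOnFromTo.monotoneOn hl (Set.mem_univ 0) (Set.mem_univ x) (Set.mem_univ y) hxy
  have hsub : ∀ x y, h y - h x = variationOnFromTo v Set.univ x y := fun x y => by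
    have := variationOnFromTo.add hl (Set.mem_univ 0) (Set.mem_univ x) (Set.mem_univ y)
    simp only [h]
    linarith
  refine ⟨h, (eVariationOn v Set.univ).toReal, hmono, fun x y hxy => ?_, fun x y => ?_⟩
  · rw [hsub, variationOnFromTo.eq_of_le _ _ hxy, ← Real.dist_eq]
    have hfin := hl x y (Set.mem_univ x) (Set.mem_univ y)
    have he := eVariationOn.edist_le v (s := Set.univ ∩ Set.Icc x y) (x := y) (y := x)
      ⟨Set.mem_univ _, hxy, le_rfl⟩ ⟨Set.mem_univ _, le_rfl, hxy⟩
    rw [dist_edist]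
    exact ENNReal.toReal_mono hfin he
  · rcases le_total x y with hxy | hxy
    · rw [hsub, variationOnFromTo.eq_of_le _ _ hxy]
      exact ENNReal.toReal_mono hv (eVariationOn.mono _ Set.inter_subset_left)
    · have := hmono hxy
      have := ENNReal.toReal_nonneg (a := eVariationOn v Set.univ)
      linarith

/-- The increments belong to disjoint unit intervals between `a` and `b`; the largest index is split
off. -/
lemma sum_increments_le {H : ℤ → ℝ} (hH : Monotone H) (s : Finset ℤ) :
    ∀ a b, (∀ i ∈ s, a ≤ i ∧ i < b) → a ≤ b → ∑ i ∈ s, (H (i + 1) - H i) ≤ H b - H a := by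
  induction s using Finset.induction_on_max with
  | empty => intro a b _ hab; simpa using hH hab
  | insert m s hm ih =>
    intro a b hs hab
    have hmem := hs m (Finset.mem_insert_self _ _)
    rw [Finset.sum_insert fun h => (hm m h).false]
    have h1 := ih a m (fun i hi => ⟨(hs i (Finset.mem_insert_of_mem hi)).1, hm i hi⟩) hmem.1
    have h2 : H (m + 1) ≤ H b := hH (by omega)
    linarith

lemma summable_increments {H : ℤ → ℝ} (hH : Monotone H) {V : ℝ} (hV : ∀ i j, H j - H i ≤ V) :
    Summable (fun i => H (i + 1) - H i) ∧ ∑' i, (H (i + 1) - H i) ≤ V := by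
  have hnn : ∀ i, 0 ≤ H (i + 1) - H i := fun i => sub_nonneg.2 (hH (by omega))
  have hle : ∀ s : Finset ℤ, ∑ i ∈ s, (H (i + 1) - H i) ≤ V := fun s => by
    rcases s.eq_empty_or_nonempty with rfl | hs
    · simpa using hV 0 0
    · refine (sum_increments_le hH s (s.min' hs) (s.max' hs + 1) (fun i hi => ?_) ?_).trans (hV _ _)
      · have := s.min'_le i hi; have := s.le_max' i hi; omega
      · have := s.min'_le _ (s.max'_mem hs); omega
  exact ⟨summable_of_sum_le hnn hle, (summable_of_sum_le hnn hle).tsum_le_of_sum_le hle⟩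

/-! ### Cell averages of functions of bounded variation. -/

section CellAverage

variable {u₀ v h : ℝ → ℝ} {V Δx : ℝ}

lemma cellAverage_eq (u₀ : ℝ → ℝ) (Δx : ℝ) (i : ℤ) :
    cellAverage u₀ Δx i = Δx⁻¹ * ∫ x in cell Δx i, u₀ x := rfl

lemma cellAverage_congr (huv : v =ᵐ[volume] u₀) (i : ℤ) :
    cellAverage u₀ Δx i = cellAverage v Δx i := by
  rw [cellAverage_eq, cellAverage_eq, setIntegral_congr_ae (measurableSet_cell Δx i)]
  filter_upwards [huv] with x hx _ using hx.symm

lemma cellAverage_eq_intervalIntegral (hΔx : 0 < Δx) (v : ℝ → ℝ) (i : ℤ) :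
    cellAverage v Δx i = Δx⁻¹ * ∫ x in (((i : ℝ) - 1 / 2) * Δx)..(((i : ℝ) + 1 / 2) * Δx), v x := by
  rw [cellAverage, intervalIntegral.integral_of_le (by nlinarith), integral_Ico_eq_integral_Ioc]

lemma cellAverage_succ (hΔx : 0 < Δx) (v : ℝ → ℝ) (i : ℤ) :
    cellAverage v Δx (i + 1) = cellAverage (fun x => v (x + Δx)) Δx i := by
  rw [cellAverage_eq_intervalIntegral hΔx, cellAverage_eq_intervalIntegral hΔx,
    intervalIntegral.integral_comp_add_right]
  congr 3 <;> push_cast <;> ring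

lemma cellAverage_nonneg (hΔx : 0 < Δx) (hu₀ : ∀ᵐ x ∂volume, 0 ≤ u₀ x) (i : ℤ) :
    0 ≤ cellAverage u₀ Δx i :=
  mul_nonneg (inv_nonneg.2 hΔx.le)
    (integral_nonneg_of_ae (ae_restrict_of_ae hu₀))

lemma abs_cellAverage_le (hΔx : 0 < Δx) (u₀ : ℝ → ℝ) (i : ℤ) :
    Δx * |cellAverage u₀ Δx i| ≤ ∫ x in cell Δx i, |u₀ x| := by
  rw [cellAverage_eq, abs_mul, abs_of_pos (inv_pos.2 hΔx), ← mul_assoc,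
    mul_inv_cancel₀ hΔx.ne', one_mul]
  exact abs_integral_le_integral_abs

lemma summable_cellAverage (hΔx : 0 < Δx) (hu₀ : Integrable u₀) :
    Summable (fun i => |cellAverage u₀ Δx i|) ∧
      Δx * ∑' i, |cellAverage u₀ Δx i| ≤ ∫ x, |u₀ x| := by
  have h := hasSum_integral_cell hΔx hu₀.abs
  have hs : Summable fun i => Δx * |cellAverage u₀ Δx i| :=
    summable_of_abs_le h.summable fun i => by
      rw [abs_of_nonneg (by positivity)]; exact abs_cellAverage_le hΔx u₀ i
  refine ⟨(summable_mul_left_iff hΔx.ne').1 hs, ?_⟩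
  rw [← tsum_mul_left, ← h.tsum_eq]
  exact hs.tsum_le_tsum (abs_cellAverage_le hΔx u₀) h.summable

lemma integrableOn_cell_of_monotone (hh : Monotone h) (i : ℤ) : IntegrableOn h (cell Δx i) :=
  ((hh.monotoneOn _).integrableOn_isCompact isCompact_Icc).mono_set Set.Ico_subset_Icc_self

lemma cellAverage_sub (hu : IntegrableOn u₀ (cell Δx i)) (hv : IntegrableOn v (cell Δx i)) :
    cellAverage (fun x => u₀ x - v x) Δx i = cellAverage u₀ Δx i - cellAverage v Δx i := by
  rw [cellAverage_eq, cellAverage_eq, cellAverage_eq, integral_sub hu hv, mul_sub]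

lemma cellAverage_mono (hΔx : 0 < Δx) (hu : IntegrableOn u₀ (cell Δx i))
    (hv : IntegrableOn v (cell Δx i)) (huv : ∀ x ∈ cell Δx i, u₀ x ≤ v x) :
    cellAverage u₀ Δx i ≤ cellAverage v Δx i :=
  mul_le_mul_of_nonneg_left (setIntegral_mono_on hu hv (measurableSet_cell Δx i) huv)
    (inv_nonneg.2 hΔx.le)

lemma cellAverage_const (hΔx : 0 < Δx) (c : ℝ) (i : ℤ) : cellAverage (fun _ => c) Δx i = c := by
  rw [cellAverage_eq, setIntegral_const, volume_real_cell hΔx]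
  simp [hΔx.ne']

/-- A shift by one cell shows that the increments of the averages of `v` are dominated by those of
the averages of `h`, which are monotone and increase by at most `V` in all. -/
lemma cellAverage_variation (hΔx : 0 < Δx) (hv : Integrable v) (hvh : VariationBound v h V) :
    Summable (fun i => |cellAverage v Δx (i + 1) - cellAverage v Δx i|) ∧
      ∑' i, |cellAverage v Δx (i + 1) - cellAverage v Δx i| ≤ V := by
  have hi : ∀ i, IntegrableOn h (cell Δx i) := integrableOn_cell_of_monotone hvh.mono
  have hmono' : Monotone fun x => h (x + Δx) := fun x y hxy => hvh.mono (by linarith)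
  have hi' : ∀ i, IntegrableOn (fun x => h (x + Δx)) (cell Δx i) :=
    integrableOn_cell_of_monotone hmono'
  have hv' : Integrable fun x => v (x + Δx) := hv.comp_add_right Δx
  have hstep : ∀ i, |cellAverage v Δx (i + 1) - cellAverage v Δx i|
      ≤ cellAverage h Δx (i + 1) - cellAverage h Δx i := fun i => by
    rw [cellAverage_succ hΔx, cellAverage_succ hΔx h,
      ← cellAverage_sub hv'.integrableOn hv.integrableOn, ← cellAverage_sub (hi' i) (hi i),
      cellAverage_eq, cellAverage_eq, abs_mul, abs_of_pos (inv_pos.2 hΔx)]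
    refine mul_le_mul_of_nonneg_left (abs_integral_le_integral_abs.trans ?_) (inv_nonneg.2 hΔx.le)
    exact setIntegral_mono_on (hv'.sub hv).abs.integrableOn ((hi' i).sub (hi i))
      (measurableSet_cell Δx i) fun x _ => hvh.increments (by linarith)
  have hmono : Monotone fun i => cellAverage h Δx i := by
    refine monotone_int_of_le_succ fun i => ?_
    linarith [hstep i, abs_nonneg (cellAverage v Δx (i + 1) - cellAverage v Δx i)]
  have hbound : ∀ i j, cellAverage h Δx j - cellAverage h Δx i ≤ V := fun i j => by
    have h1 : cellAverage h Δx j ≤ h (((i : ℝ) - 1 / 2) * Δx) + V := by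
      rw [← cellAverage_const hΔx (h (((i : ℝ) - 1 / 2) * Δx) + V) j]
      refine cellAverage_mono hΔx (hi j) (by rw [cell]; simp) fun x _ => ?_
      linarith [hvh.total (((i : ℝ) - 1 / 2) * Δx) x]
    have h2 : h (((i : ℝ) - 1 / 2) * Δx) ≤ cellAverage h Δx i := by
      rw [← cellAverage_const hΔx (h (((i : ℝ) - 1 / 2) * Δx)) i]
      exact cellAverage_mono hΔx (by rw [cell]; simp) (hi i) fun x hx => hvh.mono hx.1
    linarith
  obtain ⟨h1, h2⟩ := summable_increments hmono hbound
  have hs : Summable (fun i => |cellAverage v Δx (i + 1) - cellAverage v Δx i|) :=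
    summable_of_abs_le h1 fun i => by rw [abs_abs]; exact hstep i
  exact ⟨hs, (hs.tsum_le_tsum hstep h1).trans h2⟩

/-- The cell averages converge in `L¹` with rate `Δx`. -/
lemma integral_abs_stepFun_cellAverage_sub_le (hΔx : 0 < Δx) (hv : Integrable v)
    (hvh : VariationBound v h V) :
    ∫ x, |stepFun Δx (cellAverage v Δx) x - v x| ≤ Δx * V := by
  have hint : Integrable fun x => |stepFun Δx (cellAverage v Δx) x - v x| :=
    ((integrable_stepFun hΔx (summable_cellAverage hΔx hv).1).sub hv).abs
  have hsum := hasSum_integral_cell hΔx hint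
  set H : ℤ → ℝ := fun i => h (((i : ℝ) - 1 / 2) * Δx) with hH
  have hHm : Monotone H := fun i j hij => hvh.mono (by
    have : (i : ℝ) ≤ j := by exact_mod_cast hij
    gcongr)
  obtain ⟨h1, h2⟩ := summable_increments hHm (fun i j => hvh.total _ _)
  have hcell : ∀ i, ∫ x in cell Δx i, |stepFun Δx (cellAverage v Δx) x - v x|
      ≤ Δx * (H (i + 1) - H i) := fun i => by
    have hHi : H (i + 1) = h (((i : ℝ) + 1 / 2) * Δx) := by
      simp only [hH]; congr 2; push_cast; ring
    -- The oscillation of `v` on a cell is at most the increase of `h` across it, and so is the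
    -- distance of `v` to its average; these increases sum to at most `V`.
    have hosc : ∀ x ∈ cell Δx i, ∀ y ∈ cell Δx i, v x ≤ v y + (H (i + 1) - H i) := by
      intro x hx y hy
      rw [hHi]
      simp only [hH]
      have m1 := hvh.mono hx.1; have m2 := hvh.mono hx.2.le
      have m3 := hvh.mono hy.1; have m4 := hvh.mono hy.2.le
      rcases le_total x y with hxy | hxy
      · have := (abs_le.1 (hvh.increments hxy)).1; linarith
      · have := (abs_le.1 (hvh.increments hxy)).2; linarith
    have hpt : ∀ x ∈ cell Δx i, |stepFun Δx (cellAverage v Δx) x - v x| ≤ H (i + 1) - H i := by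
      intro x hx
      have hc : IntegrableOn (fun _ : ℝ => v x - (H (i + 1) - H i)) (cell Δx i) := by
        rw [cell]; simp
      have hc' : IntegrableOn (fun _ : ℝ => v x + (H (i + 1) - H i)) (cell Δx i) := by
        rw [cell]; simp
      have e1 := cellAverage_mono hΔx hc hv.integrableOn (fun y hy => by
        linarith [hosc x hx y hy])
      have e2 := cellAverage_mono hΔx hv.integrableOn hc' (fun y hy => hosc y hy x hx)
      rw [cellAverage_const hΔx] at e1 e2
      rw [stepFun, (mem_cell_iff hΔx).1 hx, abs_le]
      constructor <;> linarith
    calc _ ≤ ∫ _ in cell Δx i, (H (i + 1) - H i) :=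
          setIntegral_mono_on hint.integrableOn (by rw [cell]; simp) (measurableSet_cell Δx i) hpt
      _ = _ := by rw [setIntegral_const, volume_real_cell hΔx]; simp
  rw [← hsum.tsum_eq]
  refine (hsum.summable.tsum_le_tsum hcell (h1.mul_left Δx)).trans ?_
  rw [tsum_mul_left]
  exact mul_le_mul_of_nonneg_left h2 hΔx.le

end CellAverage

end NonlocalFV

namespace NonlocalFV

/-! ### The estimates of the scheme -/

/-- A common bound `C` of the data of the problem. -/
structure DataBound (f β ν μ : ℝ → ℝ) (C : ℝ) : Prop where
  beta : SmoothBound β C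
  nu : SmoothBound ν C
  mu : SmoothBound μ C
  beta_zero : β 0 = 0
  f_lip : ∀ x y, |f x - f y| ≤ C * |x - y|
  f_zero : f 0 = 0

/-- The initial datum: integrable, non-negative, almost everywhere equal to a function of bounded
variation. -/
structure InitialBound (u₀ : ℝ → ℝ) (m V : ℝ) : Prop where
  integrable : Integrable u₀
  nonneg : ∀ᵐ x ∂volume, 0 ≤ u₀ x
  mass : ∫ x, |u₀ x| ≤ m
  variation : ∃ v h, v =ᵐ[volume] u₀ ∧ VariationBound v h V

/-- A run of the scheme with a monotone flux of the general form. -/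
structure MonotoneRun (f β ν μ u₀ : ℝ → ℝ) (K D T : ℝ) (F : ℝ → ℝ → ℝ → ℝ) (Δx Δt : ℝ) (N : ℕ)
    (α : ℕ → ℤ → ℝ) : Prop where
  dx_pos : 0 < Δx
  dt_pos : 0 < Δt
  final_time : N * Δt = T
  weights : ∀ n p, α n p ∈ Set.Icc (0 : ℝ) 1
  K_nonneg : 0 ≤ K
  D_nonneg : 0 ≤ D
  flux : IsNonlocalFlux f K D F
  mono : ∀ n ≤ N, ∀ i, UpdateIncreasing F (Δt / Δx)
    (coeff β ν μ u₀ F Δx Δt α n (i - 1)) (coeff β ν μ u₀ F Δx Δt α n i)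

lemma exists_dataBound {f β ν μ : ℝ → ℝ} (hf : ∃ L, LipschitzWith L f) (hf0 : f 0 = 0)
    (hβ : SmoothBV β) (hβ0 : β 0 = 0) (hν : SmoothBV ν) (hμ : SmoothBV μ) :
    ∃ C, DataBound f β ν μ C := by
  obtain ⟨C₁, h₁⟩ := hβ.exists_smoothBound
  obtain ⟨C₂, h₂⟩ := hν.exists_smoothBound
  obtain ⟨C₃, h₃⟩ := hμ.exists_smoothBound
  refine ⟨max (lipSeminorm f) (max C₁ (max C₂ C₃)), h₁.mono ?_, h₂.mono ?_, h₃.mono ?_, hβ0,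
    fun x y => (abs_sub_le_lipSeminorm hf x y).trans ?_, hf0⟩
  · simp
  · simp
  · simp
  · gcongr
    exact le_max_left _ _

lemma exists_initialBound {u₀ : ℝ → ℝ} (hu₀ : L1BV u₀) (h0 : ∀ᵐ x ∂volume, 0 ≤ u₀ x) :
    ∃ m V, InitialBound u₀ m V := by
  obtain ⟨h1, v, h2, h3⟩ := hu₀
  obtain ⟨h, V, hV⟩ := exists_variationBound h3
  exact ⟨_, V, h1, h0, le_rfl, v, h, h2, hV⟩

/-- From here on the three kinds of flux are treated alike, with enlarged constants that serve all
of them. -/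
lemma IsRun.monotoneRun {f β ν μ u₀ : ℝ → ℝ} {K D T : ℝ} {F : ℝ → ℝ → ℝ → ℝ} {Δx Δt : ℝ} {N : ℕ}
    {α : ℕ → ℤ → ℝ} (h : IsRun f β ν μ u₀ K D T F Δx Δt N α) (hf : ∃ L, LipschitzWith L f)
    {C : ℝ} (hν : SmoothBound ν C) :
    MonotoneRun f β ν μ u₀ (max K (lipSeminorm f)) (max D 0) T F Δx Δt N α := by
  obtain ⟨h1, h2⟩ := h.admissible.toGeneral (div_pos h.dt_pos h.dx_pos) hf
    (fun n i => abs_le_supNorm hν.bound _)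
  exact ⟨h.dx_pos, h.dt_pos, h.final_time, h.weights,
    (lipSeminorm_nonneg f).trans (le_max_right _ _), le_max_right _ _, h1, h2⟩

namespace InitialBound

variable {u₀ : ℝ → ℝ} {m V Δx : ℝ}

lemma mass_nonneg (h : InitialBound u₀ m V) : 0 ≤ m :=
  (integral_nonneg fun _ => abs_nonneg _).trans h.mass

lemma variation_nonneg (h : InitialBound u₀ m V) : 0 ≤ V := by
  obtain ⟨v, g, -, hg⟩ := h.variation
  simpa using hg.total 0 0

lemma summable (h : InitialBound u₀ m V) (hΔx : 0 < Δx) :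
    Summable fun i => |cellAverage u₀ Δx i| :=
  (summable_cellAverage hΔx h.integrable).1

lemma tsum_le (h : InitialBound u₀ m V) (hΔx : 0 < Δx) :
    Δx * ∑' i, |cellAverage u₀ Δx i| ≤ m :=
  (summable_cellAverage hΔx h.integrable).2.trans h.mass

lemma variation_le (h : InitialBound u₀ m V) (hΔx : 0 < Δx) :
    ∑' i, |cellAverage u₀ Δx (i + 1) - cellAverage u₀ Δx i| ≤ V := by
  obtain ⟨v, g, hv, hg⟩ := h.variation
  simp only [cellAverage_congr hv]
  exact (cellAverage_variation hΔx (h.integrable.congr hv.symm) hg).2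

lemma approximation (h : InitialBound u₀ m V) (hΔx : 0 < Δx) :
    ∫ x, |stepFun Δx (cellAverage u₀ Δx) x - u₀ x| ≤ Δx * V := by
  obtain ⟨v, g, hv, hg⟩ := h.variation
  have e : cellAverage u₀ Δx = cellAverage v Δx := funext fun i => cellAverage_congr hv i
  rw [e]
  refine le_trans (le_of_eq (integral_congr_ae ?_))
    (integral_abs_stepFun_cellAverage_sub_le hΔx (h.integrable.congr hv.symm) hg)
  filter_upwards [hv] with x hx
  rw [hx]

end InitialBound

lemma approx_succ (β ν μ u₀ : ℝ → ℝ) (F : ℝ → ℝ → ℝ → ℝ) (Δx Δt : ℝ) (α : ℕ → ℤ → ℝ) (n : ℕ) :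
    approx β ν μ u₀ F Δx Δt α (n + 1) = step F (Δt / Δx) (coeff β ν μ u₀ F Δx Δt α n)
      (approx β ν μ u₀ F Δx Δt α n) := rfl

/-- The growth rate of the sup norm. -/
def supRate (C m : ℝ) : ℝ := 2 * C ^ 3 * m * C

/-- The growth rate of the total variation. -/
def variationRate (C m K : ℝ) : ℝ :=
  1 + 2 * (2 * C ^ 3 * m) * K + 2 * (2 * C ^ 3 * m + 4 * C ^ 5 * m ^ 2) * K * m

/-- The bound of the total variation on `[0, T]`. -/
noncomputable def variationSup (C m V K T : ℝ) : ℝ :=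
  Real.exp (variationRate C m K * T) * (V + variationRate C m K)

/-- The Lipschitz constant in time. -/
noncomputable def timeRate (C m V K D T : ℝ) : ℝ :=
  2 * (C * K + D) * variationSup C m V K T + 2 * (2 * C ^ 3 * m) * K * m

/-- The discrete Gronwall inequality, from `(1 + c τ)^n ≤ e^{c n τ}`. -/
lemma le_exp_mul_of_le_mul {x : ℕ → ℝ} {c τ T : ℝ} {N : ℕ} (hc : 0 ≤ c) (hτ : 0 ≤ τ)
    (hT : N * τ = T) (hx0 : 0 ≤ x 0) (h : ∀ n < N, x (n + 1) ≤ (1 + c * τ) * x n) :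
    ∀ n ≤ N, x n ≤ Real.exp (c * T) * x 0 := by
  have hpow : ∀ n ≤ N, x n ≤ (1 + c * τ) ^ n * x 0 := by
    intro n
    induction n with
    | zero => intro _; simp
    | succ n ih =>
      intro hn
      calc x (n + 1) ≤ (1 + c * τ) * x n := h n hn
        _ ≤ (1 + c * τ) * ((1 + c * τ) ^ n * x 0) := by
          have := ih (by omega); gcongr
        _ = _ := by ring
  intro n hn
  refine (hpow n hn).trans (mul_le_mul_of_nonneg_right ?_ hx0)
  have h1 : 1 + c * τ ≤ Real.exp (c * τ) := by linarith [Real.add_one_le_exp (c * τ)]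
  calc (1 + c * τ) ^ n ≤ Real.exp (c * τ) ^ n := pow_le_pow_left₀ (by positivity) h1 n
    _ = Real.exp (n * (c * τ)) := (Real.exp_nat_mul _ _).symm
    _ ≤ Real.exp (c * T) := by
      rw [← hT]
      refine Real.exp_le_exp.2 ?_
      have : (n : ℝ) ≤ N := by exact_mod_cast hn
      nlinarith [mul_nonneg hc hτ]

/-! ### A priori estimates along a run. -/

namespace MonotoneRun

variable {f β ν μ u₀ : ℝ → ℝ} {C m V K D T : ℝ} {F : ℝ → ℝ → ℝ → ℝ} {Δx Δt : ℝ} {N : ℕ}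
  {α : ℕ → ℤ → ℝ}

local notation "U" => approx β ν μ u₀ F Δx Δt α
local notation "A" => coeff β ν μ u₀ F Δx Δt α

section

variable (hr : MonotoneRun f β ν μ u₀ K D T F Δx Δt N α) (hd : DataBound f β ν μ C)
  (hi : InitialBound u₀ m V)

include hr

lemma lam_nonneg : 0 ≤ Δt / Δx := (div_pos hr.dt_pos hr.dx_pos).le

lemma lam_mul_dx : Δt / Δx * Δx = Δt := div_mul_cancel₀ _ hr.dx_pos.ne'

include hd hi

lemma basic : ∀ n ≤ N + 1, (∀ i, 0 ≤ U n i) ∧ Summable (fun i => |U n i|) ∧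
    ∑' i, |U n i| = ∑' i, |U 0 i| := by
  intro n
  induction n with
  | zero =>
    intro _
    exact ⟨cellAverage_nonneg hr.dx_pos hi.nonneg, hi.summable hr.dx_pos, rfl⟩
  | succ n ih =>
    intro hn
    obtain ⟨h1, h2, h3⟩ := ih (by omega)
    have hnn : ∀ i, 0 ≤ U (n + 1) i := fun i => by
      rw [approx_succ]
      exact step_nonneg hr.flux hd.f_zero (hr.mono n (by omega)) h1 i
    have hs := summable_step (lam := Δt / Δx) (a := A n) hr.flux hd.f_zero
      (fun _ => hd.nu.bound _) h2
    refine ⟨hnn, hs.abs, ?_⟩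
    rw [← h3, tsum_congr fun i => abs_of_nonneg (hnn i), tsum_congr fun i => abs_of_nonneg (h1 i)]
    exact tsum_step hr.flux hd.f_zero (fun _ => hd.nu.bound _) h2

lemma nonneg {n : ℕ} (hn : n ≤ N) (i : ℤ) : 0 ≤ U n i := (hr.basic hd hi n (by omega)).1 i

lemma summable {n : ℕ} (hn : n ≤ N) : Summable fun i => |U n i| :=
  (hr.basic hd hi n (by omega)).2.1

lemma mass_eq {n : ℕ} (hn : n ≤ N) : ∑' i, |U n i| = ∑' i, |U 0 i| :=
  (hr.basic hd hi n (by omega)).2.2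

lemma mass_le {n : ℕ} (hn : n ≤ N) : Δx * ∑' i, |U n i| ≤ m := by
  rw [hr.mass_eq hd hi hn]
  exact hi.tsum_le hr.dx_pos

/-- Conservation of the mass makes these constants uniform in the time level and in the mesh. -/
lemma coeffBound {n : ℕ} (hn : n ≤ N) :
    CoeffBound (A n) C (2 * C ^ 3 * m) (2 * C ^ 3 * m + 4 * C ^ 5 * m ^ 2) Δx :=
  coeffBound_quadrature hd.beta hd.beta_zero hd.nu hd.mu (hr.weights n) (hr.summable hd hi hn)
    hr.dx_pos (hr.mass_le hd hi hn)

lemma bddAbove {n : ℕ} (hn : n ≤ N) : BddAbove (Set.range fun i => |U n i|) := by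
  refine ⟨∑' i, |U n i|, ?_⟩
  rintro _ ⟨i, rfl⟩
  exact (hr.summable hd hi hn).le_tsum i fun j _ => abs_nonneg _

lemma sup_le {n : ℕ} (hn : n ≤ N) :
    ⨆ i, |U n i| ≤ Real.exp (supRate C m * T) * ⨆ i, |U 0 i| := by
  have hC := hd.beta.nonneg
  have hm := hi.mass_nonneg
  refine le_exp_mul_of_le_mul (x := fun n => ⨆ i, |U n i|) (by unfold supRate; positivity)
    hr.dt_pos.le hr.final_time (Real.iSup_nonneg fun i => abs_nonneg _) (fun n hn => ?_) n hn
  refine ciSup_le fun i => ?_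
  rw [abs_of_nonneg (hr.nonneg hd hi (by omega) i), approx_succ]
  have h := step_le hr.flux (L := C) (fun x => by simpa [hd.f_zero] using hd.f_lip x 0)
    (hr.coeffBound hd hi hn.le) hr.lam_nonneg (hr.mono n hn.le)
    (M := ⨆ i, |U n i|) (Real.iSup_nonneg fun i => abs_nonneg _)
    (fun i => (le_abs_self _).trans (le_ciSup (hr.bddAbove hd hi hn.le) i)) i
  rw [hr.lam_mul_dx] at h
  refine h.trans (le_of_eq ?_)
  simp only [supRate]
  ring

lemma variation {n : ℕ} (hn : n ≤ N) :
    ∑' i, |U n (i + 1) - U n i| ≤ Real.exp (variationRate C m K * T)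
      * (∑' i, |U 0 (i + 1) - U 0 i| + variationRate C m K) := by
  have hC := hd.beta.nonneg
  have hm := hi.mass_nonneg
  have hK := hr.K_nonneg
  have hdt := hr.dt_pos
  have hrate : 1 ≤ variationRate C m K := by
    unfold variationRate
    have : 0 ≤ 2 * (2 * C ^ 3 * m) * K := by positivity
    have : 0 ≤ 2 * (2 * C ^ 3 * m + 4 * C ^ 5 * m ^ 2) * K * m := by positivity
    linarith
  have hTV0 : ∀ n, 0 ≤ ∑' i, |U n (i + 1) - U n i| := fun n => tsum_nonneg fun i => abs_nonneg _
  -- A recursion `TV' ≤ (1 + p Δt) TV + q Δt` becomes homogeneous for `TV + 1`, with rate `p + q`.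
  -- The extra 1 in `variationRate` makes the rate at least 1, so that the initial value `TV + 1` is
  -- at most `TV + variationRate`.
  have key := le_exp_mul_of_le_mul (x := fun n => ∑' i, |U n (i + 1) - U n i| + 1)
    (c := variationRate C m K) (by linarith) hr.dt_pos.le hr.final_time
    (by have := hTV0 0; positivity) (fun n hn => ?_) n hn
  · refine (le_add_of_nonneg_right zero_le_one).trans (key.trans ?_)
    gcongr
  · have h := step_variation hr.flux hd.f_zero hK (hr.coeffBound hd hi hn.le)
      (hr.mono n hn.le) hr.lam_nonneg (hr.summable hd hi hn.le)
    rw [hr.lam_mul_dx, ← approx_succ] at h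
    have hm' := hr.mass_le hd hi hn.le
    have hTV := hTV0 n
    set X := ∑' i, |U n (i + 1) - U n i|
    have h2 : 2 * (2 * C ^ 3 * m + 4 * C ^ 5 * m ^ 2) * K * Δt * (Δx * ∑' i, |U n i|)
        ≤ 2 * (2 * C ^ 3 * m + 4 * C ^ 5 * m ^ 2) * K * Δt * m := by gcongr
    have p1 : 0 ≤ Δt * X := by positivity
    have p2 : 0 ≤ 2 * (2 * C ^ 3 * m) * K * Δt := by positivity
    have p3 : 0 ≤ 2 * (2 * C ^ 3 * m + 4 * C ^ 5 * m ^ 2) * K * m * Δt * X := by positivity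
    unfold variationRate
    linarith

lemma variation_le {n : ℕ} (hn : n ≤ N) :
    ∑' i, |U n (i + 1) - U n i| ≤ variationSup C m V K T := by
  refine (hr.variation hd hi hn).trans ?_
  unfold variationSup
  gcongr
  exact hi.variation_le hr.dx_pos

lemma timeRate_nonneg : 0 ≤ timeRate C m V K D T := by
  have hC := hd.beta.nonneg
  have hm := hi.mass_nonneg
  have hK := hr.K_nonneg
  have hD := hr.D_nonneg
  have : 0 ≤ variationSup C m V K T :=
    (tsum_nonneg fun i => abs_nonneg _).trans (hr.variation_le hd hi (Nat.zero_le _))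
  unfold timeRate
  positivity

lemma time_step {n : ℕ} (hn : n ≤ N) :
    Summable (fun i => |U (n + 1) i - U n i|) ∧
      Δx * ∑' i, |U (n + 1) i - U n i| ≤ timeRate C m V K D T * Δt := by
  have hC := hd.beta.nonneg
  have hm := hi.mass_nonneg
  have hK := hr.K_nonneg
  have hD := hr.D_nonneg
  obtain ⟨h1, h2⟩ := step_time_diff hr.flux hd.f_zero hK (hr.coeffBound hd hi hn)
    hr.lam_nonneg (hr.summable hd hi hn)
  refine ⟨h1, (mul_le_mul_of_nonneg_left h2 hr.dx_pos.le).trans ?_⟩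
  have h3 := hr.mass_le hd hi hn
  have h4 := hr.variation_le hd hi hn
  rw [← mul_assoc, mul_comm Δx, hr.lam_mul_dx, mul_comm]
  refine mul_le_mul_of_nonneg_right ?_ hr.dt_pos.le
  unfold timeRate
  gcongr

lemma time_diff_add (n k : ℕ) (hn : n + k ≤ N) :
    Summable (fun i => |U (n + k) i - U n i|) ∧
      Δx * ∑' i, |U (n + k) i - U n i| ≤ timeRate C m V K D T * k * Δt := by
  induction k with
  | zero => simp
  | succ k ih =>
    obtain ⟨h1, h2⟩ := ih (by omega)
    obtain ⟨h3, h4⟩ := hr.time_step hd hi (n := n + k) (by omega)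
    have hpt : ∀ i, |U (n + (k + 1)) i - U n i|
        ≤ |U (n + k + 1) i - U (n + k) i| + |U (n + k) i - U n i| := fun i => abs_sub_le _ _ _
    have hs : Summable (fun i => |U (n + (k + 1)) i - U n i|) :=
      summable_of_abs_le (h3.add h1) fun i => by rw [abs_abs]; exact hpt i
    refine ⟨hs, ?_⟩
    have h5 := mul_le_mul_of_nonneg_left (hs.tsum_le_tsum hpt (h3.add h1)) hr.dx_pos.le
    rw [h3.tsum_add h1] at h5
    push_cast
    linarith

lemma time_diff {p n : ℕ} (hp : p ≤ N) (hn : n ≤ N) :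
    Summable (fun i => |U p i - U n i|) ∧
      Δx * ∑' i, |U p i - U n i| ≤ timeRate C m V K D T * |(p : ℝ) - n| * Δt := by
  rcases le_total n p with h | h
  · obtain ⟨k, rfl⟩ := Nat.exists_eq_add_of_le h
    have := hr.time_diff_add hd hi n k hp
    have e : |((n + k : ℕ) : ℝ) - n| = k := by push_cast; simp
    rwa [e]
  · obtain ⟨k, rfl⟩ := Nat.exists_eq_add_of_le h
    have := hr.time_diff_add hd hi p k hn
    have e : |(p : ℝ) - ((p + k : ℕ) : ℝ)| = k := by push_cast; simp
    simp only [abs_sub_comm (U p _)]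
    rwa [e]

end

lemma entropy (hr : MonotoneRun f β ν μ u₀ K D T F Δx Δt N α) {n : ℕ} (hn : n ≤ N) (i : ℤ) (k : ℝ) :
    |U (n + 1) i - k| - |U n i - k|
      + Δt / Δx * (entropyFlux F (A n i) (U n i) (U n (i + 1)) k
        - entropyFlux F (A n (i - 1)) (U n (i - 1)) (U n i) k)
      + Δt / Δx * Real.sign (U (n + 1) i - k) * f k * (A n i - A n (i - 1)) ≤ 0 :=
  step_entropy hr.flux (hr.mono n hn) i k

end MonotoneRun

end NonlocalFV

namespace NonlocalFV

/-! ### Regularity of the nonlocal coefficient -/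

lemma SmoothBound.taylor {g : ℝ → ℝ} {C : ℝ} (h : SmoothBound g C) (x y : ℝ) :
    |g y - g x - deriv g x * (y - x)| ≤ C * (y - x) ^ 2 := by
  have hd : ∀ s, HasDerivAt (fun s => g s - deriv g x * s) (deriv g s - deriv g x) s := fun s => by
    have := (h.differentiable s).hasDerivAt.sub ((hasDerivAt_id s).const_mul (deriv g x))
    rwa [mul_one] at this
  have hb : ∀ s ∈ Set.uIcc x y, ‖deriv g s - deriv g x‖ ≤ C * |y - x| := fun s hs => by
    refine (h.deriv_lip s x).trans (mul_le_mul_of_nonneg_left ?_ h.nonneg)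
    exact Set.abs_sub_left_of_mem_uIcc hs
  have := Convex.norm_image_sub_le_of_norm_hasDerivWithin_le
    (fun s _ => (hd s).hasDerivWithinAt) hb (convex_uIcc x y) Set.left_mem_uIcc Set.right_mem_uIcc
  rw [Real.norm_eq_abs, Real.norm_eq_abs, mul_assoc, ← sq, sq_abs] at this
  refine le_trans (le_of_eq ?_) this
  congr 1
  ring

/-- The nonlocal average `m * β(w)`. -/
noncomputable def nonlocalAvg (β m w : ℝ → ℝ) (x : ℝ) : ℝ := ∫ y, m (x - y) * β (w y)

section NonlocalAvg

variable {f β ν μ m w w' : ℝ → ℝ} {C M : ℝ}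

lemma SmoothBound.integrable_comp (hβ : SmoothBound β C) (hβ0 : β 0 = 0) (hw : Integrable w) :
    Integrable fun y => β (w y) :=
  (hw.abs.const_mul C).mono' (hβ.continuous.comp_aestronglyMeasurable hw.1)
    (ae_of_all _ fun y => hβ.abs_le_of_zero hβ0 (w y))

lemma SmoothBound.integral_abs_comp_le (hβ : SmoothBound β C) (hβ0 : β 0 = 0)
    (hw : Integrable w) : ∫ y, |β (w y)| ≤ C * ∫ y, |w y| := by
  rw [← integral_const_mul]
  exact integral_mono (hβ.integrable_comp hβ0 hw).abs (hw.abs.const_mul C)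
    fun y => hβ.abs_le_of_zero hβ0 (w y)

lemma integrable_nonlocalAvg (hβ : SmoothBound β C) (hβ0 : β 0 = 0) (hm : Continuous m)
    (hmC : ∀ x, |m x| ≤ C) (hw : Integrable w) (x : ℝ) :
    Integrable fun y => m (x - y) * β (w y) :=
  (hβ.integrable_comp hβ0 hw).bdd_mul
    (hm.comp (continuous_const.sub continuous_id)).aestronglyMeasurable
    (ae_of_all _ fun y => hmC (x - y))

lemma abs_nonlocalAvg_le (hβ : SmoothBound β C) (hβ0 : β 0 = 0) (hm : Continuous m)
    (hmC : ∀ x, |m x| ≤ C) (hw : Integrable w) (x : ℝ) :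
    |nonlocalAvg β m w x| ≤ C ^ 2 * ∫ y, |w y| := by
  calc |nonlocalAvg β m w x| ≤ ∫ y, |m (x - y) * β (w y)| := abs_integral_le_integral_abs
    _ ≤ ∫ y, C * |β (w y)| := by
      refine integral_mono (integrable_nonlocalAvg hβ hβ0 hm hmC hw x).abs
        ((hβ.integrable_comp hβ0 hw).abs.const_mul C) fun y => ?_
      dsimp only
      rw [abs_mul]
      exact mul_le_mul_of_nonneg_right (hmC _) (abs_nonneg _)
    _ = C * ∫ y, |β (w y)| := integral_const_mul _ _
    _ ≤ C * (C * ∫ y, |w y|) :=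
      mul_le_mul_of_nonneg_left (hβ.integral_abs_comp_le hβ0 hw) hβ.nonneg
    _ = _ := by ring

/-- Averaging against a bounded kernel turns an `L¹` distance into a uniform bound. This is what
allows the difference of two coefficients to be absorbed by a Gronwall argument. -/
lemma abs_nonlocalAvg_sub_le (hβ : SmoothBound β C) (hβ0 : β 0 = 0) (hm : Continuous m)
    (hmC : ∀ x, |m x| ≤ C) (hml : ∀ x y, |m x - m y| ≤ C * |x - y|) (hw : Integrable w)
    (hw' : Integrable w') (x x' : ℝ) :
    |nonlocalAvg β m w x - nonlocalAvg β m w' x'|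
      ≤ C ^ 2 * ((∫ y, |w y|) * |x - x'| + ∫ y, |w y - w' y|) := by
  have hC := hβ.nonneg
  have hX : Integrable fun y => |w y - w' y| := (hw.sub hw').abs
  rw [nonlocalAvg, nonlocalAvg, ← integral_sub (integrable_nonlocalAvg hβ hβ0 hm hmC hw x)
    (integrable_nonlocalAvg hβ hβ0 hm hmC hw' x')]
  calc _ ≤ ∫ y, |m (x - y) * β (w y) - m (x' - y) * β (w' y)| := abs_integral_le_integral_abs
    _ ≤ ∫ y, (C ^ 2 * |x - x'| * |w y| + C ^ 2 * |w y - w' y|) := by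
      refine integral_mono ((integrable_nonlocalAvg hβ hβ0 hm hmC hw x).sub
        (integrable_nonlocalAvg hβ hβ0 hm hmC hw' x')).abs
        ((hw.abs.const_mul _).add ((hw.sub hw').abs.const_mul _)) fun y => ?_
      dsimp only
      have e : m (x - y) * β (w y) - m (x' - y) * β (w' y)
          = (m (x - y) - m (x' - y)) * β (w y) + m (x' - y) * (β (w y) - β (w' y)) := by ring
      rw [e]
      refine (abs_add_le _ _).trans (add_le_add ?_ ?_)
      · rw [abs_mul]
        have h1 := hml (x - y) (x' - y)
        rw [sub_sub_sub_cancel_right] at h1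
        calc _ ≤ C * |x - x'| * (C * |w y|) := by
              have := hβ.abs_le_of_zero hβ0 (w y)
              gcongr
          _ = _ := by ring
      · rw [abs_mul]
        calc _ ≤ C * (C * |w y - w' y|) := by
              have := hβ.lip (w y) (w' y)
              have := hmC (x' - y)
              gcongr
          _ = _ := by ring
    _ = _ := by
      rw [integral_add (hw.abs.const_mul _) (hX.const_mul _), integral_const_mul,
        integral_const_mul]
      ring

lemma hasDerivAt_nonlocalAvg (hβ : SmoothBound β C) (hβ0 : β 0 = 0) (hμ : SmoothBound μ C)
    (hw : Integrable w) (x : ℝ) :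
    HasDerivAt (nonlocalAvg β μ w) (nonlocalAvg β (deriv μ) w x) x := by
  refine (hasDerivAt_integral_of_dominated_loc_of_deriv_le (μ := volume)
    (F := fun x y => μ (x - y) * β (w y)) (F' := fun x y => deriv μ (x - y) * β (w y))
    (bound := fun y => C * |β (w y)|) (s := Set.univ) univ_mem ?_ ?_ ?_ ?_ ?_ ?_).2
  · exact Eventually.of_forall fun x =>
      (integrable_nonlocalAvg hβ hβ0 hμ.continuous hμ.bound hw x).1
  · exact integrable_nonlocalAvg hβ hβ0 hμ.continuous hμ.bound hw x
  · exact (integrable_nonlocalAvg hβ hβ0 hμ.continuous_deriv hμ.deriv_bound hw x).1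
  · refine ae_of_all _ fun y x _ => ?_
    rw [norm_mul]
    exact mul_le_mul_of_nonneg_right (hμ.deriv_bound _) (abs_nonneg _)
  · exact (hβ.integrable_comp hβ0 hw).abs.const_mul C
  · refine ae_of_all _ fun y x _ => ?_
    exact ((hμ.differentiable _).hasDerivAt.comp_sub_const x y).mul_const _

namespace DataBound

variable (hd : DataBound f β ν μ C)

include hd

lemma nonneg : 0 ≤ C := hd.beta.nonneg

lemma abs_f_le (x : ℝ) : |f x| ≤ C * |x| := by simpa [hd.f_zero] using hd.f_lip x 0

lemma continuous_f : Continuous f := continuous_of_abs_sub_le hd.f_lip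

lemma hasDerivAt_coeff (hw : Integrable w) (x : ℝ) :
    HasDerivAt (nonlocalCoeff β ν μ w)
      (deriv ν (nonlocalAvg β μ w x) * nonlocalAvg β (deriv μ) w x) x :=
  (hd.nu.differentiable _).hasDerivAt.comp x
    (hasDerivAt_nonlocalAvg hd.beta hd.beta_zero hd.mu hw x)

lemma deriv_coeff (hw : Integrable w) (x : ℝ) :
    deriv (nonlocalCoeff β ν μ w) x
      = deriv ν (nonlocalAvg β μ w x) * nonlocalAvg β (deriv μ) w x :=
  (hd.hasDerivAt_coeff hw x).deriv

lemma abs_coeff_le (w : ℝ → ℝ) (x : ℝ) : |nonlocalCoeff β ν μ w x| ≤ C := hd.nu.bound _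

lemma abs_deriv_coeff_le (hw : Integrable w) (hM : ∫ y, |w y| ≤ M) (x : ℝ) :
    |deriv (nonlocalCoeff β ν μ w) x| ≤ C ^ 3 * M := by
  have hC := hd.nonneg
  rw [hd.deriv_coeff hw, abs_mul]
  calc _ ≤ C * (C ^ 2 * M) := by
        have h1 := hd.nu.deriv_bound (nonlocalAvg β μ w x)
        have h2 := (abs_nonlocalAvg_le hd.beta hd.beta_zero hd.mu.continuous_deriv
          hd.mu.deriv_bound hw x).trans (mul_le_mul_of_nonneg_left hM (by positivity))
        gcongr
    _ = _ := by ring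

end DataBound

/-- The Lipschitz constant of the nonlocal coefficient and of its derivative, for functions with
norm at most `M` in `L¹`. -/
def coeffLip (C M : ℝ) : ℝ := (C ^ 5 * M + C ^ 3) * (M + 1)

namespace DataBound

variable (hd : DataBound f β ν μ C)

include hd

lemma coeffLip_nonneg (hM : 0 ≤ M) : 0 ≤ coeffLip C M := by
  have := hd.nonneg
  unfold coeffLip
  positivity

lemma abs_coeff_sub_le (hw : Integrable w) (hw' : Integrable w') (hM : ∫ y, |w y| ≤ M)
    (x x' : ℝ) :
    |nonlocalCoeff β ν μ w x - nonlocalCoeff β ν μ w' x'|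
      ≤ coeffLip C M * (|x - x'| + ∫ y, |w y - w' y|) := by
  have hC := hd.nonneg
  have hM0 : 0 ≤ M := (integral_nonneg fun _ => abs_nonneg _).trans hM
  have hX : 0 ≤ ∫ y, |w y - w' y| := integral_nonneg fun _ => abs_nonneg _
  set X := ∫ y, |w y - w' y|
  have h1 := abs_nonlocalAvg_sub_le hd.beta hd.beta_zero hd.mu.continuous hd.mu.bound hd.mu.lip
    hw hw' x x'
  calc _ ≤ C * |nonlocalAvg β μ w x - nonlocalAvg β μ w' x'| := hd.nu.lip _ _
    _ ≤ C * (C ^ 2 * (M * |x - x'| + X)) := by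
      refine mul_le_mul_of_nonneg_left (h1.trans ?_) hC
      gcongr
    _ ≤ _ := by
      unfold coeffLip
      have p1 : 0 ≤ C ^ 5 * M * (M + 1) * (|x - x'| + X) := by positivity
      have p2 : 0 ≤ C ^ 3 * |x - x'| := by positivity
      have p3 : 0 ≤ C ^ 3 * M * X := by positivity
      linarith

lemma abs_deriv_coeff_sub_le (hw : Integrable w) (hw' : Integrable w') (hM : ∫ y, |w y| ≤ M)
    (x x' : ℝ) :
    |deriv (nonlocalCoeff β ν μ w) x - deriv (nonlocalCoeff β ν μ w') x'|
      ≤ coeffLip C M * (|x - x'| + ∫ y, |w y - w' y|) := by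
  have hC := hd.nonneg
  have hM0 : 0 ≤ M := (integral_nonneg fun _ => abs_nonneg _).trans hM
  have hX : 0 ≤ ∫ y, |w y - w' y| := integral_nonneg fun _ => abs_nonneg _
  set X := ∫ y, |w y - w' y|
  have h1 := abs_nonlocalAvg_sub_le hd.beta hd.beta_zero hd.mu.continuous hd.mu.bound hd.mu.lip
    hw hw' x x'
  have h2 := abs_nonlocalAvg_sub_le hd.beta hd.beta_zero hd.mu.continuous_deriv hd.mu.deriv_bound
    hd.mu.deriv_lip hw hw' x x'
  have h3 := (abs_nonlocalAvg_le hd.beta hd.beta_zero hd.mu.continuous_deriv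
    hd.mu.deriv_bound hw x).trans (mul_le_mul_of_nonneg_left hM (by positivity))
  rw [hd.deriv_coeff hw, hd.deriv_coeff hw']
  set p := nonlocalAvg β μ w x
  set p' := nonlocalAvg β μ w' x'
  set q := nonlocalAvg β (deriv μ) w x
  set q' := nonlocalAvg β (deriv μ) w' x'
  have h4 : (∫ y, |w y|) * |x - x'| + X ≤ (M + 1) * (|x - x'| + X) := by
    have : (∫ y, |w y|) * |x - x'| ≤ M * |x - x'| := by gcongr
    have : 0 ≤ M * X := by positivity
    have : 0 ≤ |x - x'| := abs_nonneg _
    linarith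
  have e : deriv ν p * q - deriv ν p' * q' = (deriv ν p - deriv ν p') * q
      + deriv ν p' * (q - q') := by ring
  rw [e]
  have h5 : |p - p'| ≤ C ^ 2 * ((M + 1) * (|x - x'| + X)) :=
    h1.trans (mul_le_mul_of_nonneg_left h4 (by positivity))
  have h6 : |q - q'| ≤ C ^ 2 * ((M + 1) * (|x - x'| + X)) :=
    h2.trans (mul_le_mul_of_nonneg_left h4 (by positivity))
  calc _ ≤ |deriv ν p - deriv ν p'| * |q| + |deriv ν p'| * |q - q'| := by
        rw [← abs_mul, ← abs_mul]; exact abs_add_le _ _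
    _ ≤ C * (C ^ 2 * ((M + 1) * (|x - x'| + X))) * (C ^ 2 * M)
        + C * (C ^ 2 * ((M + 1) * (|x - x'| + X))) := by
      have h7 : |deriv ν p - deriv ν p'| ≤ C * (C ^ 2 * ((M + 1) * (|x - x'| + X))) :=
        (hd.nu.deriv_lip p p').trans (mul_le_mul_of_nonneg_left h5 hC)
      have h8 := hd.nu.deriv_bound p'
      gcongr
    _ = _ := by unfold coeffLip; ring

end DataBound

end NonlocalAvg

/-! ### Consistency of the quadrature -/

section Consistency

variable {f β ν μ m : ℝ → ℝ} {C M V Δx : ℝ} {α w : ℤ → ℝ}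

/-- The sum is the integral of a step function, so both terms are compared under one integral.
Sampling the kernel costs `B` times the mass; replacing interpolated values by cell values costs the
variation times `Δx`. It is used both for the kernel and for its difference quotient. -/
lemma abs_sum_sub_nonlocalAvg_le (hβ : SmoothBound β C) (hβ0 : β 0 = 0) (hm : Continuous m)
    (hmC : ∀ x, |m x| ≤ C) (hα : ∀ p, α p ∈ Set.Icc (0 : ℝ) 1) (hΔx : 0 < Δx)
    (hw : Summable fun i => |w i|) (hM : Δx * ∑' i, |w i| ≤ M)
    (hV : ∑' i, |w (i + 1) - w i| ≤ V) {k : ℤ → ℝ} {B : ℝ} (x : ℝ) (hkC : ∀ p, |k p| ≤ C)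
    (hk : ∀ y, |k (cellIndex Δx y) - m (x - y)| ≤ B) :
    |Δx * ∑' p, k p * β (interp α w p) - nonlocalAvg β m (stepFun Δx w) x|
      ≤ B * C * (2 * M) + C ^ 2 * V * Δx := by
  have hC := hβ.nonneg
  have hB : 0 ≤ B := (abs_nonneg _).trans (hk 0)
  have hs : Summable fun p => |k p * β (interp α w p)| :=
    (summable_mul_interp hβ hβ0 hα hw hkC).abs
  have hI := summable_abs_interp hα hw
  have hd := summable_abs_diff hw
  rw [← integral_stepFun hΔx hs, nonlocalAvg,
    ← integral_sub (integrable_stepFun hΔx hs) (integrable_nonlocalAvg hβ hβ0 hm hmC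
      (integrable_stepFun hΔx hw) x)]
  have hI' := integrable_stepFun hΔx (w := fun p => |interp α w p|) (by simpa using hI)
  have hd' := integrable_stepFun hΔx (w := fun p => |w (p + 1) - w p|) (by simpa using hd)
  calc _ ≤ ∫ y, (B * C * stepFun Δx (fun p => |interp α w p|) y
        + C ^ 2 * stepFun Δx (fun p => |w (p + 1) - w p|) y) := by
        refine abs_integral_le_integral_abs.trans (integral_mono ((integrable_stepFun hΔx hs).sub
          (integrable_nonlocalAvg hβ hβ0 hm hmC (integrable_stepFun hΔx hw) x)).abs
          ((hI'.const_mul _).add (hd'.const_mul _)) fun y => ?_)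
        simp only [stepFun]
        set p := cellIndex Δx y with hp
        have e : k p * β (interp α w p) - m (x - y) * β (w p)
            = (k p - m (x - y)) * β (interp α w p)
              + m (x - y) * (β (interp α w p) - β (w p)) := by ring
        rw [e]
        refine (abs_add_le _ _).trans (add_le_add ?_ ?_)
        · rw [abs_mul, mul_assoc]
          exact mul_le_mul (hk y) (hβ.abs_le_of_zero hβ0 _) (abs_nonneg _) hB
        · rw [abs_mul, sq, mul_assoc]
          refine mul_le_mul (hmC _) ((hβ.lip _ _).trans ?_) (abs_nonneg _) hC
          exact mul_le_mul_of_nonneg_left (abs_interp_sub_le hα w p) hC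
    _ = B * C * (Δx * ∑' p, |interp α w p|) + C ^ 2 * (Δx * ∑' p, |w (p + 1) - w p|) := by
        rw [integral_add (hI'.const_mul _) (hd'.const_mul _), integral_const_mul,
          integral_const_mul, integral_stepFun hΔx (by simpa using hI),
          integral_stepFun hΔx (by simpa using hd)]
    _ ≤ B * C * (2 * M) + C ^ 2 * (Δx * V) := by
        have h1 : Δx * ∑' p, |interp α w p| ≤ 2 * M := by
          calc _ ≤ Δx * (2 * ∑' p, |w p|) := by
                have := tsum_abs_interp_le hα hw; gcongr
            _ = 2 * (Δx * ∑' p, |w p|) := by ring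
            _ ≤ _ := by gcongr
        gcongr
    _ = _ := by ring

lemma abs_interface_sub_le (hΔx : 0 < Δx) {x y : ℝ} :
    |((cellIndex Δx x : ℝ) + 1 / 2 - (cellIndex Δx y : ℝ)) * Δx - (x - y)| ≤ 2 * Δx := by
  obtain ⟨h1, h2⟩ := mem_cell_cellIndex hΔx x
  obtain ⟨h3, h4⟩ := mem_cell_cellIndex hΔx y
  rw [abs_le]
  constructor <;> linarith

/-- The constant in the consistency estimate of the coefficients. -/
def consistencyConst (C M V : ℝ) : ℝ :=
  4 * C ^ 5 * M ^ 2 + C ^ 3 * (4 * M + V) * (2 * C ^ 2 * M + 1) + 2 * C ^ 3 * M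

lemma DataBound.consistencyConst_nonneg (hd : DataBound f β ν μ C) (hM : 0 ≤ M) (hV : 0 ≤ V) :
    0 ≤ consistencyConst C M V := by
  have := hd.nonneg
  unfold consistencyConst
  positivity

/-- The second estimate is a discrete chain rule. The quotient of `ν` is linearized at the value
`c`, and the quotient of the quadrature is itself a quadrature with a kernel close to `μ'`. -/
lemma DataBound.consistency (hd : DataBound f β ν μ C)
    (hα : ∀ p, α p ∈ Set.Icc (0 : ℝ) 1) (hΔx : 0 < Δx)
    (hw : Summable fun i => |w i|) (hM : Δx * ∑' i, |w i| ≤ M)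
    (hV : ∑' i, |w (i + 1) - w i| ≤ V) (x : ℝ) :
    |ν (quadrature β μ Δx α w (cellIndex Δx x)) - nonlocalCoeff β ν μ (stepFun Δx w) x|
        ≤ consistencyConst C M V * Δx ∧
      |(ν (quadrature β μ Δx α w (cellIndex Δx x))
          - ν (quadrature β μ Δx α w (cellIndex Δx x - 1))) / Δx
        - deriv (nonlocalCoeff β ν μ (stepFun Δx w)) x| ≤ consistencyConst C M V * Δx := by
  have hC := hd.nonneg
  have hM0 : 0 ≤ M := le_trans (by positivity) hM
  have hV0 : 0 ≤ V := le_trans (tsum_nonneg fun _ => abs_nonneg _) hV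
  set i := cellIndex Δx x with hi
  set c := quadrature β μ Δx α w i
  set c' := quadrature β μ Δx α w (i - 1)
  set q := nonlocalAvg β μ (stepFun Δx w) x with hq
  set q' := nonlocalAvg β (deriv μ) (stepFun Δx w) x with hq'
  have h1 : |c - q| ≤ C ^ 2 * (4 * M + V) * Δx := by
    have := abs_sum_sub_nonlocalAvg_le hd.beta hd.beta_zero hd.mu.continuous hd.mu.bound hα hΔx hw
      hM hV (k := fun p => μ (((i : ℝ) + 1 / 2 - p) * Δx)) (B := 2 * C * Δx) x
      (fun p => hd.mu.bound _) (fun y => by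
        refine (hd.mu.lip _ _).trans ?_
        have := abs_interface_sub_le hΔx (x := x) (y := y)
        calc _ ≤ C * (2 * Δx) := by gcongr
          _ = _ := by ring)
    refine this.trans (le_of_eq ?_)
    ring
  have hdiff : |c - c'| ≤ 2 * C ^ 2 * M * Δx :=
    (abs_quadrature_diff_le hd.beta hd.beta_zero hd.mu hα hw hΔx i).trans (by gcongr)
  have h2 : |(c - c') / Δx - q'| ≤ C ^ 2 * (6 * M + V) * Δx := by
    have hk : ∀ z, |(μ z - μ (z - Δx)) / Δx - deriv μ z| ≤ C * Δx := fun z => by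
      have := hd.mu.taylor z (z - Δx)
      have e : (μ z - μ (z - Δx)) / Δx - deriv μ z
          = -(μ (z - Δx) - μ z - deriv μ z * (z - Δx - z)) / Δx := by
        field_simp; ring
      rw [e, abs_div, abs_neg, abs_of_pos hΔx, div_le_iff₀ hΔx]
      refine this.trans (le_of_eq ?_)
      ring
    have hs : ∀ j : ℤ, Summable fun p : ℤ =>
        μ (((j : ℝ) + 1 / 2 - p) * Δx) * β (interp α w p) := fun j =>
      summable_mul_interp hd.beta hd.beta_zero hα hw fun p => hd.mu.bound _
    -- The kernel error `3 C Δx` consists of `C Δx` from the Taylor formula for the difference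
    -- quotient and `2 C Δx` from the distance between the sampling point and `x - y`.
    have key := abs_sum_sub_nonlocalAvg_le hd.beta hd.beta_zero hd.mu.continuous_deriv
      hd.mu.deriv_bound hα hΔx hw hM hV
      (k := fun p => (μ (((i : ℝ) + 1 / 2 - p) * Δx)
        - μ ((((i - 1 : ℤ) : ℝ) + 1 / 2 - p) * Δx)) / Δx) (B := 3 * C * Δx) x
      (fun p => by
        rw [abs_div, abs_of_pos hΔx, div_le_iff₀ hΔx]
        refine (hd.mu.lip _ _).trans (le_of_eq ?_)
        congr 1
        have : ((i : ℝ) + 1 / 2 - p) * Δx - (((i - 1 : ℤ) : ℝ) + 1 / 2 - p) * Δx = Δx := by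
          push_cast; ring
        rw [this, abs_of_pos hΔx]) (fun y => by
        set p := cellIndex Δx y
        have e : (((i - 1 : ℤ) : ℝ) + 1 / 2 - p) * Δx = ((i : ℝ) + 1 / 2 - p) * Δx - Δx := by
          push_cast; ring
        rw [e]
        have g1 := hk (((i : ℝ) + 1 / 2 - p) * Δx)
        have g2 : |deriv μ (((i : ℝ) + 1 / 2 - p) * Δx) - deriv μ (x - y)| ≤ C * (2 * Δx) := by
          refine (hd.mu.deriv_lip _ _).trans ?_
          have := abs_interface_sub_le hΔx (x := x) (y := y)
          gcongr
        refine (abs_sub_le _ (deriv μ (((i : ℝ) + 1 / 2 - p) * Δx)) _).trans ?_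
        linarith)
    have e : (c - c') / Δx = Δx * ∑' p : ℤ, (μ (((i : ℝ) + 1 / 2 - p) * Δx)
        - μ ((((i - 1 : ℤ) : ℝ) + 1 / 2 - p) * Δx)) / Δx * β (interp α w p) := by
      rw [tsum_congr fun p : ℤ => show _ = Δx⁻¹ * (μ (((i : ℝ) + 1 / 2 - p) * Δx)
        * β (interp α w p) - μ ((((i - 1 : ℤ) : ℝ) + 1 / 2 - p) * Δx) * β (interp α w p)) by ring,
        tsum_mul_left, (hs i).tsum_sub (hs (i - 1))]
      simp only [c, c', quadrature, interp]
      field_simp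
    rw [e]
    refine key.trans (le_of_eq ?_)
    ring
  constructor
  · calc _ ≤ C * |c - q| := hd.nu.lip _ _
      _ ≤ C * (C ^ 2 * (4 * M + V) * Δx) := by gcongr
      _ ≤ _ := by
        unfold consistencyConst
        have p1 : 0 ≤ 4 * C ^ 5 * M ^ 2 * Δx := by positivity
        have p2 : 0 ≤ C ^ 3 * (4 * M + V) * (2 * C ^ 2 * M) * Δx := by positivity
        have p3 : 0 ≤ 2 * C ^ 3 * M * Δx := by positivity
        linarith
  · rw [hd.deriv_coeff (integrable_stepFun hΔx hw)]
    have hδ : |(c - c') / Δx| ≤ 2 * C ^ 2 * M := by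
      rwa [abs_div, abs_of_pos hΔx, div_le_iff₀ hΔx]
    have t1 : |(ν c - ν c') / Δx - deriv ν c * ((c - c') / Δx)| ≤ C * (2 * C ^ 2 * M) ^ 2 * Δx := by
      have := hd.nu.taylor c c'
      have e : (ν c - ν c') / Δx - deriv ν c * ((c - c') / Δx)
          = -(ν c' - ν c - deriv ν c * (c' - c)) / Δx := by ring
      rw [e, abs_div, abs_neg, abs_of_pos hΔx, div_le_iff₀ hΔx]
      refine this.trans ?_
      have h3 : (c' - c) ^ 2 ≤ (2 * C ^ 2 * M * Δx) ^ 2 := by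
        rw [← sq_abs, abs_sub_comm]
        exact pow_le_pow_left₀ (abs_nonneg _) hdiff 2
      calc _ ≤ C * (2 * C ^ 2 * M * Δx) ^ 2 := by gcongr
        _ = _ := by ring
    have t2 : |deriv ν c * ((c - c') / Δx) - deriv ν q * q'|
        ≤ C * (C ^ 2 * (4 * M + V) * Δx) * (2 * C ^ 2 * M) + C * (C ^ 2 * (6 * M + V) * Δx) := by
      have e : deriv ν c * ((c - c') / Δx) - deriv ν q * q'
          = (deriv ν c - deriv ν q) * ((c - c') / Δx) + deriv ν q * ((c - c') / Δx - q') := by ring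
      rw [e]
      refine (abs_add_le _ _).trans ?_
      rw [abs_mul, abs_mul]
      have g1 : |deriv ν c - deriv ν q| ≤ C * (C ^ 2 * (4 * M + V) * Δx) :=
        (hd.nu.deriv_lip _ _).trans (by gcongr)
      have g2 := hd.nu.deriv_bound q
      gcongr
    refine (abs_sub_le _ (deriv ν c * ((c - c') / Δx)) _).trans ((add_le_add t1 t2).trans
      (le_of_eq ?_))
    unfold consistencyConst
    ring

end Consistency

/-! ### Translations of functions of bounded variation -/

/-- The dominating function is the sum of the jumps to the left of the cell of `x`. -/
lemma stepFun_variationBound {Δx : ℝ} (hΔx : 0 < Δx) {w : ℤ → ℝ}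
    (hw : Summable fun i => |w (i + 1) - w i|) :
    ∃ h, VariationBound (stepFun Δx w) h (∑' i, |w (i + 1) - w i|) := by
  set d : ℤ → ℝ := fun i => |w (i + 1) - w i|
  have hd0 : ∀ i, 0 ≤ d i := fun i => abs_nonneg _
  set H : ℤ → ℝ := fun n => ∑' p, Set.indicator {p | p < n} d p
  have hs : ∀ n : ℤ, Summable (Set.indicator {p | p < n} d) := fun n => hw.indicator _
  have hH0 : ∀ n, 0 ≤ H n := fun n => tsum_nonneg fun p => Set.indicator_nonneg (fun i _ => hd0 i) p
  have hH1 : ∀ n, H n ≤ ∑' i, d i := fun n => (hs n).tsum_le_tsum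
    (fun p => Set.indicator_le_self' (fun i _ => hd0 i) p) hw
  have hstep : ∀ n, H (n + 1) = H n + d n := fun n => by
    have e : ∀ p, Set.indicator {p | p < n + 1} d p
        = Set.indicator {p | p < n} d p + if p = n then d n else 0 := fun p => by
      rcases lt_trichotomy p n with h | h | h
      · simp [h, h.ne, h.le]
      · simp [h]
      · simp [not_lt.2 h.le, h.ne', not_le.2 h]
    simp only [H]
    rw [tsum_congr e, (hs n).tsum_add (summable_of_ne_finset_zero (s := {n}) (by simp_all)),
      tsum_ite_eq]
  have hmono : Monotone H := monotone_int_of_le_succ fun n => by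
    rw [hstep]; linarith [hd0 n]
  have hinc : ∀ i j, i ≤ j → |w j - w i| ≤ H j - H i := fun i j hij => by
    induction j, hij using Int.leInduction with
    | base => simp
    | succ j hj ih =>
      rw [hstep]
      calc |w (j + 1) - w i| ≤ |w (j + 1) - w j| + |w j - w i| := abs_sub_le _ _ _
        _ ≤ _ := by linarith
  exact ⟨fun x => H (cellIndex Δx x), hmono.comp (cellIndex_mono hΔx),
    fun x y hxy => hinc _ _ (cellIndex_mono hΔx hxy), fun x y => by
      linarith [hH0 (cellIndex Δx x), hH1 (cellIndex Δx y)]⟩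

/-- The line is cut into cells whose width is the translation itself, so that `x` and `x + z` lie in
adjacent cells. The increase of `h` over every cell is then counted twice, whence the factor 2. -/
lemma VariationBound.integral_translate_le_of_pos {v h : ℝ → ℝ} {V : ℝ} (hv : Integrable v)
    (hvh : VariationBound v h V) {z : ℝ} (hz : 0 < z) :
    ∫ x, |v (x + z) - v x| ≤ 2 * V * z := by
  have hint : Integrable fun x => |v (x + z) - v x| := ((hv.comp_add_right z).sub hv).abs
  have hsum := hasSum_integral_cell hz hint
  set H : ℤ → ℝ := fun i => h (((i : ℝ) - 1 / 2) * z) with hH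
  have hHm : Monotone H := fun i j hij => hvh.mono (by
    have : (i : ℝ) ≤ j := by exact_mod_cast hij
    gcongr)
  obtain ⟨h1, h2⟩ := summable_increments hHm (fun i j => hvh.total _ _)
  have h1' := summable_shift h1 1
  have hcell : ∀ i, ∫ x in cell z i, |v (x + z) - v x|
      ≤ z * ((H (i + 1 + 1) - H (i + 1)) + (H (i + 1) - H i)) := fun i => by
    have hpt : ∀ x ∈ cell z i, |v (x + z) - v x| ≤ H (i + 1 + 1) - H i := fun x hx => by
      refine (hvh.increments (by linarith)).trans (sub_le_sub (hvh.mono ?_) (hvh.mono hx.1))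
      have := hx.2
      push_cast
      linarith
    calc _ ≤ ∫ _ in cell z i, (H (i + 1 + 1) - H i) :=
          setIntegral_mono_on hint.integrableOn (by rw [cell]; simp) (measurableSet_cell z i) hpt
      _ = _ := by rw [setIntegral_const, volume_real_cell hz]; simp
  rw [← hsum.tsum_eq]
  refine (hsum.summable.tsum_le_tsum hcell ((h1'.add h1).mul_left z)).trans ?_
  rw [tsum_mul_left, h1'.tsum_add h1, tsum_shift (fun i => H (i + 1) - H i) 1]
  have := mul_le_mul_of_nonneg_left h2 hz.le
  linarith

lemma VariationBound.integral_translate_le {v h : ℝ → ℝ} {V : ℝ} (hv : Integrable v)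
    (hvh : VariationBound v h V) (z : ℝ) : ∫ x, |v (x + z) - v x| ≤ 2 * V * |z| := by
  rcases lt_trichotomy z 0 with hz | hz | hz
  · have h1 := hvh.integral_translate_le_of_pos hv (neg_pos.2 hz)
    have h2 := integral_add_right_eq_self (μ := volume) (fun x => |v (x + -z) - v x|) z
    rw [abs_of_neg hz, ← integral_congr_ae (ae_of_all _ fun x => abs_sub_comm _ _)]
    refine le_trans (le_of_eq ?_) h1
    rw [← h2]
    simp
  · simp [hz]
  · rw [abs_of_pos hz]
    exact hvh.integral_translate_le_of_pos hv hz

end NonlocalFV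

namespace NonlocalFV

/-! ### The space-time strip -/

/-- Lebesgue measure on `Q_T = (0, T) × ℝ`. -/
noncomputable def stripMeasure (T : ℝ) : Measure (ℝ × ℝ) :=
  (volume.restrict (Set.Ioo 0 T)).prod volume

instance (T : ℝ) : SFinite (stripMeasure T) := by unfold stripMeasure; infer_instance

lemma restrict_strip (T : ℝ) :
    (volume : Measure (ℝ × ℝ)).restrict (Set.Ioo 0 T ×ˢ (Set.univ : Set ℝ)) = stripMeasure T := by
  rw [stripMeasure, Measure.restrict_prod_eq_prod_univ, Measure.volume_eq_prod]

lemma measurable_sign : Measurable Real.sign := by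
  have : Real.sign = fun r : ℝ => if r < 0 then -1 else if 0 < r then 1 else 0 := by
    funext r; rfl
  rw [this]
  exact Measurable.ite measurableSet_Iio measurable_const
    (Measurable.ite measurableSet_Ioi measurable_const measurable_const)

lemma ae_strip_of_ae {T : ℝ} {p : ℝ → Prop} (h : ∀ᵐ t ∂volume.restrict (Set.Ioo 0 T), p t) :
    ∀ᵐ q : ℝ × ℝ ∂stripMeasure T, p q.1 :=
  Measure.quasiMeasurePreserving_fst.ae h

lemma ae_strip_mem (T : ℝ) : ∀ᵐ q : ℝ × ℝ ∂stripMeasure T, q.1 ∈ Set.Ioo 0 T :=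
  ae_strip_of_ae (ae_restrict_mem measurableSet_Ioo)

lemma integrable_strip_of_continuous {T : ℝ} {g : ℝ × ℝ → ℝ} (hg : Continuous g)
    (hc : HasCompactSupport g) : Integrable g (stripMeasure T) := by
  rw [← restrict_strip]
  exact (hg.integrable_of_hasCompactSupport hc).restrict

/-! ### Measurability of the nonlocal coefficient on the strip. -/

section Measurability

variable {f β ν μ m : ℝ → ℝ} {C T : ℝ} {u : ℝ → ℝ → ℝ}

/-- A jointly measurable representative of `u` agrees with `u(t, ·)` almost everywhere for almost
every `t`. At these times the average is unchanged at every `x`. -/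
lemma aestronglyMeasurable_nonlocalAvg
    (hu : AEStronglyMeasurable (Function.uncurry u) (stripMeasure T)) (hβ : Continuous β)
    (hm : Continuous m) :
    AEStronglyMeasurable (fun p : ℝ × ℝ => nonlocalAvg β m (u p.1) p.2) (stripMeasure T) := by
  have h1 : ∀ᵐ t ∂volume.restrict (Set.Ioo 0 T), ∀ᵐ x ∂(volume : Measure ℝ),
      Function.uncurry u (t, x) = hu.mk (Function.uncurry u) (t, x) :=
    Measure.ae_ae_of_ae_prod hu.ae_eq_mk
  have h2 : StronglyMeasurable fun p : ℝ × ℝ =>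
      ∫ y, m (p.2 - y) * β (hu.mk (Function.uncurry u) (p.1, y)) := by
    refine StronglyMeasurable.integral_prod_right
      (f := fun (p : ℝ × ℝ) y => m (p.2 - y) * β (hu.mk (Function.uncurry u) (p.1, y))) ?_
    refine StronglyMeasurable.mul ?_ ?_
    · exact (hm.comp ((continuous_snd.comp continuous_fst).sub continuous_snd)).stronglyMeasurable
    · exact hβ.comp_stronglyMeasurable (hu.stronglyMeasurable_mk.comp_measurable
        ((measurable_fst.comp measurable_fst).prodMk measurable_snd))
  refine ⟨_, h2, (ae_strip_of_ae (p := fun t => ∀ x, nonlocalAvg β m (u t) x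
    = ∫ y, m (x - y) * β (hu.mk (Function.uncurry u) (t, y))) ?_).mono fun p hp => hp p.2⟩
  filter_upwards [h1] with t ht x
  refine integral_congr_ae ?_
  filter_upwards [ht] with y hy
  rw [← hy]
  rfl

/-- What is needed of a space-time function for the entropy inequality to make sense: joint
measurability and a bound in `L^∞(0, T; L¹)`. -/
structure StripFun (T M : ℝ) (u : ℝ → ℝ → ℝ) : Prop where
  aesm : AEStronglyMeasurable (Function.uncurry u) (stripMeasure T)
  integrable : ∀ t ∈ Set.Icc 0 T, Integrable (u t)
  mass : ∀ t ∈ Set.Icc 0 T, ∫ x, |u t x| ≤ M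

namespace StripFun

variable {M : ℝ} (hu : StripFun T M u) (hd : DataBound f β ν μ C)

include hu

lemma ae_integrable : ∀ᵐ p : ℝ × ℝ ∂stripMeasure T, Integrable (u p.1) :=
  (ae_strip_mem T).mono fun _ hp => hu.integrable _ ⟨hp.1.le, hp.2.le⟩

include hd

lemma aesm_coeff :
    AEStronglyMeasurable (fun p : ℝ × ℝ => nonlocalCoeff β ν μ (u p.1) p.2) (stripMeasure T) :=
  hd.nu.continuous.comp_aestronglyMeasurable
    (aestronglyMeasurable_nonlocalAvg hu.aesm hd.beta.continuous hd.mu.continuous)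

lemma aesm_deriv_coeff :
    AEStronglyMeasurable (fun p : ℝ × ℝ => deriv (nonlocalCoeff β ν μ (u p.1)) p.2)
      (stripMeasure T) := by
  refine AEStronglyMeasurable.congr (f := fun p : ℝ × ℝ =>
    deriv ν (nonlocalAvg β μ (u p.1) p.2) * nonlocalAvg β (deriv μ) (u p.1) p.2) ?_ ?_
  · exact (hd.nu.continuous_deriv.comp_aestronglyMeasurable
      (aestronglyMeasurable_nonlocalAvg hu.aesm hd.beta.continuous hd.mu.continuous)).mul
      (aestronglyMeasurable_nonlocalAvg hu.aesm hd.beta.continuous hd.mu.continuous_deriv)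
  · filter_upwards [hu.ae_integrable] with p hp
    rw [hd.deriv_coeff hp]

lemma ae_abs_deriv_coeff_le :
    ∀ᵐ p : ℝ × ℝ ∂stripMeasure T, |deriv (nonlocalCoeff β ν μ (u p.1)) p.2| ≤ C ^ 3 * M := by
  filter_upwards [ae_strip_mem T] with p hp
  exact hd.abs_deriv_coeff_le (hu.integrable _ ⟨hp.1.le, hp.2.le⟩)
    (hu.mass _ ⟨hp.1.le, hp.2.le⟩) _

end StripFun

end Measurability

/-- The flux `sgn(a - k) (f(a) - f(k))` of the Kruzhkov entropy `|a - k|`. -/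
noncomputable def kruzhkov (f : ℝ → ℝ) (a k : ℝ) : ℝ := Real.sign (a - k) * (f a - f k)

/-! ### The Kruzhkov entropy flux. -/

section Kruzhkov

variable {f β ν μ : ℝ → ℝ} {C : ℝ}

/-- This form shows that the entropy flux is Lipschitz although the sign jumps, and it is the form
in which the numerical entropy flux is written. -/
lemma kruzhkov_eq (f : ℝ → ℝ) (a k : ℝ) : kruzhkov f a k = f (max a k) - f (min a k) := by
  rcases lt_trichotomy a k with h | h | h
  · rw [kruzhkov, Real.sign_of_neg (sub_neg.2 h), max_eq_right h.le, min_eq_left h.le]; ring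
  · simp [kruzhkov, h]
  · rw [kruzhkov, Real.sign_of_pos (sub_pos.2 h), max_eq_left h.le, min_eq_right h.le]; ring

lemma DataBound.abs_kruzhkov_le (hd : DataBound f β ν μ C) (a k : ℝ) :
    |kruzhkov f a k| ≤ C * |a - k| := by
  rw [kruzhkov, abs_mul]
  exact (mul_le_of_le_one_left (abs_nonneg _) (abs_sign_le _)).trans (hd.f_lip a k)

lemma abs_max_sub_max_add_abs_min_sub_min (a b k : ℝ) :
    |max a k - max b k| + |min a k - min b k| = |a - b| := by
  rcases le_total a k with h1 | h1 <;> rcases le_total b k with h2 | h2 <;>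
    simp only [max_eq_left, max_eq_right, min_eq_left, min_eq_right, h1, h2, sub_self, abs_zero,
      zero_add, add_zero]
  · rw [abs_of_nonpos (by linarith), abs_of_nonpos (by linarith), abs_of_nonpos (by linarith)]
    ring
  · rw [abs_of_nonneg (by linarith), abs_of_nonneg (by linarith), abs_of_nonneg (by linarith)]
    ring

lemma DataBound.abs_kruzhkov_sub_le (hd : DataBound f β ν μ C) (a b k : ℝ) :
    |kruzhkov f a k - kruzhkov f b k| ≤ C * |a - b| := by
  rw [kruzhkov_eq, kruzhkov_eq, ← abs_max_sub_max_add_abs_min_sub_min a b k, mul_add]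
  have e : f (max a k) - f (min a k) - (f (max b k) - f (min b k))
      = (f (max a k) - f (max b k)) - (f (min a k) - f (min b k)) := by ring
  rw [e]
  exact (abs_sub _ _).trans (add_le_add (hd.f_lip _ _) (hd.f_lip _ _))

lemma continuous_kruzhkov (hf : Continuous f) :
    Continuous fun p : ℝ × ℝ => kruzhkov f p.1 p.2 := by
  simp only [kruzhkov_eq]
  fun_prop

end Kruzhkov

/-! ### Test functions -/

/-- Bounds of a test function whose support lies in `ℝ × [y - R, y + R]`. -/
structure TestBound (φ : ℝ → ℝ → ℝ) (M R y : ℝ) : Prop where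
  bound : ∀ t x, |φ t x| ≤ M
  lip_time : ∀ t s x, |φ t x - φ s x| ≤ M * |t - s|
  deriv_bound : ∀ t x, |deriv (φ t) x| ≤ M
  deriv_lip : ∀ t s x z, |deriv (φ t) x - deriv (φ s) z| ≤ M * (|t - s| + |x - z|)
  support : ∀ t x, φ t x ≠ 0 → |x - y| ≤ R

section Tests

variable {T : ℝ} {φ : ℝ → ℝ → ℝ}

namespace IsTestFunction

lemma hasDerivAt_space (h : IsTestFunction T φ) (t x : ℝ) :
    HasDerivAt (φ t) (fderiv ℝ (Function.uncurry φ) (t, x) (0, 1)) x := by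
  have h1 : HasFDerivAt (Function.uncurry φ) (fderiv ℝ (Function.uncurry φ) (t, x)) (t, x) :=
    ((h.1.differentiable (by simp)) _).hasFDerivAt
  have h2 : HasDerivAt (fun x : ℝ => (t, x)) ((0 : ℝ), (1 : ℝ)) x :=
    (hasDerivAt_const x t).prodMk (hasDerivAt_id x)
  exact h1.comp_hasDerivAt x h2

lemma hasDerivAt_time (h : IsTestFunction T φ) (t x : ℝ) :
    HasDerivAt (fun s => φ s x) (fderiv ℝ (Function.uncurry φ) (t, x) (1, 0)) t := by
  have h1 : HasFDerivAt (Function.uncurry φ) (fderiv ℝ (Function.uncurry φ) (t, x)) (t, x) :=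
    ((h.1.differentiable (by simp)) _).hasFDerivAt
  have h2 : HasDerivAt (fun s : ℝ => (s, x)) ((1 : ℝ), (0 : ℝ)) t :=
    (hasDerivAt_id t).prodMk (hasDerivAt_const t x)
  exact h1.comp_hasDerivAt t h2

lemma deriv_space_eq (h : IsTestFunction T φ) :
    (fun p : ℝ × ℝ => deriv (φ p.1) p.2)
      = fun p => fderiv ℝ (Function.uncurry φ) p (0, 1) :=
  funext fun p => (h.hasDerivAt_space p.1 p.2).deriv

lemma deriv_time_eq (h : IsTestFunction T φ) :
    (fun p : ℝ × ℝ => deriv (fun s => φ s p.2) p.1)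
      = fun p => fderiv ℝ (Function.uncurry φ) p (1, 0) :=
  funext fun p => (h.hasDerivAt_time p.1 p.2).deriv

lemma contDiff_fderiv_apply (h : IsTestFunction T φ) (v : ℝ × ℝ) :
    ContDiff ℝ 1 fun p => fderiv ℝ (Function.uncurry φ) p v :=
  (h.1.fderiv_right (m := 1) (by norm_cast)).clm_apply contDiff_const

lemma continuous_deriv_space (h : IsTestFunction T φ) :
    Continuous fun p : ℝ × ℝ => deriv (φ p.1) p.2 := by
  rw [h.deriv_space_eq]; exact (h.contDiff_fderiv_apply _).continuous

lemma continuous_deriv_time (h : IsTestFunction T φ) :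
    Continuous fun p : ℝ × ℝ => deriv (fun s => φ s p.2) p.1 := by
  rw [h.deriv_time_eq]; exact (h.contDiff_fderiv_apply _).continuous

lemma hasCompactSupport_deriv_space (h : IsTestFunction T φ) :
    HasCompactSupport fun p : ℝ × ℝ => deriv (φ p.1) p.2 := by
  rw [h.deriv_space_eq]; exact h.2.1.fderiv_apply ℝ _

lemma hasCompactSupport_deriv_time (h : IsTestFunction T φ) :
    HasCompactSupport fun p : ℝ × ℝ => deriv (fun s => φ s p.2) p.1 := by
  rw [h.deriv_time_eq]; exact h.2.1.fderiv_apply ℝ _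

lemma continuous (h : IsTestFunction T φ) : Continuous (Function.uncurry φ) := h.1.continuous

lemma eq_zero (h : IsTestFunction T φ) {t : ℝ} (ht : T ≤ t) (x : ℝ) : φ t x = 0 := by
  by_contra h0
  have : (t, x) ∈ tsupport (Function.uncurry φ) := subset_tsupport _ h0
  exact absurd (h.2.2.1 this) (not_lt.2 ht)

lemma continuous_slice (h : IsTestFunction T φ) (t : ℝ) : Continuous (φ t) :=
  h.continuous.comp (continuous_const.prodMk continuous_id)

lemma hasCompactSupport_slice (h : IsTestFunction T φ) (t : ℝ) : HasCompactSupport (φ t) := by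
  refine HasCompactSupport.intro (h.2.1.isCompact.image continuous_snd) fun x hx => ?_
  by_contra h0
  exact hx ⟨(t, x), subset_tsupport _ h0, rfl⟩

lemma integrable_slice (h : IsTestFunction T φ) (t : ℝ) : Integrable (φ t) :=
  (h.continuous_slice t).integrable_of_hasCompactSupport (h.hasCompactSupport_slice t)

lemma exists_testBound (h : IsTestFunction T φ) : ∃ M R, TestBound φ M R 0 := by
  obtain ⟨B, hB⟩ := h.2.1.exists_bound_of_continuous h.continuous
  obtain ⟨L, hL⟩ := h.1.lipschitzWith_of_hasCompactSupport h.2.1 (by simp)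
  obtain ⟨B', hB'⟩ := h.hasCompactSupport_deriv_space.exists_bound_of_continuous
    h.continuous_deriv_space
  obtain ⟨L', hL'⟩ := ContDiff.lipschitzWith_of_hasCompactSupport (n := 1) (𝕂 := ℝ)
    (f := fun p : ℝ × ℝ => deriv (φ p.1) p.2) h.hasCompactSupport_deriv_space
    (by rw [h.deriv_space_eq]; exact h.contDiff_fderiv_apply _) (by simp)
  obtain ⟨R, hR⟩ := (h.2.1.isCompact.image continuous_snd).isBounded.exists_norm_le
  set M := max (max B L) (max B' L')
  have m1 : B ≤ M := (le_max_left _ _).trans (le_max_left _ _)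
  have m2 : (L : ℝ) ≤ M := (le_max_right _ _).trans (le_max_left _ _)
  have m3 : B' ≤ M := (le_max_left _ _).trans (le_max_right _ _)
  have m4 : (L' : ℝ) ≤ M := (le_max_right _ _).trans (le_max_right _ _)
  refine ⟨M, R, fun t x => (hB (t, x)).trans m1, fun t s x => ?_, fun t x => (hB' (t, x)).trans m3,
    fun t s x z => ?_, fun t x h0 => ?_⟩
  · have := hL.dist_le_mul (t, x) (s, x)
    rw [Prod.dist_eq, dist_self, max_eq_left dist_nonneg, Real.dist_eq, Real.dist_eq] at this
    exact this.trans (by gcongr)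
  · have := hL'.dist_le_mul (t, x) (s, z)
    rw [Prod.dist_eq, Real.dist_eq, Real.dist_eq, Real.dist_eq] at this
    refine this.trans ?_
    have : max |t - s| |x - z| ≤ |t - s| + |x - z| :=
      max_le (le_add_of_nonneg_right (abs_nonneg _)) (le_add_of_nonneg_left (abs_nonneg _))
    gcongr
  · simpa using hR x ⟨(t, x), subset_tsupport _ h0, rfl⟩

end IsTestFunction

namespace TestBound

variable {M R y : ℝ}

lemma nonneg (hb : TestBound φ M R y) : 0 ≤ M := (abs_nonneg _).trans (hb.bound 0 0)

lemma eq_zero (hb : TestBound φ M R y) {t x : ℝ} (h : R < |x - y|) : φ t x = 0 := by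
  by_contra h0
  exact absurd (hb.support t x h0) (not_le.2 h)

lemma deriv_eq_zero (hb : TestBound φ M R y) {t x : ℝ} (h : R < |x - y|) :
    deriv (φ t) x = 0 := by
  have : φ t =ᶠ[𝓝 x] fun _ => 0 := by
    have ho : IsOpen {x : ℝ | R < |x - y|} :=
      isOpen_lt continuous_const (by fun_prop)
    filter_upwards [ho.mem_nhds h] with z hz
    exact hb.eq_zero hz
  rw [this.deriv_eq, deriv_const]

end TestBound

end Tests

/-! ### The terms of the entropy inequality -/

section EntropyTerms

variable {f β ν μ u₀ : ℝ → ℝ} {C T M B k : ℝ} {u : ℝ → ℝ → ℝ} {φ : ℝ → ℝ → ℝ}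

lemma integrable_entropy_time (hu : StripFun T M u) (hB : ∀ᵐ p ∂stripMeasure T, |u p.1 p.2| ≤ B)
    (hφ : IsTestFunction T φ) (k : ℝ) :
    Integrable (fun p : ℝ × ℝ => |u p.1 p.2 - k| * deriv (fun s => φ s p.2) p.1)
      (stripMeasure T) := by
  refine (integrable_strip_of_continuous hφ.continuous_deriv_time
    hφ.hasCompactSupport_deriv_time).bdd_mul (c := B + |k|) ?_ ?_
  · exact (hu.aesm.sub aestronglyMeasurable_const).norm
  · filter_upwards [hB] with p hp
    rw [Real.norm_eq_abs, abs_abs]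
    exact (abs_sub _ _).trans (by linarith)

lemma integrable_entropy_flux (hd : DataBound f β ν μ C) (hu : StripFun T M u)
    (hB : ∀ᵐ p ∂stripMeasure T, |u p.1 p.2| ≤ B) (hφ : IsTestFunction T φ) (k : ℝ) :
    Integrable (fun p : ℝ × ℝ => Real.sign (u p.1 p.2 - k) * nonlocalCoeff β ν μ (u p.1) p.2
      * (f (u p.1 p.2) - f k) * deriv (fun y => φ p.1 y) p.2) (stripMeasure T) := by
  have hC := hd.nonneg
  refine (integrable_strip_of_continuous hφ.continuous_deriv_space
    hφ.hasCompactSupport_deriv_space).bdd_mul (c := C * (C * (B + |k|))) ?_ ?_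
  · refine ((measurable_sign.comp_aemeasurable
      (hu.aesm.aemeasurable.sub_const k)).aestronglyMeasurable.mul (hu.aesm_coeff hd)).mul ?_
    exact (hd.continuous_f.comp_aestronglyMeasurable hu.aesm).sub aestronglyMeasurable_const
  · filter_upwards [hB] with p hp
    have e : Real.sign (u p.1 p.2 - k) * nonlocalCoeff β ν μ (u p.1) p.2 * (f (u p.1 p.2) - f k)
        = nonlocalCoeff β ν μ (u p.1) p.2 * kruzhkov f (u p.1 p.2) k := by
      rw [kruzhkov]; ring
    rw [Real.norm_eq_abs, e, abs_mul]
    have h1 := hd.abs_coeff_le (u p.1) p.2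
    have h2 : |kruzhkov f (u p.1 p.2) k| ≤ C * (B + |k|) :=
      (hd.abs_kruzhkov_le _ _).trans
        (mul_le_mul_of_nonneg_left ((abs_sub _ _).trans (by linarith)) hC)
    exact mul_le_mul h1 h2 (abs_nonneg _) hC

lemma integrable_entropy_source (hd : DataBound f β ν μ C) (hu : StripFun T M u)
    (hφ : IsTestFunction T φ) (k : ℝ) :
    Integrable (fun p : ℝ × ℝ => f k * Real.sign (u p.1 p.2 - k)
      * deriv (nonlocalCoeff β ν μ (u p.1)) p.2 * φ p.1 p.2) (stripMeasure T) := by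
  refine (integrable_strip_of_continuous hφ.continuous hφ.2.1).bdd_mul
    (c := |f k| * (C ^ 3 * M)) ?_ ?_
  · exact ((measurable_sign.comp_aemeasurable
      (hu.aesm.aemeasurable.sub_const k)).aestronglyMeasurable.const_mul _).mul
      (hu.aesm_deriv_coeff hd)
  · filter_upwards [hu.ae_abs_deriv_coeff_le hd] with p hp
    rw [Real.norm_eq_abs, abs_mul, abs_mul, mul_assoc]
    refine mul_le_mul_of_nonneg_left ?_ (abs_nonneg _)
    exact (mul_le_of_le_one_left (abs_nonneg _) (abs_sign_le _)).trans hp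

/-- `u` satisfies the entropy inequality up to an error controlled by `ε`, for the test functions
bounded by `M` and with support in strips of width `2 R`. -/
def ApproxEntropy (f β ν μ u₀ : ℝ → ℝ) (T : ℝ) (u : ℝ → ℝ → ℝ) (M R ε : ℝ) : Prop :=
  ∃ g : ℝ → ℝ, (∀ y, 0 ≤ g y ∧ g y ≤ ε) ∧ Integrable g ∧ ∫ y, g y ≤ ε ∧
    ∀ (k y : ℝ) (φ : ℝ → ℝ → ℝ), IsTestFunction T φ → TestBound φ M R y →
      -(g y + ε * |k|) ≤ entropyForm f β ν μ u₀ T u k φ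

lemma IsEntropySolution.approxEntropy (h : IsEntropySolution f β ν μ u₀ T u) {ε : ℝ} (hε : 0 ≤ ε)
    (M R : ℝ) : ApproxEntropy f β ν μ u₀ T u M R ε := by
  refine ⟨fun _ => 0, fun _ => ⟨le_rfl, hε⟩, integrable_zero _ _ _, by simpa, fun k y φ hφ _ => ?_⟩
  refine le_trans ?_ (h.entropy k φ hφ)
  have := mul_nonneg hε (abs_nonneg k)
  linarith

end EntropyTerms

end NonlocalFV

namespace NonlocalFV

/-! ### Time slabs -/

section Slabs

variable {T Δt : ℝ} {N : ℕ} {H : ℝ × ℝ → ℝ}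

lemma integral_strip_eq_sum (hT : N * Δt = T) (hΔt : 0 < Δt)
    (hH : Integrable H (stripMeasure T)) :
    ∫ p, H p ∂stripMeasure T
      = ∑ n ∈ Finset.range N, ∫ t in Set.Ioo (n * Δt) ((n + 1 : ℕ) * Δt), ∫ x, H (t, x) := by
  have hint : IntegrableOn (fun t => ∫ x, H (t, x)) (Set.Ioo 0 T) := hH.integral_prod_left
  have hT0 : 0 ≤ T := by rw [← hT]; positivity
  rw [stripMeasure, integral_prod _ hH, ← integral_Ioc_eq_integral_Ioo,
    ← intervalIntegral.integral_of_le hT0]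
  have h := intervalIntegral.sum_integral_adjacent_intervals (μ := volume)
    (f := fun t => ∫ x, H (t, x)) (a := fun n : ℕ => (n : ℝ) * Δt) (n := N) fun n hn => ?_
  · simp only [Nat.cast_zero, zero_mul, hT] at h
    rw [← h]
    refine Finset.sum_congr rfl fun n _ => ?_
    rw [intervalIntegral.integral_of_le (by gcongr; simp), integral_Ioc_eq_integral_Ioo]
  · rw [intervalIntegrable_iff_integrableOn_Ioo_of_le (by gcongr; simp)]
    refine hint.mono_set (Set.Ioo_subset_Ioo (by positivity) ?_)
    rw [← hT]
    have : ((n + 1 : ℕ) : ℝ) ≤ N := by exact_mod_cast hn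
    gcongr

lemma abs_integral_strip_sub_le (hT : N * Δt = T) (hΔt : 0 < Δt)
    (hH : Integrable H (stripMeasure T)) {P e : ℕ → ℝ}
    (h : ∀ n < N, ∀ t ∈ Set.Ioo (n * Δt) ((n + 1 : ℕ) * Δt), |(∫ x, H (t, x)) - P n| ≤ e n) :
    |(∫ p, H p ∂stripMeasure T) - ∑ n ∈ Finset.range N, Δt * P n|
      ≤ ∑ n ∈ Finset.range N, Δt * e n := by
  have hint : IntegrableOn (fun t => ∫ x, H (t, x)) (Set.Ioo 0 T) := hH.integral_prod_left
  rw [integral_strip_eq_sum hT hΔt hH, ← Finset.sum_sub_distrib]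
  refine (Finset.abs_sum_le_sum_abs _ _).trans (Finset.sum_le_sum fun n hn => ?_)
  have hn' := Finset.mem_range.1 hn
  have hlen : ((n + 1 : ℕ) : ℝ) * Δt - n * Δt = Δt := by push_cast; ring
  have hvol : volume.real (Set.Ioo ((n : ℝ) * Δt) ((n + 1 : ℕ) * Δt)) = Δt := by
    rw [Real.volume_real_Ioo_of_le (by linarith), hlen]
  have hint' : IntegrableOn (fun t => ∫ x, H (t, x))
      (Set.Ioo ((n : ℝ) * Δt) ((n + 1 : ℕ) * Δt)) := by
    refine hint.mono_set (Set.Ioo_subset_Ioo (by positivity) ?_)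
    rw [← hT]
    have : ((n + 1 : ℕ) : ℝ) ≤ N := by exact_mod_cast hn'
    gcongr
  have hc : Δt * P n = ∫ _ in Set.Ioo ((n : ℝ) * Δt) ((n + 1 : ℕ) * Δt), P n := by
    rw [setIntegral_const, hvol, smul_eq_mul]
  rw [hc, ← integral_sub hint' (by simp)]
  have := norm_setIntegral_le_of_norm_le_const (μ := volume)
    (s := Set.Ioo ((n : ℝ) * Δt) ((n + 1 : ℕ) * Δt)) (f := fun t => (∫ x, H (t, x)) - P n)
    (C := e n) (by simp) (fun t ht => h n hn' t ht)
  rwa [hvol, mul_comm (e n)] at this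

lemma floor_div_eq (hΔt : 0 < Δt) {n : ℕ} {t : ℝ} (h1 : n * Δt ≤ t)
    (h2 : t < (n + 1 : ℕ) * Δt) : ⌊t / Δt⌋₊ = n := by
  have h0 : 0 ≤ t := le_trans (by positivity) h1
  rw [Nat.floor_eq_iff (by positivity), le_div_iff₀ hΔt, div_lt_iff₀ hΔt]
  exact ⟨h1, by exact_mod_cast h2⟩

lemma floor_div_le (hT : N * Δt = T) (hΔt : 0 < Δt) {t : ℝ} (ht : t ≤ T) : ⌊t / Δt⌋₊ ≤ N :=
  Nat.floor_le_of_le (by rw [div_le_iff₀ hΔt, hT]; exact ht)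

lemma abs_floor_sub_floor_le (hΔt : 0 < Δt) {s t : ℝ} (hs : 0 ≤ s) (ht : 0 ≤ t) :
    |((⌊s / Δt⌋₊ : ℕ) : ℝ) - (⌊t / Δt⌋₊ : ℕ)| * Δt ≤ |s - t| + Δt := by
  have a1 := Nat.floor_le (div_nonneg hs hΔt.le)
  have a2 := Nat.lt_floor_add_one (s / Δt)
  have a3 := Nat.floor_le (div_nonneg ht hΔt.le)
  have a4 := Nat.lt_floor_add_one (t / Δt)
  have h : |((⌊s / Δt⌋₊ : ℕ) : ℝ) - (⌊t / Δt⌋₊ : ℕ)| ≤ |s / Δt - t / Δt| + 1 := by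
    rw [abs_le]
    constructor <;> linarith [le_abs_self (s / Δt - t / Δt), neg_abs_le (s / Δt - t / Δt)]
  calc _ ≤ (|s / Δt - t / Δt| + 1) * Δt := by gcongr
    _ = |(s / Δt - t / Δt) * Δt| + Δt := by rw [abs_mul, abs_of_pos hΔt]; ring
    _ = _ := by rw [sub_mul, div_mul_cancel₀ _ hΔt.ne', div_mul_cancel₀ _ hΔt.ne']

end Slabs

/-! ### One step of the scheme, tested against a function of space -/

/-- Summation by parts in space: the shift by one cell passes from the numerical flux to `η`, where
it becomes a difference quotient. -/
lemma integral_step_le {Δx Δt B : ℝ} (hΔx : 0 < Δx) {p G q : ℤ → ℝ} (hp : ∀ i, |p i| ≤ B)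
    (hG : ∀ i, |G i| ≤ B) (hq : ∀ i, |q i| ≤ B)
    (h : ∀ i, p i + Δt / Δx * (G i - G (i - 1)) + Δt * q i ≤ 0) {η : ℝ → ℝ} (hη : Integrable η)
    (hη0 : ∀ x, 0 ≤ η x) :
    ∫ x, stepFun Δx p x * η x ≤ Δt * (∫ x, stepFun Δx G x * ((η (x + Δx) - η x) / Δx))
      - Δt * ∫ x, stepFun Δx q x * η x := by
  have hb : ∀ {w : ℤ → ℝ}, (∀ i, |w i| ≤ B) → ∀ {ζ : ℝ → ℝ}, Integrable ζ →
      Integrable fun x => stepFun Δx w x * ζ x := fun {w} hw {ζ} hζ =>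
    hζ.bdd_mul (measurable_stepFun Δx w).aestronglyMeasurable (ae_of_all _ fun x => hw _)
  have hη1 : Integrable fun x => η (x + Δx) := hη.comp_add_right Δx
  have i1 := hb hp hη
  have i2 := hb hG hη
  have i3 := hb hq hη
  have i4 := hb hG hη1
  have i5 : Integrable fun x => stepFun Δx G (x - Δx) * η x := by
    have := i4.comp_sub_right Δx
    simpa using this
  have e5 : ∫ x, stepFun Δx G (x - Δx) * η x = ∫ x, stepFun Δx G x * η (x + Δx) := by
    have := integral_sub_right_eq_self (μ := volume) (fun x => stepFun Δx G x * η (x + Δx)) Δx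
    simpa using this
  have e6 : ∫ x, stepFun Δx G x * ((η (x + Δx) - η x) / Δx)
      = Δx⁻¹ * (∫ x, stepFun Δx G x * η (x + Δx)) - Δx⁻¹ * ∫ x, stepFun Δx G x * η x := by
    rw [← integral_const_mul, ← integral_const_mul, ← integral_sub (i4.const_mul _)
      (i2.const_mul _)]
    congr 1
    funext x
    ring
  have key : ∫ x, (stepFun Δx p x * η x + Δt / Δx * (stepFun Δx G x * η x
      - stepFun Δx G (x - Δx) * η x) + Δt * (stepFun Δx q x * η x)) ≤ 0 := by
    refine integral_nonpos fun x => ?_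
    have h1 := mul_le_mul_of_nonneg_right (h (cellIndex Δx x)) (hη0 x)
    simp only [stepFun, cellIndex_sub hΔx, Pi.zero_apply]
    linarith
  have i6 : Integrable fun x => Δt / Δx * (stepFun Δx G x * η x
      - stepFun Δx G (x - Δx) * η x) := (i2.sub i5).const_mul _
  have i7 : Integrable fun x => stepFun Δx p x * η x + Δt / Δx * (stepFun Δx G x * η x
      - stepFun Δx G (x - Δx) * η x) := i1.add i6
  rw [integral_add i7 (i3.const_mul _), integral_add i1 i6, integral_const_mul,
    integral_const_mul, integral_sub i2 i5, e5] at key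
  rw [e6]
  have e7 : Δt / Δx = Δt * Δx⁻¹ := div_eq_mul_inv _ _
  rw [e7] at key
  linarith

/-! ### The approximate solutions as functions of space and time -/

/-- Regularity of the approximations: bounds of the translations in space and of the increments in
time, up to an error `e`. -/
structure Regular (T V e : ℝ) (u : ℝ → ℝ → ℝ) : Prop where
  measurable : Measurable (Function.uncurry u)
  translate : ∀ t ∈ Set.Icc 0 T, ∀ s ∈ Set.Icc 0 T, ∀ z,
    ∫ y, |u t (y + z) - u s y| ≤ V * |z| + V * |t - s| + e

namespace MonotoneRun

variable {f β ν μ u₀ : ℝ → ℝ} {C m V K D T : ℝ} {F : ℝ → ℝ → ℝ → ℝ} {Δx Δt : ℝ} {N : ℕ}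
  {α : ℕ → ℤ → ℝ}

local notation "U" => approx β ν μ u₀ F Δx Δt α
local notation "A" => coeff β ν μ u₀ F Δx Δt α

lemma approxFun_eq (t : ℝ) :
    approxFun β ν μ u₀ F Δx Δt α t = stepFun Δx (U ⌊t / Δt⌋₊) := rfl

lemma measurable_approxFun : Measurable (Function.uncurry (approxFun β ν μ u₀ F Δx Δt α)) := by
  have h : Measurable fun p : ℕ × ℤ => U p.1 p.2 := Measurable.of_discrete
  exact h.comp (((Nat.measurable_floor.comp (measurable_fst.div_const Δt))).prodMk
    ((measurable_cellIndex Δx).comp measurable_snd))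

variable (hr : MonotoneRun f β ν μ u₀ K D T F Δx Δt N α) (hd : DataBound f β ν μ C)
  (hi : InitialBound u₀ m V)

include hr hd hi

lemma integrable_stepFun {n : ℕ} (hn : n ≤ N) : Integrable (stepFun Δx (U n)) :=
  NonlocalFV.integrable_stepFun hr.dx_pos (hr.summable hd hi hn)

lemma integral_abs_stepFun_le {n : ℕ} (hn : n ≤ N) : ∫ x, |stepFun Δx (U n) x| ≤ m := by
  rw [integral_abs_stepFun hr.dx_pos (hr.summable hd hi hn)]
  exact hr.mass_le hd hi hn

lemma integral_abs_stepFun_sub_le {p n : ℕ} (hp : p ≤ N) (hn : n ≤ N) :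
    ∫ x, |stepFun Δx (U p) x - stepFun Δx (U n) x| ≤ timeRate C m V K D T * |(p : ℝ) - n| * Δt := by
  obtain ⟨h1, h2⟩ := hr.time_diff hd hi hp hn
  exact (integral_abs_stepFun hr.dx_pos (w := fun i => U p i - U n i) h1).trans_le h2

lemma stripFun : StripFun T m (approxFun β ν μ u₀ F Δx Δt α) where
  aesm := measurable_approxFun.aestronglyMeasurable
  integrable _ ht := hr.integrable_stepFun hd hi (floor_div_le hr.final_time hr.dt_pos ht.2)
  mass _ ht := hr.integral_abs_stepFun_le hd hi (floor_div_le hr.final_time hr.dt_pos ht.2)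

/-- A summable sequence tends to zero at infinity, so each of its values is bounded by its total
variation. -/
lemma abs_le {n : ℕ} (hn : n ≤ N) (i : ℤ) : |U n i| ≤ variationSup C m V K T := by
  have hs := hr.summable hd hi hn
  have hd' := summable_abs_diff hs
  obtain ⟨h, hh⟩ := stepFun_variationBound one_pos hd'
  have hlim : Tendsto (fun j : ℕ => |U n (i + j)|) atTop (𝓝 0) := by
    have := (summable_shift hs i).tendsto_cofinite_zero
    have h2 : Tendsto (fun j : ℕ => (j : ℤ)) atTop cofinite := by
      rw [← Nat.cofinite_eq_atTop]
      exact Function.Injective.tendsto_cofinite Nat.cast_injective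
    refine (this.comp h2).congr fun j => ?_
    simp [add_comm]
  have hb : ∀ j : ℕ, |U n i| - |U n (i + j)| ≤ variationSup C m V K T := fun j => by
    have h1 := hh.increments (x := (i : ℝ)) (y := ((i + j : ℤ) : ℝ)) (by push_cast; simp)
    have h2 := hh.total (i : ℝ) ((i + j : ℤ) : ℝ)
    have h3 : ∀ k : ℤ, stepFun 1 (U n) (k : ℝ) = U n k := fun k => by
      have : cellIndex 1 (k : ℝ) = k := (mem_cell_iff one_pos).1 (by
        rw [cell]; constructor <;> linarith)
      rw [stepFun, this]
    rw [h3, h3] at h1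
    have h4 := abs_sub_abs_le_abs_sub (U n i) (U n (i + j))
    rw [abs_sub_comm] at h4
    linarith [hr.variation_le hd hi hn]
  have := le_of_tendsto (tendsto_const_nhds.sub hlim) (Eventually.of_forall hb)
  simpa using this

lemma abs_approxFun_le {t : ℝ} (ht : t ≤ T) (x : ℝ) :
    |approxFun β ν μ u₀ F Δx Δt α t x| ≤ variationSup C m V K T :=
  hr.abs_le hd hi (floor_div_le hr.final_time hr.dt_pos ht) _

lemma integral_abs_approxFun_sub_le {s t : ℝ} (hs : s ∈ Set.Icc 0 T) (ht : t ∈ Set.Icc 0 T) :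
    ∫ x, |approxFun β ν μ u₀ F Δx Δt α s x - approxFun β ν μ u₀ F Δx Δt α t x|
      ≤ timeRate C m V K D T * (|s - t| + Δt) := by
  refine (hr.integral_abs_stepFun_sub_le hd hi (floor_div_le hr.final_time hr.dt_pos hs.2)
    (floor_div_le hr.final_time hr.dt_pos ht.2)).trans ?_
  rw [mul_assoc]
  exact mul_le_mul_of_nonneg_left (abs_floor_sub_floor_le hr.dt_pos hs.1 ht.1)
    (hr.timeRate_nonneg hd hi)

/-- The approximation is constant on time slabs and jumps between them. It is Lipschitz in time only
up to one time step, which is the defect `timeRate * Δt`. -/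
lemma regular : Regular T (2 * variationSup C m V K T + timeRate C m V K D T)
    (timeRate C m V K D T * Δt) (approxFun β ν μ u₀ F Δx Δt α) where
  measurable := measurable_approxFun
  translate t ht s hs z := by
    have hL := hr.timeRate_nonneg hd hi
    have hN := floor_div_le hr.final_time hr.dt_pos ht.2
    obtain ⟨h, hh⟩ := stepFun_variationBound hr.dx_pos (summable_abs_diff (hr.summable hd hi hN))
    have h1 : ∫ y, |approxFun β ν μ u₀ F Δx Δt α t (y + z)
        - approxFun β ν μ u₀ F Δx Δt α t y| ≤ 2 * variationSup C m V K T * |z| := by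
      refine (hh.integral_translate_le (hr.integrable_stepFun hd hi hN) z).trans ?_
      have := hr.variation_le hd hi hN
      gcongr
    have h2 := hr.integral_abs_approxFun_sub_le hd hi ht hs
    have hV : 0 ≤ variationSup C m V K T :=
      (abs_nonneg _).trans (hr.abs_le hd hi (Nat.zero_le N) 0)
    have it := (hr.stripFun hd hi).integrable t ht
    have is := (hr.stripFun hd hi).integrable s hs
    have hI1 : Integrable fun y => |approxFun β ν μ u₀ F Δx Δt α t (y + z)
        - approxFun β ν μ u₀ F Δx Δt α t y| := ((it.comp_add_right z).sub it).abs
    have hI2 : Integrable fun y => |approxFun β ν μ u₀ F Δx Δt α t y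
        - approxFun β ν μ u₀ F Δx Δt α s y| := (it.sub is).abs
    calc _ ≤ ∫ y, (|approxFun β ν μ u₀ F Δx Δt α t (y + z)
        - approxFun β ν μ u₀ F Δx Δt α t y| + |approxFun β ν μ u₀ F Δx Δt α t y
        - approxFun β ν μ u₀ F Δx Δt α s y|) :=
          integral_mono ((it.comp_add_right z).sub is).abs (hI1.add hI2)
            fun y => abs_sub_le _ _ _
      _ = _ := integral_add hI1 hI2
      _ ≤ _ := by
        have p1 : 0 ≤ timeRate C m V K D T * |z| := by positivity
        have p2 : 0 ≤ 2 * variationSup C m V K T * |t - s| := by positivity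
        linarith

end MonotoneRun

end NonlocalFV

namespace NonlocalFV

/-! ### Consistency of the scheme with the entropy inequality -/

lemma TestBound.abs_slope_sub_le {T M R y : ℝ} {φ : ℝ → ℝ → ℝ} (hφ : IsTestFunction T φ)
    (hb : TestBound φ M R y) {Δx : ℝ} (hΔx : 0 < Δx) (t s x : ℝ) :
    |(φ s (x + Δx) - φ s x) / Δx - deriv (φ t) x| ≤ M * (|t - s| + Δx) := by
  obtain ⟨c, hc, hce⟩ := exists_deriv_eq_slope (φ s) (by linarith : x < x + Δx)
    (hφ.continuous_slice s).continuousOn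
    (fun z _ => (hφ.hasDerivAt_space s z).differentiableAt.differentiableWithinAt)
  rw [add_sub_cancel_left] at hce
  rw [← hce, abs_sub_comm]
  refine (hb.deriv_lip _ _ _ _).trans (mul_le_mul_of_nonneg_left ?_ hb.nonneg)
  have : |x - c| ≤ Δx := by
    rw [abs_le]; constructor <;> linarith [hc.1, hc.2]
  linarith

lemma TestBound.abs_slope_le {T M R y : ℝ} {φ : ℝ → ℝ → ℝ} (hφ : IsTestFunction T φ)
    (hb : TestBound φ M R y) {Δx : ℝ} (hΔx : 0 < Δx) (s x : ℝ) :
    |(φ s (x + Δx) - φ s x) / Δx| ≤ M := by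
  obtain ⟨c, hc, hce⟩ := exists_deriv_eq_slope (φ s) (by linarith : x < x + Δx)
    (hφ.continuous_slice s).continuousOn
    (fun z _ => (hφ.hasDerivAt_space s z).differentiableAt.differentiableWithinAt)
  rw [add_sub_cancel_left] at hce
  rw [← hce]
  exact hb.deriv_bound _ _

/-- With two equal states the numerical entropy flux is the coefficient times the Kruzhkov flux.
Changing the second state moves the maximum and the minimum with `k` by `|w - v|` in total. -/
lemma IsNonlocalFlux.entropyFlux_sub_le {f : ℝ → ℝ} {K D C a : ℝ} {F : ℝ → ℝ → ℝ → ℝ}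
    (hF : IsNonlocalFlux f K D F) (ha : |a| ≤ C) (v w k : ℝ) :
    |entropyFlux F a v w k - a * kruzhkov f v k| ≤ (C * K + D) * |w - v| := by
  have e : entropyFlux F a v w k - a * kruzhkov f v k
      = (F a (max v k) (max w k) - F a (max v k) (max v k))
        - (F a (min v k) (min w k) - F a (min v k) (min v k)) := by
    rw [entropyFlux, kruzhkov_eq, hF.apply_self, hF.apply_self]; ring
  rw [e, ← abs_max_sub_max_add_abs_min_sub_min w v k, mul_add]
  refine (abs_sub _ _).trans (add_le_add ?_ ?_)
  · simpa using hF.lip ha (max v k) (max w k) (max v k) (max v k)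
  · simpa using hF.lip ha (min v k) (min w k) (min v k) (min v k)

lemma abs_integral_sub_le_of_support {g h r : ℝ → ℝ} {R y : ℝ} (hg : Integrable g)
    (hh : Integrable h) (hr : IntegrableOn r (Set.Icc (y - R) (y + R)))
    (hle : ∀ x, |g x - h x| ≤ r x) (h0 : ∀ x, R < |x - y| → g x = h x) :
    |(∫ x, g x) - ∫ x, h x| ≤ ∫ x in Set.Icc (y - R) (y + R), r x := by
  rw [← integral_sub hg hh]
  have e : ∫ x, (g x - h x) = ∫ x in Set.Icc (y - R) (y + R), (g x - h x) := by
    refine (setIntegral_eq_integral_of_forall_compl_eq_zero fun x hx => ?_).symm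
    refine sub_eq_zero.2 (h0 x ?_)
    by_contra hlt
    have := abs_le.1 (not_lt.1 hlt)
    exact hx ⟨by linarith, by linarith⟩
  rw [e]
  exact abs_integral_le_integral_abs.trans
    (setIntegral_mono_on (hg.sub hh).abs.integrableOn hr measurableSet_Icc fun x _ => hle x)

/-- The local averages of a function have the same total mass, up to the width of the window. -/
lemma integral_window {r : ℝ → ℝ} (hr : Integrable r) {R : ℝ} (hR : 0 ≤ R) :
    Integrable (fun y => ∫ x in Set.Icc (y - R) (y + R), r x) ∧
      ∫ y, ∫ x in Set.Icc (y - R) (y + R), r x = 2 * R * ∫ x, r x := by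
  have hI : Integrable (fun z : ℝ => (Set.Icc (-R) R).indicator (fun _ => (1 : ℝ)) z) :=
    (integrable_indicator_iff measurableSet_Icc).2 (by simp)
  have e : ∀ y, ∫ x in Set.Icc (y - R) (y + R), r x
      = ∫ x, r x * (Set.Icc (-R) R).indicator (fun _ => (1 : ℝ)) (y - x) := fun y => by
    rw [← integral_indicator measurableSet_Icc]
    congr 1
    funext x
    by_cases hx : x ∈ Set.Icc (y - R) (y + R)
    · have hx' : y - x ∈ Set.Icc (-R) R := ⟨by linarith [hx.2], by linarith [hx.1]⟩
      rw [Set.indicator_of_mem hx, Set.indicator_of_mem hx', mul_one]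
    · rw [Set.indicator_of_notMem hx, Set.indicator_of_notMem, mul_zero]
      exact fun h => hx ⟨by linarith [h.2], by linarith [h.1]⟩
  have hconv := hr.convolution_integrand (ContinuousLinearMap.mul ℝ ℝ) hI
  simp only [ContinuousLinearMap.mul_apply'] at hconv
  simp only [e]
  refine ⟨hconv.integral_prod_left, ?_⟩
  rw [integral_integral_swap hconv]
  have : ∀ x, ∫ y, r x * (Set.Icc (-R) R).indicator (fun _ => (1 : ℝ)) (y - x) = r x * (2 * R) := by
    intro x
    rw [integral_const_mul, integral_sub_right_eq_self
      (fun z => (Set.Icc (-R) R).indicator (fun _ => (1 : ℝ)) z) x,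
      integral_indicator measurableSet_Icc]
    simp [Real.volume_real_Icc_of_le (by linarith : -R ≤ R)]
    left; ring
  simp only [this]
  rw [integral_mul_const, mul_comm]

/-! ### Local consistency errors of the flux and of the source. -/

namespace MonotoneRun

variable {f β ν μ u₀ : ℝ → ℝ} {C m V K D T : ℝ} {F : ℝ → ℝ → ℝ → ℝ} {Δx Δt : ℝ} {N : ℕ}
  {α : ℕ → ℤ → ℝ} {φ : ℝ → ℝ → ℝ} {M R y k : ℝ}

local notation "U" => approx β ν μ u₀ F Δx Δt α
local notation "A" => coeff β ν μ u₀ F Δx Δt α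

/-- The constant in the consistency error of the flux. -/
noncomputable def fluxErrorConst (C m V K D T M : ℝ) : ℝ :=
  M * ((C * K + D) + consistencyConst C m (variationSup C m V K T) * C + C ^ 2)

/-- The constant in the consistency error of the source. -/
noncomputable def sourceErrorConst (C m V K D T M : ℝ) : ℝ :=
  C * (M * (consistencyConst C m (variationSup C m V K T) + coeffLip C m * timeRate C m V K D T)
    + 2 * C ^ 3 * m * M)

variable (hr : MonotoneRun f β ν μ u₀ K D T F Δx Δt N α) (hd : DataBound f β ν μ C)
  (hi : InitialBound u₀ m V)

include hr hd hi

lemma variationSup_nonneg : 0 ≤ variationSup C m V K T :=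
  (tsum_nonneg fun _ => abs_nonneg _).trans (hr.variation_le hd hi (Nat.zero_le N))

lemma consistency {n : ℕ} (hn : n ≤ N) (x : ℝ) :
    |A n (cellIndex Δx x) - nonlocalCoeff β ν μ (stepFun Δx (U n)) x|
        ≤ consistencyConst C m (variationSup C m V K T) * Δx ∧
      |(A n (cellIndex Δx x) - A n (cellIndex Δx x - 1)) / Δx
        - deriv (nonlocalCoeff β ν μ (stepFun Δx (U n))) x|
        ≤ consistencyConst C m (variationSup C m V K T) * Δx :=
  hd.consistency (hr.weights n) hr.dx_pos (hr.summable hd hi hn) (hr.mass_le hd hi hn)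
    (hr.variation_le hd hi hn) x

/-- Three replacements are made: numerical by Kruzhkov flux, interface by nonlocal coefficient,
slope by derivative. Each error is a local jump or the mesh size times `|u| + |k|`, hence integrable
in space apart from the part with `|k|`. -/
lemma flux_error (hφ : IsTestFunction T φ) (hb : TestBound φ M R y) {n : ℕ} (hn : n ≤ N)
    {t s : ℝ} (hts : |t - s| ≤ Δt) (x k : ℝ) :
    |stepFun Δx (fun i => entropyFlux F (A n i) (U n i) (U n (i + 1)) k) x
          * ((φ s (x + Δx) - φ s x) / Δx)
        - Real.sign (stepFun Δx (U n) x - k) * nonlocalCoeff β ν μ (stepFun Δx (U n)) x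
          * (f (stepFun Δx (U n) x) - f k) * deriv (φ t) x|
      ≤ fluxErrorConst C m V K D T M * (stepFun Δx (fun i => |U n (i + 1) - U n i|) x
        + (Δx + Δt) * (|stepFun Δx (U n) x| + |k|)) := by
  have hC := hd.nonneg
  have hM := hb.nonneg
  have hx0 := hr.dx_pos
  have ht0 := hr.dt_pos
  have hK := hr.K_nonneg
  have hD := hr.D_nonneg
  have hκ := hd.consistencyConst_nonneg hi.mass_nonneg (hr.variationSup_nonneg hd hi)
  have c1 := (hr.consistency hd hi hn x).1
  have s1 := hb.abs_slope_sub_le hφ hr.dx_pos t s x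
  have s2 := hb.abs_slope_le hφ hr.dx_pos s x
  simp only [stepFun] at c1 ⊢
  set i := cellIndex Δx x
  set κ := consistencyConst C m (variationSup C m V K T)
  set W := nonlocalCoeff β ν μ (stepFun Δx (U n)) x
  set σ := (φ s (x + Δx) - φ s x) / Δx
  set w := U n i
  set w' := U n (i + 1)
  have q1 := hd.abs_kruzhkov_le w k
  have q2 : |w - k| ≤ |w| + |k| := abs_sub _ _
  have e1 : |entropyFlux F (A n i) w w' k - A n i * kruzhkov f w k| ≤ (C * K + D) * |w' - w| :=
    hr.flux.entropyFlux_sub_le (hd.nu.bound _) w w' k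
  have eW : Real.sign (w - k) * W * (f w - f k) = W * kruzhkov f w k := by rw [kruzhkov]; ring
  rw [eW]
  have e : entropyFlux F (A n i) w w' k * σ - W * kruzhkov f w k * deriv (φ t) x
      = (entropyFlux F (A n i) w w' k - A n i * kruzhkov f w k) * σ
        + ((A n i - W) * kruzhkov f w k) * σ + W * kruzhkov f w k * (σ - deriv (φ t) x) := by ring
  rw [e]
  have b1 : |(entropyFlux F (A n i) w w' k - A n i * kruzhkov f w k) * σ|
      ≤ (C * K + D) * |w' - w| * M := by
    rw [abs_mul]; gcongr
  have b2 : |((A n i - W) * kruzhkov f w k) * σ| ≤ κ * Δx * (C * (|w| + |k|)) * M := by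
    rw [abs_mul, abs_mul]
    have : |kruzhkov f w k| ≤ C * (|w| + |k|) := q1.trans (by gcongr)
    gcongr
  have b3 : |W * kruzhkov f w k * (σ - deriv (φ t) x)|
      ≤ C * (C * (|w| + |k|)) * (M * (Δt + Δx)) := by
    rw [abs_mul, abs_mul]
    have g1 : |kruzhkov f w k| ≤ C * (|w| + |k|) := q1.trans (by gcongr)
    have g2 : |W| ≤ C := hd.abs_coeff_le _ _
    have g3 : |σ - deriv (φ t) x| ≤ M * (Δt + Δx) := s1.trans (by gcongr)
    gcongr
  refine (abs_add_three _ _ _).trans ((add_le_add_three b1 b2 b3).trans ?_)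
  unfold fluxErrorConst
  have p1 : 0 ≤ M * ((C * K + D) * ((Δx + Δt) * (|w| + |k|))) := by positivity
  have p2 : 0 ≤ M * (κ * C * |w' - w|) := by positivity
  have p3 : 0 ≤ M * (C ^ 2 * |w' - w|) := by positivity
  have p4 : 0 ≤ M * (κ * C * (Δt * (|w| + |k|))) := by positivity
  linarith

/-- The discrete source carries the sign of the new value minus `k`, so it is compared with the
exact source on the following slab, where the approximation equals the new value. Its coefficients
are still those of the old level; the continuity in time accounts for the difference. -/
lemma source_error (hb : TestBound φ M R y) {n : ℕ} (hn : n + 1 ≤ N) {t s : ℝ}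
    (hts : |t - s| ≤ Δt) (x k : ℝ) :
    |f k * Real.sign (stepFun Δx (U (n + 1)) x - k)
          * deriv (nonlocalCoeff β ν μ (stepFun Δx (U (n + 1)))) x * φ t x
        - stepFun Δx (fun i => Real.sign (U (n + 1) i - k) * f k
          * ((A n i - A n (i - 1)) / Δx)) x * φ s x|
      ≤ sourceErrorConst C m V K D T M * ((Δx + Δt) * |k|) := by
  have hC := hd.nonneg
  have hM := hb.nonneg
  have hm := hi.mass_nonneg
  have hx0 := hr.dx_pos
  have ht0 := hr.dt_pos
  have hL := hr.timeRate_nonneg hd hi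
  have hκ := hd.consistencyConst_nonneg hi.mass_nonneg (hr.variationSup_nonneg hd hi)
  have hcl := hd.coeffLip_nonneg hm
  have c1 := (hr.consistency hd hi (by omega : n ≤ N) x).2
  have c2 := hd.abs_deriv_coeff_sub_le (hr.integrable_stepFun hd hi hn)
    (hr.integrable_stepFun hd hi (by omega : n ≤ N)) (hr.integral_abs_stepFun_le hd hi hn) x x
  have c3 := hr.integral_abs_stepFun_sub_le hd hi hn (by omega : n ≤ N)
  have c4 := (hr.coeffBound hd hi (by omega : n ≤ N)).diff (cellIndex Δx x)
  have c5 : |((n + 1 : ℕ) : ℝ) - n| = 1 := by push_cast; simp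
  rw [c5, mul_one] at c3
  rw [sub_self, abs_zero, zero_add] at c2
  set I := ∫ y, |stepFun Δx (U (n + 1)) y - stepFun Δx (U n) y|
  set P := deriv (nonlocalCoeff β ν μ (stepFun Δx (U (n + 1)))) x
  set P' := deriv (nonlocalCoeff β ν μ (stepFun Δx (U n))) x
  simp only [stepFun] at c1 ⊢
  set i := cellIndex Δx x
  set κ := consistencyConst C m (variationSup C m V K T)
  set d := (A n i - A n (i - 1)) / Δx
  set σ := Real.sign (U (n + 1) i - k)
  have hd1 : |d| ≤ 2 * C ^ 3 * m := by
    rw [abs_div, abs_of_pos hx0, div_le_iff₀ hx0]; exact c4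
  have hPd : |P - d| ≤ coeffLip C m * (timeRate C m V K D T * Δt) + κ * Δx := by
    refine (abs_sub_le P P' d).trans (add_le_add (c2.trans (by gcongr)) ?_)
    rw [abs_sub_comm]; exact c1
  have e : f k * σ * P * φ t x - σ * f k * d * φ s x
      = σ * f k * ((P - d) * φ t x + d * (φ t x - φ s x)) := by ring
  rw [e, abs_mul, abs_mul]
  have g1 : |σ| * |f k| ≤ 1 * (C * |k|) :=
    mul_le_mul (abs_sign_le _) (hd.abs_f_le k) (abs_nonneg _) zero_le_one
  have g2 : |(P - d) * φ t x + d * (φ t x - φ s x)|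
      ≤ (coeffLip C m * (timeRate C m V K D T * Δt) + κ * Δx) * M
        + 2 * C ^ 3 * m * (M * Δt) := by
    refine (abs_add_le _ _).trans ?_
    rw [abs_mul, abs_mul]
    have := hb.bound t x
    have : |φ t x - φ s x| ≤ M * Δt := (hb.lip_time t s x).trans (by gcongr)
    gcongr
  refine (mul_le_mul g1 g2 (abs_nonneg _) (by positivity)).trans ?_
  unfold sourceErrorConst
  have p1 : 0 ≤ C * |k| * (coeffLip C m * timeRate C m V K D T * M * Δx) := by positivity
  have p2 : 0 ≤ C * |k| * (κ * Δt * M) := by positivity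
  have p3 : 0 ≤ C * |k| * (2 * C ^ 3 * m * M * Δx) := by positivity
  linarith

/-- Summation by parts in time. -/
lemma sum_time_ge (hφ : IsTestFunction T φ) {P : ℕ → ℝ}
    (hstep : ∀ n < N, ∫ x, (|stepFun Δx (U (n + 1)) x - k| - |stepFun Δx (U n) x - k|)
      * φ ((n + 1 : ℕ) * Δt) x ≤ P n) :
    -(∫ x, |stepFun Δx (U 0) x - k| * φ 0 x) - ∑ n ∈ Finset.range N, P n
      ≤ ∑ n ∈ Finset.range N, ∫ x, |stepFun Δx (U n) x - k|
        * (φ ((n + 1 : ℕ) * Δt) x - φ (n * Δt) x) := by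
  have hint : ∀ n ≤ N, ∀ t, Integrable fun x => |stepFun Δx (U n) x - k| * φ t x :=
    fun n hn t => (hφ.integrable_slice t).bdd_mul (c := variationSup C m V K T + |k|)
      ((measurable_stepFun Δx _).sub_const k).abs.aestronglyMeasurable
      (ae_of_all _ fun x => by
        rw [Real.norm_eq_abs, abs_abs]
        exact (abs_sub _ _).trans (by have := hr.abs_le hd hi hn (cellIndex Δx x); gcongr; exact this))
  set a : ℕ → ℝ := fun n => ∫ x, |stepFun Δx (U n) x - k| * φ (n * Δt) x with ha
  have h1 : ∀ n ∈ Finset.range N, a (n + 1) - a n - P n ≤ ∫ x, |stepFun Δx (U n) x - k|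
      * (φ ((n + 1 : ℕ) * Δt) x - φ (n * Δt) x) := fun n hn => by
    have hn' := Finset.mem_range.1 hn
    have h2 := hstep n hn'
    simp only [sub_mul] at h2
    rw [integral_sub (hint _ hn' _) (hint _ hn'.le _)] at h2
    simp only [mul_sub]
    rw [integral_sub (hint _ hn'.le _) (hint _ hn'.le _)]
    simp only [ha]
    linarith
  refine le_trans (le_of_eq ?_) (Finset.sum_le_sum h1)
  rw [Finset.sum_sub_distrib, Finset.sum_range_sub]
  have haN : a N = 0 := by
    simp only [ha]
    rw [integral_eq_zero_of_ae (ae_of_all _ fun x => ?_)]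
    rw [hr.final_time, hφ.eq_zero le_rfl]
    simp
  have ha0 : a 0 = ∫ x, |stepFun Δx (U 0) x - k| * φ 0 x := by simp [ha]
  rw [haN, ha0]
  ring

end MonotoneRun

end NonlocalFV

namespace NonlocalFV

/-! ### The approximations satisfy the entropy inequality up to a small error -/

lemma IsTestFunction.integrable_deriv_slice {T : ℝ} {φ : ℝ → ℝ → ℝ} (h : IsTestFunction T φ)
    (t : ℝ) : Integrable (deriv (φ t)) :=
  (h.continuous_deriv_space.comp (continuous_const.prodMk continuous_id)
    : Continuous (deriv (φ t))).integrable_of_hasCompactSupport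
    (h.hasCompactSupport_slice t).deriv

/-- On a slab the approximation does not depend on time, so the time derivative is integrated
exactly and this term has no consistency error. -/
lemma integral_slab_time {T : ℝ} {φ : ℝ → ℝ → ℝ} (hφ : IsTestFunction T φ) {w : ℝ → ℝ} {B : ℝ}
    (hw : Measurable w) (hB : ∀ x, |w x| ≤ B) {a b : ℝ} (hab : a ≤ b) :
    ∫ t in Set.Ioo a b, ∫ x, w x * deriv (fun s => φ s x) t
      = ∫ x, w x * (φ b x - φ a x) := by
  have hi : Integrable (fun p : ℝ × ℝ => w p.2 * deriv (fun s => φ s p.2) p.1)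
      ((volume.restrict (Set.Ioo a b)).prod volume) := by
    refine Integrable.bdd_mul (c := B) ?_ (hw.comp measurable_snd).aestronglyMeasurable
      (ae_of_all _ fun p => hB p.2)
    have := hφ.continuous_deriv_time.integrable_of_hasCompactSupport (μ := volume)
      hφ.hasCompactSupport_deriv_time
    have h2 := this.restrict (s := Set.Ioo a b ×ˢ (Set.univ : Set ℝ))
    rwa [Measure.volume_eq_prod, ← Measure.restrict_prod_eq_prod_univ] at h2
  rw [integral_integral_swap hi]
  refine integral_congr_ae (ae_of_all _ fun x => ?_)
  dsimp only
  rw [integral_const_mul, ← integral_Ioc_eq_integral_Ioo,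
    ← intervalIntegral.integral_of_le hab]
  congr 1
  refine intervalIntegral.integral_deriv_eq_sub
    (fun t _ => (hφ.hasDerivAt_time t x).differentiableAt) ?_
  exact (hφ.continuous_deriv_time.comp (continuous_id.prodMk continuous_const)
    : Continuous fun t => deriv (fun s => φ s x) t).intervalIntegrable _ _

namespace MonotoneRun

variable {f β ν μ u₀ : ℝ → ℝ} {C m V K D T : ℝ} {F : ℝ → ℝ → ℝ → ℝ} {Δx Δt : ℝ} {N : ℕ}
  {α : ℕ → ℤ → ℝ} {φ : ℝ → ℝ → ℝ} {M R y k : ℝ}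

local notation "U" => approx β ν μ u₀ F Δx Δt α
local notation "A" => coeff β ν μ u₀ F Δx Δt α

/-- The local size of the consistency error. -/
noncomputable def errorDensity (β ν μ u₀ : ℝ → ℝ) (F : ℝ → ℝ → ℝ → ℝ) (Δx Δt : ℝ)
    (α : ℕ → ℤ → ℝ) (n : ℕ) (x : ℝ) : ℝ :=
  stepFun Δx (fun i => |approx β ν μ u₀ F Δx Δt α n (i + 1) - approx β ν μ u₀ F Δx Δt α n i|) x
    + (Δx + Δt) * |stepFun Δx (approx β ν μ u₀ F Δx Δt α n) x|

local notation "Er" => errorDensity β ν μ u₀ F Δx Δt α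

/-- The constant in the entropy inequality of the approximations. -/
noncomputable def entropyErrorConst (C m V K D T M R : ℝ) : ℝ :=
  (2 * (R + 1) + 1) * (fluxErrorConst C m V K D T M * T * (variationSup C m V K T + m) + M * V)
    + 2 * (R + 1) * (fluxErrorConst C m V K D T M * T + sourceErrorConst C m V K D T M * T
      + C ^ 4 * m * M)

variable (hr : MonotoneRun f β ν μ u₀ K D T F Δx Δt N α) (hd : DataBound f β ν μ C)
  (hi : InitialBound u₀ m V)

include hr

lemma time_nonneg : 0 ≤ T := by
  have := hr.dt_pos
  rw [← hr.final_time]; positivity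

lemma errorDensity_nonneg (n : ℕ) (x : ℝ) : 0 ≤ Er n x :=
  add_nonneg (abs_nonneg _)
    (mul_nonneg (add_nonneg hr.dx_pos.le hr.dt_pos.le) (abs_nonneg _))

include hd hi

lemma fluxErrorConst_nonneg (hM : 0 ≤ M) : 0 ≤ fluxErrorConst C m V K D T M := by
  have hC := hd.nonneg
  have hK := hr.K_nonneg
  have hD := hr.D_nonneg
  have hκ := hd.consistencyConst_nonneg hi.mass_nonneg (hr.variationSup_nonneg hd hi)
  unfold fluxErrorConst
  positivity

lemma sourceErrorConst_nonneg (hM : 0 ≤ M) : 0 ≤ sourceErrorConst C m V K D T M := by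
  have hC := hd.nonneg
  have hm := hi.mass_nonneg
  have hL := hr.timeRate_nonneg hd hi
  have hcl := hd.coeffLip_nonneg hm
  have hκ := hd.consistencyConst_nonneg hi.mass_nonneg (hr.variationSup_nonneg hd hi)
  unfold sourceErrorConst
  positivity

lemma integrable_stepFun_diff {n : ℕ} (hn : n ≤ N) :
    Integrable (stepFun Δx (fun i => |U n (i + 1) - U n i|)) :=
  NonlocalFV.integrable_stepFun hr.dx_pos (by
    simpa only [abs_abs] using summable_abs_diff (hr.summable hd hi hn))

lemma integrable_errorDensity {n : ℕ} (hn : n ≤ N) : Integrable (Er n) :=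
  (hr.integrable_stepFun_diff hd hi hn).add
    ((hr.integrable_stepFun hd hi hn).abs.const_mul _)

lemma integral_errorDensity_le {n : ℕ} (hn : n ≤ N) :
    ∫ x, Er n x ≤ (variationSup C m V K T + m) * (Δx + Δt) := by
  have h1 := hr.integrable_stepFun_diff hd hi hn
  have h2 : Integrable fun x => (Δx + Δt) * |stepFun Δx (U n) x| :=
    (hr.integrable_stepFun hd hi hn).abs.const_mul _
  have e : ∫ x, Er n x = (∫ x, stepFun Δx (fun i => |U n (i + 1) - U n i|) x)
      + ∫ x, (Δx + Δt) * |stepFun Δx (U n) x| := integral_add h1 h2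
  have e1 : ∫ x, stepFun Δx (fun i => |U n (i + 1) - U n i|) x
      = Δx * ∑' i, |U n (i + 1) - U n i| :=
    integral_stepFun hr.dx_pos (by
      simpa only [abs_abs] using summable_abs_diff (hr.summable hd hi hn))
  have h3 := hr.integral_abs_stepFun_le hd hi hn
  have h4 := hr.variation_le hd hi hn
  have hx := hr.dx_pos
  have ht := hr.dt_pos
  rw [e, e1, integral_const_mul]
  have h5 : Δx * ∑' i, |U n (i + 1) - U n i| ≤ (Δx + Δt) * variationSup C m V K T :=
    mul_le_mul (by linarith) h4 (tsum_nonneg fun _ => abs_nonneg _) (by positivity)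
  have h6 : (Δx + Δt) * (∫ x, |stepFun Δx (U n) x|) ≤ (Δx + Δt) * m := by gcongr
  linarith

lemma integrable_flux_slice (hφ : IsTestFunction T φ) {n : ℕ} (hn : n ≤ N) (t k : ℝ) :
    Integrable fun x => Real.sign (stepFun Δx (U n) x - k)
      * nonlocalCoeff β ν μ (stepFun Δx (U n)) x * (f (stepFun Δx (U n) x) - f k)
      * deriv (φ t) x := by
  have hC := hd.nonneg
  have hw := measurable_stepFun Δx (U n)
  have hc : Continuous (nonlocalCoeff β ν μ (stepFun Δx (U n))) :=
    continuous_iff_continuousAt.2 fun x =>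
      (hd.hasDerivAt_coeff (hr.integrable_stepFun hd hi hn) x).continuousAt
  refine (hφ.integrable_deriv_slice t).bdd_mul
    (c := 1 * C * (C * (variationSup C m V K T + |k|))) ?_ (ae_of_all _ fun x => ?_)
  · exact (((measurable_sign.comp (hw.sub_const k)).mul hc.measurable).mul
      ((hd.continuous_f.measurable.comp hw).sub_const _)).aestronglyMeasurable
  · rw [norm_mul, norm_mul]
    have h1 : ‖f (stepFun Δx (U n) x) - f k‖ ≤ C * (variationSup C m V K T + |k|) :=
      (hd.f_lip _ _).trans (mul_le_mul_of_nonneg_left ((abs_sub _ _).trans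
        (by have := hr.abs_le hd hi hn (cellIndex Δx x); gcongr; exact this)) hC)
    have h2 : ‖nonlocalCoeff β ν μ (stepFun Δx (U n)) x‖ ≤ C := hd.abs_coeff_le _ _
    have h3 : ‖Real.sign (stepFun Δx (U n) x - k)‖ ≤ 1 := abs_sign_le _
    gcongr

lemma integrable_source_slice (hφ : IsTestFunction T φ) {n : ℕ} (hn : n ≤ N) (t k : ℝ) :
    Integrable fun x => f k * Real.sign (stepFun Δx (U n) x - k)
      * deriv (nonlocalCoeff β ν μ (stepFun Δx (U n))) x * φ t x := by
  have hC := hd.nonneg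
  have hw := measurable_stepFun Δx (U n)
  refine (hφ.integrable_slice t).bdd_mul (c := |f k| * 1 * (C ^ 3 * m)) ?_
    (ae_of_all _ fun x => ?_)
  · exact (((measurable_sign.comp (hw.sub_const k)).const_mul _).mul
      (measurable_deriv _)).aestronglyMeasurable
  · rw [norm_mul, norm_mul]
    have h2 : ‖deriv (nonlocalCoeff β ν μ (stepFun Δx (U n))) x‖ ≤ C ^ 3 * m :=
      hd.abs_deriv_coeff_le (hr.integrable_stepFun hd hi hn)
        (hr.integral_abs_stepFun_le hd hi hn) x
    have h3 : ‖Real.sign (stepFun Δx (U n) x - k)‖ ≤ 1 := abs_sign_le _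
    rw [Real.norm_eq_abs (f k)]
    gcongr

/-- The window has half-width `R + 1` because the difference quotient also sees the test function at
`x + Δx`, with `Δx ≤ 1`. -/
lemma flux_slab (hφ : IsTestFunction T φ) (hb : TestBound φ M R y) (hR : 0 ≤ R) (hx1 : Δx ≤ 1)
    (k : ℝ) {n : ℕ} (hn : n ≤ N) {t s : ℝ} (hts : |t - s| ≤ Δt)
    (hG : Integrable fun x => stepFun Δx (fun i => entropyFlux F (A n i) (U n i) (U n (i + 1)) k) x
      * ((φ s (x + Δx) - φ s x) / Δx)) :
    |(∫ x, Real.sign (stepFun Δx (U n) x - k) * nonlocalCoeff β ν μ (stepFun Δx (U n)) x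
          * (f (stepFun Δx (U n) x) - f k) * deriv (φ t) x)
        - ∫ x, stepFun Δx (fun i => entropyFlux F (A n i) (U n i) (U n (i + 1)) k) x
          * ((φ s (x + Δx) - φ s x) / Δx)|
      ≤ fluxErrorConst C m V K D T M * (∫ x in Set.Icc (y - (R + 1)) (y + (R + 1)), Er n x)
        + 2 * (R + 1) * fluxErrorConst C m V K D T M * ((Δx + Δt) * |k|) := by
  have hx0 := hr.dx_pos
  have hint := (hr.integrable_errorDensity hd hi hn)
  have h := abs_integral_sub_le_of_support (y := y) (R := R + 1)
    (r := fun x => fluxErrorConst C m V K D T M * Er n x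
      + fluxErrorConst C m V K D T M * ((Δx + Δt) * |k|))
    hG (hr.integrable_flux_slice hd hi hφ hn t k)
    ((hint.const_mul _).integrableOn.add continuous_const.integrableOn_Icc)
    (fun x => (hr.flux_error hd hi hφ hb hn hts x k).trans (le_of_eq (by
      rw [errorDensity]; ring)))
    (fun x hx => by
      rw [hb.deriv_eq_zero (by linarith), hb.eq_zero (by linarith : R < |x - y|),
        hb.eq_zero (t := s) (x := x + Δx) ?_]
      · simp
      · have := abs_sub_abs_le_abs_sub (x - y) (x + Δx - y)
        have e : x - y - (x + Δx - y) = -Δx := by ring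
        rw [e, abs_neg, abs_of_pos hx0] at this
        linarith)
  rw [abs_sub_comm]
  refine h.trans (le_of_eq ?_)
  rw [integral_add (hint.const_mul _).integrableOn continuous_const.integrableOn_Icc, integral_const_mul, setIntegral_const,
    Real.volume_real_Icc_of_le (by linarith), smul_eq_mul]
  ring

lemma source_slab (hφ : IsTestFunction T φ) (hb : TestBound φ M R y) (hR : 0 ≤ R)
    (k : ℝ) {n : ℕ} (hn : n + 1 ≤ N) {t s : ℝ} (hts : |t - s| ≤ Δt)
    (hq : Integrable fun x => stepFun Δx (fun i => Real.sign (U (n + 1) i - k) * f k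
          * ((A n i - A n (i - 1)) / Δx)) x * φ s x) :
    |(∫ x, f k * Real.sign (stepFun Δx (U (n + 1)) x - k)
          * deriv (nonlocalCoeff β ν μ (stepFun Δx (U (n + 1)))) x * φ t x)
        - ∫ x, stepFun Δx (fun i => Real.sign (U (n + 1) i - k) * f k
          * ((A n i - A n (i - 1)) / Δx)) x * φ s x|
      ≤ 2 * (R + 1) * sourceErrorConst C m V K D T M * ((Δx + Δt) * |k|) := by
  have h := abs_integral_sub_le_of_support (y := y) (R := R + 1)
    (r := fun x => sourceErrorConst C m V K D T M * ((Δx + Δt) * |k|))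
    (hr.integrable_source_slice hd hi hφ hn t k) hq continuous_const.integrableOn_Icc
    (fun x => (hr.source_error hd hi hb hn hts x k))
    (fun x hx => by
      rw [hb.eq_zero (by linarith : R < |x - y|), hb.eq_zero (by linarith : R < |x - y|)]
      simp)
  refine h.trans (le_of_eq ?_)
  rw [setIntegral_const, Real.volume_real_Icc_of_le (by linarith), smul_eq_mul]
  ring

lemma source_first_slab (hφ : IsTestFunction T φ) (hb : TestBound φ M R y) (hR : 0 ≤ R)
    (k t : ℝ) {n : ℕ} (hn : n ≤ N) :
    |∫ x, f k * Real.sign (stepFun Δx (U n) x - k)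
          * deriv (nonlocalCoeff β ν μ (stepFun Δx (U n))) x * φ t x|
      ≤ 2 * (R + 1) * (C ^ 4 * m * M) * |k| := by
  have hC := hd.nonneg
  have hm := hi.mass_nonneg
  have hM := hb.nonneg
  have h := abs_integral_sub_le_of_support (y := y) (R := R + 1)
    (r := fun x => C ^ 4 * m * M * |k|) (h := fun _ => 0)
    (hr.integrable_source_slice hd hi hφ hn t k) (integrable_zero _ _ _)
    continuous_const.integrableOn_Icc
    (fun x => ?_) (fun x hx => by rw [hb.eq_zero (by linarith : R < |x - y|)]; simp)
  · rw [integral_zero, sub_zero] at h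
    refine h.trans (le_of_eq ?_)
    rw [setIntegral_const, Real.volume_real_Icc_of_le (by linarith), smul_eq_mul]
    ring
  · rw [sub_zero, abs_mul, abs_mul, abs_mul]
    have h1 := hd.abs_f_le k
    have h2 : |deriv (nonlocalCoeff β ν μ (stepFun Δx (U n))) x| ≤ C ^ 3 * m :=
      hd.abs_deriv_coeff_le (hr.integrable_stepFun hd hi hn)
        (hr.integral_abs_stepFun_le hd hi hn) x
    have h3 : |Real.sign (stepFun Δx (U n) x - k)| ≤ 1 := abs_sign_le _
    have h4 := hb.bound t x
    calc _ ≤ (C * |k|) * 1 * (C ^ 3 * m) * M := by gcongr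
      _ = _ := by ring

/-- One step of the scheme, tested with a function of space. -/
lemma step_tested (hφ : IsTestFunction T φ) (k : ℝ) {n : ℕ} (hn : n < N) :
    (∫ x, (|stepFun Δx (U (n + 1)) x - k| - |stepFun Δx (U n) x - k|)
        * φ ((n + 1 : ℕ) * Δt) x
      ≤ Δt * (∫ x, stepFun Δx (fun i => entropyFlux F (A n i) (U n i) (U n (i + 1)) k) x
          * ((φ ((n + 1 : ℕ) * Δt) (x + Δx) - φ ((n + 1 : ℕ) * Δt) x) / Δx))
        - Δt * ∫ x, stepFun Δx (fun i => Real.sign (U (n + 1) i - k) * f k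
          * ((A n i - A n (i - 1)) / Δx)) x * φ ((n + 1 : ℕ) * Δt) x) ∧
    Integrable (fun x => stepFun Δx (fun i => entropyFlux F (A n i) (U n i) (U n (i + 1)) k) x
          * ((φ ((n + 1 : ℕ) * Δt) (x + Δx) - φ ((n + 1 : ℕ) * Δt) x) / Δx)) ∧
    Integrable (fun x => stepFun Δx (fun i => Real.sign (U (n + 1) i - k) * f k
          * ((A n i - A n (i - 1)) / Δx)) x * φ ((n + 1 : ℕ) * Δt) x) := by
  have hC := hd.nonneg
  have hm := hi.mass_nonneg
  have hK := hr.K_nonneg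
  have hD := hr.D_nonneg
  have hx0 := hr.dx_pos
  have ht0 := hr.dt_pos
  have hS := hr.variationSup_nonneg hd hi
  set S := variationSup C m V K T
  have hp : ∀ i, |(|U (n + 1) i - k| - |U n i - k|)| ≤ 2 * S := fun i => by
    refine (abs_abs_sub_abs_le_abs_sub _ _).trans ?_
    rw [sub_sub_sub_cancel_right]
    refine (abs_sub _ _).trans ?_
    linarith [hr.abs_le hd hi hn i, hr.abs_le hd hi hn.le i]
  have hG : ∀ i, |entropyFlux F (A n i) (U n i) (U n (i + 1)) k|
      ≤ (C * K + D) * (2 * S) + C * (C * (S + |k|)) := fun i => by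
    have h1 : |entropyFlux F (A n i) (U n i) (U n (i + 1)) k - A n i * kruzhkov f (U n i) k|
        ≤ (C * K + D) * |U n (i + 1) - U n i| := hr.flux.entropyFlux_sub_le (hd.nu.bound _) _ _ _
    have h2 : |U n (i + 1) - U n i| ≤ 2 * S := (abs_sub _ _).trans (by
      linarith [hr.abs_le hd hi hn.le i, hr.abs_le hd hi hn.le (i + 1)])
    have h3 : |A n i * kruzhkov f (U n i) k| ≤ C * (C * (S + |k|)) := by
      rw [abs_mul]
      refine mul_le_mul (hd.nu.bound _) ((hd.abs_kruzhkov_le _ _).trans ?_) (abs_nonneg _) hC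
      exact mul_le_mul_of_nonneg_left ((abs_sub _ _).trans (by
        linarith [hr.abs_le hd hi hn.le i])) hC
    have h4 : (C * K + D) * |U n (i + 1) - U n i| ≤ (C * K + D) * (2 * S) := by gcongr
    have h5 := abs_add_le (entropyFlux F (A n i) (U n i) (U n (i + 1)) k
      - A n i * kruzhkov f (U n i) k) (A n i * kruzhkov f (U n i) k)
    rw [sub_add_cancel] at h5
    linarith
  have hq : ∀ i, |Real.sign (U (n + 1) i - k) * f k * ((A n i - A n (i - 1)) / Δx)|
      ≤ 1 * |f k| * (2 * C ^ 3 * m) := fun i => by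
    rw [abs_mul, abs_mul]
    have h1 : |(A n i - A n (i - 1)) / Δx| ≤ 2 * C ^ 3 * m := by
      rw [abs_div, abs_of_pos hx0, div_le_iff₀ hx0]
      exact (hr.coeffBound hd hi hn.le).diff i
    have := abs_sign_le (U (n + 1) i - k)
    gcongr
  set B := max (2 * S) (max ((C * K + D) * (2 * S) + C * (C * (S + |k|)))
    (1 * |f k| * (2 * C ^ 3 * m)))
  have b1 : 2 * S ≤ B := le_max_left _ _
  have b2 : (C * K + D) * (2 * S) + C * (C * (S + |k|)) ≤ B :=
    (le_max_left _ _).trans (le_max_right _ _)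
  have b3 : 1 * |f k| * (2 * C ^ 3 * m) ≤ B := (le_max_right _ _).trans (le_max_right _ _)
  have hη := hφ.integrable_slice ((n + 1 : ℕ) * Δt)
  refine ⟨?_, ?_, ?_⟩
  · refine integral_step_le (B := B) hx0 (p := fun i => |U (n + 1) i - k| - |U n i - k|)
      (fun i => (hp i).trans b1) (fun i => (hG i).trans b2) (fun i => (hq i).trans b3)
      (fun i => ?_) hη fun x => hφ.2.2.2 _ _ (by positivity)
    have h := hr.entropy hn.le i k
    have e : Δt * (Real.sign (U (n + 1) i - k) * f k * ((A n i - A n (i - 1)) / Δx))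
        = Δt / Δx * Real.sign (U (n + 1) i - k) * f k * (A n i - A n (i - 1)) := by
      field_simp
    rw [e, sub_add_cancel]
    exact h
  · refine Integrable.bdd_mul (c := B) ?_ (measurable_stepFun Δx _).aestronglyMeasurable
      (ae_of_all _ fun x => (hG _).trans b2)
    exact ((hη.comp_add_right Δx).sub hη).div_const _
  · exact hη.bdd_mul (c := B) (measurable_stepFun Δx _).aestronglyMeasurable
      (ae_of_all _ fun x => (hq _).trans b3)

end MonotoneRun

end NonlocalFV

/-! ### Assembly of the approximate entropy inequality. -/

namespace NonlocalFV

namespace MonotoneRun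

variable {f β ν μ u₀ : ℝ → ℝ} {C m V K D T : ℝ} {F : ℝ → ℝ → ℝ → ℝ} {Δx Δt : ℝ} {N : ℕ}
  {α : ℕ → ℤ → ℝ} {φ : ℝ → ℝ → ℝ} {M R y k : ℝ}

local notation "U" => approx β ν μ u₀ F Δx Δt α
local notation "A" => coeff β ν μ u₀ F Δx Δt α
local notation "Er" => errorDensity β ν μ u₀ F Δx Δt α
local notation "UΔ" => approxFun β ν μ u₀ F Δx Δt α
local notation "G" => fun (n : ℕ) (k : ℝ) =>
  stepFun Δx (fun i => entropyFlux F (A n i) (U n i) (U n (i + 1)) k)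
local notation "Q" => fun (n : ℕ) (k : ℝ) =>
  stepFun Δx (fun i => Real.sign (U (n + 1) i - k) * f k * ((A n i - A n (i - 1)) / Δx))

variable (hr : MonotoneRun f β ν μ u₀ K D T F Δx Δt N α) (hd : DataBound f β ν μ C)
  (hi : InitialBound u₀ m V)

include hr hd hi

lemma ae_abs_approxFun_le :
    ∀ᵐ p ∂stripMeasure T, |UΔ p.1 p.2| ≤ variationSup C m V K T :=
  (ae_strip_mem T).mono fun p hp => hr.abs_approxFun_le hd hi hp.2.le p.2

lemma entropy_time_ge (hφ : IsTestFunction T φ) (k : ℝ) :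
    -(∫ x, |stepFun Δx (U 0) x - k| * φ 0 x)
      - ∑ n ∈ Finset.range N, (Δt * (∫ x, G n k x
          * ((φ ((n + 1 : ℕ) * Δt) (x + Δx) - φ ((n + 1 : ℕ) * Δt) x) / Δx))
        - Δt * ∫ x, Q n k x * φ ((n + 1 : ℕ) * Δt) x)
      ≤ ∫ p, |UΔ p.1 p.2 - k| * deriv (fun s => φ s p.2) p.1 ∂stripMeasure T := by
  refine (hr.sum_time_ge hd hi hφ fun n hn => (hr.step_tested hd hi hφ k hn).1).trans
    (le_of_eq ?_)
  rw [integral_strip_eq_sum hr.final_time hr.dt_pos (integrable_entropy_time (hr.stripFun hd hi)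
    (hr.ae_abs_approxFun_le hd hi) hφ k)]
  refine Finset.sum_congr rfl fun n hn => ?_
  have hn' := (Finset.mem_range.1 hn).le
  have hle : (n : ℝ) * Δt ≤ (n + 1 : ℕ) * Δt := by
    have := hr.dt_pos
    gcongr
    simp
  rw [← integral_slab_time hφ (w := fun x => |stepFun Δx (U n) x - k|)
    (B := variationSup C m V K T + |k|) ((measurable_stepFun Δx _).sub_const k).abs
    (fun x => ?_) hle]
  · refine setIntegral_congr_fun measurableSet_Ioo fun t ht => ?_
    dsimp only
    rw [approxFun_eq, floor_div_eq hr.dt_pos ht.1.le ht.2]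
  · rw [abs_abs]
    exact (abs_sub _ _).trans (by have := hr.abs_le hd hi hn' (cellIndex Δx x); gcongr; exact this)

lemma entropy_flux_sub_le (hφ : IsTestFunction T φ) (hb : TestBound φ M R y) (hR : 0 ≤ R)
    (hx1 : Δx ≤ 1) (k : ℝ) :
    |(∫ p, Real.sign (UΔ p.1 p.2 - k) * nonlocalCoeff β ν μ (UΔ p.1) p.2
          * (f (UΔ p.1 p.2) - f k) * deriv (fun y => φ p.1 y) p.2 ∂stripMeasure T)
        - ∑ n ∈ Finset.range N, Δt * ∫ x, G n k x
          * ((φ ((n + 1 : ℕ) * Δt) (x + Δx) - φ ((n + 1 : ℕ) * Δt) x) / Δx)|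
      ≤ ∑ n ∈ Finset.range N, Δt * (fluxErrorConst C m V K D T M
          * (∫ x in Set.Icc (y - (R + 1)) (y + (R + 1)), Er n x)
        + 2 * (R + 1) * fluxErrorConst C m V K D T M * ((Δx + Δt) * |k|)) := by
  refine abs_integral_strip_sub_le hr.final_time hr.dt_pos (integrable_entropy_flux hd
    (hr.stripFun hd hi) (hr.ae_abs_approxFun_le hd hi) hφ k) fun n hn t ht => ?_
  have hts : |t - (n + 1 : ℕ) * Δt| ≤ Δt := by
    have h1 := ht.1; have h2 := ht.2
    push_cast at h2 ⊢
    rw [_root_.abs_le]; constructor <;> linarith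
  dsimp only
  rw [approxFun_eq, floor_div_eq hr.dt_pos ht.1.le ht.2]
  exact hr.flux_slab hd hi hφ hb hR hx1 k hn.le hts (hr.step_tested hd hi hφ k hn).2.1

/-- Slab `n` is matched with the source of step `n - 1`. The first slab has no partner and costs
`O(Δt)`; the source of the last step is tested at time `T`, where the test function vanishes. -/
lemma entropy_source_sub_le (hφ : IsTestFunction T φ) (hb : TestBound φ M R y) (hR : 0 ≤ R)
    (k : ℝ) :
    |(∫ p, f k * Real.sign (UΔ p.1 p.2 - k) * deriv (nonlocalCoeff β ν μ (UΔ p.1)) p.2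
          * φ p.1 p.2 ∂stripMeasure T)
        - ∑ n ∈ Finset.range N, Δt * ∫ x, Q n k x * φ ((n + 1 : ℕ) * Δt) x|
      ≤ 2 * (R + 1) * (sourceErrorConst C m V K D T M * T + C ^ 4 * m * M)
        * ((Δx + Δt) * |k|) := by
  have hC := hd.nonneg
  have hm := hi.mass_nonneg
  have hM := hb.nonneg
  have hT := hr.time_nonneg
  have ht0 := hr.dt_pos
  have hx0 := hr.dx_pos
  have hsc := hr.sourceErrorConst_nonneg hd hi hM
  set P : ℕ → ℝ := fun n => ∫ x, Q n k x * φ ((n + 1 : ℕ) * Δt) x with hP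
  set e : ℕ → ℝ := fun n => 2 * (R + 1) * sourceErrorConst C m V K D T M * ((Δx + Δt) * |k|)
    + if n = 0 then 2 * (R + 1) * (C ^ 4 * m * M) * |k| else 0 with he
  have key := abs_integral_strip_sub_le (P := fun n => if n = 0 then 0 else P (n - 1)) (e := e)
    hr.final_time hr.dt_pos (integrable_entropy_source hd (hr.stripFun hd hi) hφ k)
    fun n hn t ht => ?_
  · have e1 : ∑ n ∈ Finset.range N, Δt * (if n = 0 then 0 else P (n - 1))
        = ∑ n ∈ Finset.range N, Δt * P n := by
      rcases Nat.eq_zero_or_pos N with h0 | h0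
      · simp [h0]
      · obtain ⟨N', hN'⟩ := Nat.exists_eq_add_of_lt h0
        have hN1 : N = N' + 1 := by omega
        have hPN : P N' = 0 := by
          simp only [hP]
          rw [integral_eq_zero_of_ae (ae_of_all _ fun x => ?_)]
          rw [← hN1, hr.final_time, hφ.eq_zero le_rfl]
          simp
        rw [hN1, Finset.sum_range_succ', Finset.sum_range_succ (fun n => Δt * P n), hPN]
        simp
    rw [e1] at key
    refine key.trans ?_
    simp only [he, mul_add, Finset.sum_add_distrib, Finset.sum_const, Finset.card_range,
      nsmul_eq_mul]
    have e2 : ∑ n ∈ Finset.range N, Δt * (if n = 0 then 2 * (R + 1) * (C ^ 4 * m * M) * |k| else 0)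
        ≤ Δt * (2 * (R + 1) * (C ^ 4 * m * M) * |k|) := by
      rw [← Finset.mul_sum, Finset.sum_ite_eq']
      refine mul_le_mul_of_nonneg_left ?_ ht0.le
      split_ifs
      · exact le_rfl
      · positivity
    have e3 : (N : ℝ) * Δt = T := hr.final_time
    have p1 : 0 ≤ 2 * (R + 1) * (C ^ 4 * m * M) * (Δx * |k|) := by positivity
    have e4 : ∀ c, (N : ℝ) * (Δt * c) = T * c := fun c => by rw [← mul_assoc, e3]
    simp only [mul_add] at e2 ⊢
    refine (add_le_add_right e2 _).trans ?_
    simp only [e4]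
    linarith
  · dsimp only
    rw [approxFun_eq, floor_div_eq hr.dt_pos ht.1.le ht.2]
    rcases n with _ | n
    · simp only [he, if_true]
      rw [sub_zero]
      refine (hr.source_first_slab hd hi hφ hb hR k t hn.le).trans (le_add_of_nonneg_left ?_)
      positivity
    · have hts : |t - (n + 1 : ℕ) * Δt| ≤ Δt := by
        have h1 := ht.1; have h2 := ht.2
        push_cast at h1 h2 ⊢
        rw [_root_.abs_le]; constructor <;> linarith
      simp only [he, Nat.succ_ne_zero, if_false, add_zero, Nat.add_sub_cancel]
      exact hr.source_slab hd hi hφ hb hR k hn.le hts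
        (hr.step_tested hd hi hφ k (by omega : n < N)).2.2

lemma entropy_initial_sub_le (hφ : IsTestFunction T φ) (hb : TestBound φ M R y) (k : ℝ) :
    |(∫ x, |stepFun Δx (U 0) x - k| * φ 0 x) - ∫ x, |u₀ x - k| * φ 0 x|
      ≤ M * ∫ x in Set.Icc (y - (R + 1)) (y + (R + 1)), |stepFun Δx (U 0) x - u₀ x| := by
  have hI : ∀ {w : ℝ → ℝ}, Integrable w → Integrable fun x => |w x - k| * φ 0 x := by
    intro w hw
    -- For `k ≠ 0` the function `|w - k|` is not integrable on the line; after subtraction of `|k|`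
    -- it is dominated by `|w|`.
    have h1 : Integrable fun x => (|w x - k| - |k|) * φ 0 x := by
      refine Integrable.mul_bdd (c := M) ?_ (hφ.continuous_slice 0).aestronglyMeasurable
        (ae_of_all _ fun x => hb.bound 0 x)
      refine hw.abs.mono' ((hw.1.sub aestronglyMeasurable_const).norm.sub
        aestronglyMeasurable_const) (ae_of_all _ fun x => ?_)
      rw [Real.norm_eq_abs]
      have := abs_abs_sub_abs_le_abs_sub (w x - k) (-k)
      rw [abs_neg, sub_neg_eq_add, sub_add_cancel] at this
      exact this
    refine (h1.add ((hφ.integrable_slice 0).const_mul |k|)).congr (ae_of_all _ fun x => ?_)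
    simp only [Pi.add_apply]
    ring
  have hU := hr.integrable_stepFun hd hi (Nat.zero_le N)
  have hD : Integrable fun x => |stepFun Δx (U 0) x - u₀ x| := (hU.sub hi.integrable).abs
  rw [← integral_const_mul]
  refine abs_integral_sub_le_of_support (hI hU) (hI hi.integrable)
    (hD.const_mul _).integrableOn (fun x => ?_)
    (fun x hx => by rw [hb.eq_zero (by linarith : R < |x - y|)]; simp)
  rw [← sub_mul, abs_mul, mul_comm]
  have h1 := abs_abs_sub_abs_le_abs_sub (stepFun Δx (U 0) x - k) (u₀ x - k)
  rw [sub_sub_sub_cancel_right] at h1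
  exact mul_le_mul (hb.bound 0 x) h1 (abs_nonneg _) hb.nonneg

/-- The approximations satisfy the entropy inequality up to an error of the order of the mesh. -/
lemma approxEntropy (hM : 0 ≤ M) (hR : 0 ≤ R) (hx1 : Δx ≤ 1) :
    ApproxEntropy f β ν μ u₀ T UΔ M R (entropyErrorConst C m V K D T M R * (Δx + Δt)) := by
  have hC := hd.nonneg
  have hm := hi.mass_nonneg
  have hV := hi.variation_nonneg
  have hS := hr.variationSup_nonneg hd hi
  have hT := hr.time_nonneg
  have ht0 := hr.dt_pos
  have hx0 := hr.dx_pos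
  have h1 := hr.fluxErrorConst_nonneg hd hi hM
  have h2 := hr.sourceErrorConst_nonneg hd hi hM
  set E := fluxErrorConst C m V K D T M with hE
  have hU := hr.integrable_stepFun hd hi (Nat.zero_le N)
  have hD : Integrable fun x => |stepFun Δx (U 0) x - u₀ x| := (hU.sub hi.integrable).abs
  have hEr : ∀ n ∈ Finset.range N, Integrable fun x => Δt * (E * Er n x) := fun n hn =>
    ((hr.integrable_errorDensity hd hi (Finset.mem_range.1 hn).le).const_mul _).const_mul _
  have hsumI : Integrable fun x => ∑ n ∈ Finset.range N, Δt * (E * Er n x) :=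
    integrable_finsetSum _ hEr
  have hDI : Integrable fun x => M * |stepFun Δx (U 0) x - u₀ x| := hD.const_mul M
  -- All errors independent of `k` are collected in one density of total mass `O(Δx + Δt)`. The
  -- error for a test function centred at `y` is the integral of this density over a window around
  -- `y`, which as a function of `y` is bounded and integrable. The factor `2 (R + 1) + 1` in the
  -- constant covers both requirements.
  set ρ : ℝ → ℝ := fun x => (∑ n ∈ Finset.range N, Δt * (E * Er n x))
    + M * |stepFun Δx (U 0) x - u₀ x| with hρ
  have hρI : Integrable ρ := hsumI.add hDI
  have hρ0 : ∀ x, 0 ≤ ρ x := fun x => add_nonneg (Finset.sum_nonneg fun n _ =>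
    mul_nonneg ht0.le (mul_nonneg h1 (hr.errorDensity_nonneg n x))) (by positivity)
  have hρle : ∫ x, ρ x ≤ (E * T * (variationSup C m V K T + m) + M * V) * (Δx + Δt) := by
    simp only [hρ]
    rw [integral_add hsumI hDI, integral_finsetSum _ hEr, integral_const_mul]
    have h3 : ∀ n ∈ Finset.range N, ∫ x, Δt * (E * Er n x)
        ≤ Δt * (E * ((variationSup C m V K T + m) * (Δx + Δt))) := fun n hn => by
      rw [integral_const_mul, integral_const_mul]
      have := hr.integral_errorDensity_le hd hi (Finset.mem_range.1 hn).le
      gcongr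
    have h4 := Finset.sum_le_sum h3
    rw [Finset.sum_const, Finset.card_range, nsmul_eq_mul, ← mul_assoc, hr.final_time] at h4
    have h5 := hi.approximation hx0
    have h6 : M * (∫ x, |stepFun Δx (U 0) x - u₀ x|) ≤ M * (Δx * V) := by gcongr; exact h5
    have p : 0 ≤ M * (Δt * V) := by positivity
    linarith
  have hwin := integral_window hρI (by linarith : 0 ≤ R + 1)
  have hg0 : ∀ y, 0 ≤ ∫ x in Set.Icc (y - (R + 1)) (y + (R + 1)), ρ x := fun y =>
    integral_nonneg hρ0
  have hg1 : ∀ y, ∫ x in Set.Icc (y - (R + 1)) (y + (R + 1)), ρ x ≤ ∫ x, ρ x := fun y =>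
    setIntegral_le_integral hρI (ae_of_all _ hρ0)
  have hρn : 0 ≤ ∫ x, ρ x := integral_nonneg hρ0
  set X := E * T * (variationSup C m V K T + m) + M * V with hX
  set Y := E * T + sourceErrorConst C m V K D T M * T + C ^ 4 * m * M with hY
  have hX0 : 0 ≤ X := by positivity
  have hY0 : 0 ≤ Y := by positivity
  have hκ : entropyErrorConst C m V K D T M R * (Δx + Δt)
      = (2 * (R + 1) + 1) * (X * (Δx + Δt)) + 2 * (R + 1) * Y * (Δx + Δt) := by
    rw [entropyErrorConst]; ring
  have hs0 : 0 < Δx + Δt := by positivity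
  have pXY : 0 ≤ 2 * (R + 1) * Y * (Δx + Δt) := by positivity
  have pX : 0 ≤ X * (Δx + Δt) := by positivity
  refine ⟨_, fun y => ⟨hg0 y, ?_⟩, hwin.1, ?_, fun k y φ hφ hb => ?_⟩
  · have pR : 0 ≤ 2 * (R + 1) * (X * (Δx + Δt)) := by positivity
    rw [hκ]
    linarith [hg1 y]
  · rw [hwin.2, hκ]
    have : 2 * (R + 1) * (∫ x, ρ x) ≤ 2 * (R + 1) * (X * (Δx + Δt)) := by gcongr
    linarith
  · rw [entropyForm, restrict_strip]
    have a1 := hr.entropy_time_ge hd hi hφ k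
    have a2 := (_root_.abs_le.1 (hr.entropy_flux_sub_le hd hi hφ hb hR hx1 k)).1
    have a3 := (_root_.abs_le.1 (hr.entropy_source_sub_le hd hi hφ hb hR k)).2
    have a4 := (_root_.abs_le.1 (hr.entropy_initial_sub_le hd hi hφ hb k)).2
    rw [Finset.sum_sub_distrib] at a1
    have e1 : ∫ x in Set.Icc (y - (R + 1)) (y + (R + 1)), ρ x
        = (∑ n ∈ Finset.range N, Δt * (E
            * ∫ x in Set.Icc (y - (R + 1)) (y + (R + 1)), Er n x))
          + M * ∫ x in Set.Icc (y - (R + 1)) (y + (R + 1)), |stepFun Δx (U 0) x - u₀ x| := by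
      simp only [hρ]
      rw [integral_add hsumI.integrableOn hDI.integrableOn,
        integral_finsetSum _ fun n hn => (hEr n hn).integrableOn, integral_const_mul]
      simp only [integral_const_mul]
    simp only [mul_add, Finset.sum_add_distrib, Finset.sum_const, Finset.card_range,
      nsmul_eq_mul] at a2
    have e4 : ∀ c, (N : ℝ) * (Δt * c) = T * c := fun c => by rw [← mul_assoc, hr.final_time]
    simp only [e4] at a2
    rw [e1]
    have e5 : Y * (2 * (R + 1) * ((Δx + Δt) * |k|)) ≤ entropyErrorConst C m V K D T M R * (Δx + Δt) * |k| := by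
      rw [hκ]
      have : 0 ≤ (2 * (R + 1) + 1) * (X * (Δx + Δt)) * |k| := by positivity
      linarith
    rw [hY] at e5
    linarith

end MonotoneRun

end NonlocalFV

namespace NonlocalFV

/-! ### Mollifiers -/

/-- A one-sided mollifier of width `2 ρ`. -/
structure Mollifier (w : ℝ → ℝ) (ρ κ b : ℝ) : Prop where
  smooth : ContDiff ℝ ((⊤ : ℕ∞) : WithTop ℕ∞) w
  compact : HasCompactSupport w
  nonneg : ∀ z, 0 ≤ w z
  support : ∀ z, w z ≠ 0 → z ∈ Set.Icc 0 (2 * ρ)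
  integral : ∫ z, w z = 1
  integral_deriv : ∫ z, |deriv w z| ≤ κ / ρ
  bound : ∀ z, |w z| ≤ b
  deriv_bound : ∀ z, |deriv w z| ≤ b
  deriv_deriv_bound : ∀ z, |deriv (deriv w) z| ≤ b

lemma contDiff_deriv {w : ℝ → ℝ} (hw : ContDiff ℝ ((⊤ : ℕ∞) : WithTop ℕ∞) w) :
    ContDiff ℝ ((⊤ : ℕ∞) : WithTop ℕ∞) (deriv w) :=
  (contDiff_infty_iff_deriv.1 hw).2

/-- A bump of radius 1 about the point 1 is scaled by `ρ`, which makes the support one-sided. It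
matters that `κ` does not depend on `ρ`. The bound `b` does, but it only fixes the class of test
functions, before the accuracy of the entropy inequalities is prescribed. -/
lemma exists_mollifier :
    ∃ κ, 0 ≤ κ ∧ ∀ ρ, 0 < ρ → ∃ w b, Mollifier w ρ κ b := by
  let φ : ContDiffBump (1 : ℝ) := ⟨1 / 2, 1, by norm_num, by norm_num⟩
  set g : ℝ → ℝ := φ.normed volume with hg
  have hgs : ContDiff ℝ ((⊤ : ℕ∞) : WithTop ℕ∞) g := φ.contDiff_normed
  refine ⟨∫ z, |deriv g z|, integral_nonneg fun _ => abs_nonneg _, fun ρ hρ => ?_⟩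
  set w : ℝ → ℝ := fun z => ρ⁻¹ * g (z / ρ) with hw
  have hsupp : ∀ z, w z ≠ 0 → z ∈ Set.Icc 0 (2 * ρ) := fun z hz => by
    have h1 : z / ρ ∈ Function.support g := fun h0 => hz (by simp [hw, h0])
    rw [hg, φ.support_normed_eq, Metric.mem_ball, Real.dist_eq] at h1
    have h2 : |z / ρ - 1| < 1 := h1
    rw [abs_lt] at h2
    have h3 : 0 < z / ρ := by linarith
    have h4 : z / ρ < 2 := by linarith
    rw [div_lt_iff₀ hρ] at h4
    exact ⟨((div_pos_iff_of_pos_right hρ).1 h3).le, h4.le⟩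
  have hsm : ContDiff ℝ ((⊤ : ℕ∞) : WithTop ℕ∞) w :=
    contDiff_const.mul (hgs.comp (contDiff_id.div_const ρ))
  have hcs : HasCompactSupport w := HasCompactSupport.intro isCompact_Icc fun z hz => by
    by_contra h
    exact hz (hsupp z h)
  have hcs1 : HasCompactSupport (deriv w) := hcs.deriv
  obtain ⟨b0, h0⟩ := hcs.exists_bound_of_continuous hsm.continuous
  obtain ⟨b1, h1⟩ := hcs1.exists_bound_of_continuous (contDiff_deriv hsm).continuous
  obtain ⟨b2, h2⟩ := hcs1.deriv.exists_bound_of_continuous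
    (contDiff_deriv (contDiff_deriv hsm)).continuous
  have hd : ∀ z, deriv w z = ρ⁻¹ * (deriv g (z / ρ) * ρ⁻¹) := fun z => by
    have hz : HasDerivAt (fun z : ℝ => z / ρ) ρ⁻¹ z := by
      simpa [div_eq_mul_inv] using (hasDerivAt_id z).mul_const ρ⁻¹
    exact (((hgs.differentiable (by simp) _).hasDerivAt.comp z hz).const_mul ρ⁻¹).deriv
  refine ⟨w, max b0 (max b1 b2), hsm, hcs, fun z => ?_, hsupp, ?_, ?_, fun z => ?_, fun z => ?_,
    fun z => ?_⟩
  · exact mul_nonneg (inv_nonneg.2 hρ.le) (φ.nonneg_normed _)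
  · simp only [hw]
    rw [integral_const_mul, Measure.integral_comp_div, abs_of_pos hρ, φ.integral_normed]
    simp [hρ.ne']
  · have e : ∀ z, |deriv w z| = ρ⁻¹ * ρ⁻¹ * |deriv g (z / ρ)| := fun z => by
      rw [hd, abs_mul, abs_mul, abs_of_pos (inv_pos.2 hρ)]; ring
    simp only [e]
    rw [integral_const_mul, Measure.integral_comp_div (fun z => |deriv g z|), abs_of_pos hρ,
      smul_eq_mul, mul_assoc, inv_mul_cancel_left₀ hρ.ne', div_eq_inv_mul]
  · exact (h0 z).trans (le_max_left _ _)
  · exact (h1 z).trans ((le_max_left _ _).trans (le_max_right _ _))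
  · exact (h2 z).trans ((le_max_right _ _).trans (le_max_right _ _))

namespace Mollifier

variable {w : ℝ → ℝ} {ρ κ b : ℝ}

lemma eq_zero (h : Mollifier w ρ κ b) {z : ℝ} (hz : z ∉ Set.Icc 0 (2 * ρ)) : w z = 0 := by
  by_contra h0
  exact hz (h.support z h0)

lemma deriv_support (h : Mollifier w ρ κ b) {z : ℝ} (hz : deriv w z ≠ 0) :
    z ∈ Set.Icc 0 (2 * ρ) := by
  have h1 : tsupport w ⊆ Set.Icc 0 (2 * ρ) :=
    closure_minimal (fun z hz => h.support z hz) isClosed_Icc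
  exact h1 (support_deriv_subset hz)

lemma bound_nonneg (h : Mollifier w ρ κ b) : 0 ≤ b := (abs_nonneg _).trans (h.bound 0)

lemma continuous (h : Mollifier w ρ κ b) : Continuous w := h.smooth.continuous

lemma continuous_deriv (h : Mollifier w ρ κ b) : Continuous (deriv w) :=
  (contDiff_deriv h.smooth).continuous

lemma differentiable (h : Mollifier w ρ κ b) : Differentiable ℝ w := h.smooth.differentiable (by simp)

lemma integrable (h : Mollifier w ρ κ b) : Integrable w :=
  h.continuous.integrable_of_hasCompactSupport h.compact

lemma integrable_deriv (h : Mollifier w ρ κ b) : Integrable (deriv w) :=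
  h.continuous_deriv.integrable_of_hasCompactSupport h.compact.deriv

lemma integral_deriv_eq_zero (h : Mollifier w ρ κ b) : ∫ z, deriv w z = 0 :=
  integral_eq_zero_of_hasDerivAt_of_integrable (fun z => (h.differentiable z).hasDerivAt)
    h.integrable_deriv h.integrable

end Mollifier

/-! ### Test functions of product form -/

lemma abs_sub_le_of_deriv_bound {g : ℝ → ℝ} {c : ℝ} (hg : Differentiable ℝ g)
    (hc : ∀ x, |deriv g x| ≤ c) (x y : ℝ) : |g x - g y| ≤ c * |x - y| :=
  convex_univ.norm_image_sub_le_of_norm_deriv_le (fun z _ => hg z) (fun z _ => hc z)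
    (Set.mem_univ y) (Set.mem_univ x)

/-- The test function `(t, x) ↦ a(t) b(x)`. -/
lemma isTestFunction_mul {a b : ℝ → ℝ} {T ca cb R y : ℝ}
    (ha : ContDiff ℝ ((⊤ : ℕ∞) : WithTop ℕ∞) a) (hb : ContDiff ℝ ((⊤ : ℕ∞) : WithTop ℕ∞) b)
    (ha0 : ∀ t, |a t| ≤ ca) (ha1 : ∀ t, |deriv a t| ≤ ca) (hb0 : ∀ x, |b x| ≤ cb)
    (hb1 : ∀ x, |deriv b x| ≤ cb) (hb2 : ∀ x, |deriv (deriv b) x| ≤ cb)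
    {t₀ t₁ : ℝ} (ht₁ : t₁ < T) (hat : ∀ t, a t ≠ 0 → t ∈ Set.Icc t₀ t₁)
    (hbx : ∀ x, b x ≠ 0 → |x - y| ≤ R) (han : ∀ t, 0 ≤ t → 0 ≤ a t) (hbn : ∀ x, 0 ≤ b x) :
    IsTestFunction T (fun t x => a t * b x) ∧ TestBound (fun t x => a t * b x) (ca * cb) R y := by
  have hca : 0 ≤ ca := (abs_nonneg _).trans (ha0 0)
  have hcb : 0 ≤ cb := (abs_nonneg _).trans (hb0 0)
  have hda : Differentiable ℝ a := ha.differentiable (by simp)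
  have hdb : Differentiable ℝ b := hb.differentiable (by simp)
  have hdb1 : Differentiable ℝ (deriv b) := (contDiff_deriv hb).differentiable (by simp)
  have hs : Function.support (Function.uncurry fun t x => a t * b x)
      ⊆ Set.Icc t₀ t₁ ×ˢ Set.Icc (y - R) (y + R) := fun p hp => by
    have hp' : a p.1 * b p.2 ≠ 0 := hp
    have h1 := abs_le.1 (hbx p.2 (right_ne_zero_of_mul hp'))
    exact ⟨hat p.1 (left_ne_zero_of_mul hp'), by linarith, by linarith⟩
  have hts : tsupport (Function.uncurry fun t x => a t * b x)
      ⊆ Set.Icc t₀ t₁ ×ˢ Set.Icc (y - R) (y + R) :=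
    closure_minimal hs (isClosed_Icc.prod isClosed_Icc)
  have hder : ∀ t x, deriv (fun z => a t * b z) x = a t * deriv b x := fun t x =>
    deriv_const_mul _ (hdb x)
  refine ⟨⟨?_, ?_, ?_, ?_⟩, ⟨?_, ?_, ?_, ?_, ?_⟩⟩
  · exact (ha.comp contDiff_fst).mul (hb.comp contDiff_snd)
  · exact HasCompactSupport.of_support_subset_isCompact (isCompact_Icc.prod isCompact_Icc) hs
  · exact fun p hp => lt_of_le_of_lt (hts hp).1.2 ht₁
  · exact fun t x ht => mul_nonneg (han t ht) (hbn x)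
  · intro t x
    rw [abs_mul]
    exact mul_le_mul (ha0 t) (hb0 x) (abs_nonneg _) hca
  · intro t s x
    rw [← sub_mul, abs_mul]
    calc _ ≤ (ca * |t - s|) * cb := mul_le_mul (abs_sub_le_of_deriv_bound hda ha1 t s) (hb0 x)
          (abs_nonneg _) (by positivity)
      _ = _ := by ring
  · intro t x
    rw [hder, abs_mul]
    exact mul_le_mul (ha0 t) (hb1 x) (abs_nonneg _) hca
  · intro t s x z
    rw [hder, hder]
    have e : a t * deriv b x - a s * deriv b z
        = (a t - a s) * deriv b x + a s * (deriv b x - deriv b z) := by ring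
    rw [e, mul_add]
    refine (abs_add_le _ _).trans (add_le_add ?_ ?_)
    · rw [abs_mul]
      calc _ ≤ (ca * |t - s|) * cb := mul_le_mul (abs_sub_le_of_deriv_bound hda ha1 t s) (hb1 x)
            (abs_nonneg _) (by positivity)
        _ = _ := by ring
    · rw [abs_mul, mul_assoc]
      exact mul_le_mul (ha0 s) (abs_sub_le_of_deriv_bound hdb1 hb2 x z) (abs_nonneg _) hca
  · exact fun t x h => hbx x (right_ne_zero_of_mul h)

/-- A non-increasing cutoff in time, vanishing after the time `τ`. -/
structure TimeCutoff (χ : ℝ → ℝ) (τ X : ℝ) : Prop where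
  smooth : ContDiff ℝ ((⊤ : ℕ∞) : WithTop ℕ∞) χ
  nonneg : ∀ s, 0 ≤ χ s
  eq_zero : ∀ s, τ ≤ s → χ s = 0
  deriv_nonpos : ∀ s, deriv χ s ≤ 0
  bound : ∀ s, -1 ≤ s → χ s ≤ X
  deriv_bound : ∀ s, -1 ≤ s → |deriv χ s| ≤ X

namespace TimeCutoff

variable {χ w : ℝ → ℝ} {τ X T ρ κ b : ℝ}

lemma differentiable (h : TimeCutoff χ τ X) : Differentiable ℝ χ := h.smooth.differentiable (by simp)

lemma continuous (h : TimeCutoff χ τ X) : Continuous χ := h.smooth.continuous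

lemma continuous_deriv (h : TimeCutoff χ τ X) : Continuous (deriv χ) :=
  (contDiff_deriv h.smooth).continuous

lemma bound_nonneg (h : TimeCutoff χ τ X) : 0 ≤ X := (h.nonneg 0).trans (h.bound 0 (by norm_num))

lemma deriv_eq_zero (h : TimeCutoff χ τ X) {s : ℝ} (hs : τ ≤ s) : deriv χ s = 0 := by
  have h1 : HasDerivWithinAt χ (deriv χ s) (Set.Ici s) s :=
    (h.differentiable s).hasDerivAt.hasDerivWithinAt
  have h2 : HasDerivWithinAt χ 0 (Set.Ici s) s :=
    (hasDerivWithinAt_const s (Set.Ici s) 0).congr (fun x hx => h.eq_zero x (hs.trans hx))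
      (h.eq_zero s hs)
  exact (uniqueDiffOn_Ici s s Set.self_mem_Ici).eq_deriv _ h1 h2

end TimeCutoff

/-! ### The test functions of the doubling of variables. -/

section Doubling

variable {χ w : ℝ → ℝ} {τ X T ρ κ b : ℝ}

/-- The test function of the entropy inequality of the first solution, frozen at `(s, y)`. -/
lemma isTestFunction_first (hw : Mollifier w ρ κ b) (hχ : TimeCutoff χ τ X) (hρ : ρ ≤ 1 / 2)
    (hτ : τ + 2 * ρ < T) {s : ℝ} (hs : 0 < s) (y : ℝ) :
    IsTestFunction T (fun t x => (w (t - s) * χ s) * w (x - y)) ∧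
      TestBound (fun t x => (w (t - s) * χ s) * w (x - y)) (2 * b * X * b) 1 y := by
  have hb := hw.bound_nonneg
  have hX := hχ.bound_nonneg
  have h0 : |χ s| ≤ X := by rw [abs_of_nonneg (hχ.nonneg s)]; exact hχ.bound s (by linarith)
  have hd : ∀ t, deriv (fun t => w (t - s) * χ s) t = deriv w (t - s) * χ s := fun t =>
    (((hw.differentiable (t - s)).hasDerivAt.comp_sub_const t s).mul_const (χ s)).deriv
  have hbx : b * X ≤ 2 * b * X := by nlinarith [mul_nonneg hb hX]
  have e1 : deriv (fun x => w (x - y)) = fun x => deriv w (x - y) :=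
    funext fun x => deriv_comp_sub_const ..
  have e2 : deriv (fun x => deriv w (x - y)) = fun x => deriv (deriv w) (x - y) :=
    funext fun x => deriv_comp_sub_const ..
  refine isTestFunction_mul (t₀ := s) (t₁ := τ + 2 * ρ)
    ((hw.smooth.comp (contDiff_id.sub contDiff_const)).mul contDiff_const)
    (hw.smooth.comp (contDiff_id.sub contDiff_const)) (fun t => ?_) (fun t => ?_)
    (fun x => hw.bound _) (fun x => ?_) (fun x => ?_) hτ
    (fun t ht => ?_) (fun x hx => ?_)
    (fun t _ => mul_nonneg (hw.nonneg _) (hχ.nonneg _)) fun x => hw.nonneg _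
  · rw [abs_mul]
    exact (mul_le_mul (hw.bound _) h0 (abs_nonneg _) hb).trans hbx
  · rw [hd, abs_mul]
    exact (mul_le_mul (hw.deriv_bound _) h0 (abs_nonneg _) hb).trans hbx
  · rw [e1]; exact hw.deriv_bound _
  · rw [e1, e2]; exact hw.deriv_deriv_bound _
  -- On the support `s ≤ t ≤ s + 2 ρ` and `s < τ`; this is why `τ + 2 ρ < T` is required.
  · have h1 := hw.support _ (left_ne_zero_of_mul ht)
    have h2 : s < τ := by
      by_contra h
      exact right_ne_zero_of_mul ht (hχ.eq_zero s (not_lt.1 h))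
    exact ⟨by linarith [h1.1], by linarith [h1.2]⟩
  · have h1 := hw.support _ hx
    rw [abs_le]
    exact ⟨by linarith [h1.1], by linarith [h1.2]⟩

/-- The test function of the entropy inequality of the second solution, frozen at `(t, x)`. -/
lemma isTestFunction_second (hw : Mollifier w ρ κ b) (hχ : TimeCutoff χ τ X) (hρ : ρ ≤ 1 / 2)
    (hτ : τ < T) {t : ℝ} (ht : 0 < t) (x : ℝ) :
    IsTestFunction T (fun s y => (w (t - s) * χ s) * w (x - y)) ∧
      TestBound (fun s y => (w (t - s) * χ s) * w (x - y)) (2 * b * X * b) 1 x := by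
  have hb := hw.bound_nonneg
  have hX := hχ.bound_nonneg
  have h0 : ∀ s, -1 ≤ s → |χ s| ≤ X := fun s hs => by
    rw [abs_of_nonneg (hχ.nonneg s)]; exact hχ.bound s hs
  have hd : ∀ s, deriv (fun s => w (t - s) * χ s) s
      = -deriv w (t - s) * χ s + w (t - s) * deriv χ s := fun s => by
    have h1 : HasDerivAt (fun s => w (t - s)) (-deriv w (t - s)) s :=
      (hw.differentiable (t - s)).hasDerivAt.comp_const_sub t s
    exact (h1.mul (hχ.differentiable s).hasDerivAt).deriv
  have hsx : ∀ {g : ℝ → ℝ}, (fun y => deriv (fun z => g (x - z)) y)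
      = fun y => -deriv g (x - y) := fun {g} => funext fun y => deriv_comp_const_sub ..
  have e1 : deriv (fun y => w (x - y)) = fun y => -deriv w (x - y) := hsx
  have e2 : deriv (fun y => -deriv w (x - y)) = fun y => deriv (deriv w) (x - y) := by
    funext y
    have := congrFun (hsx (g := deriv w)) y
    rw [deriv.fun_neg, this, neg_neg]
  refine isTestFunction_mul (t₀ := t - 2 * ρ) (t₁ := τ)
    ((hw.smooth.comp (contDiff_const.sub contDiff_id)).mul hχ.smooth)
    (hw.smooth.comp (contDiff_const.sub contDiff_id)) (fun s => ?_) (fun s => ?_)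
    (fun y => hw.bound _) (fun y => ?_) (fun y => ?_) hτ
    (fun s hs => ?_) (fun y hy => ?_)
    (fun s _ => mul_nonneg (hw.nonneg _) (hχ.nonneg _)) fun y => hw.nonneg _
  · rw [abs_mul]
    by_cases h : w (t - s) = 0
    · rw [h]; simp; positivity
    -- Where the mollifier does not vanish, `s ≥ t - 2 ρ ≥ -1`, which is the range in which the
    -- cutoff is bounded.
    · have h1 := hw.support _ h
      refine (mul_le_mul (hw.bound _) (h0 s (by linarith [h1.2])) (abs_nonneg _) hb).trans ?_
      nlinarith [mul_nonneg hb hX]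
  · rw [hd]
    by_cases h : t - s ∈ Set.Icc 0 (2 * ρ)
    · have hs : -1 ≤ s := by linarith [h.2]
      refine (abs_add_le _ _).trans ?_
      rw [abs_mul, abs_mul, abs_neg]
      have := mul_le_mul (hw.deriv_bound (t - s)) (h0 s hs) (abs_nonneg _) hb
      have := mul_le_mul (hw.bound (t - s)) (hχ.deriv_bound s hs) (abs_nonneg _) hb
      linarith
    · have h1 : deriv w (t - s) = 0 := by
        by_contra h2
        exact h (hw.deriv_support h2)
      rw [h1, hw.eq_zero h]
      simp; positivity
  · rw [e1, abs_neg]; exact hw.deriv_bound _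
  · rw [e1, e2]; exact hw.deriv_deriv_bound _
  · have h1 := hw.support _ (left_ne_zero_of_mul hs)
    have h2 : s < τ := by
      by_contra h
      exact right_ne_zero_of_mul hs (hχ.eq_zero s (not_lt.1 h))
    exact ⟨by linarith [h1.2], h2.le⟩
  · have h1 := hw.support _ hy
    rw [abs_le]
    exact ⟨by linarith [h1.2], by linarith [h1.1]⟩

end Doubling

end NonlocalFV

namespace NonlocalFV

/-! ### Integrals against convolution kernels -/

/-- If `f` is not integrable its integral is `0` by convention, so no integrability is needed. Upper
bounds can thus be computed with the Lebesgue integral of the positive part. -/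
lemma integral_le_of_lintegral_le {Ω : Type*} [MeasurableSpace Ω] {μ : Measure Ω} {f : Ω → ℝ}
    {c : ℝ} (hc : 0 ≤ c) (h : ∫⁻ a, ENNReal.ofReal (f a) ∂μ ≤ ENNReal.ofReal c) :
    ∫ a, f a ∂μ ≤ c := by
  by_cases hf : Integrable f μ
  · rw [integral_eq_lintegral_pos_part_sub_lintegral_neg_part hf]
    have := ENNReal.toReal_mono ENNReal.ofReal_ne_top h
    rw [ENNReal.toReal_ofReal hc] at this
    linarith [ENNReal.toReal_nonneg (a := ∫⁻ a, ENNReal.ofReal (-f a) ∂μ)]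
  · rw [integral_undef hf]; exact hc

section Kernels

variable {T V e m r : ℝ} {u : ℝ → ℝ → ℝ} {a b : ℝ → ℝ}

/-- After the substitution `x = y + z` and an exchange of the integrals, the integral over `y` is a
translation difference of `u` by a displacement `|z| ≤ r`. -/
lemma lintegral_space_kernel_le (hu : Regular T V e u) (hs : StripFun T m u) (hV : 0 ≤ V)
    (he : 0 ≤ e) (hr : 0 ≤ r) (hb : Measurable b) (hb0 : ∀ z, 0 ≤ b z) (hbi : Integrable b)
    (hbr : ∀ z, b z ≠ 0 → |z| ≤ r) {s t : ℝ} (hs' : s ∈ Set.Icc 0 T) (ht : t ∈ Set.Icc 0 T) :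
    ∫⁻ y, ∫⁻ x, ENNReal.ofReal (|u s y - u t x| * b (x - y))
      ≤ ENNReal.ofReal ((V * r + V * |t - s| + e) * ∫ z, b z) := by
  have hms : Measurable (u s) := hu.measurable.comp (measurable_const.prodMk measurable_id)
  have hmt : Measurable (u t) := hu.measurable.comp (measurable_const.prodMk measurable_id)
  have h1 : ∀ y, ∫⁻ x, ENNReal.ofReal (|u s y - u t x| * b (x - y))
      = ∫⁻ z, ENNReal.ofReal (|u s y - u t (y + z)| * b z) := fun y => by
    rw [← lintegral_add_left_eq_self (μ := volume)
      (fun x => ENNReal.ofReal (|u s y - u t x| * b (x - y))) y]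
    simp
  simp only [h1]
  rw [lintegral_lintegral_swap]
  · have h2 : ∀ z, ∫⁻ y, ENNReal.ofReal (|u s y - u t (y + z)| * b z)
        ≤ ENNReal.ofReal ((V * r + V * |t - s| + e) * b z) := fun z => by
      by_cases hz : b z = 0
      · simp [hz]
      have hint : Integrable fun y => |u s y - u t (y + z)| :=
        ((hs.integrable s hs').sub ((hs.integrable t ht).comp_add_right z)).abs
      rw [← ofReal_integral_eq_lintegral_ofReal (hint.mul_const _)
        (ae_of_all _ fun y => mul_nonneg (abs_nonneg _) (hb0 z)), integral_mul_const]
      refine ENNReal.ofReal_le_ofReal (mul_le_mul_of_nonneg_right ?_ (hb0 z))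
      have := hu.translate t ht s hs' z
      simp only [abs_sub_comm (u s _)]
      refine this.trans ?_
      have := hbr z hz
      gcongr
    refine (lintegral_mono h2).trans ?_
    rw [← ofReal_integral_eq_lintegral_ofReal (hbi.const_mul _)
      (ae_of_all _ fun z => mul_nonneg (by positivity) (hb0 z)), integral_const_mul]
  · refine (Measurable.ennreal_ofReal ?_).aemeasurable
    exact ((hms.comp measurable_fst).sub (hmt.comp (measurable_fst.add measurable_snd))).abs.mul
      (hb.comp measurable_snd)

/-- Both kernels keep the displacement below `r`, so the regularity of `u` gains a factor of order
`r` that compensates a weight `Γ` of order `1/r`. -/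
lemma lintegral_kernel_le (hu : Regular T V e u) (hs : StripFun T m u) (hV : 0 ≤ V)
    (he : 0 ≤ e) (hr : 0 ≤ r) (hb : Measurable b) (hb0 : ∀ z, 0 ≤ b z) (hbi : Integrable b)
    (hbr : ∀ z, b z ≠ 0 → |z| ≤ r) (ha : Measurable a) (ha0 : ∀ z, 0 ≤ a z) (hai : Integrable a)
    (har : ∀ z, a z ≠ 0 → |z| ≤ r) (Γ : ℝ → ℝ) :
    ∫⁻ z, ENNReal.ofReal ((|u z.1.1 z.1.2 - u z.2.1 z.2.2| * b (z.2.2 - z.1.2))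
        * a (z.2.1 - z.1.1)) * ENNReal.ofReal (Γ z.1.1)
        ∂(stripMeasure T).prod (stripMeasure T)
      ≤ ∫⁻ s in Set.Ioo 0 T, ENNReal.ofReal ((2 * V * r + e) * (∫ z, b z) * ∫ z, a z)
        * ENNReal.ofReal (Γ s) := by
  have hB0 : 0 ≤ ∫ z, b z := integral_nonneg hb0
  refine (lintegral_prod_le _).trans ?_
  rw [stripMeasure]
  refine (lintegral_prod_le _).trans ?_
  refine lintegral_mono_ae ((ae_restrict_mem measurableSet_Ioo).mono fun s hs' => ?_)
  have hsI : s ∈ Set.Icc 0 T := ⟨hs'.1.le, hs'.2.le⟩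
  have h1 : ∀ y, ∫⁻ p : ℝ × ℝ, ENNReal.ofReal ((|u s y - u p.1 p.2| * b (p.2 - y)) * a (p.1 - s))
        * ENNReal.ofReal (Γ s) ∂(volume.restrict (Set.Ioo 0 T)).prod volume
      ≤ (∫⁻ t in Set.Ioo 0 T, ∫⁻ x, ENNReal.ofReal ((|u s y - u t x| * b (x - y)) * a (t - s)))
        * ENNReal.ofReal (Γ s) := fun y => by
    rw [lintegral_mul_const' _ _ ENNReal.ofReal_ne_top]
    gcongr
    exact lintegral_prod_le _
  refine (lintegral_mono h1).trans ?_
  rw [lintegral_mul_const' _ _ ENNReal.ofReal_ne_top]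
  refine mul_le_mul_left ?_ _
  rw [lintegral_lintegral_swap]
  · have h2 : ∀ t ∈ Set.Ioo 0 T, ∫⁻ y, ∫⁻ x, ENNReal.ofReal ((|u s y - u t x| * b (x - y)) * a (t - s))
        ≤ ENNReal.ofReal (((2 * V * r + e) * ∫ z, b z) * a (t - s)) := fun t ht => by
      have h3 : ∀ y, ∫⁻ x, ENNReal.ofReal ((|u s y - u t x| * b (x - y)) * a (t - s))
          = (∫⁻ x, ENNReal.ofReal (|u s y - u t x| * b (x - y))) * ENNReal.ofReal (a (t - s)) :=
        fun y => by
          rw [← lintegral_mul_const' _ _ ENNReal.ofReal_ne_top]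
          simp only [ENNReal.ofReal_mul' (ha0 _)]
      simp only [h3]
      rw [lintegral_mul_const' _ _ ENNReal.ofReal_ne_top]
      by_cases hz : a (t - s) = 0
      · simp [hz]
      rw [ENNReal.ofReal_mul' (ha0 _)]
      refine mul_le_mul_left ((lintegral_space_kernel_le hu hs hV he hr hb hb0 hbi hbr hsI
        ⟨ht.1.le, ht.2.le⟩).trans (ENNReal.ofReal_le_ofReal ?_)) _
      refine mul_le_mul_of_nonneg_right ?_ hB0
      have := mul_le_mul_of_nonneg_left (har _ hz) hV
      linarith
    refine (lintegral_mono_ae ((ae_restrict_mem measurableSet_Ioo).mono h2)).trans ?_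
    refine (setLIntegral_le_lintegral _ _).trans (le_of_eq ?_)
    rw [← ofReal_integral_eq_lintegral_ofReal ((hai.comp_sub_right s).const_mul _)
      (ae_of_all _ fun t => mul_nonneg (by positivity) (ha0 _)), integral_const_mul,
      integral_sub_right_eq_self]
  · refine Measurable.aemeasurable (Measurable.lintegral_prod_right' (ν := volume)
      (f := fun q : (ℝ × ℝ) × ℝ => ENNReal.ofReal ((|u s q.1.1 - u q.1.2 q.2| * b (q.2 - q.1.1))
        * a (q.1.2 - s))) ?_)
    have m1 : Measurable fun q : (ℝ × ℝ) × ℝ => u s q.1.1 :=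
      hu.measurable.comp (measurable_const.prodMk (measurable_fst.comp measurable_fst))
    have m2 : Measurable fun q : (ℝ × ℝ) × ℝ => u q.1.2 q.2 :=
      hu.measurable.comp ((measurable_snd.comp measurable_fst).prodMk measurable_snd)
    exact (((m1.sub m2).abs.mul (hb.comp (measurable_snd.sub
      (measurable_fst.comp measurable_fst)))).mul
      (ha.comp ((measurable_snd.comp measurable_fst).sub_const s))).ennreal_ofReal

end Kernels

/-! ### Integrals of a function of one point against product kernels. -/

section Convolution

variable {T : ℝ} {H : ℝ × ℝ → ℝ} {a b : ℝ → ℝ}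

lemma integrable_kernel_slice (ha : Integrable a) (hb : Integrable b) (s y : ℝ) :
    Integrable (fun p : ℝ × ℝ => b (p.2 - y) * a (p.1 - s)) (stripMeasure T) := by
  have := ((ha.comp_sub_right s).restrict (s := Set.Ioo 0 T)).mul_prod (hb.comp_sub_right y)
  exact this.congr (ae_of_all _ fun p => mul_comm _ _)

lemma integral_kernel_slice (a b : ℝ → ℝ) (s y : ℝ) :
    ∫ p : ℝ × ℝ, b (p.2 - y) * a (p.1 - s) ∂stripMeasure T
      = (∫ t in Set.Ioo 0 T, a (t - s)) * ∫ z, b z := by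
  rw [← integral_sub_right_eq_self b y, stripMeasure,
    ← integral_prod_mul (fun t => a (t - s)) (fun x => b (x - y))]
  simp only [mul_comm]

lemma integrable_kernel_fst (hH : Integrable H (stripMeasure T)) (ha : Continuous a)
    (hai : Integrable a) (hb : Continuous b) (hbi : Integrable b) :
    Integrable (fun z : (ℝ × ℝ) × (ℝ × ℝ) => H z.1 * (b (z.2.2 - z.1.2) * a (z.2.1 - z.1.1)))
      ((stripMeasure T).prod (stripMeasure T)) := by
  have hm : AEStronglyMeasurable
      (fun z : (ℝ × ℝ) × (ℝ × ℝ) => H z.1 * (b (z.2.2 - z.1.2) * a (z.2.1 - z.1.1)))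
      ((stripMeasure T).prod (stripMeasure T)) := by
    refine hH.1.comp_fst.mul (Continuous.aestronglyMeasurable ?_)
    fun_prop
  refine (integrable_prod_iff hm).2 ⟨ae_of_all _ fun q => ?_, ?_⟩
  · exact (integrable_kernel_slice hai hbi q.1 q.2).const_mul (H q)
  · refine (hH.abs.mul_const ((∫ t, |a t|) * ∫ z, |b z|)).mono' hm.norm.integral_prod_right'
      (ae_of_all _ fun q => ?_)
    have e : ∫ p, ‖H q * (b (p.2 - q.2) * a (p.1 - q.1))‖ ∂stripMeasure T
        = |H q| * ((∫ t in Set.Ioo 0 T, |a (t - q.1)|) * ∫ z, |b z|) := by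
      rw [← integral_kernel_slice (fun t => |a t|) (fun z => |b z|) q.1 q.2, ← integral_const_mul]
      simp only [Real.norm_eq_abs, abs_mul]
    rw [e, Real.norm_of_nonneg (mul_nonneg (abs_nonneg _) (mul_nonneg
      (integral_nonneg fun _ => abs_nonneg _) (integral_nonneg fun _ => abs_nonneg _)))]
    refine mul_le_mul_of_nonneg_left (mul_le_mul_of_nonneg_right ?_
      (integral_nonneg fun _ => abs_nonneg _)) (abs_nonneg _)
    refine (setIntegral_le_integral (hai.comp_sub_right q.1).abs
      (ae_of_all _ fun _ => abs_nonneg _)).trans (le_of_eq ?_)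
    exact integral_sub_right_eq_self (fun t => |a t|) q.1

lemma integral_kernel_fst (hH : Integrable H (stripMeasure T)) (ha : Continuous a)
    (hai : Integrable a) (hb : Continuous b) (hbi : Integrable b) :
    ∫ z : (ℝ × ℝ) × (ℝ × ℝ), H z.1 * (b (z.2.2 - z.1.2) * a (z.2.1 - z.1.1))
        ∂(stripMeasure T).prod (stripMeasure T)
      = ∫ q, H q * ((∫ t in Set.Ioo 0 T, a (t - q.1)) * ∫ z, b z) ∂stripMeasure T := by
  rw [integral_prod _ (integrable_kernel_fst hH ha hai hb hbi)]
  simp only [integral_const_mul, integral_kernel_slice]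

lemma integral_kernel_fst_le (hH : Integrable H (stripMeasure T)) (hH0 : ∀ q, 0 ≤ H q)
    (ha : Continuous a) (hai : Integrable a) (ha0 : ∀ z, 0 ≤ a z) (hb : Continuous b)
    (hbi : Integrable b) (hb0 : ∀ z, 0 ≤ b z) :
    ∫ z : (ℝ × ℝ) × (ℝ × ℝ), H z.1 * (b (z.2.2 - z.1.2) * a (z.2.1 - z.1.1))
        ∂(stripMeasure T).prod (stripMeasure T)
      ≤ (∫ q, H q ∂stripMeasure T) * ((∫ t, a t) * ∫ z, b z) := by
  rw [integral_kernel_fst hH ha hai hb hbi, ← integral_mul_const]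
  refine integral_mono_of_nonneg (ae_of_all _ fun q => mul_nonneg (hH0 q) (mul_nonneg
    (integral_nonneg fun _ => ha0 _) (integral_nonneg hb0))) (hH.mul_const _)
    (ae_of_all _ fun q => ?_)
  refine mul_le_mul_of_nonneg_left (mul_le_mul_of_nonneg_right ?_ (integral_nonneg hb0)) (hH0 q)
  refine (setIntegral_le_integral (hai.comp_sub_right q.1)
    (ae_of_all _ fun _ => ha0 _)).trans (le_of_eq ?_)
  exact integral_sub_right_eq_self a q.1

lemma integrable_kernel_snd (hH : Integrable H (stripMeasure T)) (ha : Continuous a)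
    (hai : Integrable a) (hb : Continuous b) (hbi : Integrable b) :
    Integrable (fun z : (ℝ × ℝ) × (ℝ × ℝ) => H z.2 * (b (z.2.2 - z.1.2) * a (z.2.1 - z.1.1)))
      ((stripMeasure T).prod (stripMeasure T)) := by
  have := (integrable_kernel_fst hH (ha.comp continuous_neg) hai.comp_neg
    (hb.comp continuous_neg) hbi.comp_neg).swap
  refine this.congr (ae_of_all _ fun z => ?_)
  simp

end Convolution

end NonlocalFV

namespace NonlocalFV

/-! ### Doubling of the variables -/

lemma entropyForm_eq {f β ν μ u₀ : ℝ → ℝ} {C T M B : ℝ} {u φ : ℝ → ℝ → ℝ}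
    (hd : DataBound f β ν μ C) (hu : StripFun T M u) (hB : ∀ᵐ p ∂stripMeasure T, |u p.1 p.2| ≤ B)
    (hφ : IsTestFunction T φ) (k : ℝ) :
    entropyForm f β ν μ u₀ T u k φ
      = (∫ p, (|u p.1 p.2 - k| * deriv (fun s => φ s p.2) p.1
          + Real.sign (u p.1 p.2 - k) * nonlocalCoeff β ν μ (u p.1) p.2 * (f (u p.1 p.2) - f k)
            * deriv (fun y => φ p.1 y) p.2
          - f k * Real.sign (u p.1 p.2 - k) * deriv (nonlocalCoeff β ν μ (u p.1)) p.2
            * φ p.1 p.2) ∂stripMeasure T) + ∫ x, |u₀ x - k| * φ 0 x := by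
  have h1 := integrable_entropy_time hu hB hφ k
  have h2 := integrable_entropy_flux hd hu hB hφ k
  have h3 := integrable_entropy_source hd hu hφ k
  have h12 : Integrable (fun p : ℝ × ℝ => |u p.1 p.2 - k| * deriv (fun s => φ s p.2) p.1
      + Real.sign (u p.1 p.2 - k) * nonlocalCoeff β ν μ (u p.1) p.2 * (f (u p.1 p.2) - f k)
        * deriv (fun y => φ p.1 y) p.2) (stripMeasure T) := h1.add h2
  rw [integral_sub h12 h3, integral_add h1 h2, entropyForm, restrict_strip]

lemma StripFun.integrable_uncurry {T M : ℝ} {u : ℝ → ℝ → ℝ} (hu : StripFun T M u) :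
    Integrable (fun p : ℝ × ℝ => u p.1 p.2) (stripMeasure T) := by
  have h1 : ∀ᵐ t ∂volume.restrict (Set.Ioo 0 T), t ∈ Set.Ioo 0 T := ae_restrict_mem measurableSet_Ioo
  refine (integrable_prod_iff hu.aesm).2
    ⟨h1.mono fun t ht => hu.integrable t ⟨ht.1.le, ht.2.le⟩, ?_⟩
  refine Integrable.mono' (g := fun _ => M) (by simp) hu.aesm.norm.integral_prod_right' ?_
  refine h1.mono fun t ht => ?_
  rw [Real.norm_of_nonneg (integral_nonneg fun _ => norm_nonneg _)]
  exact hu.mass t ⟨ht.1.le, ht.2.le⟩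

/-- Two functions to be compared: the first one is regular. -/
structure Pair (f β ν μ : ℝ → ℝ) (C T m V e B : ℝ) (u v : ℝ → ℝ → ℝ) : Prop where
  data : DataBound f β ν μ C
  first : StripFun T m u
  second : StripFun T m v
  regular : Regular T V e u
  V_nonneg : 0 ≤ V
  e_nonneg : 0 ≤ e
  first_bound : ∀ᵐ p ∂stripMeasure T, |u p.1 p.2| ≤ B
  second_bound : ∀ᵐ p ∂stripMeasure T, |v p.1 p.2| ≤ B

/-- The integrand of the entropy inequality of the first solution, at `z = ((s, y), (t, x))`. -/
noncomputable def firstIntegrand (f β ν μ w χ : ℝ → ℝ) (u v : ℝ → ℝ → ℝ)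
    (z : (ℝ × ℝ) × (ℝ × ℝ)) : ℝ :=
  |u z.2.1 z.2.2 - v z.1.1 z.1.2| * (deriv w (z.2.1 - z.1.1) * χ z.1.1 * w (z.2.2 - z.1.2))
  + Real.sign (u z.2.1 z.2.2 - v z.1.1 z.1.2) * nonlocalCoeff β ν μ (u z.2.1) z.2.2
    * (f (u z.2.1 z.2.2) - f (v z.1.1 z.1.2))
    * (w (z.2.1 - z.1.1) * χ z.1.1 * deriv w (z.2.2 - z.1.2))
  - f (v z.1.1 z.1.2) * Real.sign (u z.2.1 z.2.2 - v z.1.1 z.1.2)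
    * deriv (nonlocalCoeff β ν μ (u z.2.1)) z.2.2
    * (w (z.2.1 - z.1.1) * χ z.1.1 * w (z.2.2 - z.1.2))

/-- The integrand of the entropy inequality of the second solution, at `z = ((s, y), (t, x))`. -/
noncomputable def secondIntegrand (f β ν μ w χ : ℝ → ℝ) (u v : ℝ → ℝ → ℝ)
    (z : (ℝ × ℝ) × (ℝ × ℝ)) : ℝ :=
  |v z.1.1 z.1.2 - u z.2.1 z.2.2| * ((-deriv w (z.2.1 - z.1.1) * χ z.1.1
    + w (z.2.1 - z.1.1) * deriv χ z.1.1) * w (z.2.2 - z.1.2))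
  + Real.sign (v z.1.1 z.1.2 - u z.2.1 z.2.2) * nonlocalCoeff β ν μ (v z.1.1) z.1.2
    * (f (v z.1.1 z.1.2) - f (u z.2.1 z.2.2))
    * (w (z.2.1 - z.1.1) * χ z.1.1 * -deriv w (z.2.2 - z.1.2))
  - f (u z.2.1 z.2.2) * Real.sign (v z.1.1 z.1.2 - u z.2.1 z.2.2)
    * deriv (nonlocalCoeff β ν μ (v z.1.1)) z.1.2
    * (w (z.2.1 - z.1.1) * χ z.1.1 * w (z.2.2 - z.1.2))

namespace Pair

variable {f β ν μ u₀ w χ : ℝ → ℝ} {C T m V e B τ X ρ κ b ε : ℝ} {u v : ℝ → ℝ → ℝ}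

local notation "Z₁" => firstIntegrand f β ν μ w χ u v
local notation "Z₂" => secondIntegrand f β ν μ w χ u v

variable (hp : Pair f β ν μ C T m V e B u v) (hw : Mollifier w ρ κ b) (hχ : TimeCutoff χ τ X)

include hp

lemma mass_nonneg (hT : 0 ≤ T) : 0 ≤ m :=
  (integral_nonneg fun _ => abs_nonneg _).trans (hp.first.mass 0 ⟨le_rfl, hT⟩)

include hw hχ

lemma ge_first (hρ : ρ ≤ 1 / 2) (hτ : τ + 2 * ρ < T) {g : ℝ → ℝ}
    (hg : ∀ (k y : ℝ) (φ : ℝ → ℝ → ℝ), IsTestFunction T φ → TestBound φ (2 * b * X * b) 1 y →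
      -(g y + ε * |k|) ≤ entropyForm f β ν μ u₀ T u k φ) {q : ℝ × ℝ} (hq : 0 < q.1) :
    -(g q.2 + ε * |v q.1 q.2|) ≤ ∫ p, Z₁ (q, p) ∂stripMeasure T := by
  obtain ⟨h1, h2⟩ := isTestFunction_first hw hχ hρ hτ hq q.2
  have h := hg (v q.1 q.2) q.2 _ h1 h2
  rw [entropyForm_eq hp.data hp.first hp.first_bound h1] at h
  -- The mollifier vanishes on the negative axis and `s > 0`, so the first inequality has no initial
  -- term.
  have h0 : w (0 - q.1) = 0 := hw.eq_zero fun h => by linarith [h.1]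
  simp only [h0, zero_mul, mul_zero, integral_zero, add_zero] at h
  refine h.trans (le_of_eq ?_)
  congr 1
  funext p
  have e1 : deriv (fun s => w (s - q.1) * χ q.1 * w (p.2 - q.2)) p.1
      = deriv w (p.1 - q.1) * χ q.1 * w (p.2 - q.2) :=
    ((((hw.differentiable (p.1 - q.1)).hasDerivAt.comp_sub_const p.1 q.1).mul_const
      (χ q.1)).mul_const _).deriv
  have e2 : deriv (fun y => w (p.1 - q.1) * χ q.1 * w (y - q.2)) p.2
      = w (p.1 - q.1) * χ q.1 * deriv w (p.2 - q.2) :=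
    (((hw.differentiable (p.2 - q.2)).hasDerivAt.comp_sub_const p.2 q.2).const_mul _).deriv
  rw [e1, e2]
  rfl

lemma ge_second (hρ : ρ ≤ 1 / 2) (hτ : τ < T) {g : ℝ → ℝ}
    (hg : ∀ (k y : ℝ) (φ : ℝ → ℝ → ℝ), IsTestFunction T φ → TestBound φ (2 * b * X * b) 1 y →
      -(g y + ε * |k|) ≤ entropyForm f β ν μ u₀ T v k φ) {p : ℝ × ℝ} (hp' : 0 < p.1) :
    -(g p.2 + ε * |u p.1 p.2|) ≤ (∫ q, Z₂ (q, p) ∂stripMeasure T)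
      + χ 0 * w p.1 * ∫ y, |u₀ y - u p.1 p.2| * w (p.2 - y) := by
  obtain ⟨h1, h2⟩ := isTestFunction_second hw hχ hρ hτ hp' p.2
  have h := hg (u p.1 p.2) p.2 _ h1 h2
  rw [entropyForm_eq hp.data hp.second hp.second_bound h1] at h
  refine h.trans (le_of_eq ?_)
  congr 1
  · congr 1
    funext q
    have e1 : deriv (fun s => w (p.1 - s) * χ s * w (p.2 - q.2)) q.1
        = (-deriv w (p.1 - q.1) * χ q.1 + w (p.1 - q.1) * deriv χ q.1) * w (p.2 - q.2) := by
      have h3 : HasDerivAt (fun s => w (p.1 - s)) (-deriv w (p.1 - q.1)) q.1 :=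
        (hw.differentiable (p.1 - q.1)).hasDerivAt.comp_const_sub p.1 q.1
      exact ((h3.mul (hχ.differentiable q.1).hasDerivAt).mul_const _).deriv
    have e2 : deriv (fun y => w (p.1 - q.1) * χ q.1 * w (p.2 - y)) q.2
        = w (p.1 - q.1) * χ q.1 * -deriv w (p.2 - q.2) :=
      (((hw.differentiable (p.2 - q.2)).hasDerivAt.comp_const_sub p.2 q.2).const_mul _).deriv
    rw [e1, e2]
    rfl
  · rw [← integral_const_mul]
    congr 1
    funext y
    rw [sub_zero]
    ring

/-- Both integrands are dominated by convolution kernels. -/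
lemma integrable_integrands (hT : 0 ≤ T) :
    Integrable Z₁ ((stripMeasure T).prod (stripMeasure T)) ∧
      Integrable Z₂ ((stripMeasure T).prod (stripMeasure T)) := by
  have hd := hp.data
  have hC := hd.nonneg
  have hX := hχ.bound_nonneg
  have hm := hp.mass_nonneg hT
  set a : ℝ → ℝ := fun z => |w z| + |deriv w z| with ha
  have hac : Continuous a := hw.continuous.abs.add hw.continuous_deriv.abs
  have hai : Integrable a := hw.integrable.abs.add hw.integrable_deriv.abs
  have hdom : Integrable (fun z : (ℝ × ℝ) × (ℝ × ℝ) => (1 + C ^ 2 + C ^ 4 * m) * X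
      * (|v z.1.1 z.1.2| * (a (z.2.2 - z.1.2) * a (z.2.1 - z.1.1))
        + |u z.2.1 z.2.2| * (a (z.2.2 - z.1.2) * a (z.2.1 - z.1.1))))
      ((stripMeasure T).prod (stripMeasure T)) :=
    ((integrable_kernel_fst hp.second.integrable_uncurry.abs hac hai hac hai).add
      (integrable_kernel_snd hp.first.integrable_uncurry.abs hac hai hac hai)).const_mul _
  have mu : AEStronglyMeasurable (fun z : (ℝ × ℝ) × (ℝ × ℝ) => u z.2.1 z.2.2)
      ((stripMeasure T).prod (stripMeasure T)) := hp.first.aesm.comp_snd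
  have mv : AEStronglyMeasurable (fun z : (ℝ × ℝ) × (ℝ × ℝ) => v z.1.1 z.1.2)
      ((stripMeasure T).prod (stripMeasure T)) := hp.second.aesm.comp_fst
  have mU : AEStronglyMeasurable (fun z : (ℝ × ℝ) × (ℝ × ℝ) => nonlocalCoeff β ν μ (u z.2.1) z.2.2)
      ((stripMeasure T).prod (stripMeasure T)) := (hp.first.aesm_coeff hd).comp_snd
  have mW : AEStronglyMeasurable (fun z : (ℝ × ℝ) × (ℝ × ℝ) => nonlocalCoeff β ν μ (v z.1.1) z.1.2)
      ((stripMeasure T).prod (stripMeasure T)) := (hp.second.aesm_coeff hd).comp_fst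
  have mU' : AEStronglyMeasurable (fun z : (ℝ × ℝ) × (ℝ × ℝ) =>
      deriv (nonlocalCoeff β ν μ (u z.2.1)) z.2.2)
      ((stripMeasure T).prod (stripMeasure T)) := (hp.first.aesm_deriv_coeff hd).comp_snd
  have mW' : AEStronglyMeasurable (fun z : (ℝ × ℝ) × (ℝ × ℝ) =>
      deriv (nonlocalCoeff β ν μ (v z.1.1)) z.1.2)
      ((stripMeasure T).prod (stripMeasure T)) := (hp.second.aesm_deriv_coeff hd).comp_fst
  have mfu : AEStronglyMeasurable (fun z : (ℝ × ℝ) × (ℝ × ℝ) => f (u z.2.1 z.2.2))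
      ((stripMeasure T).prod (stripMeasure T)) := hd.continuous_f.comp_aestronglyMeasurable mu
  have mfv : AEStronglyMeasurable (fun z : (ℝ × ℝ) × (ℝ × ℝ) => f (v z.1.1 z.1.2))
      ((stripMeasure T).prod (stripMeasure T)) := hd.continuous_f.comp_aestronglyMeasurable mv
  have ms1 : AEStronglyMeasurable (fun z : (ℝ × ℝ) × (ℝ × ℝ) =>
      Real.sign (u z.2.1 z.2.2 - v z.1.1 z.1.2)) ((stripMeasure T).prod (stripMeasure T)) :=
    (measurable_sign.comp_aemeasurable (mu.sub mv).aemeasurable).aestronglyMeasurable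
  have ms2 : AEStronglyMeasurable (fun z : (ℝ × ℝ) × (ℝ × ℝ) =>
      Real.sign (v z.1.1 z.1.2 - u z.2.1 z.2.2)) ((stripMeasure T).prod (stripMeasure T)) :=
    (measurable_sign.comp_aemeasurable (mv.sub mu).aemeasurable).aestronglyMeasurable
  have cw := hw.continuous
  have cw' := hw.continuous_deriv
  have cχ := hχ.continuous
  have cχ' := hχ.continuous_deriv
  have c1 : Continuous fun z : (ℝ × ℝ) × (ℝ × ℝ) =>
      deriv w (z.2.1 - z.1.1) * χ z.1.1 * w (z.2.2 - z.1.2) := by fun_prop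
  have c2 : Continuous fun z : (ℝ × ℝ) × (ℝ × ℝ) =>
      w (z.2.1 - z.1.1) * χ z.1.1 * deriv w (z.2.2 - z.1.2) := by fun_prop
  have c3 : Continuous fun z : (ℝ × ℝ) × (ℝ × ℝ) =>
      w (z.2.1 - z.1.1) * χ z.1.1 * w (z.2.2 - z.1.2) := by fun_prop
  have c4 : Continuous fun z : (ℝ × ℝ) × (ℝ × ℝ) => (-deriv w (z.2.1 - z.1.1) * χ z.1.1
      + w (z.2.1 - z.1.1) * deriv χ z.1.1) * w (z.2.2 - z.1.2) := by fun_prop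
  have c5 : Continuous fun z : (ℝ × ℝ) × (ℝ × ℝ) =>
      w (z.2.1 - z.1.1) * χ z.1.1 * -deriv w (z.2.2 - z.1.2) := by fun_prop
  have m1 : AEStronglyMeasurable Z₁ ((stripMeasure T).prod (stripMeasure T)) :=
    (((mu.sub mv).norm.mul c1.aestronglyMeasurable).add
      (((ms1.mul mU).mul (mfu.sub mfv)).mul c2.aestronglyMeasurable)).sub
      (((mfv.mul ms1).mul mU').mul c3.aestronglyMeasurable)
  have m2 : AEStronglyMeasurable Z₂ ((stripMeasure T).prod (stripMeasure T)) :=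
    (((mv.sub mu).norm.mul c4.aestronglyMeasurable).add
      (((ms2.mul mW).mul (mfv.sub mfu)).mul c5.aestronglyMeasurable)).sub
      (((mfu.mul ms2).mul mW').mul c3.aestronglyMeasurable)
  have hmem : ∀ᵐ z ∂(stripMeasure T).prod (stripMeasure T),
      z.1.1 ∈ Set.Ioo 0 T ∧ z.2.1 ∈ Set.Ioo 0 T :=
    (Measure.quasiMeasurePreserving_fst.ae (ae_strip_mem T)).and
      (Measure.quasiMeasurePreserving_snd.ae (ae_strip_mem T))
  have wa : ∀ z, |w z| ≤ a z := fun z => le_add_of_nonneg_right (abs_nonneg _)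
  have wa' : ∀ z, |deriv w z| ≤ a z := fun z => le_add_of_nonneg_left (abs_nonneg _)
  have a0 : ∀ z, 0 ≤ a z := fun z => add_nonneg (abs_nonneg _) (abs_nonneg _)
  have hχ0 : ∀ s, 0 < s → |χ s| ≤ X := fun s hs => by
    rw [abs_of_nonneg (hχ.nonneg s)]; exact hχ.bound s (by linarith)
  have hk : ∀ {x y s α γ : ℝ}, 0 < s → |α| ≤ a x → |γ| ≤ a y →
      |α * χ s * γ| ≤ X * (a y * a x) := fun {x y s α γ} hs hα hγ => by
    have h0 := hχ0 s hs
    have h1 := a0 x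
    rw [abs_mul, abs_mul]
    calc _ ≤ a x * X * a y := by gcongr
      _ = _ := by ring
  -- One bound serves both integrands; the `G`'s stand for the three kernels, the `U`'s for a
  -- coefficient and its derivative.
  have key : ∀ (x y F1 F2 G1 G2 G3 U0 U1 A1 A2 : ℝ), |G1| ≤ X * (A1 * A2) → |G2| ≤ X * (A1 * A2) →
      |G3| ≤ X * (A1 * A2) → |U0| ≤ C → |U1| ≤ C ^ 3 * m → |F1| ≤ C * |x - y| → |F2| ≤ C * |y| →
      ∀ σ, |σ| ≤ 1 →
      |(|x - y| * G1 + U0 * F1 * G2 - F2 * σ * U1 * G3)|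
        ≤ (1 + C ^ 2 + C ^ 4 * m) * X * (|y| * (A1 * A2) + |x| * (A1 * A2)) := by
    intro x y F1 F2 G1 G2 G3 U0 U1 A1 A2 g1 g2 g3 u0 u1 f1 f2 σ hσ
    have hxy : |x - y| ≤ |x| + |y| := abs_sub _ _
    have hA : 0 ≤ X * (A1 * A2) := (abs_nonneg _).trans g1
    refine (abs_sub _ _).trans ((add_le_add_left (abs_add_le _ _) _).trans ?_)
    rw [abs_mul, abs_abs, abs_mul, abs_mul, abs_mul, abs_mul, abs_mul]
    have b1 : |x - y| * |G1| ≤ (|x| + |y|) * (X * (A1 * A2)) := by gcongr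
    have b2 : |U0| * |F1| * |G2| ≤ C * (C * (|x| + |y|)) * (X * (A1 * A2)) := by
      have : |F1| ≤ C * (|x| + |y|) := f1.trans (by gcongr)
      gcongr
    have b3 : |F2| * |σ| * |U1| * |G3| ≤ C * (|x| + |y|) * 1 * (C ^ 3 * m) * (X * (A1 * A2)) := by
      have : |F2| ≤ C * (|x| + |y|) := f2.trans (by
        have := abs_nonneg x
        gcongr; linarith)
      gcongr
    linarith
  refine ⟨hdom.mono' m1 (hmem.mono fun z hz => ?_), hdom.mono' m2 (hmem.mono fun z hz => ?_)⟩
  · rw [Real.norm_eq_abs, firstIntegrand]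
    have e : Real.sign (u z.2.1 z.2.2 - v z.1.1 z.1.2) * nonlocalCoeff β ν μ (u z.2.1) z.2.2
        * (f (u z.2.1 z.2.2) - f (v z.1.1 z.1.2))
        = nonlocalCoeff β ν μ (u z.2.1) z.2.2 * kruzhkov f (u z.2.1 z.2.2) (v z.1.1 z.1.2) := by
      rw [kruzhkov]; ring
    rw [e]
    refine key _ _ _ _ _ _ _ _ _ _ _ ?_ ?_ ?_ (hd.abs_coeff_le _ _)
      (hd.abs_deriv_coeff_le (hp.first.integrable _ ⟨hz.2.1.le, hz.2.2.le⟩)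
        (hp.first.mass _ ⟨hz.2.1.le, hz.2.2.le⟩) _)
      (hd.abs_kruzhkov_le _ _) (hd.abs_f_le _) _ (abs_sign_le _)
    · exact hk hz.1.1 (wa' _) (wa _)
    · exact hk hz.1.1 (wa _) (wa' _)
    · exact hk hz.1.1 (wa _) (wa _)
  · rw [Real.norm_eq_abs, secondIntegrand]
    have e : Real.sign (v z.1.1 z.1.2 - u z.2.1 z.2.2) * nonlocalCoeff β ν μ (v z.1.1) z.1.2
        * (f (v z.1.1 z.1.2) - f (u z.2.1 z.2.2))
        = nonlocalCoeff β ν μ (v z.1.1) z.1.2 * kruzhkov f (v z.1.1 z.1.2) (u z.2.1 z.2.2) := by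
      rw [kruzhkov]; ring
    rw [e, add_comm (|v z.1.1 z.1.2| * _)]
    have h0 := hχ0 _ hz.1.1
    refine key _ _ _ _ _ _ _ _ _ _ _ ?_ ?_ ?_ (hd.abs_coeff_le _ _)
      (hd.abs_deriv_coeff_le (hp.second.integrable _ ⟨hz.1.1.le, hz.1.2.le⟩)
        (hp.second.mass _ ⟨hz.1.1.le, hz.1.2.le⟩) _)
      (hd.abs_kruzhkov_le _ _) (hd.abs_f_le _) _ (abs_sign_le _)
    · rw [abs_mul]
      have h1 : |(-deriv w (z.2.1 - z.1.1) * χ z.1.1 + w (z.2.1 - z.1.1) * deriv χ z.1.1)|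
          ≤ X * a (z.2.1 - z.1.1) := by
        refine (abs_add_le _ _).trans ?_
        rw [abs_mul, abs_mul, abs_neg]
        have h2 := mul_le_mul_of_nonneg_left h0 (abs_nonneg (deriv w (z.2.1 - z.1.1)))
        have h3 := mul_le_mul_of_nonneg_left (hχ.deriv_bound z.1.1 (by linarith [hz.1.1]))
          (abs_nonneg (w (z.2.1 - z.1.1)))
        simp only [ha]
        linarith
      calc _ ≤ (X * a (z.2.1 - z.1.1)) * a (z.2.2 - z.1.2) := by
            gcongr
            exact wa _
        _ = _ := by ring
    · exact hk hz.1.1 (wa _) (by rw [abs_neg]; exact wa' _)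
    · exact hk hz.1.1 (wa _) (wa _)

end Pair

end NonlocalFV

/-! ### The pointwise estimate of the doubled integrand. -/

namespace NonlocalFV

/-- The distance of `u(s)` and `v(s)` in `L¹(ℝ)`. -/
noncomputable def l1Dist (u v : ℝ → ℝ → ℝ) (s : ℝ) : ℝ := ∫ y, |u s y - v s y|

lemma l1Dist_nonneg (u v : ℝ → ℝ → ℝ) (s : ℝ) : 0 ≤ l1Dist u v s :=
  integral_nonneg fun _ => abs_nonneg _

/-- The combination of the flux and source terms of both entropy inequalities. -/
lemma doubling_algebra {ku0 k0 k : ℝ} (Up Uq Wq Ux Wy fv fu σ χ a b b' : ℝ)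
    (hk : k = σ * (fu - fv)) (h0 : k0 = ku0) :
    (σ * Up * (fu - fv) * (a * χ * b') - fv * σ * Ux * (a * χ * b))
      + (-σ * Wq * (fv - fu) * (a * χ * -b') - fu * -σ * Wy * (a * χ * b))
      = k0 * (Uq - Wq) * χ * (b' * a) + (k * (Up - Uq) + (k - ku0) * (Uq - Wq)) * χ * (b' * a)
        + (k * Wy - σ * fv * (Ux - Wy)) * χ * (b * a) := by
  subst hk h0
  ring

/-- The constant of the terms controlled by the distance. -/
def doublingConst (C m V : ℝ) : ℝ := C * coeffLip C m * (2 * V + 3) + C ^ 4 * m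

namespace Pair

variable {f β ν μ u₀ w χ : ℝ → ℝ} {C T m V e B τ X ρ κ b ε : ℝ} {u v : ℝ → ℝ → ℝ}

local notation "Z₁" => firstIntegrand f β ν μ w χ u v
local notation "Z₂" => secondIntegrand f β ν μ w χ u v

variable (hp : Pair f β ν μ C T m V e B u v) (hw : Mollifier w ρ κ b) (hχ : TimeCutoff χ τ X)

include hp

lemma doublingConst_nonneg (hT : 0 ≤ T) : 0 ≤ doublingConst C m V := by
  have hm := hp.mass_nonneg hT
  have hC := hp.data.nonneg
  have hcl := hp.data.coeffLip_nonneg hm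
  have := hp.V_nonneg
  unfold doublingConst
  positivity

lemma l1Dist_time_le {s t : ℝ} (hs : s ∈ Set.Icc 0 T) (ht : t ∈ Set.Icc 0 T) :
    ∫ y, |u t y - u s y| ≤ V * |t - s| + e := by
  simpa using hp.regular.translate t ht s hs 0

include hw hχ

/-- The first two terms on the right are kept exactly, since they are integrated exactly later: one
gives the distance against `χ'`, the other integrates to zero. The third is a weight at `(s,y)`
times kernels of bounded mass. The last carries `|u(s,y) - u(t,x)|`, which is small after
integration and pays for the `1/ρ` next to it. -/
lemma integrand_le (hρ0 : 0 < ρ) (hρ : ρ ≤ 1 / 2) (he : e ≤ ρ) {s t : ℝ}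
    (hs : s ∈ Set.Icc 0 T) (ht : t ∈ Set.Icc 0 T) (x y : ℝ) :
    Z₁ ((s, y), (t, x)) + Z₂ ((s, y), (t, x))
      ≤ (|u s y - v s y| * deriv χ s) * (w (x - y) * w (t - s))
        + (kruzhkov f (u s y) (v s y) * (nonlocalCoeff β ν μ (u s) y
            - nonlocalCoeff β ν μ (v s) y) * χ s) * (deriv w (x - y) * w (t - s))
        + ((doublingConst C m V * |u s y - v s y| + C * coeffLip C m
            * ((2 * V + 3) * ρ + l1Dist u v s) * |v s y|) * χ s)
          * ((w (x - y) + ρ * |deriv w (x - y)|) * w (t - s))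
        + (|u s y - u t x| * (w (x - y) + ρ * |deriv w (x - y)|)) * w (t - s)
          * (|deriv χ s| + (doublingConst C m V + C * coeffLip C m / ρ * l1Dist u v s) * χ s) := by
  have hT : 0 ≤ T := hs.1.trans hs.2
  have hd := hp.data
  have hC := hd.nonneg
  have hm := hp.mass_nonneg hT
  have hcl := hd.coeffLip_nonneg hm
  have hV := hp.V_nonneg
  have hc2 := hp.doublingConst_nonneg hT
  have hE := l1Dist_nonneg u v s
  have hχ0 := hχ.nonneg s
  have hχ1 := hχ.deriv_nonpos s
  have hneg : Real.sign (v s y - u t x) = -Real.sign (u t x - v s y) := by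
    rw [← Real.sign_neg, neg_sub]
  have hsplit := doubling_algebra (k0 := kruzhkov f (u s y) (v s y)) (nonlocalCoeff β ν μ (u t) x)
    (nonlocalCoeff β ν μ (u s) y) (nonlocalCoeff β ν μ (v s) y)
    (deriv (nonlocalCoeff β ν μ (u t)) x) (deriv (nonlocalCoeff β ν μ (v s)) y)
    (f (v s y)) (f (u t x)) (Real.sign (u t x - v s y)) (χ s) (w (t - s)) (w (x - y))
    (deriv w (x - y)) (k := kruzhkov f (u t x) (v s y)) rfl rfl
  have hZ : Z₁ ((s, y), (t, x)) + Z₂ ((s, y), (t, x))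
      = |u t x - v s y| * deriv χ s * (w (x - y) * w (t - s))
        + ((Real.sign (u t x - v s y) * nonlocalCoeff β ν μ (u t) x * (f (u t x) - f (v s y))
              * (w (t - s) * χ s * deriv w (x - y))
            - f (v s y) * Real.sign (u t x - v s y) * deriv (nonlocalCoeff β ν μ (u t)) x
              * (w (t - s) * χ s * w (x - y)))
          + (-Real.sign (u t x - v s y) * nonlocalCoeff β ν μ (v s) y * (f (v s y) - f (u t x))
              * (w (t - s) * χ s * -deriv w (x - y))
            - f (u t x) * -Real.sign (u t x - v s y) * deriv (nonlocalCoeff β ν μ (v s)) y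
              * (w (t - s) * χ s * w (x - y)))) := by
    simp only [firstIntegrand, secondIntegrand]
    rw [hneg, abs_sub_comm (v s y)]
    ring
  rw [hZ, hsplit]
  by_cases hts : t - s ∈ Set.Icc 0 (2 * ρ)
  swap
  · rw [hw.eq_zero hts]; simp
  by_cases hxy : x - y ∈ Set.Icc 0 (2 * ρ)
  swap
  · have h1 : deriv w (x - y) = 0 := by
      by_contra h2
      exact hxy (hw.deriv_support h2)
    rw [hw.eq_zero hxy, h1]; simp
  have hts' : |t - s| ≤ 2 * ρ := by rw [abs_of_nonneg hts.1]; exact hts.2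
  have hxy' : |x - y| ≤ 2 * ρ := by rw [abs_of_nonneg hxy.1]; exact hxy.2
  have hut := hp.first.integrable t ht
  have hus := hp.first.integrable s hs
  have hvs := hp.second.integrable s hs
  -- `V |t - s|` with `|t - s| ≤ 2 ρ`, plus the defect `e ≤ ρ`. A further `2 ρ` from `|x - y|` gives
  -- the factor `2 V + 3` below.
  have htime : ∫ y, |u t y - u s y| ≤ (2 * V + 1) * ρ := by
    refine (hp.l1Dist_time_le hs ht).trans ?_
    have := mul_le_mul_of_nonneg_left hts' hV
    linarith
  have hUU : |nonlocalCoeff β ν μ (u t) x - nonlocalCoeff β ν μ (u s) y|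
      ≤ coeffLip C m * ((2 * V + 3) * ρ) := by
    refine (hd.abs_coeff_sub_le hut hus (hp.first.mass t ht) x y).trans ?_
    refine mul_le_mul_of_nonneg_left ?_ hcl
    linarith
  have hUW : |nonlocalCoeff β ν μ (u s) y - nonlocalCoeff β ν μ (v s) y|
      ≤ coeffLip C m * l1Dist u v s := by
    refine (hd.abs_coeff_sub_le hus hvs (hp.first.mass s hs) y y).trans (le_of_eq ?_)
    rw [sub_self, abs_zero, zero_add, l1Dist]
  have hUWx : |deriv (nonlocalCoeff β ν μ (u t)) x - deriv (nonlocalCoeff β ν μ (v s)) y|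
      ≤ coeffLip C m * ((2 * V + 3) * ρ + l1Dist u v s) := by
    refine (hd.abs_deriv_coeff_sub_le hut hvs (hp.first.mass t ht) x y).trans ?_
    refine mul_le_mul_of_nonneg_left ?_ hcl
    have h1 : Integrable fun z => |u t z - u s z| := (hut.sub hus).abs
    have h2 : Integrable fun z => |u s z - v s z| := (hus.sub hvs).abs
    have h3 : ∫ z, |u t z - v s z| ≤ (∫ z, |u t z - u s z|) + ∫ z, |u s z - v s z| := by
      rw [← integral_add h1 h2]
      exact integral_mono (hut.sub hvs).abs (h1.add h2) fun z => abs_sub_le _ _ _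
    rw [l1Dist]
    linarith
  have hWy : |deriv (nonlocalCoeff β ν μ (v s)) y| ≤ C ^ 3 * m :=
    hd.abs_deriv_coeff_le hvs (hp.second.mass s hs) y
  have hσ := abs_sign_le (u t x - v s y)
  have hk : |kruzhkov f (u t x) (v s y)| ≤ C * (|u s y - v s y| + |u s y - u t x|) := by
    refine (hd.abs_kruzhkov_le _ _).trans (mul_le_mul_of_nonneg_left ?_ hC)
    have := abs_sub_le (u t x) (u s y) (v s y)
    rw [abs_sub_comm (u t x) (u s y)] at this
    linarith
  have hkk : |kruzhkov f (u t x) (v s y) - kruzhkov f (u s y) (v s y)|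
      ≤ C * |u s y - u t x| := by
    rw [abs_sub_comm (u s y)]; exact hd.abs_kruzhkov_sub_le _ _ _
  have hfv := hd.abs_f_le (v s y)
  have hlow : |u s y - v s y| - |u s y - u t x| ≤ |u t x - v s y| := by
    have := abs_sub_le (u s y) (u t x) (v s y)
    linarith
  have hw0 := hw.nonneg (x - y)
  have hw1 := hw.nonneg (t - s)
  have hw2 : deriv w (x - y) ≤ |deriv w (x - y)| := le_abs_self _
  have hw3 : -|deriv w (x - y)| ≤ deriv w (x - y) := neg_abs_le _
  have hw4 := abs_nonneg (deriv w (x - y))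
  have hd0 := abs_nonneg (u s y - v s y)
  have he0 := abs_nonneg (u s y - u t x)
  have hv0 := abs_nonneg (v s y)
  have hm0 : |deriv χ s| = -deriv χ s := abs_of_nonpos hχ1
  generalize |u s y - v s y| = d at *
  generalize |u s y - u t x| = E at *
  generalize |u t x - v s y| = d' at *
  generalize kruzhkov f (u t x) (v s y) = k at *
  generalize kruzhkov f (u s y) (v s y) = k0 at *
  generalize nonlocalCoeff β ν μ (u t) x - nonlocalCoeff β ν μ (u s) y = p at *
  generalize nonlocalCoeff β ν μ (u s) y - nonlocalCoeff β ν μ (v s) y = r at *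
  generalize deriv (nonlocalCoeff β ν μ (u t)) x - deriv (nonlocalCoeff β ν μ (v s)) y = pp at *
  generalize deriv (nonlocalCoeff β ν μ (v s)) y = Wy at *
  generalize Real.sign (u t x - v s y) = σ at *
  generalize f (v s y) = fv at *
  generalize |v s y| = vv at *
  generalize l1Dist u v s = L at *
  generalize w (t - s) = a at *
  generalize w (x - y) = b0 at *
  generalize deriv w (x - y) = b1 at *
  set cl := coeffLip C m
  have hc3 : 0 ≤ 2 * V + 3 := by linarith
  set c3 := 2 * V + 3
  -- Since `χ' ≤ 0`, the lower bound `d' ≥ d - E` gives an upper bound here.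
  have t1 : d' * deriv χ s * (b0 * a) ≤ d * deriv χ s * (b0 * a)
      + E * |deriv χ s| * ((b0 + ρ * |b1|) * a) := by
    have h1 : d' * deriv χ s ≤ d * deriv χ s + E * |deriv χ s| := by
      rw [hm0]; nlinarith
    have h2 : d' * deriv χ s * (b0 * a) ≤ (d * deriv χ s + E * |deriv χ s|) * (b0 * a) := by gcongr
    have h3 : 0 ≤ E * |deriv χ s| * (ρ * |b1| * a) := by positivity
    linarith
  -- The increment `p` of the coefficient is `O(ρ)` and turns `|w'|` into `ρ |w'|`. The other term
  -- has no such factor; it is written with `1/ρ` and keeps the difference `E` of the values of `u`.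
  have t2 : (k * p + (k - k0) * r) * χ s * (b1 * a)
      ≤ (C * (d + E) * (cl * c3) + C * E * (cl / ρ * L)) * χ s * (ρ * |b1| * a) := by
    have h1 : |k * p + (k - k0) * r| ≤ C * (d + E) * (cl * (c3 * ρ)) + C * E * (cl * L) := by
      refine (abs_add_le _ _).trans ?_
      rw [abs_mul, abs_mul]
      gcongr
    have h2 : (k * p + (k - k0) * r) * b1
        ≤ (C * (d + E) * (cl * (c3 * ρ)) + C * E * (cl * L)) * |b1| := by
      refine (le_abs_self _).trans ?_
      rw [abs_mul]
      gcongr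
    calc _ = ((k * p + (k - k0) * r) * b1) * (χ s * a) := by ring
      _ ≤ ((C * (d + E) * (cl * (c3 * ρ)) + C * E * (cl * L)) * |b1|) * (χ s * a) := by gcongr
      _ = _ := by field_simp
  have t3 : (k * Wy - σ * fv * pp) * χ s * (b0 * a)
      ≤ (C * (d + E) * (C ^ 3 * m) + C * vv * (cl * (c3 * ρ + L))) * χ s * (b0 * a) := by
    have h1 : k * Wy - σ * fv * pp
        ≤ C * (d + E) * (C ^ 3 * m) + 1 * (C * vv) * (cl * (c3 * ρ + L)) := by
      refine (le_abs_self _).trans ((abs_sub _ _).trans ?_)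
      rw [abs_mul, abs_mul, abs_mul]
      gcongr
    rw [one_mul] at h1
    gcongr
  have hc2e : doublingConst C m V = C * cl * c3 + C ^ 4 * m := rfl
  rw [hc2e]
  have p1 : 0 ≤ C ^ 4 * m * (d + E) * χ s * (ρ * |b1| * a) := by positivity
  have p2 : 0 ≤ C * cl * c3 * (d + E) * χ s * (b0 * a) := by positivity
  have p3 : 0 ≤ C * cl * (c3 * ρ + L) * vv * χ s * (ρ * |b1| * a) := by positivity
  have p4 : 0 ≤ E * (C * cl / ρ * L) * χ s * (b0 * a) := by positivity
  have e4 : C * E * (cl / ρ * L) = E * (C * cl / ρ * L) := by ring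
  rw [e4] at t2
  linarith

end Pair

end NonlocalFV

namespace NonlocalFV

lemma ofReal_integral_le {Ω : Type*} [MeasurableSpace Ω] {μ : Measure Ω} {f : Ω → ℝ}
    (hf : ∀ a, 0 ≤ f a) : ENNReal.ofReal (∫ a, f a ∂μ) ≤ ∫⁻ a, ENNReal.ofReal (f a) ∂μ := by
  by_cases h : Integrable f μ
  · exact (ofReal_integral_eq_lintegral_ofReal h (ae_of_all _ hf)).le
  · simp [integral_undef h]

lemma Mollifier.abs_le {w : ℝ → ℝ} {ρ κ b : ℝ} (h : Mollifier w ρ κ b) {z : ℝ} (hz : w z ≠ 0) :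
    |z| ≤ 2 * ρ := by
  have := h.support z hz
  rw [abs_of_nonneg this.1]; exact this.2

/-! ### The initial term and the lower bounds of the doubled integrals. -/

section Initial

variable {T V e m ρ κ b : ℝ} {u : ℝ → ℝ → ℝ} {u₀ w : ℝ → ℝ}

/-- The value `u(0,y)` is inserted. The first part sees the mollifier only through its unit mass;
the second is a displacement of `u` by at most `2 ρ` in space and in time, which costs `4 V ρ + e`.
-/
lemma lintegral_initial_le (hu : Regular T V e u) (hs : StripFun T m u) (hV : 0 ≤ V) (he0 : 0 ≤ e)
    (he : e ≤ ρ) (hw : Mollifier w ρ κ b) (hρ : 0 < ρ) (hu₀ : Integrable u₀) {t : ℝ}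
    (ht : t ∈ Set.Icc 0 T) (htρ : |t| ≤ 2 * ρ) :
    ∫⁻ x, ∫⁻ y, ENNReal.ofReal (|u₀ y - u t x| * w (x - y))
      ≤ ENNReal.ofReal ((∫ y, |u₀ y - u 0 y|) + (4 * V + 1) * ρ) := by
  have hT : (0 : ℝ) ∈ Set.Icc 0 T := ⟨le_rfl, ht.1.trans ht.2⟩
  have hm0 : Measurable (u 0) := hu.measurable.comp (measurable_const.prodMk measurable_id)
  have hmt : Measurable (u t) := hu.measurable.comp (measurable_const.prodMk measurable_id)
  have hwm : Measurable w := hw.continuous.measurable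
  have hF : Measurable fun p : ℝ × ℝ => ENNReal.ofReal (|u 0 p.2 - u t p.1| * w (p.1 - p.2)) :=
    (((hm0.comp measurable_snd).sub (hmt.comp measurable_fst)).abs.mul
      (hwm.comp (measurable_fst.sub measurable_snd))).ennreal_ofReal
  have h1 : ∀ x, ∫⁻ y, ENNReal.ofReal (|u₀ y - u t x| * w (x - y))
      ≤ (∫⁻ y, ENNReal.ofReal (|u₀ y - u 0 y|) * ENNReal.ofReal (w (x - y)))
        + ∫⁻ y, ENNReal.ofReal (|u 0 y - u t x| * w (x - y)) := fun x => by
    have hx : Measurable fun y => ENNReal.ofReal (|u 0 y - u t x| * w (x - y)) :=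
      hF.comp (measurable_const.prodMk measurable_id)
    rw [← lintegral_add_right _ hx]
    refine lintegral_mono fun y => ?_
    rw [← ENNReal.ofReal_mul (abs_nonneg _), ← ENNReal.ofReal_add
      (mul_nonneg (abs_nonneg _) (hw.nonneg _)) (mul_nonneg (abs_nonneg _) (hw.nonneg _)), ← add_mul]
    exact ENNReal.ofReal_le_ofReal (mul_le_mul_of_nonneg_right (abs_sub_le _ _ _) (hw.nonneg _))
  refine (lintegral_mono h1).trans ?_
  rw [lintegral_add_right _ hF.lintegral_prod_right', ENNReal.ofReal_add
    (integral_nonneg fun _ => abs_nonneg _) (by positivity)]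
  refine add_le_add ?_ ?_
  · rw [lintegral_lintegral_swap]
    · have h2 : ∀ y, ∫⁻ x, ENNReal.ofReal (|u₀ y - u 0 y|) * ENNReal.ofReal (w (x - y))
          = ENNReal.ofReal (|u₀ y - u 0 y|) := fun y => by
        rw [lintegral_const_mul' _ _ ENNReal.ofReal_ne_top,
          lintegral_sub_right_eq_self (fun z => ENNReal.ofReal (w z)),
          ← ofReal_integral_eq_lintegral_ofReal hw.integrable (ae_of_all _ hw.nonneg), hw.integral]
        simp
      simp only [h2]
      exact (ofReal_integral_eq_lintegral_ofReal (hu₀.sub (hs.integrable 0 hT)).abs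
        (ae_of_all _ fun _ => abs_nonneg _)).ge
    · have h3 : AEMeasurable (fun y => ENNReal.ofReal (|u₀ y - u 0 y|)) volume :=
        (hu₀.sub (hs.integrable 0 hT)).abs.1.aemeasurable.ennreal_ofReal
      refine AEMeasurable.mul h3.comp_snd (Measurable.aemeasurable ?_)
      exact (hwm.comp (measurable_fst.sub measurable_snd)).ennreal_ofReal
  · rw [lintegral_lintegral_swap hF.aemeasurable]
    refine (lintegral_space_kernel_le hu hs hV he0 (by positivity : 0 ≤ 2 * ρ) hwm hw.nonneg
      hw.integrable (fun z hz => hw.abs_le hz) hT ht).trans (ENNReal.ofReal_le_ofReal ?_)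
    rw [hw.integral, sub_zero]
    have := mul_le_mul_of_nonneg_left htρ hV
    linarith

end Initial

lemma integral_strip_snd {T : ℝ} (hT : 0 ≤ T) {g : ℝ → ℝ} (hg : Integrable g) :
    Integrable (fun q : ℝ × ℝ => g q.2) (stripMeasure T) ∧
      ∫ q : ℝ × ℝ, g q.2 ∂stripMeasure T = T * ∫ y, g y := by
  refine ⟨hg.comp_snd _, ?_⟩
  rw [stripMeasure, integral_fun_snd]
  simp [hT]

lemma StripFun.integral_uncurry_le {T M : ℝ} {u : ℝ → ℝ → ℝ} (hu : StripFun T M u) (hT : 0 ≤ T) :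
    ∫ p : ℝ × ℝ, |u p.1 p.2| ∂stripMeasure T ≤ T * M := by
  have h := hu.integrable_uncurry.abs
  have h2 : IntegrableOn (fun t => ∫ x, |u t x|) (Set.Ioo 0 T) := h.integral_prod_left
  rw [stripMeasure, integral_prod _ h]
  refine (setIntegral_mono_on h2 (by simp) measurableSet_Ioo
    fun t ht => hu.mass t ⟨ht.1.le, ht.2.le⟩).trans ?_
  rw [setIntegral_const, Real.volume_real_Ioo_of_le hT, smul_eq_mul, sub_zero]

namespace Pair

variable {f β ν μ u₀ w χ : ℝ → ℝ} {C T m V e B τ X ρ κ b ε : ℝ} {u v : ℝ → ℝ → ℝ}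

local notation "Z₁" => firstIntegrand f β ν μ w χ u v
local notation "Z₂" => secondIntegrand f β ν μ w χ u v

variable (hp : Pair f β ν μ C T m V e B u v) (hw : Mollifier w ρ κ b) (hχ : TimeCutoff χ τ X)

include hp hw hχ

/-- The error `g(y) + ε |v(s,y)|` is integrated over the strip. It stays of order `ε` because `g`
and `v` have bounded mass; a constant error would not be integrable. -/
lemma integral_first_ge (hT : 0 ≤ T) (hρ : ρ ≤ 1 / 2) (hτ : τ + 2 * ρ < T) (hε : 0 ≤ ε)
    (h : ApproxEntropy f β ν μ u₀ T u (2 * b * X * b) 1 ε) :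
    -(T * ε * (1 + m)) ≤ ∫ z, Z₁ z ∂(stripMeasure T).prod (stripMeasure T) := by
  obtain ⟨g, -, hgi, hg1, hg⟩ := h
  have hI := (hp.integrable_integrands hw hχ hT).1
  obtain ⟨s1, s2⟩ := integral_strip_snd hT hgi
  have s3 := hp.second.integrable_uncurry.abs
  have s4 := hp.second.integral_uncurry_le hT
  have s5 : Integrable (fun q : ℝ × ℝ => ε * |v q.1 q.2|) (stripMeasure T) := s3.const_mul ε
  have s6 : Integrable (fun q : ℝ × ℝ => g q.2 + ε * |v q.1 q.2|) (stripMeasure T) := s1.add s5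
  rw [integral_prod _ hI]
  have h1 : ∫ q : ℝ × ℝ, -(g q.2 + ε * |v q.1 q.2|) ∂stripMeasure T
      ≤ ∫ q, (∫ p, Z₁ (q, p) ∂stripMeasure T) ∂stripMeasure T :=
    integral_mono_ae s6.neg hI.integral_prod_left ((ae_strip_mem T).mono fun q hq =>
      hp.ge_first hw hχ hρ hτ hg hq.1)
  refine le_trans ?_ h1
  rw [integral_neg, integral_add s1 s5, s2, integral_const_mul]
  have h2 := mul_le_mul_of_nonneg_left hg1 hT
  have h3 := mul_le_mul_of_nonneg_left s4 hε
  linarith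

lemma integral_second_ge (hT : 0 ≤ T) (hρ0 : 0 < ρ) (hρ : ρ ≤ 1 / 2) (hτ : τ < T) (hε : 0 ≤ ε)
    (he : e ≤ ρ) (hu₀ : Integrable u₀)
    (h : ApproxEntropy f β ν μ u₀ T v (2 * b * X * b) 1 ε) :
    -(T * ε * (1 + m)) - X * ((∫ y, |u₀ y - u 0 y|) + (4 * V + 1) * ρ)
      ≤ ∫ z, Z₂ z ∂(stripMeasure T).prod (stripMeasure T) := by
  obtain ⟨g, -, hgi, hg1, hg⟩ := h
  have hX := hχ.bound_nonneg
  have hV := hp.V_nonneg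
  have hδ : 0 ≤ ∫ y, |u₀ y - u 0 y| := integral_nonneg fun _ => abs_nonneg _
  have hI := (hp.integrable_integrands hw hχ hT).2
  obtain ⟨s1, s2⟩ := integral_strip_snd hT hgi
  have s3 := hp.first.integrable_uncurry.abs
  have s4 := hp.first.integral_uncurry_le hT
  have s5 : Integrable (fun q : ℝ × ℝ => ε * |u q.1 q.2|) (stripMeasure T) := s3.const_mul ε
  have s6 : Integrable (fun q : ℝ × ℝ => g q.2 + ε * |u q.1 q.2|) (stripMeasure T) := s1.add s5
  have s7 : Integrable (fun p => -(∫ q, Z₂ (q, p) ∂stripMeasure T)) (stripMeasure T) :=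
    hI.integral_prod_right.neg
  have h1 : ∫ p, (-(∫ q, Z₂ (q, p) ∂stripMeasure T) - (g p.2 + ε * |u p.1 p.2|)) ∂stripMeasure T
      ≤ X * ((∫ y, |u₀ y - u 0 y|) + (4 * V + 1) * ρ) := by
    -- The use of the lower Lebesgue integral avoids a proof that the initial term is integrable in
    -- `(t,x)`.
    refine integral_le_of_lintegral_le (by positivity) ?_
    have h2 : ∀ᵐ p ∂stripMeasure T,
        ENNReal.ofReal (-(∫ q, Z₂ (q, p) ∂stripMeasure T) - (g p.2 + ε * |u p.1 p.2|))
        ≤ ENNReal.ofReal (X * w p.1)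
          * ∫⁻ y, ENNReal.ofReal (|u₀ y - u p.1 p.2| * w (p.2 - y)) := by
      refine (ae_strip_mem T).mono fun p hp' => ?_
      have h3 := hp.ge_second (u₀ := u₀) hw hχ hρ hτ hg hp'.1
      have h4 : 0 ≤ ∫ y, |u₀ y - u p.1 p.2| * w (p.2 - y) :=
        integral_nonneg fun y => mul_nonneg (abs_nonneg _) (hw.nonneg _)
      have h5 : χ 0 * w p.1 ≤ X * w p.1 :=
        mul_le_mul_of_nonneg_right (hχ.bound 0 (by norm_num)) (hw.nonneg _)
      have h6 := mul_le_mul_of_nonneg_right h5 h4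
      refine (ENNReal.ofReal_le_ofReal (by linarith : _ ≤ X * w p.1
        * ∫ y, |u₀ y - u p.1 p.2| * w (p.2 - y))).trans ?_
      rw [ENNReal.ofReal_mul (mul_nonneg hX (hw.nonneg _))]
      gcongr
      exact ofReal_integral_le fun y => mul_nonneg (abs_nonneg _) (hw.nonneg _)
    refine (lintegral_mono_ae h2).trans ?_
    rw [stripMeasure]
    refine (lintegral_prod_le _).trans ?_
    have h7 : ∀ t ∈ Set.Ioo 0 T, ∫⁻ x, ENNReal.ofReal (X * w t)
          * ∫⁻ y, ENNReal.ofReal (|u₀ y - u t x| * w (x - y))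
        ≤ ENNReal.ofReal (X * ((∫ y, |u₀ y - u 0 y|) + (4 * V + 1) * ρ) * w t) := fun t ht => by
      rw [lintegral_const_mul' _ _ ENNReal.ofReal_ne_top]
      by_cases hz : w t = 0
      · simp [hz]
      have h8 := lintegral_initial_le hp.regular hp.first hV hp.e_nonneg he hw hρ0 hu₀
        ⟨ht.1.le, ht.2.le⟩ (hw.abs_le hz)
      refine (mul_le_mul_right h8 _).trans (le_of_eq ?_)
      rw [← ENNReal.ofReal_mul (mul_nonneg hX (hw.nonneg _))]
      congr 1
      ring
    refine (lintegral_mono_ae ((ae_restrict_mem measurableSet_Ioo).mono h7)).trans ?_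
    refine (setLIntegral_le_lintegral _ _).trans (le_of_eq ?_)
    rw [← ofReal_integral_eq_lintegral_ofReal (hw.integrable.const_mul _)
      (ae_of_all _ fun t => mul_nonneg (by positivity) (hw.nonneg _)), integral_const_mul,
      hw.integral, mul_one]
  rw [integral_sub s7 s6, integral_neg, integral_add s1 s5, s2, integral_const_mul] at h1
  rw [integral_prod_symm _ hI]
  have h2 := mul_le_mul_of_nonneg_left hg1 hT
  have h3 := mul_le_mul_of_nonneg_left s4 hε
  linarith

end Pair

end NonlocalFV

/-! ### The upper bound of the doubled integral and the Gronwall inequality. -/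

namespace NonlocalFV

namespace Pair

variable {f β ν μ u₀ w χ : ℝ → ℝ} {C T m V e B τ X ρ κ b ε : ℝ} {u v : ℝ → ℝ → ℝ}

local notation "Z₁" => firstIntegrand f β ν μ w χ u v
local notation "Z₂" => secondIntegrand f β ν μ w χ u v

variable (hp : Pair f β ν μ C T m V e B u v) (hw : Mollifier w ρ κ b) (hχ : TimeCutoff χ τ X)

include hp

lemma integrable_sub :
    Integrable (fun q : ℝ × ℝ => |u q.1 q.2 - v q.1 q.2|) (stripMeasure T) :=
  (hp.first.integrable_uncurry.sub hp.second.integrable_uncurry).abs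

lemma integrableOn_l1Dist : IntegrableOn (l1Dist u v) (Set.Ioo 0 T) :=
  hp.integrable_sub.integral_prod_left

lemma l1Dist_le {s : ℝ} (hs : s ∈ Set.Icc 0 T) : l1Dist u v s ≤ 2 * m := by
  have h1 := (hp.first.integrable s hs).abs
  have h2 := (hp.second.integrable s hs).abs
  calc l1Dist u v s ≤ ∫ y, (|u s y| + |v s y|) :=
        integral_mono ((hp.first.integrable s hs).sub (hp.second.integrable s hs)).abs (h1.add h2)
          fun y => abs_sub _ _
    _ = (∫ y, |u s y|) + ∫ y, |v s y| := integral_add h1 h2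
    _ ≤ _ := by linarith [hp.first.mass s hs, hp.second.mass s hs]

include hχ

lemma integrableOn_l1Dist_mul : IntegrableOn (fun s => l1Dist u v s * χ s) (Set.Ioo 0 T) :=
  hp.integrableOn_l1Dist.mul_bdd (c := X) hχ.continuous.aestronglyMeasurable
    ((ae_restrict_mem measurableSet_Ioo).mono fun s hs => by
      rw [Real.norm_of_nonneg (hχ.nonneg s)]
      exact hχ.bound s (by linarith [hs.1]))

lemma integrableOn_l1Dist_mul_deriv :
    IntegrableOn (fun s => l1Dist u v s * deriv χ s) (Set.Ioo 0 T) :=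
  hp.integrableOn_l1Dist.mul_bdd (c := X) hχ.continuous_deriv.aestronglyMeasurable
    ((ae_restrict_mem measurableSet_Ioo).mono fun s hs => hχ.deriv_bound s (by linarith [hs.1]))

/-- The function multiplying the consistency kernels. -/
lemma integrable_weight (hT : 0 ≤ T) {c₁ c₂ c₃ : ℝ} :
    Integrable (fun q : ℝ × ℝ => (c₁ * |u q.1 q.2 - v q.1 q.2|
      + c₂ * (c₃ + l1Dist u v q.1) * |v q.1 q.2|) * χ q.1) (stripMeasure T) ∧
    (0 ≤ c₁ → 0 ≤ c₂ → 0 ≤ c₃ → ∫ q : ℝ × ℝ, (c₁ * |u q.1 q.2 - v q.1 q.2|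
      + c₂ * (c₃ + l1Dist u v q.1) * |v q.1 q.2|) * χ q.1 ∂stripMeasure T
      ≤ c₁ * (∫ s in Set.Ioo 0 T, l1Dist u v s * χ s)
        + c₂ * (c₃ * m * X * T + m * ∫ s in Set.Ioo 0 T, l1Dist u v s * χ s)) := by
  have hm := hp.mass_nonneg hT
  have hE : AEStronglyMeasurable (fun q : ℝ × ℝ => c₂ * (c₃ + l1Dist u v q.1)) (stripMeasure T) :=
    (aestronglyMeasurable_const.add hp.integrableOn_l1Dist.1.comp_fst).const_mul c₂
  have hE2 : ∀ᵐ q ∂stripMeasure T, ‖c₂ * (c₃ + l1Dist u v q.1)‖ ≤ |c₂| * (|c₃| + 2 * m) :=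
    (ae_strip_mem T).mono fun q hq => by
      rw [Real.norm_eq_abs, abs_mul]
      refine mul_le_mul_of_nonneg_left ((abs_add_le _ _).trans ?_) (abs_nonneg _)
      rw [abs_of_nonneg (l1Dist_nonneg u v q.1)]
      linarith [hp.l1Dist_le ⟨hq.1.le, hq.2.le⟩]
  have i2 : Integrable (fun q : ℝ × ℝ => c₂ * (c₃ + l1Dist u v q.1) * |v q.1 q.2|)
      (stripMeasure T) := hp.second.integrable_uncurry.abs.bdd_mul hE hE2
  have i12 : Integrable (fun q : ℝ × ℝ => c₁ * |u q.1 q.2 - v q.1 q.2|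
      + c₂ * (c₃ + l1Dist u v q.1) * |v q.1 q.2|) (stripMeasure T) :=
    (hp.integrable_sub.const_mul c₁).add i2
  have i3 : Integrable (fun q : ℝ × ℝ => (c₁ * |u q.1 q.2 - v q.1 q.2|
      + c₂ * (c₃ + l1Dist u v q.1) * |v q.1 q.2|) * χ q.1) (stripMeasure T) :=
    i12.mul_bdd (c := X) (hχ.continuous.comp continuous_fst).aestronglyMeasurable
      ((ae_strip_mem T).mono fun q hq => by
        rw [Real.norm_of_nonneg (hχ.nonneg _)]
        exact hχ.bound _ (by linarith [hq.1]))
  refine ⟨i3, fun hc₁ hc₂ hc₃ => ?_⟩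
  have j1 := hp.integrableOn_l1Dist_mul hχ
  have jc : IntegrableOn (fun s => c₂ * (c₃ * m * X)) (Set.Ioo 0 T) :=
    continuous_const.integrableOn_Icc.mono_set Set.Ioo_subset_Icc_self
  have j2 : IntegrableOn (fun s => (c₁ + c₂ * m) * (l1Dist u v s * χ s)) (Set.Ioo 0 T) :=
    j1.const_mul _
  have h1 : ∀ s ∈ Set.Ioo 0 T, ∫ y, (c₁ * |u s y - v s y|
      + c₂ * (c₃ + l1Dist u v s) * |v s y|) * χ s
      ≤ (c₁ + c₂ * m) * (l1Dist u v s * χ s) + c₂ * (c₃ * m * X) := fun s hs => by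
    have hs' : s ∈ Set.Icc 0 T := ⟨hs.1.le, hs.2.le⟩
    have k1 : Integrable fun y => c₁ * |u s y - v s y| :=
      ((hp.first.integrable s hs').sub (hp.second.integrable s hs')).abs.const_mul c₁
    have k2 : Integrable fun y => c₂ * (c₃ + l1Dist u v s) * |v s y| :=
      (hp.second.integrable s hs').abs.const_mul _
    rw [integral_mul_const, integral_add k1 k2, integral_const_mul, integral_const_mul]
    have hχ0 := hχ.nonneg s
    have hχ1 := hχ.bound s (by linarith [hs.1])
    have hL := l1Dist_nonneg u v s
    have hmass := hp.second.mass s hs'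
    have h2 : c₂ * (c₃ + l1Dist u v s) * (∫ y, |v s y|) ≤ c₂ * (c₃ + l1Dist u v s) * m := by gcongr
    have h3 : (c₁ * (∫ y, |u s y - v s y|) + c₂ * (c₃ + l1Dist u v s) * (∫ y, |v s y|)) * χ s
        ≤ (c₁ * l1Dist u v s + c₂ * (c₃ + l1Dist u v s) * m) * χ s := by
      rw [l1Dist] at h2 ⊢
      gcongr
    have h4 : c₂ * c₃ * m * χ s ≤ c₂ * c₃ * m * X := by gcongr
    linarith
  rw [stripMeasure, integral_prod _ i3]
  have j3 : IntegrableOn (fun s => (c₁ + c₂ * m) * (l1Dist u v s * χ s) + c₂ * (c₃ * m * X))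
      (Set.Ioo 0 T) := j2.add jc
  refine (setIntegral_mono_on i3.integral_prod_left j3 measurableSet_Ioo h1).trans ?_
  rw [integral_add j2 jc, integral_const_mul, setIntegral_const, Real.volume_real_Ioo_of_le hT,
    smul_eq_mul]
  linarith

include hw

/-- For `s < τ` the mollifier in time has its whole mass inside `(0,T)`, because its support is `[s,
s + 2 ρ]`; for `s ≥ τ` the derivative of the cutoff vanishes. -/
lemma integral_distance_kernel (hρ : 0 < ρ) (hτ : τ + 2 * ρ < T) :
    Integrable (fun z : (ℝ × ℝ) × (ℝ × ℝ) => (|u z.1.1 z.1.2 - v z.1.1 z.1.2| * deriv χ z.1.1)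
        * (w (z.2.2 - z.1.2) * w (z.2.1 - z.1.1))) ((stripMeasure T).prod (stripMeasure T)) ∧
    ∫ z : (ℝ × ℝ) × (ℝ × ℝ), (|u z.1.1 z.1.2 - v z.1.1 z.1.2| * deriv χ z.1.1)
        * (w (z.2.2 - z.1.2) * w (z.2.1 - z.1.1)) ∂(stripMeasure T).prod (stripMeasure T)
      = ∫ s in Set.Ioo 0 T, l1Dist u v s * deriv χ s := by
  have i1 : Integrable (fun q : ℝ × ℝ => |u q.1 q.2 - v q.1 q.2| * deriv χ q.1)
      (stripMeasure T) :=
    hp.integrable_sub.mul_bdd (c := X) (hχ.continuous_deriv.comp continuous_fst).aestronglyMeasurable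
      ((ae_strip_mem T).mono fun q hq => hχ.deriv_bound _ (by linarith [hq.1]))
  refine ⟨integrable_kernel_fst i1 hw.continuous hw.integrable hw.continuous hw.integrable, ?_⟩
  rw [integral_kernel_fst i1 hw.continuous hw.integrable hw.continuous hw.integrable, hw.integral]
  have h1 : ∫ q : ℝ × ℝ, |u q.1 q.2 - v q.1 q.2| * deriv χ q.1
        * ((∫ t in Set.Ioo 0 T, w (t - q.1)) * 1) ∂stripMeasure T
      = ∫ q : ℝ × ℝ, |u q.1 q.2 - v q.1 q.2| * deriv χ q.1 ∂stripMeasure T := by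
    refine integral_congr_ae ((ae_strip_mem T).mono fun q hq => ?_)
    dsimp only
    by_cases hs : τ ≤ q.1
    · rw [hχ.deriv_eq_zero hs]; simp
    · have h2 : ∫ t in Set.Ioo 0 T, w (t - q.1) = 1 := by
        rw [setIntegral_eq_integral_of_forall_compl_eq_zero, integral_sub_right_eq_self w q.1,
          hw.integral]
        intro t ht
        by_contra h3
        have h4 := hw.support _ h3
        have h5 := not_le.1 hs
        rcases h4.1.eq_or_lt with h6 | h6
        · exact ht ⟨by linarith [hq.1], by linarith [hq.2]⟩
        · exact ht ⟨by linarith [hq.1], by linarith [h4.2]⟩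
      rw [h2, one_mul, mul_one]
  rw [h1, stripMeasure, integral_prod _ i1]
  simp only [integral_mul_const]
  rfl

/-- The weight depends on `(s,y)` only, so the integral over `x` meets nothing but `w'`, which has
mean zero. A term of order `1/ρ` disappears without any regularity of `v`. -/
lemma integral_special_kernel :
    Integrable (fun z : (ℝ × ℝ) × (ℝ × ℝ) => (kruzhkov f (u z.1.1 z.1.2) (v z.1.1 z.1.2)
        * (nonlocalCoeff β ν μ (u z.1.1) z.1.2 - nonlocalCoeff β ν μ (v z.1.1) z.1.2) * χ z.1.1)
        * (deriv w (z.2.2 - z.1.2) * w (z.2.1 - z.1.1)))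
      ((stripMeasure T).prod (stripMeasure T)) ∧
    ∫ z : (ℝ × ℝ) × (ℝ × ℝ), (kruzhkov f (u z.1.1 z.1.2) (v z.1.1 z.1.2)
        * (nonlocalCoeff β ν μ (u z.1.1) z.1.2 - nonlocalCoeff β ν μ (v z.1.1) z.1.2) * χ z.1.1)
        * (deriv w (z.2.2 - z.1.2) * w (z.2.1 - z.1.1))
        ∂(stripMeasure T).prod (stripMeasure T) = 0 := by
  have hd := hp.data
  have hC := hd.nonneg
  have hX := hχ.bound_nonneg
  have mu := hp.first.integrable_uncurry.1
  have mv := hp.second.integrable_uncurry.1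
  have i1 : Integrable (fun q : ℝ × ℝ => kruzhkov f (u q.1 q.2) (v q.1 q.2)
      * (nonlocalCoeff β ν μ (u q.1) q.2 - nonlocalCoeff β ν μ (v q.1) q.2) * χ q.1)
      (stripMeasure T) := by
    refine (hp.integrable_sub.const_mul (C * (C + C) * X)).mono' ?_
      ((ae_strip_mem T).mono fun q hq => ?_)
    · exact ((((measurable_sign.comp_aemeasurable (mu.sub mv).aemeasurable).aestronglyMeasurable.mul
        ((hd.continuous_f.comp_aestronglyMeasurable mu).sub
          (hd.continuous_f.comp_aestronglyMeasurable mv))).mul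
        ((hp.first.aesm_coeff hd).sub (hp.second.aesm_coeff hd))).mul
        (hχ.continuous.comp continuous_fst).aestronglyMeasurable)
    · rw [norm_mul, norm_mul, Real.norm_of_nonneg (hχ.nonneg _)]
      have h1 : ‖kruzhkov f (u q.1 q.2) (v q.1 q.2)‖ ≤ C * |u q.1 q.2 - v q.1 q.2| :=
        hd.abs_kruzhkov_le _ _
      have h2 : ‖nonlocalCoeff β ν μ (u q.1) q.2 - nonlocalCoeff β ν μ (v q.1) q.2‖ ≤ C + C :=
        (abs_sub _ _).trans (add_le_add (hd.abs_coeff_le _ _) (hd.abs_coeff_le _ _))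
      have h3 := hχ.bound q.1 (by linarith [hq.1])
      have h4 := hχ.nonneg q.1
      calc _ ≤ (C * |u q.1 q.2 - v q.1 q.2|) * (C + C) * X := by gcongr
        _ = _ := by ring
  refine ⟨integrable_kernel_fst i1 hw.continuous hw.integrable hw.continuous_deriv
    hw.integrable_deriv, ?_⟩
  rw [integral_kernel_fst i1 hw.continuous hw.integrable hw.continuous_deriv
    hw.integrable_deriv, hw.integral_deriv_eq_zero]
  simp

/-- The integrated form of `integrand_le`. The first three terms are integrable and are moved to the
left; the last is bounded by `lintegral_kernel_le` with displacement `2 ρ`, where `2 V · 2 ρ + e ≤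
(4 V + 1) ρ`. The factor `1 + κ` is the mass of `w + ρ |w'|`. -/
lemma integral_le (hT : 0 ≤ T) (hρ0 : 0 < ρ) (hρ : ρ ≤ 1 / 2) (he : e ≤ ρ)
    (hτ : τ + 2 * ρ < T) :
    (∫ z, Z₁ z ∂(stripMeasure T).prod (stripMeasure T))
        + ∫ z, Z₂ z ∂(stripMeasure T).prod (stripMeasure T)
      ≤ (∫ s in Set.Ioo 0 T, l1Dist u v s * deriv χ s)
        + (1 + κ) * (doublingConst C m V * (∫ s in Set.Ioo 0 T, l1Dist u v s * χ s)
          + C * coeffLip C m * ((2 * V + 3) * ρ * m * X * T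
            + m * ∫ s in Set.Ioo 0 T, l1Dist u v s * χ s))
        + (4 * V + 1) * ρ * (1 + κ) * ((1 + doublingConst C m V) * X * T
          + C * coeffLip C m / ρ * ∫ s in Set.Ioo 0 T, l1Dist u v s * χ s) := by
  have hd := hp.data
  have hC := hd.nonneg
  have hX := hχ.bound_nonneg
  have hm := hp.mass_nonneg hT
  have hV := hp.V_nonneg
  have he0 := hp.e_nonneg
  have hcl := hd.coeffLip_nonneg hm
  have hc2 := hp.doublingConst_nonneg hT
  obtain ⟨I1, I2⟩ := hp.integrable_integrands hw hχ hT
  obtain ⟨J1, J2⟩ := hp.integral_distance_kernel hw hχ hρ0 hτ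
  obtain ⟨J3, J4⟩ := hp.integral_special_kernel hw hχ
  obtain ⟨W1, W2⟩ := hp.integrable_weight hχ hT (c₁ := doublingConst C m V)
    (c₂ := C * coeffLip C m) (c₃ := (2 * V + 3) * ρ)
  have W3 := W2 hc2 (by positivity) (by positivity)
  set bb : ℝ → ℝ := fun z => w z + ρ * |deriv w z| with hbb
  have bbc : Continuous bb := hw.continuous.add (hw.continuous_deriv.abs.const_mul ρ)
  have bbi : Integrable bb := hw.integrable.add (hw.integrable_deriv.abs.const_mul ρ)
  have bb0 : ∀ z, 0 ≤ bb z := fun z =>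
    add_nonneg (hw.nonneg z) (mul_nonneg hρ0.le (abs_nonneg _))
  have bbs : ∀ z, bb z ≠ 0 → |z| ≤ 2 * ρ := fun z hz => by
    by_cases h1 : w z = 0
    · have h2 : deriv w z ≠ 0 := fun h3 => hz (by simp [hbb, h1, h3])
      have h4 := hw.deriv_support h2
      rw [abs_of_nonneg h4.1]; exact h4.2
    · exact hw.abs_le h1
  have bbint : ∫ z, bb z ≤ 1 + κ := by
    simp only [hbb]
    rw [integral_add hw.integrable (hw.integrable_deriv.abs.const_mul ρ), hw.integral,
      integral_const_mul]
    have h1 := mul_le_mul_of_nonneg_left hw.integral_deriv hρ0.le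
    rw [mul_div_cancel₀ _ hρ0.ne'] at h1
    linarith
  have bbint0 : 0 ≤ ∫ z, bb z := integral_nonneg bb0
  have J5 := integrable_kernel_fst W1 hw.continuous hw.integrable bbc bbi
  have J6 := integral_kernel_fst_le W1 (fun q => mul_nonneg (add_nonneg
    (mul_nonneg hc2 (abs_nonneg _)) (mul_nonneg (mul_nonneg (by positivity)
      (add_nonneg (by positivity) (l1Dist_nonneg _ _ _))) (abs_nonneg _))) (hχ.nonneg _))
    hw.continuous hw.integrable hw.nonneg bbc bbi bb0
  rw [hw.integral, one_mul] at J6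
  set J := ∫ s in Set.Ioo 0 T, l1Dist u v s * χ s with hJ
  have hJ0 : 0 ≤ J := integral_nonneg fun s => mul_nonneg (l1Dist_nonneg _ _ _) (hχ.nonneg _)
  set Γ : ℝ → ℝ := fun s => |deriv χ s| + (doublingConst C m V
    + C * coeffLip C m / ρ * l1Dist u v s) * χ s with hΓ
  have Γ0 : ∀ s, 0 ≤ Γ s := fun s => add_nonneg (abs_nonneg _) (mul_nonneg (add_nonneg hc2
    (mul_nonneg (by positivity) (l1Dist_nonneg _ _ _))) (hχ.nonneg s))
  have Γi : IntegrableOn Γ (Set.Ioo 0 T) := by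
    have h1 : IntegrableOn (fun s => |deriv χ s|) (Set.Ioo 0 T) :=
      (hχ.continuous_deriv.abs.integrableOn_Icc).mono_set Set.Ioo_subset_Icc_self
    have h2 : IntegrableOn χ (Set.Ioo 0 T) :=
      (hχ.continuous.integrableOn_Icc).mono_set Set.Ioo_subset_Icc_self
    refine (h1.add ((h2.const_mul (doublingConst C m V)).add
      ((hp.integrableOn_l1Dist_mul hχ).const_mul (C * coeffLip C m / ρ)))).congr
      (ae_of_all _ fun s => ?_)
    simp only [Pi.add_apply, hΓ]
    ring
  have Γle : ∫ s in Set.Ioo 0 T, Γ s ≤ (1 + doublingConst C m V) * X * T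
      + C * coeffLip C m / ρ * J := by
    have h1 : IntegrableOn (fun _ => (1 + doublingConst C m V) * X) (Set.Ioo 0 T) :=
    continuous_const.integrableOn_Icc.mono_set Set.Ioo_subset_Icc_self
    have h2 : IntegrableOn (fun s => C * coeffLip C m / ρ * (l1Dist u v s * χ s)) (Set.Ioo 0 T) :=
      (hp.integrableOn_l1Dist_mul hχ).const_mul _
    have h12 : IntegrableOn (fun s => (1 + doublingConst C m V) * X
        + C * coeffLip C m / ρ * (l1Dist u v s * χ s)) (Set.Ioo 0 T) := h1.add h2
    refine (setIntegral_mono_on Γi h12 measurableSet_Ioo fun s hs => ?_).trans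
      (le_of_eq ?_)
    · simp only [hΓ]
      have h3 := hχ.deriv_bound s (by linarith [hs.1])
      have h4 := mul_le_mul_of_nonneg_left (hχ.bound s (by linarith [hs.1])) hc2
      linarith
    · rw [integral_add h1 h2, setIntegral_const, integral_const_mul,
        Real.volume_real_Ioo_of_le hT, smul_eq_mul]
      ring
  have key : ∫ z : (ℝ × ℝ) × (ℝ × ℝ), (Z₁ z + Z₂ z
      - (|u z.1.1 z.1.2 - v z.1.1 z.1.2| * deriv χ z.1.1)
        * (w (z.2.2 - z.1.2) * w (z.2.1 - z.1.1))
      - (kruzhkov f (u z.1.1 z.1.2) (v z.1.1 z.1.2)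
        * (nonlocalCoeff β ν μ (u z.1.1) z.1.2 - nonlocalCoeff β ν μ (v z.1.1) z.1.2) * χ z.1.1)
        * (deriv w (z.2.2 - z.1.2) * w (z.2.1 - z.1.1))
      - ((doublingConst C m V * |u z.1.1 z.1.2 - v z.1.1 z.1.2| + C * coeffLip C m
            * ((2 * V + 3) * ρ + l1Dist u v z.1.1) * |v z.1.1 z.1.2|) * χ z.1.1)
          * (bb (z.2.2 - z.1.2) * w (z.2.1 - z.1.1)))
        ∂(stripMeasure T).prod (stripMeasure T)
      ≤ (4 * V + 1) * ρ * (1 + κ) * ∫ s in Set.Ioo 0 T, Γ s := by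
    have hκ : 0 ≤ 1 + κ := bbint0.trans bbint
    have hΓint : 0 ≤ ∫ s in Set.Ioo 0 T, Γ s := integral_nonneg Γ0
    refine integral_le_of_lintegral_le (by positivity) ?_
    have h1 := lintegral_kernel_le hp.regular hp.first hV he0 (by positivity : 0 ≤ 2 * ρ)
      bbc.measurable bb0 bbi bbs hw.continuous.measurable hw.nonneg hw.integrable
      (fun z hz => hw.abs_le hz) Γ
    have hmem : ∀ᵐ z ∂(stripMeasure T).prod (stripMeasure T),
        z.1.1 ∈ Set.Ioo 0 T ∧ z.2.1 ∈ Set.Ioo 0 T :=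
      (Measure.quasiMeasurePreserving_fst.ae (ae_strip_mem T)).and
        (Measure.quasiMeasurePreserving_snd.ae (ae_strip_mem T))
    refine (lintegral_mono_ae (hmem.mono fun z hz => ?_)).trans (h1.trans ?_)
    · rw [← ENNReal.ofReal_mul' (Γ0 _)]
      refine ENNReal.ofReal_le_ofReal ?_
      have h2 := hp.integrand_le hw hχ hρ0 hρ he ⟨hz.1.1.le, hz.1.2.le⟩ ⟨hz.2.1.le, hz.2.2.le⟩
        z.2.2 z.1.2
      simp only [hbb, hΓ]
      simp only [Prod.mk.eta] at h2
      linarith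
    · rw [lintegral_const_mul' _ _ ENNReal.ofReal_ne_top,
        ← ofReal_integral_eq_lintegral_ofReal Γi (ae_of_all _ Γ0), hw.integral, mul_one,
        ← ENNReal.ofReal_mul (by positivity)]
      refine ENNReal.ofReal_le_ofReal (mul_le_mul_of_nonneg_right ?_ hΓint)
      refine mul_le_mul ?_ bbint bbint0 (by positivity)
      linarith
  have I12 : Integrable (fun z => Z₁ z + Z₂ z) ((stripMeasure T).prod (stripMeasure T)) :=
    I1.add I2
  have K1 : Integrable (fun z : (ℝ × ℝ) × (ℝ × ℝ) => Z₁ z + Z₂ z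
      - (|u z.1.1 z.1.2 - v z.1.1 z.1.2| * deriv χ z.1.1)
        * (w (z.2.2 - z.1.2) * w (z.2.1 - z.1.1))) ((stripMeasure T).prod (stripMeasure T)) :=
    I12.sub J1
  have K2 : Integrable (fun z : (ℝ × ℝ) × (ℝ × ℝ) => Z₁ z + Z₂ z
      - (|u z.1.1 z.1.2 - v z.1.1 z.1.2| * deriv χ z.1.1)
        * (w (z.2.2 - z.1.2) * w (z.2.1 - z.1.1))
      - (kruzhkov f (u z.1.1 z.1.2) (v z.1.1 z.1.2)
        * (nonlocalCoeff β ν μ (u z.1.1) z.1.2 - nonlocalCoeff β ν μ (v z.1.1) z.1.2) * χ z.1.1)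
        * (deriv w (z.2.2 - z.1.2) * w (z.2.1 - z.1.1)))
      ((stripMeasure T).prod (stripMeasure T)) := K1.sub J3
  rw [integral_sub K2 J5, integral_sub K1 J3, integral_sub I12 J1,
    integral_add I1 I2, J2, J4] at key
  have hκ : 0 ≤ 1 + κ := bbint0.trans bbint
  have h2 : (4 * V + 1) * ρ * (1 + κ) * (∫ s in Set.Ioo 0 T, Γ s)
      ≤ (4 * V + 1) * ρ * (1 + κ) * ((1 + doublingConst C m V) * X * T
      + C * coeffLip C m / ρ * J) := by gcongr
  have hD0 : 0 ≤ doublingConst C m V * J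
      + C * coeffLip C m * ((2 * V + 3) * ρ * m * X * T + m * J) := by positivity
  have h3 := mul_le_mul W3 bbint bbint0 hD0
  have h4 := J6.trans h3
  linarith

/-- The growth rate of the distance. -/
def distanceRate (C m V κ : ℝ) : ℝ :=
  (1 + κ) * (doublingConst C m V + C * coeffLip C m * m + (4 * V + 1) * (C * coeffLip C m))

/-- The constant of the error terms. -/
def distanceError (C T m V κ X : ℝ) : ℝ :=
  2 * T * (1 + m) + X * (4 * V + 1)
    + (1 + κ) * (C * coeffLip C m * ((2 * V + 3) * m * X * T))
    + (4 * V + 1) * (1 + κ) * ((1 + doublingConst C m V) * X * T)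

/-- The Gronwall inequality for the distance, in integrated form. -/
lemma gronwall (hT : 0 ≤ T) (hρ0 : 0 < ρ) (hρ : ρ ≤ 1 / 2) (he : e ≤ ρ)
    (hτ : τ + 2 * ρ < T) (hε0 : 0 ≤ ε) (hε : ε ≤ ρ) (hu₀ : Integrable u₀)
    (h₁ : ApproxEntropy f β ν μ u₀ T u (2 * b * X * b) 1 ε)
    (h₂ : ApproxEntropy f β ν μ u₀ T v (2 * b * X * b) 1 ε) :
    -∫ s in Set.Ioo 0 T, l1Dist u v s * deriv χ s
      ≤ distanceRate C m V κ * (∫ s in Set.Ioo 0 T, l1Dist u v s * χ s)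
        + distanceError C T m V κ X * ρ + X * ∫ y, |u₀ y - u 0 y| := by
  have hm := hp.mass_nonneg hT
  have a1 := hp.integral_first_ge hw hχ hT hρ hτ hε0 h₁
  have a2 := hp.integral_second_ge hw hχ hT hρ0 hρ (by linarith) hε0 he hu₀ h₂
  have a3 := hp.integral_le hw hχ hT hρ0 hρ he hτ
  have a4 : T * ε * (1 + m) ≤ T * ρ * (1 + m) := by gcongr
  set J := ∫ s in Set.Ioo 0 T, l1Dist u v s * χ s
  -- The `ρ` gained from the regularity of `u` cancels the `1/ρ` of the weight, so the growth rate
  -- does not depend on `ρ`.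
  have e1 : (4 * V + 1) * ρ * (1 + κ) * (C * coeffLip C m / ρ * J)
      = (4 * V + 1) * (1 + κ) * (C * coeffLip C m) * J := by
    field_simp
  rw [mul_add _ _ (C * coeffLip C m / ρ * J), e1] at a3
  unfold distanceRate distanceError
  linarith

end Pair

end NonlocalFV

namespace NonlocalFV

/-! ### Comparison of approximate solutions -/

lemma exists_abs_deriv_smoothTransition_le : ∃ S, ∀ x, |deriv Real.smoothTransition x| ≤ S := by
  have hc : Continuous (deriv Real.smoothTransition) :=
    (contDiff_deriv Real.smoothTransition.contDiff).continuous
  have hs : HasCompactSupport (deriv Real.smoothTransition) := by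
    refine HasCompactSupport.intro (isCompact_Icc (a := (0 : ℝ)) (b := 1)) fun x hx => ?_
    rcases lt_or_ge x 0 with h | h
    · have : Real.smoothTransition =ᶠ[𝓝 x] fun _ => 0 := by
        filter_upwards [Iio_mem_nhds h] with z hz
        exact Real.smoothTransition.zero_of_nonpos (le_of_lt hz)
      rw [this.deriv_eq, deriv_const]
    · have h1 : 1 < x := by
        by_contra h2
        exact hx ⟨h, not_lt.1 h2⟩
      have : Real.smoothTransition =ᶠ[𝓝 x] fun _ => 1 := by
        filter_upwards [Ioi_mem_nhds h1] with z hz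
        exact Real.smoothTransition.one_of_one_le (le_of_lt hz)
      rw [this.deriv_eq, deriv_const]
  exact hs.exists_bound_of_continuous hc

/-- Exponentially weighted cutoffs. -/
lemma exists_timeCutoff {Λ h : ℝ} (hΛ : 0 ≤ Λ) (hh : 0 < h) :
    ∃ X, ∀ t₀ : ℝ, ∃ χ ψ : ℝ → ℝ, TimeCutoff χ (t₀ + h) X ∧ (∀ s, 0 ≤ ψ s) ∧
      (∀ s, deriv χ s = -(Λ * χ s) - ψ s) ∧ (∀ s, ψ s ≠ 0 → s ∈ Set.Icc t₀ (t₀ + h)) ∧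
      ∀ T, 0 ≤ t₀ → t₀ + h ≤ T → Real.exp (-(Λ * T)) ≤ ∫ s in Set.Ioo 0 T, ψ s := by
  obtain ⟨S, hS⟩ := exists_abs_deriv_smoothTransition_le
  have hS0 : 0 ≤ S := (abs_nonneg _).trans (hS 0)
  -- The factor `e^Λ` bounds the weight for `s ≥ -1`; the bound is uniform in `t₀`.
  refine ⟨Real.exp Λ * (1 + Λ + S / h), fun t₀ => ?_⟩
  have hsm : ContDiff ℝ ((⊤ : ℕ∞) : WithTop ℕ∞) Real.smoothTransition :=
    Real.smoothTransition.contDiff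
  have hdS : ∀ s, HasDerivAt (fun s => Real.smoothTransition ((s - t₀) / h))
      (deriv Real.smoothTransition ((s - t₀) / h) * h⁻¹) s := fun s => by
    have h1 : HasDerivAt (fun s : ℝ => (s - t₀) / h) h⁻¹ s := by
      simpa [div_eq_mul_inv] using ((hasDerivAt_id s).sub_const t₀).mul_const h⁻¹
    exact (hsm.differentiable (by simp) _).hasDerivAt.comp s h1
  have hdE : ∀ s, HasDerivAt (fun s => Real.exp (-(Λ * s))) (-Λ * Real.exp (-(Λ * s))) s :=
    fun s => by
      have h1 : HasDerivAt (fun s : ℝ => -(Λ * s)) (-Λ) s := by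
        simpa using ((hasDerivAt_id s).const_mul Λ).fun_neg
      exact h1.exp.congr_deriv (mul_comm _ _)
  have hS' : ∀ x, 0 ≤ deriv Real.smoothTransition x := fun x =>
    Real.smoothTransition.monotone.deriv_nonneg
  -- The exponential weight is an integrating factor: `-χ' = Λ χ + ψ`, where `ψ` is a bump on `[t₀,
  -- t₀ + h]` of mass at least `e^{-Λ T}`.
  set χ : ℝ → ℝ := fun s => Real.exp (-(Λ * s)) * (1 - Real.smoothTransition ((s - t₀) / h)) with hχ
  set ψ : ℝ → ℝ := fun s =>
    Real.exp (-(Λ * s)) * (deriv Real.smoothTransition ((s - t₀) / h) * h⁻¹) with hψ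
  have hder : ∀ s, deriv χ s = -(Λ * χ s) - ψ s := fun s => by
    have hs : HasDerivAt χ _ s := (hdE s).mul ((hdS s).const_sub 1)
    rw [hs.deriv]
    simp only [hχ, hψ]
    ring
  have hχ0 : ∀ s, 0 ≤ χ s := fun s =>
    mul_nonneg (Real.exp_nonneg _) (sub_nonneg.2 (Real.smoothTransition.le_one _))
  have hψ0 : ∀ s, 0 ≤ ψ s := fun s =>
    mul_nonneg (Real.exp_nonneg _) (mul_nonneg (hS' _) (inv_nonneg.2 hh.le))
  have hexp : ∀ s, -1 ≤ s → Real.exp (-(Λ * s)) ≤ Real.exp Λ := fun s hs =>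
    Real.exp_le_exp.2 (by nlinarith)
  have hχ1 : ∀ s, -1 ≤ s → χ s ≤ Real.exp Λ := fun s hs => by
    have h1 := Real.smoothTransition.nonneg ((s - t₀) / h)
    have h2 := Real.exp_nonneg (-(Λ * s))
    simp only [hχ]
    nlinarith [hexp s hs]
  have hψ1 : ∀ s, -1 ≤ s → ψ s ≤ Real.exp Λ * (S / h) := fun s hs => by
    simp only [hψ, div_eq_mul_inv]
    have h1 := (le_abs_self _).trans (hS ((s - t₀) / h))
    have h2 := hexp s hs
    have h3 := hS' ((s - t₀) / h)
    simp only [div_eq_mul_inv] at h1 h3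
    gcongr
  have hψs : ∀ s, ψ s ≠ 0 → s ∈ Set.Icc t₀ (t₀ + h) := fun s hs => by
    by_contra hn
    refine hs ?_
    have hz : deriv Real.smoothTransition ((s - t₀) / h) = 0 := by
      rcases lt_or_ge s t₀ with h1 | h1
      · have h2 : (s - t₀) / h < 0 := div_neg_of_neg_of_pos (by linarith) hh
        have : Real.smoothTransition =ᶠ[𝓝 ((s - t₀) / h)] fun _ => 0 := by
          filter_upwards [Iio_mem_nhds h2] with z hz
          exact Real.smoothTransition.zero_of_nonpos (le_of_lt hz)
        rw [this.deriv_eq, deriv_const]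
      · have h2 : 1 < (s - t₀) / h := by
          rw [lt_div_iff₀ hh]
          by_contra h3
          exact hn ⟨h1, by linarith⟩
        have : Real.smoothTransition =ᶠ[𝓝 ((s - t₀) / h)] fun _ => 1 := by
          filter_upwards [Ioi_mem_nhds h2] with z hz
          exact Real.smoothTransition.one_of_one_le (le_of_lt hz)
        rw [this.deriv_eq, deriv_const]
    simp [hψ, hz]
  have hE : 0 ≤ Real.exp Λ := Real.exp_nonneg _
  refine ⟨χ, ψ, ⟨?_, hχ0, fun s hs => ?_, fun s => ?_, fun s hs => ?_, fun s hs => ?_⟩, hψ0, hder,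
    hψs, fun T ht₀ hT => ?_⟩
  · refine (Real.contDiff_exp.comp (contDiff_const.mul contDiff_id).neg).mul
      (contDiff_const.sub (hsm.comp ((contDiff_id.sub contDiff_const).div_const h)))
  · have h1 : 1 ≤ (s - t₀) / h := by rw [le_div_iff₀ hh]; linarith
    simp [hχ, Real.smoothTransition.one_of_one_le h1]
  · rw [hder]
    have := mul_nonneg hΛ (hχ0 s)
    linarith [hψ0 s]
  · refine (hχ1 s hs).trans ?_
    have : 0 ≤ Real.exp Λ * (Λ + S / h) := by positivity
    linarith
  · rw [hder, abs_le]
    have h1 := mul_nonneg hΛ (hχ0 s)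
    have h2 := hψ0 s
    have h3 := mul_le_mul_of_nonneg_left (hχ1 s hs) hΛ
    have h4 := hψ1 s hs
    constructor <;> linarith
  · have hcont : Continuous fun s => deriv Real.smoothTransition ((s - t₀) / h) * h⁻¹ :=
      ((contDiff_deriv hsm).continuous.comp ((continuous_sub_right t₀).div_const h)).mul_const _
    have hψc : Continuous ψ := (by fun_prop : Continuous fun s => Real.exp (-(Λ * s))).mul hcont
    have h1 : ∫ s in t₀..(t₀ + h), deriv Real.smoothTransition ((s - t₀) / h) * h⁻¹ = 1 := by
      rw [intervalIntegral.integral_eq_sub_of_hasDerivAt (fun s _ => hdS s)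
        (hcont.intervalIntegrable _ _)]
      simp [hh.ne']
    have h2 : Real.exp (-(Λ * T)) ≤ ∫ s in t₀..(t₀ + h), ψ s := by
      have h3 : ∫ s in t₀..(t₀ + h), Real.exp (-(Λ * T))
          * (deriv Real.smoothTransition ((s - t₀) / h) * h⁻¹) = Real.exp (-(Λ * T)) := by
        rw [intervalIntegral.integral_const_mul, h1, mul_one]
      rw [← h3]
      refine intervalIntegral.integral_mono_on (by linarith)
        ((hcont.const_mul _).intervalIntegrable _ _) (hψc.intervalIntegrable _ _) fun s hs => ?_
      refine mul_le_mul_of_nonneg_right (Real.exp_le_exp.2 ?_)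
        (mul_nonneg (hS' _) (inv_nonneg.2 hh.le))
      have : s ≤ T := hs.2.trans hT
      nlinarith
    refine h2.trans ?_
    rw [intervalIntegral.integral_of_le (by linarith), ← integral_Ioc_eq_integral_Ioo]
    exact setIntegral_mono_set ((hψc.integrableOn_Icc).mono_set Set.Ioc_subset_Icc_self)
      (ae_of_all _ hψ0) (Set.Ioc_subset_Ioc ht₀ hT).eventuallyLE

namespace Pair

variable {f β ν μ u₀ w : ℝ → ℝ} {C T m V e B ρ κ b ε ω δ h t t₀ X : ℝ} {u v : ℝ → ℝ → ℝ}

/-- The distance at the time `t`, in terms of its average near `t`. -/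
lemma l1Dist_le_of_cutoff (hp : Pair f β ν μ C T m V e B u v) (hw : Mollifier w ρ κ b)
    (hT : 0 ≤ T) (hρ0 : 0 < ρ) (hρ : ρ ≤ 1 / 2) (he : e ≤ ρ) (hε0 : 0 ≤ ε) (hε : ε ≤ ρ)
    (hu₀ : Integrable u₀) (hτ : t₀ + h + 2 * ρ < T) {χ ψ : ℝ → ℝ}
    (hχ : TimeCutoff χ (t₀ + h) X) (hψ0 : ∀ s, 0 ≤ ψ s)
    (hχ' : ∀ s, deriv χ s = -(distanceRate C m V κ * χ s) - ψ s)
    (hψs : ∀ s, ψ s ≠ 0 → s ∈ Set.Icc t₀ (t₀ + h))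
    (hψi : Real.exp (-(distanceRate C m V κ * T)) ≤ ∫ s in Set.Ioo 0 T, ψ s)
    (h₁ : ApproxEntropy f β ν μ u₀ T u (2 * b * X * b) 1 ε)
    (h₂ : ApproxEntropy f β ν μ u₀ T v (2 * b * X * b) 1 ε)
    (hω : ∀ s ∈ Set.Icc t₀ (t₀ + h), l1Dist u v t - ω ≤ l1Dist u v s) :
    l1Dist u v t ≤ ω + Real.exp (distanceRate C m V κ * T)
      * (distanceError C T m V κ X * ρ + X * ∫ y, |u₀ y - u 0 y|) := by
  have key := hp.gronwall hw hχ hT hρ0 hρ he hτ hε0 hε hu₀ h₁ h₂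
  have i1 := hp.integrableOn_l1Dist_mul hχ
  have i2 := hp.integrableOn_l1Dist_mul_deriv hχ
  set Λ := distanceRate C m V κ
  -- By the choice of the cutoff the growth term of the Gronwall inequality is absorbed, and the
  -- average of the distance against `ψ` remains.
  have e1 : ∀ s, l1Dist u v s * ψ s
      = -(l1Dist u v s * deriv χ s) - Λ * (l1Dist u v s * χ s) := fun s => by
    rw [hχ']; ring
  have i3 : IntegrableOn (fun s => l1Dist u v s * ψ s) (Set.Ioo 0 T) := by
    simp only [e1]
    exact i2.neg.sub (i1.const_mul Λ)
  have e2 : ∫ s in Set.Ioo 0 T, l1Dist u v s * ψ s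
      = -(∫ s in Set.Ioo 0 T, l1Dist u v s * deriv χ s)
        - Λ * ∫ s in Set.Ioo 0 T, l1Dist u v s * χ s := by
    have i2n : IntegrableOn (fun s => -(l1Dist u v s * deriv χ s)) (Set.Ioo 0 T) := i2.neg
    simp only [e1]
    rw [integral_sub i2n (i1.const_mul Λ), integral_neg, integral_const_mul]
  set Y := distanceError C T m V κ X * ρ + X * ∫ y, |u₀ y - u 0 y| with hY
  have hle : ∫ s in Set.Ioo 0 T, l1Dist u v s * ψ s ≤ Y := by
    rw [e2]; linarith
  have hY0 : 0 ≤ Y := (integral_nonneg fun s => mul_nonneg (l1Dist_nonneg _ _ _) (hψ0 s)).trans hle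
  by_cases hc : l1Dist u v t - ω ≤ 0
  · have := mul_nonneg (Real.exp_nonneg (Λ * T)) hY0
    linarith
  have hc' := not_le.1 hc
  have h3 : (l1Dist u v t - ω) * ∫ s in Set.Ioo 0 T, ψ s
      ≤ ∫ s in Set.Ioo 0 T, l1Dist u v s * ψ s := by
    rw [← integral_const_mul]
    refine integral_mono_of_nonneg (ae_of_all _ fun s => mul_nonneg hc'.le (hψ0 s)) i3
      (ae_of_all _ fun s => ?_)
    by_cases hz : ψ s = 0
    · simp [hz]
    · exact mul_le_mul_of_nonneg_right (hω s (hψs s hz)) (hψ0 s)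
  have h4 := mul_le_mul_of_nonneg_left hψi hc'.le
  have h5 : (l1Dist u v t - ω) * Real.exp (-(Λ * T)) ≤ Y := by linarith
  rw [Real.exp_neg, ← div_eq_mul_inv, div_le_iff₀ (Real.exp_pos _)] at h5
  linarith

/-- Two approximate solutions which satisfy the entropy inequality up to a small error are close,
at the times near which the second one varies little. -/
theorem l1Dist_le_of_approxEntropy (hd : DataBound f β ν μ C) (hu₀ : Integrable u₀) (hT : 0 < T)
    (hm : 0 ≤ m) (hV : 0 ≤ V) (hε : 0 < ε) (hh : 0 < h) :
    ∃ M δ : ℝ, 0 ≤ M ∧ 0 < δ ∧ ∀ e B u v, Pair f β ν μ C T m V e B u v → e ≤ δ →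
      ApproxEntropy f β ν μ u₀ T u M 1 δ → ApproxEntropy f β ν μ u₀ T v M 1 δ →
      ∫ y, |u₀ y - u 0 y| ≤ δ → ∀ t ∈ Set.Icc 0 T,
      (∀ s ∈ Set.Icc 0 T, |s - t| ≤ h → ∫ y, |v s y - v t y| ≤ ε) → l1Dist u v t ≤ 5 * ε := by
  obtain ⟨κ, hκ, hmol⟩ := exists_mollifier
  have hC := hd.nonneg
  have hcl := hd.coeffLip_nonneg hm
  have hdc : 0 ≤ doublingConst C m V := by unfold doublingConst; positivity
  have hΛ : 0 ≤ distanceRate C m V κ := by unfold distanceRate; positivity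
  -- The length of the averaging window: short for the modulus of `v`, for the room before `T`, and
  -- for the modulus of `u`. The later choices depend on the earlier ones in the order `k`, `X`,
  -- `ρ`, `b`, `δ`, so that the bound of the test functions is fixed before `u` and `v` are given.
  set k := min (h / 2) (min (T / 4) (ε / (2 * V + 1)))
  have hk : 0 < k := lt_min (by positivity) (lt_min (by positivity) (by positivity))
  have hk1 : 2 * k ≤ h := by linarith [min_le_left (h / 2) (min (T / 4) (ε / (2 * V + 1)))]
  have hk2 : 4 * k ≤ T := by
    linarith [(min_le_right (h / 2) (min (T / 4) (ε / (2 * V + 1)))).trans (min_le_left _ _)]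
  have hk3 : V * (2 * k) ≤ ε := by
    have h1 : k ≤ ε / (2 * V + 1) := (min_le_right _ _).trans (min_le_right _ _)
    rw [le_div_iff₀ (by positivity)] at h1
    linarith
  obtain ⟨X, hX⟩ := exists_timeCutoff hΛ hk
  have hX0 : 0 ≤ X := by
    obtain ⟨χ, ψ, h1, -⟩ := hX 0
    exact h1.bound_nonneg
  set E := Real.exp (distanceRate C m V κ * T)
  have hE : 0 < E := Real.exp_pos _
  have hDE : 0 ≤ distanceError C T m V κ X := by unfold distanceError; positivity
  set ρ := min (1 / 2) (min (k / 4) (ε / (E * distanceError C T m V κ X + 1)))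
  have hρ0 : 0 < ρ := lt_min (by norm_num) (lt_min (by positivity) (by positivity))
  have hρ1 : ρ ≤ 1 / 2 := min_le_left _ _
  have hρ2 : ρ ≤ k / 4 := (min_le_right _ _).trans (min_le_left _ _)
  have hρ3 : E * (distanceError C T m V κ X * ρ) ≤ ε := by
    have h1 : ρ ≤ ε / (E * distanceError C T m V κ X + 1) :=
      (min_le_right _ _).trans (min_le_right _ _)
    rw [le_div_iff₀ (by positivity)] at h1
    linarith
  obtain ⟨w, b, hw⟩ := hmol ρ hρ0
  have hb := hw.bound_nonneg
  set δ := min ρ (min ε (ε / (E * X + 1)))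
  have hδ0 : 0 < δ := lt_min hρ0 (lt_min hε (by positivity))
  have hδ1 : δ ≤ ρ := min_le_left _ _
  have hδ2 : δ ≤ ε := (min_le_right _ _).trans (min_le_left _ _)
  have hδ3 : E * (X * δ) ≤ ε := by
    have h1 : δ ≤ ε / (E * X + 1) := (min_le_right _ _).trans (min_le_right _ _)
    rw [le_div_iff₀ (by positivity)] at h1
    linarith
  refine ⟨2 * b * X * b, δ, by positivity, hδ0,
    fun e B u v hp he hu hv hi t ht hmod => ?_⟩
  -- The window `[t₀, t₀ + k]` is pulled back from `T`, which leaves room for the mollifier: `t₀ + k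
  -- + 2 ρ < T`.
  set t₀ := min t (T - 2 * k)
  have ht₀ : 0 ≤ t₀ := le_min ht.1 (by linarith)
  have ht₁ : t₀ ≤ t := min_le_left _ _
  have ht₂ : t₀ ≤ T - 2 * k := min_le_right _ _
  have ht₃ : t ≤ t₀ + 2 * k := by
    rcases min_choice t (T - 2 * k) with h1 | h1
    · have : t₀ = t := h1
      linarith
    · have : t₀ = T - 2 * k := h1
      linarith [ht.2]
  obtain ⟨χ, ψ, hχ, hψ0, hχ', hψs, hψi⟩ := hX t₀
  -- One `ε` from the modulus of `v`, one from `2 k V`, one from the defect `e ≤ δ`. The bounds on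
  -- `ρ` and `δ` contribute the remaining two of the five.
  have hω : ∀ s ∈ Set.Icc t₀ (t₀ + k), l1Dist u v t - 3 * ε ≤ l1Dist u v s := fun s hs => by
    have hs' : s ∈ Set.Icc 0 T := ⟨ht₀.trans hs.1, by linarith [hs.2]⟩
    have hst : |s - t| ≤ 2 * k := by
      rw [abs_le]
      constructor <;> linarith [hs.1, hs.2]
    have h1 := hmod s hs' (hst.trans hk1)
    have h2 := hp.l1Dist_time_le hs' ht
    have h3 : V * |t - s| ≤ V * (2 * k) := by
      rw [abs_sub_comm]
      gcongr
    have a1 : Integrable fun y => |u t y - u s y| :=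
      ((hp.first.integrable t ht).sub (hp.first.integrable s hs')).abs
    have a2 : Integrable fun y => |u s y - v s y| :=
      ((hp.first.integrable s hs').sub (hp.second.integrable s hs')).abs
    have a3 : Integrable fun y => |v s y - v t y| :=
      ((hp.second.integrable s hs').sub (hp.second.integrable t ht)).abs
    have a4 : Integrable fun y => |u t y - u s y| + |u s y - v s y| := a1.add a2
    have h4 : l1Dist u v t ≤ (∫ y, |u t y - u s y|) + l1Dist u v s + ∫ y, |v s y - v t y| := by
      rw [l1Dist, l1Dist, ← integral_add a1 a2, ← integral_add a4 a3]
      refine integral_mono ((hp.first.integrable t ht).sub (hp.second.integrable t ht)).abs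
        (a4.add a3) fun y => ?_
      have b1 := abs_sub_le (u t y) (u s y) (v t y)
      have b2 := abs_sub_le (u s y) (v s y) (v t y)
      dsimp only [Pi.add_apply]
      linarith
    linarith
  have h1 := hp.l1Dist_le_of_cutoff hw hT.le hρ0 hρ1 (he.trans hδ1) hδ0.le hδ1 hu₀
    (by linarith) hχ hψ0 hχ' hψs (hψi T ht₀ (by linarith)) hu hv hω
  have h2 : E * (X * ∫ y, |u₀ y - u 0 y|) ≤ E * (X * δ) := by gcongr
  rw [mul_add] at h1
  linarith

end Pair

end NonlocalFV

namespace NonlocalFV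

/-! ### Limits of approximate solutions -/

/-- Fatou's lemma, through which all bounds pass to the limit. -/
lemma integrable_and_integral_abs_le_of_tendsto {g : ℕ → ℝ → ℝ} {G : ℝ → ℝ} {c : ℝ}
    (hg : ∀ n, Integrable (g n)) (hc : ∀ᶠ n in atTop, ∫ x, |g n x| ≤ c)
    (h : ∀ᵐ x ∂volume, Tendsto (fun n => g n x) atTop (𝓝 (G x))) :
    Integrable G ∧ ∫ x, |G x| ≤ c := by
  have hc0 : 0 ≤ c := by
    obtain ⟨n, hn⟩ := hc.exists
    exact (integral_nonneg fun _ => abs_nonneg _).trans hn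
  have h1 := lintegral_enorm_le_liminf_of_tendsto h fun n => (hg n).1.aemeasurable.enorm
  have h2 : liminf (fun n => ∫⁻ x, ‖g n x‖ₑ) atTop ≤ ENNReal.ofReal c := by
    refine liminf_le_of_frequently_le' (hc.mono fun n hn => ?_).frequently
    rw [← ofReal_integral_norm_eq_lintegral_enorm (hg n)]
    exact ENNReal.ofReal_le_ofReal hn
  have hG : Integrable G :=
    ⟨aestronglyMeasurable_of_tendsto_ae _ (fun n => (hg n).1) h,
      (h1.trans h2).trans_lt ENNReal.ofReal_lt_top⟩
  refine ⟨hG, ?_⟩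
  have h3 := h1.trans h2
  rw [← ofReal_integral_norm_eq_lintegral_enorm hG] at h3
  exact (ENNReal.ofReal_le_ofReal_iff hc0).1 h3

/-- A sequence of space-time functions which is Cauchy in `C([0, T]; L¹)` has a limit, and a
subsequence converges almost everywhere at every time. -/
lemma exists_l1Dist_limit {T m : ℝ} {w : ℕ → ℝ → ℝ → ℝ}
    (hmeas : ∀ n, Measurable (Function.uncurry (w n))) (hw : ∀ n, StripFun T m (w n))
    (hc : ∀ ε > 0, ∃ n₀, ∀ p ≥ n₀, ∀ q ≥ n₀, ∀ t ∈ Set.Icc 0 T, l1Dist (w p) (w q) t ≤ ε) :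
    ∃ (u : ℝ → ℝ → ℝ) (ψ : ℕ → ℕ), StrictMono ψ ∧ Measurable (Function.uncurry u) ∧
      StripFun T m u ∧
      (∀ t ∈ Set.Icc 0 T, ∀ᵐ x ∂volume, Tendsto (fun n => w (ψ n) t x) atTop (𝓝 (u t x))) ∧
      ∀ ε > 0, ∃ n₀, ∀ n ≥ n₀, ∀ t ∈ Set.Icc 0 T, l1Dist (w n) u t ≤ ε := by
  -- Summable distances give almost everywhere convergence, and the uniformity in `t` lets one
  -- subsequence serve all times. The extra factor `1/2` makes the later inequality strict.
  choose n₀ hn₀ using fun n : ℕ => hc ((1 / 2) ^ n / 2) (by positivity)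
  obtain ⟨ψ, hψ, hψn⟩ := extraction_forall_of_eventually' (P := fun n k => n₀ n ≤ k)
    fun n => ⟨n₀ n, fun k hk => hk⟩
  -- The upper limit at every point is jointly measurable, so no representatives have to be chosen
  -- time by time.
  set u : ℝ → ℝ → ℝ := fun t x => limsup (fun n => w (ψ n) t x) atTop
  have hum : Measurable (Function.uncurry u) :=
    Measurable.limsup (f := fun n p => Function.uncurry (w (ψ n)) p) fun n => hmeas _
  have hlim : ∀ t ∈ Set.Icc 0 T, ∀ᵐ x ∂volume,
      Tendsto (fun n => w (ψ n) t x) atTop (𝓝 (u t x)) := fun t ht => by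
    have h1 := Lp.ae_tendsto_of_cauchy_eLpNorm (μ := volume) (p := 1)
      (f := fun n x => w (ψ n) t x) (B := fun n => ENNReal.ofReal ((1 / 2) ^ n))
      (fun n => ((hw _).integrable t ht).1) le_rfl
      (Summable.tsum_ofReal_ne_top summable_geometric_two) fun N p q hp hq => ?_
    · filter_upwards [h1] with x hx
      obtain ⟨l, hl⟩ := hx
      have : u t x = l := hl.limsup_eq
      rw [this]
      exact hl
    · have hi : Integrable fun x => w (ψ p) t x - w (ψ q) t x :=
        ((hw _).integrable t ht).sub ((hw _).integrable t ht)
      change eLpNorm (fun x => w (ψ p) t x - w (ψ q) t x) 1 volume < _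
      rw [eLpNorm_one_eq_lintegral_enorm, ← ofReal_integral_norm_eq_lintegral_enorm hi]
      refine (ENNReal.ofReal_lt_ofReal_iff (by positivity)).2 ?_
      have h2 := hn₀ N (ψ p) ((hψn N).trans (hψ.monotone hp)) (ψ q)
        ((hψn N).trans (hψ.monotone hq)) t ht
      have h3 : (0 : ℝ) < (1 / 2) ^ N := by positivity
      exact h2.trans_lt (by linarith)
  refine ⟨u, ψ, hψ, hum, ⟨hum.aestronglyMeasurable, fun t ht => ?_, fun t ht => ?_⟩, hlim,
    fun ε hε => ?_⟩
  · exact (integrable_and_integral_abs_le_of_tendsto (fun n => (hw (ψ n)).integrable t ht)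
      (Eventually.of_forall fun n => (hw (ψ n)).mass t ht) (hlim t ht)).1
  · exact (integrable_and_integral_abs_le_of_tendsto (fun n => (hw (ψ n)).integrable t ht)
      (Eventually.of_forall fun n => (hw (ψ n)).mass t ht) (hlim t ht)).2
  · obtain ⟨k, hk⟩ := hc ε hε
    refine ⟨k, fun n hn t ht => ?_⟩
    refine (integrable_and_integral_abs_le_of_tendsto
      (g := fun j x => w n t x - w (ψ j) t x) (fun j => ((hw n).integrable t ht).sub
        ((hw (ψ j)).integrable t ht)) ?_ ?_).2
    · filter_upwards [hψ.tendsto_atTop.eventually_ge_atTop k] with j hj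
      exact hk n hn _ hj t ht
    · filter_upwards [hlim t ht] with x hx
      exact tendsto_const_nhds.sub hx

lemma tendsto_sign {ι : Type*} {l : Filter ι} {a : ι → ℝ} {r : ℝ} (ha : Tendsto a l (𝓝 r))
    (hr : r ≠ 0) : Tendsto (fun i => Real.sign (a i)) l (𝓝 (Real.sign r)) := by
  refine tendsto_const_nhds.congr' ?_
  rcases hr.lt_or_gt with h | h
  · filter_upwards [ha.eventually (Iio_mem_nhds h)] with i hi
    rw [Real.sign_of_neg h, Real.sign_of_neg hi]
  · filter_upwards [ha.eventually (Ioi_mem_nhds h)] with i hi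
    rw [Real.sign_of_pos h, Real.sign_of_pos hi]

/-- The integrand over the strip in the entropy inequality. -/
noncomputable def entropyIntegrand (f β ν μ : ℝ → ℝ) (φ : ℝ → ℝ → ℝ) (k : ℝ) (u : ℝ → ℝ → ℝ)
    (p : ℝ × ℝ) : ℝ :=
  |u p.1 p.2 - k| * deriv (fun s => φ s p.2) p.1
    + nonlocalCoeff β ν μ (u p.1) p.2 * kruzhkov f (u p.1 p.2) k * deriv (φ p.1) p.2
    - f k * Real.sign (u p.1 p.2 - k) * deriv (nonlocalCoeff β ν μ (u p.1)) p.2 * φ p.1 p.2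

/-! ### Stability of the entropy functional. -/

section Limits

variable {f β ν μ u₀ : ℝ → ℝ} {C T m B k κ : ℝ} {u φ : ℝ → ℝ → ℝ} {w : ℕ → ℝ → ℝ → ℝ}

lemma entropyIntegrand_eq (p : ℝ × ℝ) : entropyIntegrand f β ν μ φ k u p
    = |u p.1 p.2 - k| * deriv (fun s => φ s p.2) p.1
      + Real.sign (u p.1 p.2 - k) * nonlocalCoeff β ν μ (u p.1) p.2 * (f (u p.1 p.2) - f k)
        * deriv (fun y => φ p.1 y) p.2
      - f k * Real.sign (u p.1 p.2 - k) * deriv (nonlocalCoeff β ν μ (u p.1)) p.2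
        * φ p.1 p.2 := by
  rw [entropyIntegrand, kruzhkov]; ring

lemma entropyForm_eq_integral (hd : DataBound f β ν μ C) (hu : StripFun T m u)
    (hB : ∀ᵐ p ∂stripMeasure T, |u p.1 p.2| ≤ B) (hφ : IsTestFunction T φ) (k : ℝ) :
    entropyForm f β ν μ u₀ T u k φ
      = (∫ p, entropyIntegrand f β ν μ φ k u p ∂stripMeasure T) + ∫ x, |u₀ x - k| * φ 0 x := by
  simp only [entropyForm_eq hd hu hB hφ, entropyIntegrand_eq]

lemma integrable_entropyIntegrand (hd : DataBound f β ν μ C) (hu : StripFun T m u)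
    (hB : ∀ᵐ p ∂stripMeasure T, |u p.1 p.2| ≤ B) (hφ : IsTestFunction T φ) (k : ℝ) :
    Integrable (entropyIntegrand f β ν μ φ k u) (stripMeasure T) := by
  refine (((integrable_entropy_time hu hB hφ k).add (integrable_entropy_flux hd hu hB hφ k)).sub
    (integrable_entropy_source hd hu hφ k)).congr (ae_of_all _ fun p => ?_)
  rw [entropyIntegrand_eq]
  rfl

lemma integrable_entropy_dominant (hφ : IsTestFunction T φ) (a b c : ℝ) :
    Integrable (fun p : ℝ × ℝ => a * |deriv (fun s => φ s p.2) p.1| + b * |deriv (φ p.1) p.2|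
      + c * |φ p.1 p.2|) (stripMeasure T) :=
  (((integrable_strip_of_continuous hφ.continuous_deriv_time
    hφ.hasCompactSupport_deriv_time).abs.const_mul a).add
    ((integrable_strip_of_continuous hφ.continuous_deriv_space
    hφ.hasCompactSupport_deriv_space).abs.const_mul b)).add
    ((integrable_strip_of_continuous hφ.continuous hφ.2.1).abs.const_mul c)

lemma abs_entropyIntegrand_le (hd : DataBound f β ν μ C) (hu : StripFun T m u)
    (hB : ∀ᵐ p ∂stripMeasure T, |u p.1 p.2| ≤ B) (hk : |k| ≤ κ) :
    ∀ᵐ p ∂stripMeasure T, |entropyIntegrand f β ν μ φ k u p|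
      ≤ (B + κ) * |deriv (fun s => φ s p.2) p.1| + C * (C * (B + κ)) * |deriv (φ p.1) p.2|
        + C * κ * (C ^ 3 * m) * |φ p.1 p.2| := by
  have hC := hd.nonneg
  have hκ : 0 ≤ κ := (abs_nonneg k).trans hk
  filter_upwards [hB, hu.ae_abs_deriv_coeff_le hd] with p h1 h2
  have h3 : |u p.1 p.2 - k| ≤ B + κ := (abs_sub _ _).trans (by linarith)
  have h4 : |kruzhkov f (u p.1 p.2) k| ≤ C * (B + κ) :=
    (hd.abs_kruzhkov_le _ _).trans (mul_le_mul_of_nonneg_left h3 hC)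
  have h5 := hd.abs_coeff_le (u p.1) p.2
  have h6 : |f k| ≤ C * κ := (hd.abs_f_le k).trans (by gcongr)
  have h7 : |f k * Real.sign (u p.1 p.2 - k)| ≤ C * κ := by
    rw [abs_mul]
    exact (mul_le_of_le_one_right (abs_nonneg _) (abs_sign_le _)).trans h6
  rw [entropyIntegrand]
  refine (abs_sub _ _).trans (add_le_add ((abs_add_le _ _).trans (add_le_add ?_ ?_)) ?_)
  · rw [abs_mul, abs_abs]
    gcongr
  · rw [abs_mul, abs_mul]
    gcongr
  · rw [abs_mul, abs_mul]
    gcongr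

/-- Stability of the entropy functional, for the levels that the limit does not charge. -/
lemma tendsto_entropyForm (hd : DataBound f β ν μ C) (hw : ∀ n, StripFun T m (w n))
    (hB : ∀ n, ∀ᵐ p ∂stripMeasure T, |w n p.1 p.2| ≤ B) (hu : StripFun T m u)
    (huB : ∀ᵐ p ∂stripMeasure T, |u p.1 p.2| ≤ B)
    (hlim : ∀ᵐ p ∂stripMeasure T, Tendsto (fun n => w n p.1 p.2) atTop (𝓝 (u p.1 p.2)))
    (hL : ∀ t ∈ Set.Icc 0 T, Tendsto (fun n => l1Dist (w n) u t) atTop (𝓝 0))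
    (hk : ∀ᵐ p ∂stripMeasure T, u p.1 p.2 ≠ k) (hφ : IsTestFunction T φ) :
    Tendsto (fun n => entropyForm f β ν μ u₀ T (w n) k φ) atTop
      (𝓝 (entropyForm f β ν μ u₀ T u k φ)) := by
  rw [entropyForm_eq_integral hd hu huB hφ]
  simp only [entropyForm_eq_integral hd (hw _) (hB _) hφ]
  refine Tendsto.add_const _ (tendsto_integral_of_dominated_convergence _
    (fun n => (integrable_entropyIntegrand hd (hw n) (hB n) hφ k).1)
    (integrable_entropy_dominant hφ _ _ _)
    (fun n => abs_entropyIntegrand_le hd (hw n) (hB n) le_rfl) ?_)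
  filter_upwards [hlim, hk, ae_strip_mem T] with p h1 h2 hp
  have ht : p.1 ∈ Set.Icc 0 T := ⟨hp.1.le, hp.2.le⟩
  have h3 : Tendsto (fun n => coeffLip C m * (|p.2 - p.2| + l1Dist (w n) u p.1)) atTop (𝓝 0) := by
    have := (hL p.1 ht).const_mul (coeffLip C m)
    simpa using this
  have h4 : Tendsto (fun n => nonlocalCoeff β ν μ (w n p.1) p.2) atTop
      (𝓝 (nonlocalCoeff β ν μ (u p.1) p.2)) :=
    tendsto_iff_dist_tendsto_zero.2 (squeeze_zero (fun _ => dist_nonneg) (fun n =>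
      hd.abs_coeff_sub_le ((hw n).integrable _ ht) (hu.integrable _ ht) ((hw n).mass _ ht) _ _) h3)
  have h5 : Tendsto (fun n => deriv (nonlocalCoeff β ν μ (w n p.1)) p.2) atTop
      (𝓝 (deriv (nonlocalCoeff β ν μ (u p.1)) p.2)) :=
    tendsto_iff_dist_tendsto_zero.2 (squeeze_zero (fun _ => dist_nonneg) (fun n =>
      hd.abs_deriv_coeff_sub_le ((hw n).integrable _ ht) (hu.integrable _ ht) ((hw n).mass _ ht)
        _ _) h3)
  have h6 : Tendsto (fun n => kruzhkov f (w n p.1 p.2) k) atTop (𝓝 (kruzhkov f (u p.1 p.2) k)) :=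
    ((continuous_kruzhkov hd.continuous_f).tendsto (u p.1 p.2, k)).comp
      (h1.prodMk_nhds tendsto_const_nhds)
  have h7 := tendsto_sign (h1.sub_const k) (sub_ne_zero.2 h2)
  exact (((h1.sub_const k).abs.mul_const _).add ((h4.mul h6).mul_const _)).sub
    (((h7.const_mul _).mul h5).mul_const _)

/-- The Kruzhkov inequality at a level `k` is the mean of the limits of the inequalities at the
levels from the left and from the right of `k`. -/
lemma tendsto_entropyForm_add (hd : DataBound f β ν μ C) (hu₀ : Integrable u₀)
    (hu : StripFun T m u) (hB : ∀ᵐ p ∂stripMeasure T, |u p.1 p.2| ≤ B) (hφ : IsTestFunction T φ)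
    {a b : ℕ → ℝ} (ha : ∀ n, k < a n) (hb : ∀ n, b n < k) (ha' : Tendsto a atTop (𝓝 k))
    (hb' : Tendsto b atTop (𝓝 k)) :
    Tendsto (fun n => entropyForm f β ν μ u₀ T u (a n) φ + entropyForm f β ν μ u₀ T u (b n) φ)
      atTop (𝓝 (2 * entropyForm f β ν μ u₀ T u k φ)) := by
  obtain ⟨κ₁, h₁⟩ := (Metric.isBounded_range_of_tendsto a ha').exists_norm_le
  obtain ⟨κ₂, h₂⟩ := (Metric.isBounded_range_of_tendsto b hb').exists_norm_le
  set κ := max κ₁ κ₂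
  have hκa : ∀ n, |a n| ≤ κ := fun n => (h₁ _ ⟨n, rfl⟩).trans (le_max_left _ _)
  have hκb : ∀ n, |b n| ≤ κ := fun n => (h₂ _ ⟨n, rfl⟩).trans (le_max_right _ _)
  have hinit : ∀ c : ℕ → ℝ, (∀ n, |c n| ≤ κ) → Tendsto c atTop (𝓝 k) →
      Tendsto (fun n => ∫ x, |u₀ x - c n| * φ 0 x) atTop (𝓝 (∫ x, |u₀ x - k| * φ 0 x)) := by
    intro c hc hc'
    obtain ⟨M, R, hM⟩ := hφ.exists_testBound
    refine tendsto_integral_of_dominated_convergence (fun x => |u₀ x| * |φ 0 x| + κ * |φ 0 x|)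
      (fun n => ((hu₀.1.sub aestronglyMeasurable_const).norm.mul
        (hφ.integrable_slice 0).1)) ?_ (fun n => ae_of_all _ fun x => ?_) (ae_of_all _ fun x => ?_)
    · refine (Integrable.mul_bdd (c := M) hu₀.abs (hφ.integrable_slice 0).abs.1
        (ae_of_all _ fun x => ?_)).add ((hφ.integrable_slice 0).abs.const_mul κ)
      rw [Real.norm_eq_abs, abs_abs]
      exact hM.bound 0 x
    · rw [Real.norm_eq_abs, abs_mul, abs_abs, ← add_mul]
      gcongr
      exact (abs_sub _ _).trans (by linarith [hc n])
    · exact (tendsto_const_nhds.sub hc').abs.mul_const _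
  simp only [entropyForm_eq_integral hd hu hB hφ]
  have iI := integrable_entropyIntegrand hd hu hB hφ
  have key : Tendsto (fun n => ∫ p, (entropyIntegrand f β ν μ φ (a n) u p
      + entropyIntegrand f β ν μ φ (b n) u p) ∂stripMeasure T) atTop
      (𝓝 (∫ p, 2 * entropyIntegrand f β ν μ φ k u p ∂stripMeasure T)) := by
    refine tendsto_integral_of_dominated_convergence _ (fun n => ((iI (a n)).add (iI (b n))).1)
      ((integrable_entropy_dominant hφ (B + κ) (C * (C * (B + κ)))
        (C * κ * (C ^ 3 * m))).const_mul 2) (fun n => ?_) ?_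
    · filter_upwards [abs_entropyIntegrand_le (φ := φ) hd hu hB (hκa n),
        abs_entropyIntegrand_le (φ := φ) hd hu hB (hκb n)] with p h1 h2
      rw [Real.norm_eq_abs]
      exact (abs_add_le _ _).trans (by linarith)
    · refine ae_of_all _ fun p => ?_
      have e : ∀ n, entropyIntegrand f β ν μ φ (a n) u p + entropyIntegrand f β ν μ φ (b n) u p
          = (|u p.1 p.2 - a n| + |u p.1 p.2 - b n|) * deriv (fun s => φ s p.2) p.1
            + nonlocalCoeff β ν μ (u p.1) p.2
              * (kruzhkov f (u p.1 p.2) (a n) + kruzhkov f (u p.1 p.2) (b n)) * deriv (φ p.1) p.2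
            - (f (a n) * Real.sign (u p.1 p.2 - a n) + f (b n) * Real.sign (u p.1 p.2 - b n))
              * deriv (nonlocalCoeff β ν μ (u p.1)) p.2 * φ p.1 p.2 := fun n => by
        simp only [entropyIntegrand]; ring
      have e' : 2 * entropyIntegrand f β ν μ φ k u p
          = (|u p.1 p.2 - k| + |u p.1 p.2 - k|) * deriv (fun s => φ s p.2) p.1
            + nonlocalCoeff β ν μ (u p.1) p.2
              * (kruzhkov f (u p.1 p.2) k + kruzhkov f (u p.1 p.2) k) * deriv (φ p.1) p.2
            - (2 * (f k * Real.sign (u p.1 p.2 - k)))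
              * deriv (nonlocalCoeff β ν μ (u p.1)) p.2 * φ p.1 p.2 := by
        simp only [entropyIntegrand]; ring
      simp only [e, e']
      have hkr : ∀ c : ℕ → ℝ, Tendsto c atTop (𝓝 k) →
          Tendsto (fun n => kruzhkov f (u p.1 p.2) (c n)) atTop (𝓝 (kruzhkov f (u p.1 p.2) k)) :=
        fun c hc => ((continuous_kruzhkov hd.continuous_f).tendsto (u p.1 p.2, k)).comp
          (tendsto_const_nhds.prodMk_nhds hc)
      have hfa := (hd.continuous_f.tendsto k).comp ha'
      have hfb := (hd.continuous_f.tendsto k).comp hb'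
      have hs : Tendsto (fun n => f (a n) * Real.sign (u p.1 p.2 - a n)
          + f (b n) * Real.sign (u p.1 p.2 - b n)) atTop
          (𝓝 (2 * (f k * Real.sign (u p.1 p.2 - k)))) := by
        -- On `{u = k}` the two signs are opposite and the sum is `f(bₙ) - f(aₙ) → 0`, in agreement
        -- with `sgn(0) = 0`.
        by_cases hz : u p.1 p.2 - k = 0
        · have e1 : ∀ n, f (a n) * Real.sign (u p.1 p.2 - a n)
              + f (b n) * Real.sign (u p.1 p.2 - b n) = f (b n) - f (a n) := fun n => by
            rw [Real.sign_of_neg (by linarith [ha n]), Real.sign_of_pos (by linarith [hb n])]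
            ring
          simp only [e1, hz, Real.sign_zero, mul_zero]
          simpa using hfb.sub hfa
        · rw [two_mul]
          exact (hfa.mul (tendsto_sign (tendsto_const_nhds.sub ha') hz)).add
            (hfb.mul (tendsto_sign (tendsto_const_nhds.sub hb') hz))
      exact ((((tendsto_const_nhds.sub ha').abs.add (tendsto_const_nhds.sub hb').abs).mul_const
        _).add ((((hkr a ha').add (hkr b hb')).const_mul _).mul_const _)).sub
        ((hs.mul_const _).mul_const _)
  rw [integral_const_mul] at key
  have h3 := (hinit a hκa ha').add (hinit b hκb hb')
  refine ((key.add h3).congr fun n => ?_).trans (le_of_eq (congrArg 𝓝 ?_))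
  · rw [integral_add (iI (a n)) (iI (b n))]; ring
  · ring

/-- The complement of a countable set is dense, so an exceptional level can be approached from both
sides by admissible ones, and the inequality at the level is half the limit of their sum. -/
lemma entropyForm_nonneg_of_countable (hd : DataBound f β ν μ C) (hu₀ : Integrable u₀)
    (hu : StripFun T m u) (hB : ∀ᵐ p ∂stripMeasure T, |u p.1 p.2| ≤ B) (hφ : IsTestFunction T φ)
    {S : Set ℝ} (hS : S.Countable) (h : ∀ k ∉ S, 0 ≤ entropyForm f β ν μ u₀ T u k φ) (k : ℝ) :
    0 ≤ entropyForm f β ν μ u₀ T u k φ := by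
  have hD : Dense Sᶜ := hS.dense_compl ℝ
  choose a ha using fun n : ℕ => hD.exists_between
    (show k < k + 1 / ((n : ℝ) + 1) by linarith [Nat.one_div_pos_of_nat (α := ℝ) (n := n)])
  choose b hb using fun n : ℕ => hD.exists_between
    (show k - 1 / ((n : ℝ) + 1) < k by linarith [Nat.one_div_pos_of_nat (α := ℝ) (n := n)])
  have h0 := tendsto_one_div_add_atTop_nhds_zero_nat (𝕜 := ℝ)
  have ha' : Tendsto a atTop (𝓝 k) := tendsto_of_tendsto_of_tendsto_of_le_of_le
    tendsto_const_nhds (by simpa using h0.const_add k) (fun n => (ha n).2.1.le)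
    fun n => (ha n).2.2.le
  have hb' : Tendsto b atTop (𝓝 k) := tendsto_of_tendsto_of_tendsto_of_le_of_le
    (by simpa using h0.const_sub k) tendsto_const_nhds (fun n => (hb n).2.1.le)
    fun n => (hb n).2.2.le
  have := ge_of_tendsto' (tendsto_entropyForm_add hd hu₀ hu hB hφ (fun n => (ha n).2.1)
    (fun n => (hb n).2.2) ha' hb') fun n => add_nonneg (h _ (ha n).1) (h _ (hb n).1)
  linarith

end Limits

end NonlocalFV

namespace NonlocalFV

/-! ### Existence, uniqueness and convergence -/

section Solutions

variable {f β ν μ u₀ : ℝ → ℝ} {C m V K D T B L M R ε ε' h : ℝ} {u v : ℝ → ℝ → ℝ}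

lemma ApproxEntropy.mono (hu : ApproxEntropy f β ν μ u₀ T u M R ε) (hε : ε ≤ ε') :
    ApproxEntropy f β ν μ u₀ T u M R ε' := by
  obtain ⟨g, h1, h2, h3, h4⟩ := hu
  refine ⟨g, fun y => ⟨(h1 y).1, (h1 y).2.trans hε⟩, h2, h3.trans hε, fun k y φ hφ hb => ?_⟩
  have := mul_le_mul_of_nonneg_right hε (abs_nonneg k)
  linarith [h4 k y φ hφ hb]

lemma ae_strip_tendsto {w : ℕ → ℝ → ℝ → ℝ} (hw : ∀ n, Measurable (Function.uncurry (w n)))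
    (hu : Measurable (Function.uncurry u)) (hlim : ∀ t ∈ Set.Icc 0 T, ∀ᵐ x ∂volume,
      Tendsto (fun n => w n t x) atTop (𝓝 (u t x))) :
    ∀ᵐ p ∂stripMeasure T, Tendsto (fun n => w n p.1 p.2) atTop (𝓝 (u p.1 p.2)) := by
  refine (Measure.ae_prod_iff_ae_ae (measurableSet_tendsto_fun
    (f := fun n (p : ℝ × ℝ) => w n p.1 p.2) hw hu)).2 ?_
  filter_upwards [ae_restrict_mem measurableSet_Ioo] with t ht
  exact hlim t ⟨ht.1.le, ht.2.le⟩

/-- Limits of approximate entropy solutions are entropy solutions. -/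
lemma isEntropySolution_of_tendsto (hd : DataBound f β ν μ C) (hu₀ : Integrable u₀)
    {w : ℕ → ℝ → ℝ → ℝ} (hw : ∀ n, StripFun T m (w n))
    (hB : ∀ n, ∀ᵐ p ∂stripMeasure T, |w n p.1 p.2| ≤ B)
    (hwe : ∀ M R δ, 0 ≤ M → 0 ≤ R → 0 < δ → ∀ᶠ n in atTop, ApproxEntropy f β ν μ u₀ T (w n) M R δ)
    (hu : StripFun T m u) (huB : ∀ᵐ p ∂stripMeasure T, |u p.1 p.2| ≤ B)
    (hlim : ∀ᵐ p ∂stripMeasure T, Tendsto (fun n => w n p.1 p.2) atTop (𝓝 (u p.1 p.2)))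
    (hL1 : ∀ t ∈ Set.Icc 0 T, Tendsto (fun n => l1Dist (w n) u t) atTop (𝓝 0))
    (hL : ∀ s ∈ Set.Icc 0 T, ∀ t ∈ Set.Icc 0 T, ∫ x, |u s x - u t x| ≤ L * |s - t|) :
    IsEntropySolution f β ν μ u₀ T u where
  integrable := hu.integrable
  continuous t ht := by
    have h0 : Tendsto (fun s => L * |s - t|) (𝓝[Set.Icc 0 T] t) (𝓝 0) := by
      have : Continuous fun s : ℝ => L * |s - t| := by fun_prop
      simpa using (this.tendsto t).mono_left nhdsWithin_le_nhds
    refine tendsto_of_tendsto_of_tendsto_of_le_of_le' tendsto_const_nhds h0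
      (Eventually.of_forall fun s => integral_nonneg fun _ => abs_nonneg _) ?_
    filter_upwards [self_mem_nhdsWithin] with s hs
    exact hL s hs t ht
  measurable := by rw [restrict_strip]; exact hu.aesm
  bounded := ⟨B, by rw [restrict_strip]; exact huB⟩
  entropy k φ hφ := by
    -- The level sets are disjoint, so at most countably many have positive measure; at the others
    -- the sign passes to the limit almost everywhere.
    have hS : Set.Countable {k : ℝ | 0 < stripMeasure T {p | u p.1 p.2 = k}} :=
      Measure.countable_meas_level_set_pos₀ hu.aesm.aemeasurable.nullMeasurable
    refine entropyForm_nonneg_of_countable hd hu₀ hu huB hφ hS (fun k hk => ?_) k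
    have hk' : ∀ᵐ p ∂stripMeasure T, u p.1 p.2 ≠ k := by
      rw [ae_iff]
      simpa using hk
    obtain ⟨M, R, hb⟩ := hφ.exists_testBound
    have hb' : TestBound φ M (max R 0) 0 :=
      { hb with support := fun t x h0 => (hb.support t x h0).trans (le_max_left _ _) }
    refine le_of_forall_pos_le_add fun ε hε => ?_
    have h1 : ∀ᶠ n in atTop, -ε ≤ entropyForm f β ν μ u₀ T (w n) k φ := by
      -- With this choice of `δ` the error `g(0) + δ |k| ≤ δ (1 + |k|)` is at most `ε`.
      filter_upwards [hwe M (max R 0) (ε / (1 + |k|)) hb.nonneg (le_max_right _ _)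
        (by positivity)] with n hn
      obtain ⟨g, g1, -, -, g2⟩ := hn
      refine le_trans ?_ (g2 k 0 φ hφ hb')
      have e : ε / (1 + |k|) + ε / (1 + |k|) * |k| = ε := by field_simp
      linarith [(g1 0).2]
    linarith [ge_of_tendsto (tendsto_entropyForm (u₀ := u₀) hd hw hB hu huB hlim hL1 hk' hφ) h1]

/-- The `L¹` norm is continuous in time on a compact interval, hence bounded. -/
lemma IsEntropySolution.exists_stripFun (hv : IsEntropySolution f β ν μ u₀ T v) :
    ∃ M, StripFun T M v := by
  have hc : ContinuousOn (fun t => ∫ x, |v t x|) (Set.Icc 0 T) := fun t ht => by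
    refine tendsto_iff_dist_tendsto_zero.2 (tendsto_of_tendsto_of_tendsto_of_le_of_le'
      tendsto_const_nhds (hv.continuous t ht) (Eventually.of_forall fun _ => dist_nonneg) ?_)
    filter_upwards [self_mem_nhdsWithin] with s hs
    have is := hv.integrable s hs
    have it := hv.integrable t ht
    rw [Real.dist_eq, ← integral_sub is.abs it.abs]
    refine (abs_integral_le_integral_abs).trans
      (integral_mono (is.abs.sub it.abs).abs (is.sub it).abs fun x => ?_)
    exact abs_abs_sub_abs_le_abs_sub _ _
  obtain ⟨M, hM⟩ := isCompact_Icc.exists_bound_of_continuousOn hc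
  refine ⟨M, by rw [← restrict_strip]; exact hv.measurable, hv.integrable, fun t ht => ?_⟩
  exact (le_abs_self _).trans (hM t ht)

lemma StripFun.mono {M' : ℝ} (hu : StripFun T M u) (hM : M ≤ M') : StripFun T M' u :=
  ⟨hu.aesm, hu.integrable, fun t ht => (hu.mass t ht).trans hM⟩

/-- A regular entropy solution is unique. -/
lemma IsEntropySolution.ae_eq (hd : DataBound f β ν μ C) (hu₀ : Integrable u₀) (hT : 0 < T)
    (hu : IsEntropySolution f β ν μ u₀ T u) (hv : IsEntropySolution f β ν μ u₀ T v) (hL : 0 ≤ L)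
    (hreg : Regular T L 0 u) (h0 : ∫ y, |u₀ y - u 0 y| = 0) {t : ℝ} (ht : t ∈ Set.Icc 0 T) :
    v t =ᵐ[volume] u t := by
  obtain ⟨m₁, hm₁⟩ := hu.exists_stripFun
  obtain ⟨m₂, hm₂⟩ := hv.exists_stripFun
  obtain ⟨B₁, hB₁⟩ := hu.bounded
  obtain ⟨B₂, hB₂⟩ := hv.bounded
  rw [restrict_strip] at hB₁ hB₂
  have hp : Pair f β ν μ C T (max m₁ m₂) L 0 (max B₁ B₂) u v :=
    ⟨hd, hm₁.mono (le_max_left _ _), hm₂.mono (le_max_right _ _), hreg, hL, le_rfl,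
      hB₁.mono fun p hp => hp.trans (le_max_left _ _),
      hB₂.mono fun p hp => hp.trans (le_max_right _ _)⟩
  have hle : l1Dist u v t ≤ 0 := by
    refine le_of_forall_pos_le_add fun ε hε => ?_
    -- The comparison needs only the continuity of `v` at the time `t` considered.
    have h1 := (hv.continuous t ht).eventually (gt_mem_nhds (show 0 < ε / 5 by positivity))
    obtain ⟨h, hh, h2⟩ := Metric.mem_nhdsWithin_iff.1 h1
    obtain ⟨M, δ, hM, hδ, key⟩ := Pair.l1Dist_le_of_approxEntropy hd hu₀ hT
      (hp.mass_nonneg hT.le) hL (show 0 < ε / 5 by positivity) (half_pos hh)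
    have := key _ _ u v hp hδ.le (hu.approxEntropy hδ.le M 1) (hv.approxEntropy hδ.le M 1)
      (h0.le.trans hδ.le) t ht fun s hs hst => by
        refine le_of_lt (h2 ⟨?_, hs⟩)
        rw [Metric.mem_ball, Real.dist_eq]
        linarith
    linarith
  have hi : Integrable fun y => |u t y - v t y| :=
    ((hu.integrable t ht).sub (hv.integrable t ht)).abs
  have h3 := (integral_eq_zero_iff_of_nonneg (fun y => abs_nonneg _) hi).1
    (le_antisymm hle (l1Dist_nonneg u v t))
  filter_upwards [h3] with y hy
  have : u t y - v t y = 0 := abs_eq_zero.1 hy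
  linarith

end Solutions

/-! ### Fine meshes: closeness to entropy solutions, Cauchy property, existence. -/

namespace MonotoneRun

variable {f β ν μ u₀ : ℝ → ℝ} {C m V K D T ε h : ℝ}

/-- Approximations on fine meshes satisfy the entropy inequality up to a small error. -/
lemma exists_approxEntropy (hd : DataBound f β ν μ C) (hi : InitialBound u₀ m V) (K D T : ℝ)
    {M R δ : ℝ} (hM : 0 ≤ M) (hR : 0 ≤ R) (hδ : 0 < δ) :
    ∃ η > 0, ∀ F Δx Δt N α, MonotoneRun f β ν μ u₀ K D T F Δx Δt N α → Δx < η → Δt < η →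
      ApproxEntropy f β ν μ u₀ T (approxFun β ν μ u₀ F Δx Δt α) M R δ := by
  set E := entropyErrorConst C m V K D T M R
  refine ⟨min 1 (δ / (2 * (|E| + 1))), lt_min one_pos (by positivity),
    fun F Δx Δt N α hr hx ht => ?_⟩
  refine (hr.approxEntropy hd hi hM hR (hx.le.trans (min_le_left _ _))).mono ?_
  have h1 := hx.le.trans (min_le_right _ _)
  have h2 := ht.le.trans (min_le_right _ _)
  have h3 := hr.dx_pos
  have h4 := hr.dt_pos
  calc E * (Δx + Δt) ≤ (|E| + 1) * (δ / (2 * (|E| + 1)) + δ / (2 * (|E| + 1))) := by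
        have : E ≤ |E| + 1 := (le_abs_self _).trans (by linarith)
        gcongr
    _ = δ := by field_simp; ring

/-- Approximations on fine meshes are close to the approximate entropy solutions. -/
lemma exists_l1Dist_le (hd : DataBound f β ν μ C) (hi : InitialBound u₀ m V) (hT : 0 < T)
    (K D : ℝ) (hε : 0 < ε) (hh : 0 < h) :
    ∃ M δ : ℝ, 0 ≤ M ∧ 0 < δ ∧ ∀ F Δx Δt N α, MonotoneRun f β ν μ u₀ K D T F Δx Δt N α →
      Δx < δ → Δt < δ → ∀ v B, StripFun T m v → (∀ᵐ p ∂stripMeasure T, |v p.1 p.2| ≤ B) →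
      ApproxEntropy f β ν μ u₀ T v M 1 δ → ∀ t ∈ Set.Icc 0 T,
      (∀ s ∈ Set.Icc 0 T, |s - t| ≤ h → ∫ y, |v s y - v t y| ≤ ε) →
      l1Dist (approxFun β ν μ u₀ F Δx Δt α) v t ≤ 5 * ε := by
  set τ := timeRate C m V K D T
  set S := 2 * variationSup C m V K T + τ
  -- A negative value excludes all runs, and the statement is then vacuous.
  by_cases hS : 0 ≤ S
  swap
  · refine ⟨0, 1, le_rfl, one_pos, fun F Δx Δt N α hr => absurd ?_ hS⟩
    exact add_nonneg (mul_nonneg zero_le_two (hr.variationSup_nonneg hd hi))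
      (hr.timeRate_nonneg hd hi)
  obtain ⟨M, δ, hM, hδ, key⟩ := Pair.l1Dist_le_of_approxEntropy hd hi.integrable hT
    hi.mass_nonneg hS hε hh
  obtain ⟨η, hη, hap⟩ := exists_approxEntropy hd hi K D T hM zero_le_one hδ
  have hV := hi.variation_nonneg
  refine ⟨M, min δ (min η (min (δ / (|τ| + 1)) (δ / (V + 1)))), hM,
    lt_min hδ (lt_min hη (lt_min (by positivity) (by positivity))),
    fun F Δx Δt N α hr hx ht v B hv hB hve t htt hmod => ?_⟩
  obtain ⟨hx1, hx2⟩ := lt_min_iff.1 hx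
  obtain ⟨hx2, hx3⟩ := lt_min_iff.1 hx2
  obtain ⟨-, hx4⟩ := lt_min_iff.1 hx3
  obtain ⟨-, ht2⟩ := lt_min_iff.1 ht
  obtain ⟨ht2, ht3⟩ := lt_min_iff.1 ht2
  obtain ⟨ht3, -⟩ := lt_min_iff.1 ht3
  rw [lt_div_iff₀ (by positivity)] at hx4 ht3
  have hτ : 0 ≤ τ := hr.timeRate_nonneg hd hi
  rw [abs_of_nonneg hτ] at ht3
  have hdt := hr.dt_pos
  have hdx := hr.dx_pos
  have hp : Pair f β ν μ C T m S (τ * Δt) (max (variationSup C m V K T) B)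
      (approxFun β ν μ u₀ F Δx Δt α) v :=
    ⟨hd, hr.stripFun hd hi, hv, hr.regular hd hi, hS, by positivity,
      (hr.ae_abs_approxFun_le hd hi).mono fun p hp => hp.trans (le_max_left _ _),
      hB.mono fun p hp => hp.trans (le_max_right _ _)⟩
  refine key _ _ _ _ hp (by linarith) (hap F Δx Δt N α hr hx2 ht2)
    (hve.mono (min_le_left _ _)) ?_ t htt hmod
  have h1 : approxFun β ν μ u₀ F Δx Δt α 0 = stepFun Δx (cellAverage u₀ Δx) := by
    rw [approxFun_eq, zero_div, Nat.floor_zero]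
    rfl
  rw [h1]
  simp only [abs_sub_comm (u₀ _)]
  exact (hi.approximation hdx).trans (by linarith)

/-- Approximations on fine meshes are close to each other. -/
lemma exists_l1Dist_approxFun_le (hd : DataBound f β ν μ C) (hi : InitialBound u₀ m V) (hT : 0 < T)
    (K D : ℝ) (hε : 0 < ε) :
    ∃ η > 0, ∀ F Δx Δt N α F' Δx' Δt' N' α', MonotoneRun f β ν μ u₀ K D T F Δx Δt N α →
      MonotoneRun f β ν μ u₀ K D T F' Δx' Δt' N' α' → Δx < η → Δt < η → Δx' < η → Δt' < η →
      ∀ t ∈ Set.Icc 0 T,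
        l1Dist (approxFun β ν μ u₀ F Δx Δt α) (approxFun β ν μ u₀ F' Δx' Δt' α') t ≤ ε := by
  set τ := timeRate C m V K D T
  -- The second approximation varies by at most `τ (|s - t| + Δt')`; both summands in the bracket
  -- are kept below this length.
  have hh : 0 < ε / 5 / (2 * (|τ| + 1)) := by positivity
  obtain ⟨M, δ, hM, hδ, key⟩ := exists_l1Dist_le hd hi hT K D (show 0 < ε / 5 by positivity) hh
  obtain ⟨η, hη, hap⟩ := exists_approxEntropy hd hi K D T hM zero_le_one hδ
  refine ⟨min δ (min η (ε / 5 / (2 * (|τ| + 1)))), lt_min hδ (lt_min hη hh),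
    fun F Δx Δt N α F' Δx' Δt' N' α' hr hr' hx ht hx' ht' t htt => ?_⟩
  have hx'2 := (lt_min_iff.1 (lt_min_iff.1 hx').2).1
  obtain ⟨ht'2, ht'3⟩ := lt_min_iff.1 (lt_min_iff.1 ht').2
  refine (key F Δx Δt N α hr (lt_min_iff.1 hx).1 (lt_min_iff.1 ht).1 _ _ (hr'.stripFun hd hi)
    (hr'.ae_abs_approxFun_le hd hi) (hap _ _ _ _ _ hr' hx'2 ht'2) t htt fun s hs hst => ?_).trans
    (by linarith)
  refine (hr'.integral_abs_approxFun_sub_le hd hi hs htt).trans ?_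
  have hτ : 0 ≤ τ := hr'.timeRate_nonneg hd hi
  rw [abs_of_nonneg hτ] at hst ht'3
  calc τ * (|s - t| + Δt')
      ≤ (τ + 1) * (ε / 5 / (2 * (τ + 1)) + ε / 5 / (2 * (τ + 1))) := by
        have := hr'.dt_pos
        gcongr
        linarith
    _ = ε / 5 := by field_simp; ring

/-- Existence of an entropy solution, as the limit of the approximations on finer and finer
meshes. -/
lemma exists_isEntropySolution (hd : DataBound f β ν μ C) (hi : InitialBound u₀ m V) (hT : 0 < T)
    (hrun : ∀ η > 0, ∃ F Δx Δt N α, MonotoneRun f β ν μ u₀ K D T F Δx Δt N α ∧ Δx < η ∧ Δt < η) :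
    ∃ (u : ℝ → ℝ → ℝ) (L : ℝ), 0 ≤ L ∧ IsEntropySolution f β ν μ u₀ T u ∧ StripFun T m u ∧
      Regular T L 0 u ∧ ∫ y, |u₀ y - u 0 y| = 0 := by
  choose F Δx Δt N α hr hx ht using fun n : ℕ => hrun (1 / ((n : ℝ) + 1)) (by positivity)
  have h0 := tendsto_one_div_add_atTop_nhds_zero_nat (𝕜 := ℝ)
  have hx0 : Tendsto Δx atTop (𝓝 0) :=
    squeeze_zero (fun n => (hr n).dx_pos.le) (fun n => (hx n).le) h0
  have ht0 : Tendsto Δt atTop (𝓝 0) :=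
    squeeze_zero (fun n => (hr n).dt_pos.le) (fun n => (ht n).le) h0
  set w : ℕ → ℝ → ℝ → ℝ := fun n => approxFun β ν μ u₀ (F n) (Δx n) (Δt n) (α n)
  have hwm : ∀ n, Measurable (Function.uncurry (w n)) := fun n => measurable_approxFun
  have hws : ∀ n, StripFun T m (w n) := fun n => (hr n).stripFun hd hi
  have hsmall : ∀ η > 0, ∃ n₀, ∀ n ≥ n₀, Δx n < η ∧ Δt n < η := fun η hη =>
    eventually_atTop.1 ((hx0.eventually (gt_mem_nhds hη)).and (ht0.eventually (gt_mem_nhds hη)))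
  obtain ⟨u, ψ, hψ, hum, hus, hlim, hL1⟩ := exists_l1Dist_limit hwm hws fun ε hε => by
    obtain ⟨η, hη, key⟩ := exists_l1Dist_approxFun_le hd hi hT K D hε
    obtain ⟨n₀, hn₀⟩ := hsmall η hη
    exact ⟨n₀, fun p hp q hq => key _ _ _ _ _ _ _ _ _ _ (hr p) (hr q) (hn₀ p hp).1 (hn₀ p hp).2
      (hn₀ q hq).1 (hn₀ q hq).2⟩
  have hL1' : ∀ t ∈ Set.Icc 0 T, Tendsto (fun n => l1Dist (w n) u t) atTop (𝓝 0) :=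
    fun t htt => by
      rw [Metric.tendsto_atTop]
      intro ε hε
      obtain ⟨n₀, hn₀⟩ := hL1 (ε / 2) (half_pos hε)
      refine ⟨n₀, fun n hn => ?_⟩
      rw [Real.dist_0_eq_abs, abs_of_nonneg (l1Dist_nonneg _ _ _)]
      linarith [hn₀ n hn t htt]
  set τ := timeRate C m V K D T
  set L := 2 * variationSup C m V K T + τ
  have hL : 0 ≤ L := add_nonneg (mul_nonneg zero_le_two ((hr 0).variationSup_nonneg hd hi))
    ((hr 0).timeRate_nonneg hd hi)
  -- The moduli pass to the limit by Fatou's lemma, and the defect `τ Δt` disappears.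
  have hreg : Regular T L 0 u := ⟨hum, fun t htt s hs z => by
    refine le_of_forall_pos_le_add fun ε hε => ?_
    refine (integrable_and_integral_abs_le_of_tendsto
      (g := fun n y => w (ψ n) t (y + z) - w (ψ n) s y)
      (fun n => (((hws _).integrable t htt).comp_add_right z).sub ((hws _).integrable s hs))
      ?_ ?_).2
    · have h1 : Tendsto (fun n => τ * Δt (ψ n)) atTop (𝓝 0) := by
        simpa using (ht0.comp hψ.tendsto_atTop).const_mul τ
      filter_upwards [h1.eventually (gt_mem_nhds hε)] with n hn
      have := ((hr (ψ n)).regular hd hi).translate t htt s hs z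
      linarith
    · have h1 := (measurePreserving_add_right volume z).quasiMeasurePreserving.ae (hlim t htt)
      filter_upwards [h1, hlim s hs] with y hy1 hy2
      exact hy1.sub hy2⟩
  have hstrip := ae_strip_tendsto (fun n => hwm (ψ n)) hum hlim
  have hB : ∀ n, ∀ᵐ p ∂stripMeasure T, |w (ψ n) p.1 p.2| ≤ variationSup C m V K T :=
    fun n => (hr _).ae_abs_approxFun_le hd hi
  have huB : ∀ᵐ p ∂stripMeasure T, |u p.1 p.2| ≤ variationSup C m V K T := by
    filter_upwards [hstrip, ae_all_iff.2 hB] with p h1 h2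
    exact le_of_tendsto' h1.abs h2
  refine ⟨u, L, hL, isEntropySolution_of_tendsto (L := L) hd hi.integrable (fun n => hws (ψ n)) hB
    ?_ hus huB hstrip (fun t htt => (hL1' t htt).comp hψ.tendsto_atTop) ?_, hus, hreg, ?_⟩
  · intro M R δ hM hR hδ
    obtain ⟨η, hη, key⟩ := exists_approxEntropy hd hi K D T hM hR hδ
    obtain ⟨n₀, hn₀⟩ := hsmall η hη
    filter_upwards [hψ.tendsto_atTop.eventually_ge_atTop n₀] with n hn
    exact key _ _ _ _ _ (hr _) (hn₀ _ hn).1 (hn₀ _ hn).2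
  · intro s hs t htt
    simpa using hreg.translate s hs t htt 0
  · have hT0 : (0 : ℝ) ∈ Set.Icc 0 T := ⟨le_rfl, hT.le⟩
    have h1 : Tendsto (fun n => Δx n * V + l1Dist (w n) u 0) atTop (𝓝 0) := by
      simpa using (hx0.mul_const V).add (hL1' 0 hT0)
    refine le_antisymm (ge_of_tendsto' h1 fun n => ?_) (integral_nonneg fun _ => abs_nonneg _)
    have e : w n 0 = stepFun (Δx n) (cellAverage u₀ (Δx n)) := by
      change approxFun β ν μ u₀ (F n) (Δx n) (Δt n) (α n) 0 = _
      rw [approxFun_eq, zero_div, Nat.floor_zero]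
      rfl
    have h2 := hi.approximation (hr n).dx_pos
    rw [← e] at h2
    have i1 : Integrable fun y => |w n 0 y - u₀ y| :=
      (((hws n).integrable 0 hT0).sub hi.integrable).abs
    have i2 : Integrable fun y => |w n 0 y - u 0 y| :=
      (((hws n).integrable 0 hT0).sub (hus.integrable 0 hT0)).abs
    calc ∫ y, |u₀ y - u 0 y| ≤ ∫ y, (|w n 0 y - u₀ y| + |w n 0 y - u 0 y|) := by
          refine integral_mono (hi.integrable.sub (hus.integrable 0 hT0)).abs (i1.add i2)
            fun y => ?_
          have := abs_sub_le (u₀ y) (w n 0 y) (u 0 y)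
          rw [abs_sub_comm (u₀ y) (w n 0 y)] at this
          exact this
      _ = (∫ y, |w n 0 y - u₀ y|) + l1Dist (w n) u 0 := integral_add i1 i2
      _ ≤ _ := add_le_add_left h2 _

end MonotoneRun

/-- There are Lax-Friedrichs runs on arbitrarily fine meshes. -/
lemma exists_isRun (f β ν μ u₀ : ℝ → ℝ) {T : ℝ} (hT : 0 < T) :
    ∃ D, ∀ η > 0, ∃ F Δx Δt N α, IsRun f β ν μ u₀ 0 D T F Δx Δt N α ∧ Δx < η ∧ Δt < η := by
  have hS : 0 ≤ supNorm ν := Real.iSup_nonneg fun _ => abs_nonneg _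
  have hf := lipSeminorm_nonneg f
  -- For `θ = 1/3` the minimum in the CFL condition is 1, so this is the largest admissible ratio.
  -- It is kept fixed while the mesh is refined.
  set lam := 1 / (1 + 6 * lipSeminorm f * supNorm ν) with hlam
  have hl : 0 < lam := by positivity
  refine ⟨1 / 3 / lam, fun η hη => ?_⟩
  obtain ⟨n, hn⟩ := exists_nat_gt (max (T / η) (T / (lam * η)))
  have hn1 := (le_max_left _ _).trans_lt hn
  have hn2 := (le_max_right _ _).trans_lt hn
  have hn0 : (0 : ℝ) < n := (by positivity : 0 < T / η).trans hn1
  have e : T / n / (T / n / lam) = lam := by field_simp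
  refine ⟨laxFriedrichs f (1 / 3) lam, T / n / lam, T / n, n, 0, ⟨by positivity, by positivity,
    by field_simp, fun _ _ => by simp, ?_⟩, ?_, ?_⟩
  · rw [e]
    refine .laxFriedrichs (1 / 3) (by norm_num) (by norm_num) (le_of_eq ?_) le_rfl
    rw [hlam]
    norm_num
  · rw [div_lt_iff₀ (by positivity)] at hn2
    rw [div_div, div_lt_iff₀ (by positivity)]
    linarith
  · rw [div_lt_iff₀ hη] at hn1
    rw [div_lt_iff₀ hn0]
    linarith

end NonlocalFV

theorem theorem2p2 (f β ν μ u₀ : ℝ → ℝ)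
    (hf : ∃ L, LipschitzWith L f) (hf0 : f 0 = 0)
    (hβ : NonlocalFV.SmoothBV β) (hβ0 : β 0 = 0)
    (hν : NonlocalFV.SmoothBV ν) (hν0 : ν 0 = 0)
    (hμ : NonlocalFV.SmoothBV μ)
    (hu₀ : NonlocalFV.L1BV u₀) (hu₀_nonneg : ∀ᵐ x ∂volume, 0 ≤ u₀ x) :
    -- the estimates, with constants that do not depend on the mesh
    (∀ K : ℝ, ∃ L₁ L₂ : ℝ, ∀ T : ℝ, 0 < T → ∀ D : ℝ, ∃ L₃ : ℝ,
      ∀ (F : ℝ → ℝ → ℝ → ℝ) (Δx Δt : ℝ) (N : ℕ) (α : ℕ → ℤ → ℝ),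
        NonlocalFV.IsRun f β ν μ u₀ K D T F Δx Δt N α →
        ∀ (u : ℕ → ℤ → ℝ) (a : ℕ → ℤ → ℝ),
          u = NonlocalFV.approx β ν μ u₀ F Δx Δt α →
          a = NonlocalFV.coeff β ν μ u₀ F Δx Δt α →
          -- positivity
          (∀ n ≤ N, ∀ i, 0 ≤ u n i) ∧
          -- sup norm bound
          (∀ n ≤ N, BddAbove (Set.range fun i => |u n i|) ∧
            ⨆ i, |u n i| ≤ Real.exp (L₁ * T) * ⨆ i, |u 0 i|) ∧
          -- conservation of the L¹ norm
          (∀ n ≤ N, Summable (fun i => |u n i|) ∧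
            Δx * ∑' i, |u n i| = Δx * ∑' i, |u 0 i|) ∧
          -- bound of the total variation
          (∀ n ≤ N, Summable (fun i => |u n (i + 1) - u n i|) ∧
            ∑' i, |u n (i + 1) - u n i| ≤
              Real.exp (L₂ * T) * (∑' i, |u 0 (i + 1) - u 0 i| + L₂)) ∧
          -- continuity in time
          (∀ m ≤ N, ∀ n ≤ N, Summable (fun i => |u m i - u n i|) ∧
            Δx * ∑' i, |u m i - u n i| ≤ L₃ * |(m : ℝ) - n| * Δt) ∧
          -- discrete entropy inequality
          (∀ n ≤ N, ∀ (i : ℤ) (k : ℝ),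
            |u (n + 1) i - k| - |u n i - k|
              + Δt / Δx * (NonlocalFV.entropyFlux F (a n i) (u n i) (u n (i + 1)) k
                  - NonlocalFV.entropyFlux F (a n (i - 1)) (u n (i - 1)) (u n i) k)
              + Δt / Δx * Real.sign (u (n + 1) i - k) * f k * (a n i - a n (i - 1)) ≤ 0)) ∧
    -- existence and uniqueness of the entropy solution, and convergence to it
    (∀ T : ℝ, 0 < T → ∃ u : ℝ → ℝ → ℝ,
      NonlocalFV.IsEntropySolution f β ν μ u₀ T u ∧
      (∀ v : ℝ → ℝ → ℝ, NonlocalFV.IsEntropySolution f β ν μ u₀ T v →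
        ∀ t ∈ Set.Icc 0 T, v t =ᵐ[volume] u t) ∧
      (∀ K D ε : ℝ, 0 < ε → ∃ δ : ℝ, 0 < δ ∧
        ∀ (F : ℝ → ℝ → ℝ → ℝ) (Δx Δt : ℝ) (N : ℕ) (α : ℕ → ℤ → ℝ),
          NonlocalFV.IsRun f β ν μ u₀ K D T F Δx Δt N α → Δx < δ → Δt < δ →
          ∀ t ∈ Set.Icc 0 T,
            eLpNorm (fun x => NonlocalFV.approxFun β ν μ u₀ F Δx Δt α t x - u t x) 1 volume
              ≤ ENNReal.ofReal ε)) := by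
  open NonlocalFV in
  obtain ⟨C, hd⟩ := exists_dataBound hf hf0 hβ hβ0 hν hμ
  obtain ⟨m, V, hi⟩ := exists_initialBound hu₀ hu₀_nonneg
  refine ⟨fun K => ⟨supRate C m, variationRate C m (max K (lipSeminorm f)), fun T hT D =>
    ⟨timeRate C m V (max K (lipSeminorm f)) (max D 0) T, fun F Δx Δt N α h u a hu ha => ?_⟩⟩,
    fun T hT => ?_⟩
  · subst hu ha
    have hr := h.monotoneRun hf hd.nu
    exact ⟨fun n hn i => hr.nonneg hd hi hn i,
      fun n hn => ⟨hr.bddAbove hd hi hn, hr.sup_le hd hi hn⟩,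
      fun n hn => ⟨hr.summable hd hi hn, by rw [hr.mass_eq hd hi hn]⟩,
      fun n hn => ⟨summable_abs_diff (hr.summable hd hi hn), hr.variation hd hi hn⟩,
      fun p hp n hn => hr.time_diff hd hi hp hn,
      fun n hn i k => hr.entropy hn i k⟩
  -- Lax–Friedrichs runs suffice for existence. Any other run, for any `K` and `D`, is then compared
  -- directly with the solution obtained.
  · obtain ⟨D₀, hrun⟩ := exists_isRun f β ν μ u₀ hT
    obtain ⟨u, L, hL, hu, hus, hreg, h0⟩ := MonotoneRun.exists_isEntropySolution hd hi hT
      fun η hη => by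
        obtain ⟨F, Δx, Δt, N, α, h, hx, ht⟩ := hrun η hη
        exact ⟨F, Δx, Δt, N, α, h.monotoneRun hf hd.nu, hx, ht⟩
    refine ⟨u, hu, fun v hv t ht => hu.ae_eq hd hi.integrable hT hv hL hreg h0 ht,
      fun K D ε hε => ?_⟩
    obtain ⟨B, hB⟩ := hu.bounded
    rw [restrict_strip] at hB
    -- The second function is now the solution, which is Lipschitz in time with constant `L`. The
    -- window `(ε/5)/(L + 1)` works for all times, so the convergence is uniform.
    obtain ⟨M, δ, hM, hδ, key⟩ := MonotoneRun.exists_l1Dist_le hd hi hT (max K (lipSeminorm f))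
      (max D 0) (show 0 < ε / 5 by positivity) (show 0 < ε / 5 / (L + 1) by positivity)
    refine ⟨δ, hδ, fun F Δx Δt N α h hx ht t htt => ?_⟩
    have hr := h.monotoneRun hf hd.nu
    have h1 := key F Δx Δt N α hr hx ht u B hus hB (hu.approxEntropy hδ.le M 1) t htt
      fun s hs hst => by
        have h2 := hreg.translate s hs t htt 0
        simp only [add_zero, abs_zero, mul_zero, zero_add] at h2
        rw [le_div_iff₀ (by positivity)] at hst
        have : 0 ≤ |s - t| := abs_nonneg _
        linarith
    have hint : Integrable fun x => approxFun β ν μ u₀ F Δx Δt α t x - u t x :=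
      ((hr.stripFun hd hi).integrable t htt).sub (hus.integrable t htt)
    rw [eLpNorm_one_eq_lintegral_enorm, ← ofReal_integral_norm_eq_lintegral_enorm hint]
    refine ENNReal.ofReal_le_ofReal (le_trans h1 ?_)
    linarith
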